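/- **Setting.** The rotating Kepler problem is the Hamiltonian $H(q,p)=\tfrac12\|p\|^2-\tfrac1{\|q\|}+p_1q_2-p_2q_1$ on $(T^*(\mathbb R^3\setminus 0),dp\wedge dq)$ (the restricted three-body problem with mass ratio $\mu=1$). Fix an energy $c<-\tfrac32$. Let $T^*S^3=\{(\xi,\eta)\in\mathbb R^4\times\mathbb R^4:\|\xi\|=1,\langle\xi,\eta\rangle=0\}$ with $\omega=d\eta\wedge d\xi$, write $\xi=(\xi_0,\vec\xi)$, $\eta=(\eta_0,\vec\eta)$, and let $$Q=\tfrac12f^2\|\eta\|^2,\qquad f=1+(1-\xi_0)\left(-c-\tfrac12+\xi_2\eta_1-\xi_1\eta_2\right).$$ Under $p=-\vec\xi/(1-\xi_0)$, $q=\eta_0\vec\xi+(1-\xi_0)\vec\eta$ this is the Moser regularization of $H=c$, and $\xi_0=1$ is the collision locus. Let $\Sigma_c$ be the connected component of $\{Q=\tfrac12\}\subset T^*S^3$ that contains the collisions $\{\xi_0=1,\|\eta\|=1\}$, with the Hamiltonian flow of $Q$, and let $P=\{\xi_3=0,\eta_3\ge0\}\subset\Sigma_c$, with interior $\{\eta_3>0\}$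 and boundary $\partial P=\{\eta_3=0\}$ (the planar problem). **Theorem 1.6.** Let $c<-\tfrac32$. 1. There are exactly one direct and one retrograde planar circular orbit in $\Sigma_c$ (orbits with $q_3=p_3=0$, $\|q\|$ constant, and angular momentum $q_1p_2-q_2p_1$ positive, respectively negative). Call them $\gamma_{dir}$ and $\gamma_{ret}$, and put $\Gamma=\gamma_{dir}\cup\gamma_{ret}$. The page $P$ is diffeomorphic to the disk cotangent bundle $\mathbb D^*S^2$. There is a diffeomorphism $\partial P\cong\mathbb RP^3=S^3/\pm1$ that takes $\gamma_{dir}$, $\gamma_{ret}$ to the images of the two components of the Hopf link $\{z_1z_2=0\}\subset S^3\subset\mathbb C^2$. 2. The first return map of the flow to the interior of $P$ is defined on the whole interior and extends, uniquely, to a smooth map $R:P\to P$. 3. There is a symplectic Lefschetz fibration $\pi$ of $P\cong\mathbb D^*S^2$ over the closed unit disk $\mathbb D$, of abstract type $\mathbf{LF}(\mathbb D^*S^1,\tau_P^2)$. This means the following. * $\pi:P\setminus\Gamma\to\mathbb D$ is smooth and onto, and $\pi^{-1}(\partial\mathbb D)=\partial P\setminus\Gamma$. The form $\omega$ is symplectic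 in the interior of $P$, and nondegenerate on the fibers away from the critical points of $\pi$. * The critical points lie in the interior of $P$ and on different fibers, and they are nodes: $\pi=z_1^2+z_2^2$ in suitable complex coordinates on $P$, tamed by $\omega$, and an oriented coordinate on the base. * The closure of each fiber $\pi^{-1}(z)$, $z\in\mathbb D$, is $\pi^{-1}(z)\cup\Gamma$. For the regular values $z$ these closures form a smooth, locally trivial family of compact annuli $\mathbb D^*S^1$ with common boundary $\gamma_{dir}\cup\gamma_{ret}$, by trivializations that do not depend on $z$ along the boundary. * The monodromy, relative to the boundary of the annulus, along $\partial\mathbb D$ is $\tau_P^2$, where $\tau_P$ is the positive Dehn twist of $\mathbb D^*S^1$. It is related to $R$ as follows. * $R$ maps each fiber of $\pi$ onto itself. * On the closure of each regular fiber, $R$ is an integrable twist map: there are coordinates $\theta\in\mathbb R/2\pi\mathbb Z$, $r\in[0,1]$ on the compact annulus and a smooth, strictly increasing function $I(r)$ such that $\omega=dI\wedge d\theta$ and $R(\theta,r)=(\theta+g(I(r)),r)$, with $g$ smooth and $g'\neq0$ on $[I(0),I(1)]$. * $\pi$ has exactly two critical points, $x_+=(1,0,0,0;0,0,0,1)$ and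 $x_-=(-1,0,0,0;0,0,0,-\tfrac1{2c})$, and $R(x_\pm)=x_\pm$. They correspond to the polar collision orbits: the orbits through $x_+$ and $x_-$ are periodic, they stay on the $q_3$-axis ($q_1=q_2=p_1=p_2=0$ away from collisions), in $q_3\le0$ and $q_3\ge0$ respectively, and they collide with the primary. -/

import Mathlib

open Set Filter Topology Metric
open scoped ContDiff

noncomputable section

namespace RotatingKepler

/-! ### Smooth maps and phase space -/

/-- Smoothness of a map on an arbitrary subset `s` of a normed space: the map is `C^∞` on an open
neighbourhood of `s`. (A map that is only given on `s` is smooth if and only if it can be extended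
in this way.) -/
def SmoothOn {X Y : Type*} [NormedAddCommGroup X] [NormedSpace ℝ X]
    [NormedAddCommGroup Y] [NormedSpace ℝ Y] (f : X → Y) (s : Set X) : Prop :=
  ∃ U : Set X, IsOpen U ∧ s ⊆ U ∧ ContDiffOn ℝ ∞ f U

abbrev E3 := EuclideanSpace ℝ (Fin 3)

abbrev E4 := EuclideanSpace ℝ (Fin 4)

/-- `T*ℝ⁴ = ℝ⁴ × ℝ⁴`, with points `(ξ, η)`; it contains `T*S³`. -/
abbrev Phase := E4 × E4

/-- `T*S³ = {(ξ, η) : ‖ξ‖ = 1, ⟨ξ, η⟩ = 0}`. -/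
def cotangentSphere : Set Phase := {x | ‖x.1‖ = 1 ∧ inner ℝ x.1 x.2 = 0}

/-- The tangent space of `T*S³` at `x = (ξ, η)`: the vectors `(u, v)` with `⟨ξ, u⟩ = 0` and
`⟨u, η⟩ + ⟨ξ, v⟩ = 0`. -/
def tangentCotangentSphere (x : Phase) : Set Phase :=
  {v | inner ℝ x.1 v.1 = 0 ∧ inner ℝ v.1 x.2 + inner ℝ x.1 v.2 = 0}

/-- The symplectic form `dη ∧ dξ`. -/
def symp (v w : Phase) : ℝ := inner ℝ v.2 w.1 - inner ℝ w.2 v.1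

/-! ### The rotating Kepler problem and its Moser regularization -/

/-- The Hamiltonian of the rotating Kepler problem, i.e. the Jacobi Hamiltonian of the circular
restricted three-body problem for the mass ratio `μ = 1`. -/
def jacobi (q p : E3) : ℝ := ‖p‖ ^ 2 / 2 - 1 / ‖q‖ + p 0 * q 1 - p 1 * q 0

/-- The position `q = η₀ (ξ₁,ξ₂,ξ₃) + (1 - ξ₀) (η₁,η₂,η₃)` at the point `(ξ, η)`. -/
def position (x : Phase) : E3 :=
  WithLp.toLp 2 fun i => x.2 0 * x.1 i.succ + (1 - x.1 0) * x.2 i.succ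

/-- The momentum `p = -(ξ₁,ξ₂,ξ₃) / (1 - ξ₀)` at the point `(ξ, η)`, if this is not on the collision
locus `ξ₀ = 1`. -/
def momentum (x : Phase) : E3 :=
  WithLp.toLp 2 fun i => -(x.1 i.succ / (1 - x.1 0))

/-- The factor `f(ξ, η) = 1 + (1 - ξ₀) (- c - 1/2 + ξ₂ η₁ - ξ₁ η₂)`. -/
def moserFactor (c : ℝ) (x : Phase) : ℝ :=
  1 + (1 - x.1 0) * (-c - 1 / 2 + x.1 2 * x.2 1 - x.1 1 * x.2 2)

/-- The regularized Hamiltonian `Q = f² ‖η‖² / 2` for the energy `c`. -/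
def regHam (c : ℝ) (x : Phase) : ℝ := moserFactor c x ^ 2 * ‖x.2‖ ^ 2 / 2

/-- Away from collisions the level `f ‖η‖ = 1` is the energy level `H = c` of the rotating Kepler
problem, written in the coordinates `(ξ, η)`. -/
theorem moser_regularization (c : ℝ) (x : Phase) (hx : x ∈ cotangentSphere) (h0 : x.1 0 ≠ 1)
    (hη : x.2 ≠ 0) :
    (jacobi (position x) (momentum x) - c) * ‖position x‖ = moserFactor c x * ‖x.2‖ - 1 := by
  obtain ⟨ξ, η⟩ := x
  obtain ⟨h1, h2⟩ := hx
  simp only at h0 hη h1 h2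
  have e1 : ξ 0 ^ 2 + ξ 1 ^ 2 + ξ 2 ^ 2 + ξ 3 ^ 2 = 1 := by
    have h := EuclideanSpace.real_norm_sq_eq ξ
    rw [h1, Fin.sum_univ_four] at h
    linarith
  have e2 : ξ 0 * η 0 + ξ 1 * η 1 + ξ 2 * η 2 + ξ 3 * η 3 = 0 := by
    simp only [PiLp.inner_apply, Fin.sum_univ_four, RCLike.inner_apply, conj_trivial] at h2
    linarith
  have e3 : ‖η‖ ^ 2 = η 0 ^ 2 + η 1 ^ 2 + η 2 ^ 2 + η 3 ^ 2 := by
    rw [EuclideanSpace.real_norm_sq_eq, Fin.sum_univ_four]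
  have hlt : 0 < 1 - ξ 0 := by
    have : ξ 0 ≤ 1 := by nlinarith [sq_nonneg (ξ 1), sq_nonneg (ξ 2), sq_nonneg (ξ 3)]
    have := lt_of_le_of_ne this h0
    linarith
  have hη' : 0 < ‖η‖ := norm_pos_iff.mpr hη
  have s1 : (1 : Fin 3).succ = (2 : Fin 4) := rfl
  have s2 : (2 : Fin 3).succ = (3 : Fin 4) := rfl
  have s0 : (0 : Fin 3).succ = (1 : Fin 4) := rfl
  have hq : ‖position (ξ, η)‖ = (1 - ξ 0) * ‖η‖ := by
    rw [← sq_eq_sq₀ (norm_nonneg _) (by positivity), EuclideanSpace.real_norm_sq_eq,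
      Fin.sum_univ_three, mul_pow, e3]
    simp only [position, s0, s1, s2]
    linear_combination (η 0 ^ 2) * e1 + (2 * η 0 * (1 - ξ 0)) * e2
  have hp : ‖momentum (ξ, η)‖ ^ 2 = (1 + ξ 0) / (1 - ξ 0) := by
    rw [EuclideanSpace.real_norm_sq_eq, Fin.sum_univ_three]
    simp only [momentum, s0, s1, s2]
    field_simp
    linear_combination e1
  have hL : momentum (ξ, η) 0 * position (ξ, η) 1 - momentum (ξ, η) 1 * position (ξ, η) 0
      = ξ 2 * η 1 - ξ 1 * η 2 := by
    simp only [momentum, position, s0, s1]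
    field_simp
    ring
  have hJ : jacobi (position (ξ, η)) (momentum (ξ, η)) =
      (1 + ξ 0) / (1 - ξ 0) / 2 - 1 / ((1 - ξ 0) * ‖η‖) + (ξ 2 * η 1 - ξ 1 * η 2) := by
    rw [jacobi, hp, hq, ← hL]
    ring
  rw [hJ, hq, moserFactor]
  field_simp
  ring

/-- The pole `x₊ = (1,0,0,0; 0,0,0,1)`. It is a point of the collision locus `ξ₀ = 1`. -/
def poleNorth : Phase := (!₂[1, 0, 0, 0], !₂[0, 0, 0, 1])

/-- The pole `x₋ = (-1,0,0,0; 0,0,0,-1/(2c))`. -/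
def poleSouth (c : ℝ) : Phase := (!₂[-1, 0, 0, 0], !₂[0, 0, 0, -1 / (2 * c)])

/-- The bounded component `Σ_c` of the regularized energy hypersurface: the connected component of
`{Q = 1/2} ⊆ T*S³` that contains the collisions with the primary. -/
def energySurface (c : ℝ) : Set Phase :=
  connectedComponentIn {x | x ∈ cotangentSphere ∧ regHam c x = 1 / 2} poleNorth

/-- `γ` is an orbit in `Σ_c` of the Hamiltonian flow of `Q` on `(T*S³, dη ∧ dξ)`: at all times the
velocity `X` is tangent to `T*S³` and `ω(X, ·) = - dQ` on the tangent space of `T*S³`. -/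
def IsOrbit (c : ℝ) (γ : ℝ → Phase) : Prop :=
  ∀ t, γ t ∈ energySurface c ∧ ∃ X ∈ tangentCotangentSphere (γ t), HasDerivAt γ X t ∧
    ∀ Y ∈ tangentCotangentSphere (γ t), symp X Y = -(fderiv ℝ (regHam c) (γ t) Y)

/-! ### Distinguished orbits -/

/-- A planar circular orbit: it has no collisions, it stays in the plane `q₃ = p₃ = 0`, and the
distance to the primary is constant. -/
def IsCircularOrbit (c : ℝ) (γ : ℝ → Phase) : Prop :=
  IsOrbit c γ ∧ ∃ ρ : ℝ, ∀ t, (γ t).1 0 ≠ 1 ∧ position (γ t) 2 = 0 ∧ momentum (γ t) 2 = 0 ∧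
    ‖position (γ t)‖ = ρ

/-- The angular momentum `q₁ p₂ - q₂ p₁`. -/
def angularMomentum (x : Phase) : ℝ :=
  position x 0 * momentum x 1 - position x 1 * momentum x 0

/-- A direct planar circular orbit: the body turns around the primary in the direction in which the
coordinate system rotates. -/
def IsDirectOrbit (c : ℝ) (γ : ℝ → Phase) : Prop :=
  IsCircularOrbit c γ ∧ ∀ t, 0 < angularMomentum (γ t)

/-- A retrograde planar circular orbit: the body turns in the opposite direction. -/
def IsRetrogradeOrbit (c : ℝ) (γ : ℝ → Phase) : Prop :=
  IsCircularOrbit c γ ∧ ∀ t, angularMomentum (γ t) < 0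

/-- A polar collision orbit: a periodic orbit on the `q₃`-axis that collides with the primary. -/
def IsPolarOrbit (c : ℝ) (γ : ℝ → Phase) : Prop :=
  IsOrbit c γ ∧ (∃ T > 0, ∀ t, γ (t + T) = γ t) ∧
    (∀ t, (γ t).1 1 = 0 ∧ (γ t).1 2 = 0 ∧ (γ t).2 1 = 0 ∧ (γ t).2 2 = 0) ∧ ∃ t, (γ t).1 0 = 1

/-! ### The page and the return map -/

/-- The page `P = {ξ₃ = 0, η₃ ≥ 0}` of the geodesic open book. -/
def page (c : ℝ) : Set Phase := {x | x ∈ energySurface c ∧ x.1 3 = 0 ∧ 0 ≤ x.2 3}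

/-- The interior of the page. -/
def pageInterior (c : ℝ) : Set Phase := {x | x ∈ energySurface c ∧ x.1 3 = 0 ∧ 0 < x.2 3}

/-- The boundary of the page, which is the planar problem. -/
def pageBoundary (c : ℝ) : Set Phase := {x | x ∈ energySurface c ∧ x.1 3 = 0 ∧ x.2 3 = 0}

/-- The tangent space of the page at one of its points (also at the boundary points). -/
def tangentPage (c : ℝ) (x : Phase) : Set Phase :=
  {v | v ∈ tangentCotangentSphere x ∧ v.1 3 = 0 ∧ fderiv ℝ (regHam c) x v = 0}

/-- `R` is the Poincaré return map of the page: in the interior it is the first return of the flow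
to the interior, and it is smooth up to the boundary. -/
def IsReturnMap (c : ℝ) (R : Phase → Phase) : Prop :=
  SmoothOn R (page c) ∧ MapsTo R (page c) (page c) ∧
    ∀ x ∈ pageInterior c, ∃ γ : ℝ → Phase, IsOrbit c γ ∧ γ 0 = x ∧ ∃ τ > 0,
      γ τ = R x ∧ γ τ ∈ pageInterior c ∧ ∀ t ∈ Ioo 0 τ, γ t ∉ pageInterior c

/-! ### Annuli -/

/-- `ψ (θ, r)`, for `θ ∈ ℝ/2πℤ` and `r ∈ [0,1]`, is a diffeomorphism of the compact annulus
`𝔻*S¹ ≅ ℝ/2πℤ × [0,1]` onto `F`, which takes the boundary circles `r = 0`, `r = 1` to `A₀`, `A₁`,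
and for which `ω` is positive in the interior of the annulus with the orientation `dr ∧ dθ`. -/
structure IsAnnulus (F A₀ A₁ : Set Phase) (ψ : ℝ × ℝ → Phase) : Prop where
  smooth : SmoothOn ψ (univ ×ˢ Icc 0 1)
  periodic : ∀ θ, ∀ r ∈ Icc (0 : ℝ) 1, ψ (θ + 2 * Real.pi, r) = ψ (θ, r)
  injective : ∀ θ θ', ∀ r ∈ Icc (0 : ℝ) 1, ∀ r' ∈ Icc (0 : ℝ) 1, ψ (θ, r) = ψ (θ', r') →
    r = r' ∧ ∃ k : ℤ, θ' = θ + k * (2 * Real.pi)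
  immersion : ∀ θ, ∀ r ∈ Icc (0 : ℝ) 1, Function.Injective (fderiv ℝ ψ (θ, r))
  image : ψ '' (univ ×ˢ Icc 0 1) = F
  image_zero : range (fun θ => ψ (θ, 0)) = A₀
  image_one : range (fun θ => ψ (θ, 1)) = A₁
  positive : ∀ θ, ∀ r ∈ Ioo (0 : ℝ) 1,
    0 < symp (fderiv ℝ ψ (θ, r) (0, 1)) (fderiv ℝ ψ (θ, r) (1, 0))

/-- The positive (right-handed) Dehn twist `τ_P` of the annulus `ℝ/2πℤ × [0,1]` with the orientation
`dr ∧ dθ`. It is the identity on both boundary circles. -/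
def dehnTwist (p : ℝ × ℝ) : ℝ × ℝ := (p.1 - 2 * Real.pi * p.2, p.2)

/-- `R` acts on the annulus `F` as an integrable twist map: in coordinates `(θ, r)` on the compact
annulus with action variable `I(r)`, so that `ω = dI ∧ dθ`, it is
`(θ, r) ↦ (θ + g(I(r)), r)`, with `g' ≠ 0` on the whole range of the action. -/
def IsIntegrableTwist (F A₀ A₁ : Set Phase) (R : Phase → Phase) : Prop :=
  ∃ (ψ : ℝ × ℝ → Phase) (I g : ℝ → ℝ), IsAnnulus F A₀ A₁ ψ ∧
    SmoothOn I (Icc 0 1) ∧ StrictMonoOn I (Icc 0 1) ∧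
    (∀ θ, ∀ r ∈ Icc (0 : ℝ) 1,
      symp (fderiv ℝ ψ (θ, r) (0, 1)) (fderiv ℝ ψ (θ, r) (1, 0)) = deriv I r) ∧
    SmoothOn g (Icc (I 0) (I 1)) ∧ (∀ s ∈ Icc (I 0) (I 1), deriv g s ≠ 0) ∧
    ∀ θ, ∀ r ∈ Icc (0 : ℝ) 1, R (ψ (θ, r)) = ψ (θ + g (I r), r)

/-! ### Lefschetz fibrations of the page -/

/-- The (open) fiber over `z` of a map `π` that is defined on `P ∖ (A₀ ∪ A₁)`. -/
def fiber (c : ℝ) (A₀ A₁ : Set Phase) (π : Phase → ℂ) (z : ℂ) : Set Phase :=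
  {x | x ∈ page c \ (A₀ ∪ A₁) ∧ π x = z}

/-- The critical points of `π`: the points at which `dπ`, on the tangent space of the page, is not
onto `ℂ`. -/
def criticalSet (c : ℝ) (A₀ A₁ : Set Phase) (π : Phase → ℂ) : Set Phase :=
  {x | x ∈ page c \ (A₀ ∪ A₁) ∧ ¬ ∀ w : ℂ, ∃ v ∈ tangentPage c x, fderiv ℝ π x v = w}

/-- `x` is a nodal (Lefschetz) singularity of `π`: there are complex coordinates `(z₁, z₂)` on the
page, centred at `x`, and an orientation-preserving local coordinate `β` on the base `ℂ`, centred at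
`π x`, in which `π` is `z₁² + z₂²`. The complex structure of the coordinates `(z₁, z₂)` is tamed by
`ω` (in particular, they are compatible with the orientation `ω ∧ ω` of the page). -/
def IsNode (c : ℝ) (π : Phase → ℂ) (x : Phase) : Prop :=
  ∃ (V : Set (ℂ × ℂ)) (ψ : ℂ × ℂ → Phase) (W : Set ℂ) (β : ℂ → ℂ),
    IsOpen V ∧ (0, 0) ∈ V ∧ ψ (0, 0) = x ∧ ContDiffOn ℝ ∞ ψ V ∧ InjOn ψ V ∧
    MapsTo ψ V (page c) ∧
    (∀ p ∈ V, ∃ O : Set Phase, IsOpen O ∧ ψ p ∈ O ∧ page c ∩ O ⊆ ψ '' V) ∧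
    (∀ p ∈ V, ∀ v : ℂ × ℂ, v ≠ 0 →
      0 < symp (fderiv ℝ ψ p v) (fderiv ℝ ψ p (Complex.I • v))) ∧
    IsOpen W ∧ 0 ∈ W ∧ β 0 = π x ∧ ContDiffOn ℝ ∞ β W ∧ InjOn β W ∧
    (∀ u ∈ W, 0 < (fderiv ℝ β u).det) ∧
    ∀ p ∈ V, p.1 ^ 2 + p.2 ^ 2 ∈ W ∧ π (ψ p) = β (p.1 ^ 2 + p.2 ^ 2)

/-- A smooth family, parametrized by `B`, of parametrizations `Ψ (b, ·)` of the compact fibers over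
the points `z b` by the annulus. All the compact fibers have the same boundary `A₀ ∪ A₁`, and the
parametrization of this boundary does not depend on `b`. -/
def IsFiberFamily (c : ℝ) (A₀ A₁ : Set Phase) (π : Phase → ℂ) {X : Type*} [NormedAddCommGroup X]
    [NormedSpace ℝ X] (B : Set X) (z : X → ℂ) (Ψ : X × (ℝ × ℝ) → Phase) : Prop :=
  SmoothOn Ψ (B ×ˢ (univ ×ˢ Icc 0 1)) ∧
    (∀ b ∈ B, IsAnnulus (closure (fiber c A₀ A₁ π (z b))) A₀ A₁ fun p => Ψ (b, p)) ∧
    ∀ b ∈ B, ∀ b' ∈ B, ∀ θ, Ψ (b, (θ, 0)) = Ψ (b', (θ, 0)) ∧ Ψ (b, (θ, 1)) = Ψ (b', (θ, 1))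

/-- `π` is a symplectic Lefschetz fibration of the page `P ≅ 𝔻*S²` over the closed unit disk, of
abstract type `LF(𝔻*S¹, τ_P²)`, all of whose compact fibers have the boundary `A₀ ∪ A₁`.

The map `π` is defined on the complement of `A₀ ∪ A₁`, where the compact fibers come together. The
fibers over the unit circle are the pages of the open book `OB(𝔻*S¹, τ_P²)` of `∂P`. -/
structure IsSymplecticLefschetzFibration (c : ℝ) (A₀ A₁ : Set Phase) (π : Phase → ℂ) :
    Prop where
  smooth : SmoothOn π (page c \ (A₀ ∪ A₁))
  image : π '' (page c \ (A₀ ∪ A₁)) = closedBall 0 1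
  boundary : ∀ x ∈ page c \ (A₀ ∪ A₁), x ∈ pageBoundary c ↔ ‖π x‖ = 1
  /-- `ω` is a symplectic form on the interior of the page. -/
  symplectic : ∀ x ∈ pageInterior c, ∀ v ∈ tangentPage c x, v ≠ 0 →
    ∃ w ∈ tangentPage c x, symp v w ≠ 0
  /-- The fibers are symplectic away from the critical points. -/
  symplectic_fiber : ∀ x ∈ (page c \ (A₀ ∪ A₁)) \ criticalSet c A₀ A₁ π,
    ∀ v ∈ tangentPage c x, fderiv ℝ π x v = 0 → v ≠ 0 →
      ∃ w ∈ tangentPage c x, fderiv ℝ π x w = 0 ∧ symp v w ≠ 0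
  /-- There are finitely many critical points; they are nodes in the interior of the page, and
  lie on different fibers. -/
  critical_finite : (criticalSet c A₀ A₁ π).Finite
  critical_interior : criticalSet c A₀ A₁ π ⊆ pageInterior c
  critical_injOn : InjOn π (criticalSet c A₀ A₁ π)
  node : ∀ x ∈ criticalSet c A₀ A₁ π, IsNode c π x
  /-- The boundary of each fiber is `A₀ ∪ A₁`. -/
  closure_fiber : ∀ z ∈ closedBall (0 : ℂ) 1,
    closure (fiber c A₀ A₁ π z) = fiber c A₀ A₁ π z ∪ (A₀ ∪ A₁)
  /-- Over the regular values, the compact fibers form a locally trivial family of annuli. -/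
  locally_trivial : ∀ z₀ ∈ closedBall (0 : ℂ) 1, z₀ ∉ π '' criticalSet c A₀ A₁ π →
    ∃ N ∈ 𝓝 z₀, ∃ Ψ : ℂ × (ℝ × ℝ) → Phase,
      IsFiberFamily c A₀ A₁ π (N ∩ closedBall 0 1) (fun z => z) Ψ
  /-- The monodromy of the fibration, along the boundary of the disk, is `τ_P²`. -/
  monodromy : ∃ Ψ : ℝ × (ℝ × ℝ) → Phase,
    IsFiberFamily c A₀ A₁ π (Icc (0 : ℝ) 1)
      (fun t => Complex.exp (2 * Real.pi * t * Complex.I)) Ψ ∧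
    ∀ θ, ∀ r ∈ Icc (0 : ℝ) 1, Ψ (1, (θ, r)) = Ψ (0, dehnTwist (dehnTwist (θ, r)))

/-! ### The topology of the page and of its boundary -/

/-- The unit disk cotangent bundle `𝔻*S²`. -/
def diskCotangentBundle : Set (E3 × E3) := {x | ‖x.1‖ = 1 ∧ inner ℝ x.1 x.2 = 0 ∧ ‖x.2‖ ≤ 1}

/-- The sets `s` and `t` are diffeomorphic. -/
def AreDiffeomorphic {X Y : Type*} [NormedAddCommGroup X] [NormedSpace ℝ X]
    [NormedAddCommGroup Y] [NormedSpace ℝ Y] (s : Set X) (t : Set Y) : Prop :=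
  ∃ (F : X → Y) (G : Y → X), SmoothOn F s ∧ SmoothOn G t ∧ MapsTo F s t ∧ MapsTo G t s ∧
    LeftInvOn G F s ∧ RightInvOn G F t

/-- `M` is diffeomorphic to `ℝP³ = S³/±1`, by a diffeomorphism that identifies `A₀`, `A₁` with the
images of the two components `{z₂ = 0}`, `{z₁ = 0}` of the Hopf link in `S³ ⊆ ℂ²`: there is an
immersion `h` of `S³` onto `M` that identifies exactly the antipodal points. -/
def IsHopfLink (M A₀ A₁ : Set Phase) : Prop :=
  ∃ h : ℂ × ℂ → Phase, SmoothOn h {z | ‖z.1‖ ^ 2 + ‖z.2‖ ^ 2 = 1} ∧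
    h '' {z | ‖z.1‖ ^ 2 + ‖z.2‖ ^ 2 = 1} = M ∧
    (∀ z w : ℂ × ℂ, ‖z.1‖ ^ 2 + ‖z.2‖ ^ 2 = 1 → ‖w.1‖ ^ 2 + ‖w.2‖ ^ 2 = 1 →
      (h z = h w ↔ w = z ∨ w = -z)) ∧
    (∀ z v : ℂ × ℂ, ‖z.1‖ ^ 2 + ‖z.2‖ ^ 2 = 1 → inner ℝ z.1 v.1 + inner ℝ z.2 v.2 = 0 →
      fderiv ℝ h z v = 0 → v = 0) ∧
    h '' {z | ‖z.1‖ = 1 ∧ z.2 = 0} = A₀ ∧ h '' {z | z.1 = 0 ∧ ‖z.2‖ = 1} = A₁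

end RotatingKepler

end

open Set Filter Topology Metric
open scoped ContDiff

noncomputable section

namespace RotatingKepler

/-! ### Coordinates on phase space -/

/-! The Hamiltonian is the Kepler energy plus the moment `L = rotMoment` of the rotations about the
`q₃`-axis, and the two commute. On `H = c` the Kepler energy is thus `-k²/2` with `k² = 2 (L - c)`,
and `k` is constant along orbits. Rescaling momenta by `k`, which on `S³` is the conformal map
`boost k`, turns the regularized Kepler flow of that energy into the geodesic flow on unit
covectors. The normalized moment is `s = k L`, so `k` is a root of `k³ + 2 c k = 2 s`. On unit
covectors `|s| ≤ 1`, while the branch `k > minFreq c` of roots is smooth as long as `s > -minFreq c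
^ 3`. The hypothesis `c < -3/2` says exactly that `minFreq c > 1`, so the branch is defined on all
unit covectors. Hence `chart c` maps the unit cotangent bundle diffeomorphically onto `Σ_c`, the
part of the level with `L > 2c/3` (`chart_image_unitCotangent`, `energySurface_eq`).

In this chart the Hamiltonian field is `k` times the geodesic field plus `(1 - ξ₀)/k²` times the
rotation field (`hasDerivAt_chart`). These flows commute, and the flow is explicit: `normalFlow`.
The geodesic closes up after time `2π/k`, when the frame has turned by `2π/k³`. So the return map is
the rotation by `2π/k³` (`firstReturn`), a formula that is smooth up to the boundary of the page.

To describe the page put `ζ = ξ + i η`, `α = ζ₁ + i ζ₂`, `β = ζ₁ - i ζ₂`, `Z = ζ₀`, `t = η₃`. Then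
the page is the part `t ≥ 0` of the affine cone `αβ + Z² = t²` intersected with a sphere. Rotations
multiply `α` and `β` by opposite phases and fix `(Z, t)`. The direction of `(Z, t)` lies in a closed
hemisphere, that is in a disk, and this direction is the fibration; it is undefined only where `Z =
t = 0`, which is the union of the circles `α = 0` and `β = 0`, the two circular orbits.

Over a direction `w` the fiber is the conic `αβ = a² δ`, `a > 0`, with `δ = t² - Z²` evaluated at
`w` (`pencil`). If `δ ≠ 0` it is an open annulus whose ends close up at the two circular orbits. If
`δ = 0`, that is `Z = ±t`, it is a pair of disks meeting in a node at one of the poles. On the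
equator `t = 0` one has `δ = -Z²`, which winds twice around the origin, and this gives the monodromy
`τ_P²` (`exists_monodromy`).

Since `L` generates the rotations, it is the action variable on each annulus: `ω = dL ∧ dθ`
(`symp_annulus`). The return map adds the angle `2π / (2 (L - c))^(3/2)` to `θ`
(`returnMap_annulus`), which has nonzero derivative in `L`; this is the twist. -/

theorem phase_ext {x y : Phase} (h1 : ∀ i, x.1 i = y.1 i) (h2 : ∀ i, x.2 i = y.2 i) : x = y :=
  Prod.ext (PiLp.ext h1) (PiLp.ext h2)

theorem norm_sq_four (x : E4) : ‖x‖ ^ 2 = x 0 ^ 2 + x 1 ^ 2 + x 2 ^ 2 + x 3 ^ 2 := by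
  rw [EuclideanSpace.real_norm_sq_eq, Fin.sum_univ_four]

theorem inner_four (x y : E4) :
    inner ℝ x y = x 0 * y 0 + x 1 * y 1 + x 2 * y 2 + x 3 * y 3 := by
  simp only [PiLp.inner_apply, Fin.sum_univ_four, RCLike.inner_apply, conj_trivial]
  ring

theorem contDiff_phase_fst (i : Fin 4) {n : WithTop ℕ∞} :
    ContDiff ℝ n fun x : Phase => x.1 i := by
  fun_prop

theorem contDiff_phase_snd (i : Fin 4) {n : WithTop ℕ∞} :
    ContDiff ℝ n fun x : Phase => x.2 i := by
  fun_prop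

theorem contDiffAt_phase {E : Type*} [NormedAddCommGroup E] [NormedSpace ℝ E]
    {n : WithTop ℕ∞} {f : E → Phase} {e : E} (h1 : ∀ i, ContDiffAt ℝ n (fun x => (f x).1 i) e)
    (h2 : ∀ i, ContDiffAt ℝ n (fun x => (f x).2 i) e) : ContDiffAt ℝ n f e :=
  (contDiffAt_euclidean.2 h1).prodMk (contDiffAt_euclidean.2 h2)

/-- The moment `ξ₂ η₁ - ξ₁ η₂` of the rotation about the `q₃`-axis. -/
def rotMoment (x : Phase) : ℝ := x.1 2 * x.2 1 - x.1 1 * x.2 2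

/-! ### The conformal rescaling of the sphere -/

/-- The denominator of the conformal map `boost k`. -/
def boostDenom (k : ℝ) (x : Phase) : ℝ := k ^ 2 * (1 + x.1 0) + (1 - x.1 0)

/-- The cotangent lift of the conformal map of `S³` that is `p ↦ k p` under stereographic
projection. -/
def boost (k : ℝ) (x : Phase) : Phase :=
  (!₂[(k ^ 2 * (1 + x.1 0) - (1 - x.1 0)) / boostDenom k x, 2 * k * x.1 1 / boostDenom k x,
      2 * k * x.1 2 / boostDenom k x, 2 * k * x.1 3 / boostDenom k x],
   !₂[x.2 0, (boostDenom k x * x.2 1 + (1 - k ^ 2) * x.2 0 * x.1 1) / (2 * k),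
      (boostDenom k x * x.2 2 + (1 - k ^ 2) * x.2 0 * x.1 2) / (2 * k),
      (boostDenom k x * x.2 3 + (1 - k ^ 2) * x.2 0 * x.1 3) / (2 * k)])

section boost

variable (k : ℝ) (x : Phase)

@[simp] theorem boost_fst_zero :
    (boost k x).1 0 = (k ^ 2 * (1 + x.1 0) - (1 - x.1 0)) / boostDenom k x := rfl
@[simp] theorem boost_fst_one : (boost k x).1 1 = 2 * k * x.1 1 / boostDenom k x := rfl
@[simp] theorem boost_fst_two : (boost k x).1 2 = 2 * k * x.1 2 / boostDenom k x := rfl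
@[simp] theorem boost_fst_three : (boost k x).1 3 = 2 * k * x.1 3 / boostDenom k x := rfl
@[simp] theorem boost_snd_zero : (boost k x).2 0 = x.2 0 := rfl
@[simp] theorem boost_snd_one :
    (boost k x).2 1 = (boostDenom k x * x.2 1 + (1 - k ^ 2) * x.2 0 * x.1 1) / (2 * k) := rfl
@[simp] theorem boost_snd_two :
    (boost k x).2 2 = (boostDenom k x * x.2 2 + (1 - k ^ 2) * x.2 0 * x.1 2) / (2 * k) := rfl
@[simp] theorem boost_snd_three :
    (boost k x).2 3 = (boostDenom k x * x.2 3 + (1 - k ^ 2) * x.2 0 * x.1 3) / (2 * k) := rfl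

variable {k x}

theorem boostDenom_inv_boost (hk : k ≠ 0) (hD : boostDenom k x ≠ 0) :
    boostDenom k⁻¹ (boost k x) = 4 / boostDenom k x := by
  rw [boostDenom, boost_fst_zero]
  field_simp
  rw [boostDenom]
  ring

theorem boost_inv_boost (hk : k ≠ 0) (hD : boostDenom k x ≠ 0) : boost k⁻¹ (boost k x) = x := by
  apply phase_ext <;> intro i <;> fin_cases i <;>
    simp only [Fin.zero_eta, Fin.mk_one, Fin.reduceFinMk, boost_fst_zero, boost_fst_one,
      boost_fst_two, boost_fst_three, boost_snd_zero, boost_snd_one, boost_snd_two,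
      boost_snd_three, boostDenom_inv_boost hk hD] <;> field_simp <;> (try rw [boostDenom]) <;> ring

/-- The conformal map commutes with the rotations, so its cotangent lift preserves their moment. -/
theorem rotMoment_boost (hk : k ≠ 0) (hD : boostDenom k x ≠ 0) :
    rotMoment (boost k x) = rotMoment x := by
  simp only [rotMoment, boost_fst_one, boost_fst_two, boost_snd_one, boost_snd_two]
  field_simp
  ring

/-- This identity and the next two hold off `T*S³` as well and express the defects of the
constraints after `boost` through the defects before. Differentiating them later matches the tangent
spaces without computing the derivative of the map. -/
theorem norm_sq_boost (hD : boostDenom k x ≠ 0) :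
    ‖(boost k x).1‖ ^ 2 - 1 = 4 * k ^ 2 / boostDenom k x ^ 2 * (‖x.1‖ ^ 2 - 1) := by
  simp only [norm_sq_four, boost_fst_zero, boost_fst_one, boost_fst_two, boost_fst_three]
  field_simp
  rw [boostDenom]
  ring

theorem inner_boost (hk : k ≠ 0) (hD : boostDenom k x ≠ 0) :
    inner ℝ (boost k x).1 (boost k x).2 = inner ℝ x.1 x.2 +
      (1 - k ^ 2) * x.2 0 / boostDenom k x * (‖x.1‖ ^ 2 - 1) := by
  simp only [norm_sq_four, inner_four, boost_fst_zero, boost_fst_one, boost_fst_two,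
    boost_fst_three, boost_snd_zero, boost_snd_one, boost_snd_two, boost_snd_three]
  field_simp
  rw [boostDenom]
  ring

theorem norm_sq_snd_boost (hk : k ≠ 0) :
    4 * k ^ 2 * ‖(boost k x).2‖ ^ 2 = boostDenom k x ^ 2 * ‖x.2‖ ^ 2 +
      2 * boostDenom k x * (1 - k ^ 2) * x.2 0 * inner ℝ x.1 x.2 +
      (1 - k ^ 2) ^ 2 * x.2 0 ^ 2 * (‖x.1‖ ^ 2 - 1) := by
  simp only [norm_sq_four, inner_four, boost_snd_zero, boost_snd_one, boost_snd_two,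
    boost_snd_three]
  field_simp
  rw [boostDenom]
  ring

end boost

/-! ### The frequency of the Kepler motion as a function of the normalized moment -/

/-- The smallest frequency for which the moment is not bounded away from its admissible range. -/
def minFreq (c : ℝ) : ℝ := √(-2 * c / 3)

open Classical in
/-- The largest root `k` of `k³ + 2 c k = 2 s`. -/
def freq (c s : ℝ) : ℝ :=
  if h : ∃ k, minFreq c < k ∧ k ^ 3 + 2 * c * k = 2 * s then h.choose else 1

section freq

variable {c : ℝ}

theorem minFreq_sq (hc : c < -3 / 2) : minFreq c ^ 2 = -2 * c / 3 :=
  Real.sq_sqrt (by linarith)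

theorem one_lt_minFreq (hc : c < -3 / 2) : 1 < minFreq c := by
  rw [minFreq, Real.lt_sqrt (by norm_num)]
  linarith

/-- The difference of the values is `(l - k) (l² + k l + k² + 2 c)`, and each of the three squares
and products is at least `minFreq c ^ 2 = -2c/3`. -/
theorem strictMonoOn_cubic (hc : c < -3 / 2) {k l : ℝ} (hk : minFreq c ≤ k) (hkl : k < l) :
    k ^ 3 + 2 * c * k < l ^ 3 + 2 * c * l := by
  have h1 := one_lt_minFreq hc
  have h2 := minFreq_sq hc
  have h3 : minFreq c ^ 2 ≤ k ^ 2 := by gcongr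
  have h4 : k ^ 2 < k * l := by nlinarith
  have h5 : k * l < l ^ 2 := by nlinarith
  have : 0 < (l - k) * (l ^ 2 + k * l + k ^ 2 + 2 * c) := by
    apply mul_pos <;> nlinarith
  nlinarith

/-- The number `-minFreq c ^ 3` is half the value of the cubic at its local minimum `minFreq c`, so
the intermediate value theorem gives a root beyond that point. -/
theorem freq_spec (hc : c < -3 / 2) {s : ℝ} (hs : -minFreq c ^ 3 < s) :
    minFreq c < freq c s ∧ freq c s ^ 3 + 2 * c * freq c s = 2 * s := by
  have h : ∃ k, minFreq c < k ∧ k ^ 3 + 2 * c * k = 2 * s := by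
    have h1 := one_lt_minFreq hc
    have h2 := minFreq_sq hc
    -- A crude point at which the cubic already exceeds `2 s`.
    set K := minFreq c + |s| + 1 + -2 * c with hK
    have hs' := neg_abs_le s
    have hs'' := le_abs_self s
    have hKl : minFreq c ≤ K := by rw [hK]; linarith [abs_nonneg s]
    have hlow : minFreq c ^ 3 + 2 * c * minFreq c < 2 * s := by nlinarith
    have hhigh : 2 * s < K ^ 3 + 2 * c * K := by
      have : 2 * |s| + 2 < K ^ 2 + 2 * c := by nlinarith [abs_nonneg s]
      nlinarith [abs_nonneg s]
    obtain ⟨k, hk, hk2⟩ := intermediate_value_Ioo hKl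
      (f := fun k : ℝ => k ^ 3 + 2 * c * k) (by fun_prop) ⟨hlow, hhigh⟩
    exact ⟨k, hk.1, hk2⟩
  rw [freq, dif_pos h]
  exact h.choose_spec

theorem freq_unique (hc : c < -3 / 2) {s k : ℝ} (hk : minFreq c < k)
    (h : k ^ 3 + 2 * c * k = 2 * s) : freq c s = k := by
  have hs : -minFreq c ^ 3 < s := by
    have h1 := strictMonoOn_cubic hc le_rfl hk
    have h2 : 2 * c * minFreq c = -3 * minFreq c ^ 3 := by
      linear_combination 3 * minFreq c * minFreq_sq hc
    linarith
  obtain ⟨h1, h2⟩ := freq_spec hc hs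
  rcases lt_trichotomy (freq c s) k with h3 | h3 | h3
  · linarith [strictMonoOn_cubic hc h1.le h3]
  · exact h3
  · linarith [strictMonoOn_cubic hc hk.le h3]

theorem hasDerivAt_cubic (c k : ℝ) :
    HasDerivAt (fun k : ℝ => (k ^ 3 + 2 * c * k) / 2) ((3 * k ^ 2 + 2 * c) / 2) k := by
  have := (((hasDerivAt_id k).pow 3).add ((hasDerivAt_id k).const_mul (2 * c))).div_const 2
  refine this.congr_deriv ?_
  simp only [id, mul_one]
  norm_num

theorem freq_deriv_pos (hc : c < -3 / 2) {k : ℝ} (hk : minFreq c < k) :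
    0 < (3 * k ^ 2 + 2 * c) / 2 := by
  have h1 := one_lt_minFreq hc
  have h2 := minFreq_sq hc
  nlinarith

/-- By the inverse function theorem the cubic has a smooth local inverse; by continuity its values
stay above `minFreq c`, so uniqueness of the root identifies it with `freq c`. The derivative
follows from the chain rule. -/
theorem contDiffAt_freq (hc : c < -3 / 2) {s : ℝ} (hs : -minFreq c ^ 3 < s) :
    ContDiffAt ℝ ∞ (freq c) s ∧
      HasDerivAt (freq c) (2 / (3 * freq c s ^ 2 + 2 * c)) s := by
  obtain ⟨h1, h2⟩ := freq_spec hc hs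
  set k := freq c s with hk
  set g : ℝ → ℝ := fun k : ℝ => (k ^ 3 + 2 * c * k) / 2 with hg
  have hgs : g k = s := by simp only [hg]; linarith
  have hd := freq_deriv_pos hc h1
  have hgC : ContDiffAt ℝ ∞ g k := by fun_prop
  have hg' := hasDerivAt_cubic c k
  set e := ContinuousLinearEquiv.unitsEquivAut ℝ (Units.mk0 _ hd.ne')
  have hg'' : HasFDerivAt g (e : ℝ →L[ℝ] ℝ) k := by
    have : (e : ℝ →L[ℝ] ℝ) = ContinuousLinearMap.toSpanSingleton ℝ ((3 * k ^ 2 + 2 * c) / 2) := by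
      ext
      simp [e]
    rw [this]
    exact hg'.hasFDerivAt
  have hloc := hgC.to_localInverse hg'' (by simp)
  have hst := hgC.hasStrictFDerivAt' hg'' (by simp)
  have hev : freq c =ᶠ[𝓝 s] hgC.localInverse hg'' (by simp) := by
    have e1 := hst.eventually_right_inverse
    have e2 := hst.localInverse_continuousAt
    have e3 : hst.localInverse g e k (g k) = k := hst.localInverse_apply_image
    have e4 : ∀ᶠ y in 𝓝 (g k), minFreq c < hst.localInverse g e k y :=
      e2.eventually (by rw [e3]; exact lt_mem_nhds h1)
    rw [hgs] at e1 e4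
    filter_upwards [e1, e4] with y hy1 hy2
    refine freq_unique hc hy2 ?_
    have : g (hst.localInverse g e k y) = y := hy1
    change ((hst.localInverse g e k y) ^ 3 + 2 * c * hst.localInverse g e k y) / 2 = y at this
    change (hst.localInverse g e k y) ^ 3 + 2 * c * hst.localInverse g e k y = 2 * y
    linarith
  rw [hgs] at hloc
  have hC : ContDiffAt ℝ ∞ (freq c) s := hloc.congr_of_eventuallyEq hev
  refine ⟨hC, ?_⟩
  have hdf := (hC.differentiableAt (by simp)).hasDerivAt
  have hcomp : HasDerivAt (fun y => g (freq c y))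
      (((3 * k ^ 2 + 2 * c) / 2) * deriv (freq c) s) s :=
    HasDerivAt.comp s (h₂ := g) (by rw [← hk]; exact hg') hdf
  have hid : HasDerivAt (fun y => g (freq c y)) 1 s := by
    refine (hasDerivAt_id s).congr_of_eventuallyEq ?_
    filter_upwards [lt_mem_nhds hs] with y hy
    have := (freq_spec hc hy).2
    simp only [hg, id]
    linarith
  have := hcomp.unique hid
  refine hdf.congr_deriv ?_
  rw [eq_div_iff (by linarith)]
  linarith

end freq

/-! ### The chart of the energy surface in which the Kepler flow is the geodesic flow -/

/-- The normalized Kepler problem `(x, v)` in the coordinates `(ξ, η)`. -/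
def chart (c : ℝ) (x : Phase) : Phase :=
  boost (freq c (rotMoment x)) (x.1, (freq c (rotMoment x))⁻¹ • x.2)

/-- The frequency `√(-2E)` of the Kepler ellipse, for the Kepler energy `E = c - rotMoment x`. -/
def keplerFreq (c : ℝ) (x : Phase) : ℝ := √(2 * (rotMoment x - c))

/-- The inverse of `chart`. -/
def chartInv (c : ℝ) (x : Phase) : Phase :=
  ((boost (keplerFreq c x)⁻¹ x).1, keplerFreq c x • (boost (keplerFreq c x)⁻¹ x).2)

/-- An open condition in the whole ambient space, so that derivatives of `chart` make sense at the
points of the unit cotangent bundle. -/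
def chartSource (c : ℝ) : Set Phase :=
  {x | -minFreq c ^ 3 < rotMoment x ∧ 0 < boostDenom (freq c (rotMoment x)) x}

/-- The bound `2c/3` on the moment is the bound `minFreq c` on the Kepler frequency. -/
def chartTarget (c : ℝ) : Set Phase :=
  {x | 2 * c / 3 < rotMoment x ∧ 0 < boostDenom (keplerFreq c x)⁻¹ x}

theorem contDiff_rotMoment {n : WithTop ℕ∞} : ContDiff ℝ n rotMoment := by
  unfold rotMoment
  fun_prop

theorem contDiffAt_boost {E : Type*} [NormedAddCommGroup E] [NormedSpace ℝ E] {n : WithTop ℕ∞}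
    {k : E → ℝ} {f : E → Phase} {e : E} (hk : ContDiffAt ℝ n k e) (hf : ContDiffAt ℝ n f e)
    (hk0 : k e ≠ 0) (hD : boostDenom (k e) (f e) ≠ 0) :
    ContDiffAt ℝ n (fun y => boost (k y) (f y)) e := by
  have h1 : ∀ i, ContDiffAt ℝ n (fun y => (f y).1 i) e := fun i =>
    (contDiff_phase_fst i).contDiffAt.comp e hf
  have h2 : ∀ i, ContDiffAt ℝ n (fun y => (f y).2 i) e := fun i =>
    (contDiff_phase_snd i).contDiffAt.comp e hf
  have hDs : ContDiffAt ℝ n (fun y => boostDenom (k y) (f y)) e := by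
    unfold boostDenom
    exact ((hk.pow 2).mul (contDiffAt_const.add (h1 0))).add (contDiffAt_const.sub (h1 0))
  have h2k : ContDiffAt ℝ n (fun y => 2 * k y) e := contDiffAt_const.mul hk
  have h2k0 : 2 * k e ≠ 0 := by simpa using hk0
  have aux1 : ∀ i, ContDiffAt ℝ n (fun y => 2 * k y * (f y).1 i / boostDenom (k y) (f y)) e :=
    fun i => (h2k.mul (h1 i)).div hDs hD
  have aux2 : ∀ i, ContDiffAt ℝ n (fun y => (boostDenom (k y) (f y) * (f y).2 i +
      (1 - k y ^ 2) * (f y).2 0 * (f y).1 i) / (2 * k y)) e := fun i =>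
    ((hDs.mul (h2 i)).add (((contDiffAt_const.sub (hk.pow 2)).mul (h2 0)).mul (h1 i))).div h2k h2k0
  apply contDiffAt_phase <;> intro i <;> fin_cases i
  · exact (((hk.pow 2).mul (contDiffAt_const.add (h1 0))).sub
      (contDiffAt_const.sub (h1 0))).div hDs hD
  · exact aux1 1
  · exact aux1 2
  · exact aux1 3
  · exact h2 0
  · exact aux2 1
  · exact aux2 2
  · exact aux2 3

/-! ### The chart as a diffeomorphism of open sets -/

section chart

variable {c : ℝ} (hc : c < -3 / 2) {x : Phase}
include hc

theorem freq_rotMoment_pos (hx : x ∈ chartSource c) : 0 < freq c (rotMoment x) := by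
  linarith [(freq_spec hc hx.1).1, one_lt_minFreq hc]

theorem keplerFreq_sq (hx : 2 * c / 3 ≤ rotMoment x) :
    keplerFreq c x ^ 2 = 2 * (rotMoment x - c) :=
  Real.sq_sqrt (by linarith)

theorem minFreq_lt_keplerFreq (hx : 2 * c / 3 < rotMoment x) : minFreq c < keplerFreq c x :=
  Real.sqrt_lt_sqrt (by linarith) (by linarith)

theorem keplerFreq_pos (hx : 2 * c / 3 < rotMoment x) : 0 < keplerFreq c x := by
  linarith [minFreq_lt_keplerFreq hc hx, one_lt_minFreq hc]

theorem rotMoment_chart (hx : x ∈ chartSource c) :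
    rotMoment (chart c x) = rotMoment x / freq c (rotMoment x) := by
  have hk := freq_rotMoment_pos hc hx
  rw [chart, rotMoment_boost hk.ne']
  · simp only [rotMoment, PiLp.smul_apply, smul_eq_mul]
    ring
  · exact hx.2.ne'

/-- Divided by `k`, the cubic equation reads `k² = 2 (s/k - c)`, and `s/k` is the moment of the
image. The frequency is therefore visible on the target side, which makes the chart invertible. -/
theorem keplerFreq_chart (hx : x ∈ chartSource c) :
    keplerFreq c (chart c x) = freq c (rotMoment x) := by
  have hk := freq_rotMoment_pos hc hx
  rw [keplerFreq, rotMoment_chart hc hx, Real.sqrt_eq_iff_eq_sq _ hk.le]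
  · have := (freq_spec hc hx.1).2
    field_simp
    linarith
  · have := (freq_spec hc hx.1).2
    have h : rotMoment x / freq c (rotMoment x) = freq c (rotMoment x) ^ 2 / 2 + c := by
      field_simp
      linarith
    rw [h]
    nlinarith [sq_nonneg (freq c (rotMoment x))]

theorem chart_mem (hx : x ∈ chartSource c) : chart c x ∈ chartTarget c := by
  have hk := freq_rotMoment_pos hc hx
  refine ⟨?_, ?_⟩
  · have h1 := (freq_spec hc hx.1).1
    have h2 := (freq_spec hc hx.1).2
    have h : rotMoment x / freq c (rotMoment x) = freq c (rotMoment x) ^ 2 / 2 + c := by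
      field_simp
      linarith
    rw [rotMoment_chart hc hx, h]
    nlinarith [minFreq_sq hc, one_lt_minFreq hc]
  · rw [keplerFreq_chart hc hx, chart, boostDenom_inv_boost hk.ne']
    · exact div_pos (by norm_num) hx.2
    · exact hx.2.ne'

theorem chartInv_chart (hx : x ∈ chartSource c) : chartInv c (chart c x) = x := by
  have hk := freq_rotMoment_pos hc hx
  rw [chartInv, keplerFreq_chart hc hx, chart, boost_inv_boost hk.ne']
  · refine Prod.ext rfl ?_
    simp [smul_smul, hk.ne']
  · exact hx.2.ne'

theorem rotMoment_chartInv (hx : x ∈ chartTarget c) :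
    rotMoment (chartInv c x) = keplerFreq c x * rotMoment x := by
  have hk := keplerFreq_pos hc hx.1
  have h := rotMoment_boost (k := (keplerFreq c x)⁻¹) (x := x) (inv_ne_zero hk.ne') hx.2.ne'
  rw [← h]
  simp only [rotMoment, chartInv, PiLp.smul_apply, smul_eq_mul]
  ring

theorem freq_chartInv (hx : x ∈ chartTarget c) :
    freq c (rotMoment (chartInv c x)) = keplerFreq c x := by
  apply freq_unique hc (minFreq_lt_keplerFreq hc hx.1)
  rw [rotMoment_chartInv hc hx]
  linear_combination keplerFreq c x * keplerFreq_sq hc hx.1.le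

theorem chart_chartInv (hx : x ∈ chartTarget c) : chart c (chartInv c x) = x := by
  have hk := keplerFreq_pos hc hx.1
  have h := boost_inv_boost (k := (keplerFreq c x)⁻¹) (x := x) (inv_ne_zero hk.ne') hx.2.ne'
  rw [inv_inv] at h
  rw [chart, freq_chartInv hc hx, chartInv]
  simp only [smul_smul, inv_mul_cancel₀ hk.ne', one_smul, Prod.mk.eta]
  exact h

theorem contDiffAt_freq_rotMoment (hx : x ∈ chartSource c) :
    ContDiffAt ℝ ∞ (fun y => freq c (rotMoment y)) x :=
  (contDiffAt_freq hc hx.1).1.comp x contDiff_rotMoment.contDiffAt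

theorem contDiffAt_chart (hx : x ∈ chartSource c) : ContDiffAt ℝ ∞ (chart c) x := by
  have hk := freq_rotMoment_pos hc hx
  have hf := contDiffAt_freq_rotMoment hc hx
  refine contDiffAt_boost hf ?_ hk.ne' hx.2.ne'
  exact contDiffAt_fst.prodMk ((hf.inv hk.ne').smul contDiffAt_snd)

theorem contDiffAt_keplerFreq (hx : 2 * c / 3 < rotMoment x) :
    ContDiffAt ℝ ∞ (keplerFreq c) x := by
  unfold keplerFreq
  refine ContDiffAt.sqrt ?_ (by linarith)
  exact contDiffAt_const.mul (contDiff_rotMoment.contDiffAt.sub contDiffAt_const)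

theorem contDiffAt_chartInv (hx : x ∈ chartTarget c) : ContDiffAt ℝ ∞ (chartInv c) x := by
  have hk := keplerFreq_pos hc hx.1
  have hf := contDiffAt_keplerFreq hc hx.1
  have h := contDiffAt_boost (f := id) (hf.inv hk.ne') contDiffAt_id (inv_ne_zero hk.ne') hx.2.ne'
  exact h.fst.prodMk (hf.smul h.snd)

theorem isOpen_chartSource : IsOpen (chartSource c) := by
  rw [isOpen_iff_mem_nhds]
  intro x hx
  have h1 : ∀ᶠ y in 𝓝 x, -minFreq c ^ 3 < rotMoment y :=
    (contDiff_rotMoment (n := 0)).continuous.continuousAt.eventually (lt_mem_nhds hx.1)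
  have hf := (contDiffAt_freq_rotMoment hc hx).continuousAt
  have h2 : ContinuousAt (fun y => boostDenom (freq c (rotMoment y)) y) x := by
    unfold boostDenom
    fun_prop
  filter_upwards [h1, h2.eventually (lt_mem_nhds hx.2)] with y h3 h4 using ⟨h3, h4⟩

theorem isOpen_chartTarget : IsOpen (chartTarget c) := by
  rw [isOpen_iff_mem_nhds]
  intro x hx
  have h1 : ∀ᶠ y in 𝓝 x, 2 * c / 3 < rotMoment y :=
    (contDiff_rotMoment (n := 0)).continuous.continuousAt.eventually (lt_mem_nhds hx.1)
  have hf : ContinuousAt (fun y => (keplerFreq c y)⁻¹) x :=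
    ((contDiffAt_keplerFreq hc hx.1).inv (keplerFreq_pos hc hx.1).ne').continuousAt
  have h2 : ContinuousAt (fun y => boostDenom (keplerFreq c y)⁻¹ y) x := by
    have h0 : ContinuousAt (fun y : Phase => y.1 0) x := by fun_prop
    exact ((hf.pow 2).mul (continuousAt_const.add h0)).add (continuousAt_const.sub h0)
  filter_upwards [h1, h2.eventually (lt_mem_nhds hx.2)] with y h3 h4 using ⟨h3, h4⟩

end chart

/-! ### The energy surface in the chart -/

theorem norm_sq_eq_one_iff {E : Type*} [NormedAddCommGroup E] {x : E} :
    ‖x‖ ^ 2 = 1 ↔ ‖x‖ = 1 := by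
  exact pow_eq_one_iff_of_nonneg (norm_nonneg x) two_ne_zero

/-- The unit cotangent bundle of `S³`. -/
def unitCotangent : Set Phase := {x | ‖x.1‖ = 1 ∧ inner ℝ x.1 x.2 = 0 ∧ ‖x.2‖ = 1}

theorem mem_unitCotangent {x : Phase} :
    x ∈ unitCotangent ↔ x.1 0 ^ 2 + x.1 1 ^ 2 + x.1 2 ^ 2 + x.1 3 ^ 2 = 1 ∧
      x.1 0 * x.2 0 + x.1 1 * x.2 1 + x.1 2 * x.2 2 + x.1 3 * x.2 3 = 0 ∧
      x.2 0 ^ 2 + x.2 1 ^ 2 + x.2 2 ^ 2 + x.2 3 ^ 2 = 1 := by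
  rw [unitCotangent, mem_ofPred_eq, ← norm_sq_four, ← norm_sq_four, ← inner_four,
    norm_sq_eq_one_iff, norm_sq_eq_one_iff]

theorem mem_cotangentSphere {x : Phase} :
    x ∈ cotangentSphere ↔ x.1 0 ^ 2 + x.1 1 ^ 2 + x.1 2 ^ 2 + x.1 3 ^ 2 = 1 ∧
      x.1 0 * x.2 0 + x.1 1 * x.2 1 + x.1 2 * x.2 2 + x.1 3 * x.2 3 = 0 := by
  rw [cotangentSphere, mem_ofPred_eq, ← norm_sq_four, ← inner_four,
    norm_sq_eq_one_iff]

/-- By the inequality of arithmetic and geometric means, `2 |ξ₂ η₁ - ξ₁ η₂|` is at most `‖ξ‖² + ‖η‖²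
= 2`. -/
theorem abs_rotMoment_le {x : Phase} (hx : x ∈ unitCotangent) : |rotMoment x| ≤ 1 := by
  obtain ⟨h1, -, h3⟩ := mem_unitCotangent.1 hx
  rw [rotMoment, abs_le]
  constructor
  · nlinarith [sq_nonneg (x.1 2 + x.2 1), sq_nonneg (x.1 1 - x.2 2), sq_nonneg (x.1 0),
      sq_nonneg (x.1 3), sq_nonneg (x.2 0), sq_nonneg (x.2 3)]
  · nlinarith [sq_nonneg (x.1 2 - x.2 1), sq_nonneg (x.1 1 + x.2 2), sq_nonneg (x.1 0),
      sq_nonneg (x.1 3), sq_nonneg (x.2 0), sq_nonneg (x.2 3)]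

theorem boostDenom_pos {k : ℝ} (hk : k ≠ 0) {x : Phase}
    (hx : x.1 0 ^ 2 + x.1 1 ^ 2 + x.1 2 ^ 2 + x.1 3 ^ 2 = 1) : 0 < boostDenom k x := by
  have h1 : -1 ≤ x.1 0 := by nlinarith [sq_nonneg (x.1 1), sq_nonneg (x.1 2), sq_nonneg (x.1 3)]
  have h2 : x.1 0 ≤ 1 := by nlinarith [sq_nonneg (x.1 1), sq_nonneg (x.1 2), sq_nonneg (x.1 3)]
  have hk2 : 0 < k ^ 2 := by positivity
  rw [boostDenom]
  rcases h2.lt_or_eq with h | h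
  · have : 0 ≤ k ^ 2 * (1 + x.1 0) := mul_nonneg hk2.le (by linarith)
    linarith
  · rw [h]
    linarith

/-- The form in which the energy bound is used: the moments of unit covectors stay away from the
critical value of the cubic. -/
theorem neg_minFreq_cube_lt {c : ℝ} (hc : c < -3 / 2) {s : ℝ} (hs : -1 ≤ s) :
    -minFreq c ^ 3 < s := by
  have : 1 < minFreq c ^ 3 := one_lt_pow₀ (one_lt_minFreq hc) (by norm_num)
  linarith

theorem unitCotangent_subset {c : ℝ} (hc : c < -3 / 2) : unitCotangent ⊆ chartSource c := by
  intro x hx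
  have h1 := neg_minFreq_cube_lt hc (neg_le_of_abs_le (abs_rotMoment_le hx))
  refine ⟨h1, boostDenom_pos ?_ (mem_unitCotangent.1 hx).1⟩
  linarith [(freq_spec hc h1).1, one_lt_minFreq hc]

section identities

variable {c : ℝ} {x : Phase} (hc : c < -3 / 2) (hx : x ∈ chartSource c)
include hx

theorem norm_sq_chart : ‖(chart c x).1‖ ^ 2 - 1 =
    4 * freq c (rotMoment x) ^ 2 / boostDenom (freq c (rotMoment x)) x ^ 2 * (‖x.1‖ ^ 2 - 1) :=
  norm_sq_boost hx.2.ne'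

include hc

theorem inner_chart : inner ℝ (chart c x).1 (chart c x).2 =
    (freq c (rotMoment x))⁻¹ * inner ℝ x.1 x.2 + (1 - freq c (rotMoment x) ^ 2) *
      ((freq c (rotMoment x))⁻¹ * x.2 0) / boostDenom (freq c (rotMoment x)) x *
        (‖x.1‖ ^ 2 - 1) := by
  have h := inner_boost (x := (x.1, (freq c (rotMoment x))⁻¹ • x.2))
    (freq_rotMoment_pos hc hx).ne' hx.2.ne'
  rw [chart, h]
  simp only [inner_smul_right, PiLp.smul_apply, smul_eq_mul]
  rfl

/-- On the image `rotMoment - c = k²/2`, so the factor is affine in `ξ₀` and reduces to `k` times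
the conformal factor `2 k / boostDenom` of the boost. -/
theorem moserFactor_chart : moserFactor c (chart c x) =
    2 * freq c (rotMoment x) ^ 2 / boostDenom (freq c (rotMoment x)) x := by
  have hk := freq_rotMoment_pos hc hx
  have h1 : (chart c x).1 2 * (chart c x).2 1 - (chart c x).1 1 * (chart c x).2 2 =
      freq c (rotMoment x) ^ 2 / 2 + c := by
    change rotMoment (chart c x) = _
    rw [rotMoment_chart hc hx]
    have := (freq_spec hc hx.1).2
    field_simp
    linarith
  have h2 : (chart c x).1 0 = (freq c (rotMoment x) ^ 2 * (1 + x.1 0) - (1 - x.1 0)) /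
    boostDenom (freq c (rotMoment x)) x := rfl
  have h3 : moserFactor c (chart c x) = 1 + (1 - (chart c x).1 0) * (-c - 1 / 2 +
    ((chart c x).1 2 * (chart c x).2 1 - (chart c x).1 1 * (chart c x).2 2)) := by
    rw [moserFactor]
    ring
  have hD := hx.2.ne'
  rw [h3, h1, h2]
  field_simp
  rw [boostDenom]
  ring

/-- The cotangent lift divides `‖η‖` by the conformal factor, and the Moser factor undoes this
together with the `k⁻¹` in the chart. The last two terms vanish on `T*S³`; they are kept because the
identity is differentiated in directions that leave it. -/
theorem regHam_chart : 2 * regHam c (chart c x) = ‖x.2‖ ^ 2 +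
    2 * (1 - freq c (rotMoment x) ^ 2) * x.2 0 / boostDenom (freq c (rotMoment x)) x *
      inner ℝ x.1 x.2 +
    ((1 - freq c (rotMoment x) ^ 2) * x.2 0 / boostDenom (freq c (rotMoment x)) x) ^ 2 *
      (‖x.1‖ ^ 2 - 1) := by
  have hk := (freq_rotMoment_pos hc hx).ne'
  have hD := hx.2.ne'
  have h := norm_sq_snd_boost (x := (x.1, (freq c (rotMoment x))⁻¹ • x.2)) hk
  have hD' : boostDenom (freq c (rotMoment x)) (x.1, (freq c (rotMoment x))⁻¹ • x.2) =
    boostDenom (freq c (rotMoment x)) x := rfl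
  simp only [hD', inner_smul_right, PiLp.smul_apply, smul_eq_mul, norm_smul, norm_inv,
    mul_pow, Real.norm_eq_abs, inv_pow, sq_abs] at h
  rw [regHam, moserFactor_chart hc hx]
  change 2 * (_ ^ 2 * ‖(boost _ _).2‖ ^ 2 / 2) = _
  set N := ‖(boost (freq c (rotMoment x)) (x.1, (freq c (rotMoment x))⁻¹ • x.2)).2‖ ^ 2
  have h' : N = (boostDenom (freq c (rotMoment x)) x ^ 2 * ((freq c (rotMoment x) ^ 2)⁻¹ *
    ‖x.2‖ ^ 2) + 2 * boostDenom (freq c (rotMoment x)) x * (1 - freq c (rotMoment x) ^ 2) *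
      ((freq c (rotMoment x))⁻¹ * x.2 0) * ((freq c (rotMoment x))⁻¹ * inner ℝ x.1 x.2) +
    (1 - freq c (rotMoment x) ^ 2) ^ 2 * ((freq c (rotMoment x) ^ 2)⁻¹ * x.2 0 ^ 2) *
      (‖x.1‖ ^ 2 - 1)) / (4 * freq c (rotMoment x) ^ 2) := by
    rw [eq_div_iff (by positivity)]
    linarith
  rw [h']
  field_simp
  ring

end identities

theorem chart_unitCotangent {c : ℝ} (hc : c < -3 / 2) {x : Phase} (hx : x ∈ unitCotangent) :
    chart c x ∈ cotangentSphere ∧ regHam c (chart c x) = 1 / 2 ∧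
      2 * c / 3 < rotMoment (chart c x) := by
  have hs := unitCotangent_subset hc hx
  obtain ⟨h1, h2, h3⟩ := hx
  have e1 := norm_sq_chart hs
  have e2 := inner_chart hc hs
  have e3 := regHam_chart hc hs
  rw [h1] at e1 e2 e3
  rw [h2] at e2 e3
  rw [h3] at e3
  refine ⟨⟨?_, ?_⟩, ?_, (chart_mem hc hs).1⟩
  · rw [← norm_sq_eq_one_iff]
    linarith
  · rw [e2]
    ring
  · linarith

/-- A point of the energy level, in normalized coordinates. -/
theorem boost_mem_unitCotangent {c : ℝ} {x : Phase} {k : ℝ} (hk : 0 < k)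
    (hkx : k ^ 2 = 2 * (rotMoment x - c)) (hx : x ∈ cotangentSphere) (hQ : regHam c x = 1 / 2) :
    ((boost k⁻¹ x).1, k • (boost k⁻¹ x).2) ∈ unitCotangent := by
  have hD := (boostDenom_pos (inv_ne_zero hk.ne') (mem_cotangentSphere.1 hx).1)
  have hk' := inv_ne_zero hk.ne'
  have e1 := norm_sq_boost hD.ne'
  have e2 := inner_boost hk' hD.ne'
  have e3 := norm_sq_snd_boost (x := x) hk'
  obtain ⟨h1, h2⟩ := hx
  rw [h1] at e1 e2 e3
  rw [h2] at e2 e3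
  refine ⟨?_, ?_, ?_⟩
  · rw [← norm_sq_eq_one_iff]
    linarith
  · simp only [inner_smul_right, e2]
    ring
  · rw [← norm_sq_eq_one_iff]
    simp only [norm_smul, mul_pow, Real.norm_eq_abs, sq_abs]
    have hf : moserFactor c x = k ^ 2 * boostDenom k⁻¹ x / 2 := by
      have : moserFactor c x = 1 + (1 - x.1 0) * (-c - 1 / 2 + rotMoment x) := by
        rw [moserFactor, rotMoment]
        ring
      rw [this, boostDenom]
      have h : -c + rotMoment x = k ^ 2 / 2 := by linarith
      have h' : -c - 1 / 2 + rotMoment x = k ^ 2 / 2 - 1 / 2 := by linarith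
      rw [h']
      field_simp
      ring
    rw [regHam, hf] at hQ
    have e4 : k ^ 2 * ‖(boost k⁻¹ x).2‖ ^ 2 =
        k ^ 4 / 4 * (4 * k⁻¹ ^ 2 * ‖(boost k⁻¹ x).2‖ ^ 2) := by
      field_simp
    rw [e4, e3]
    linear_combination 2 * hQ

/-! ### The energy surface -/

/-- Quaternion multiplication trivializes the bundle: `m` multiplies a point of `S³` by an imaginary
unit quaternion, and this exhibits the unit covectors as the image of `S³ × S²`. -/
theorem isPreconnected_unitCotangent : IsPreconnected unitCotangent := by
  let m : E4 × E3 → Phase := fun p => (p.1,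
    !₂[-(p.1 1 * p.2 0 + p.1 2 * p.2 1 + p.1 3 * p.2 2),
      p.1 0 * p.2 0 + p.1 2 * p.2 2 - p.1 3 * p.2 1,
      p.1 0 * p.2 1 + p.1 3 * p.2 0 - p.1 1 * p.2 2,
      p.1 0 * p.2 2 + p.1 1 * p.2 1 - p.1 2 * p.2 0])
  have hm : Continuous m := by
    refine continuous_fst.prodMk ((PiLp.continuous_toLp 2 _).comp (continuous_pi ?_))
    intro i
    fin_cases i <;> simp only [Fin.zero_eta, Fin.mk_one, Fin.reduceFinMk, Matrix.cons_val] <;>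
      fun_prop
  have h4 : IsPreconnected (sphere (0 : E4) 1) := isPreconnected_sphere
    (by rw [← Module.finrank_eq_rank, finrank_euclideanSpace_fin]; norm_num) _ _
  have h3 : IsPreconnected (sphere (0 : E3) 1) := isPreconnected_sphere
    (by rw [← Module.finrank_eq_rank, finrank_euclideanSpace_fin]; norm_num) _ _
  have himage : unitCotangent = m '' (sphere (0 : E4) 1 ×ˢ sphere (0 : E3) 1) := by
    ext x
    rw [mem_unitCotangent]
    constructor
    · rintro ⟨h1, h2, h3⟩
      have hsq : ∀ u : E3, ‖u‖ ^ 2 = u 0 ^ 2 + u 1 ^ 2 + u 2 ^ 2 := fun u => by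
        rw [EuclideanSpace.real_norm_sq_eq, Fin.sum_univ_three]
      -- The imaginary part of the quaternion product of the conjugate of `ξ` with `η`; its real
      -- part is `⟨ξ, η⟩ = 0`.
      refine ⟨(x.1, !₂[x.1 0 * x.2 1 - x.1 1 * x.2 0 - x.1 2 * x.2 3 + x.1 3 * x.2 2,
        x.1 0 * x.2 2 - x.1 2 * x.2 0 - x.1 3 * x.2 1 + x.1 1 * x.2 3,
        x.1 0 * x.2 3 - x.1 3 * x.2 0 - x.1 1 * x.2 2 + x.1 2 * x.2 1]), ⟨?_, ?_⟩, ?_⟩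
      · rw [mem_sphere_zero_iff_norm, ← norm_sq_eq_one_iff, norm_sq_four]
        exact h1
      · rw [mem_sphere_zero_iff_norm, ← norm_sq_eq_one_iff, hsq]
        simp only [Matrix.cons_val]
        linear_combination (x.2 0 ^ 2 + x.2 1 ^ 2 + x.2 2 ^ 2 + x.2 3 ^ 2) * h1 + h3 -
          (x.1 0 * x.2 0 + x.1 1 * x.2 1 + x.1 2 * x.2 2 + x.1 3 * x.2 3) * h2
      · refine phase_ext (fun i => rfl) fun i => ?_
        fin_cases i <;> simp only [Fin.zero_eta, Fin.mk_one, Fin.reduceFinMk, Matrix.cons_val, m]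
        · linear_combination x.2 0 * h1 - x.1 0 * h2
        · linear_combination x.2 1 * h1 - x.1 1 * h2
        · linear_combination x.2 2 * h1 - x.1 2 * h2
        · linear_combination x.2 3 * h1 - x.1 3 * h2
    · rintro ⟨⟨y, u⟩, ⟨hy, hu⟩, rfl⟩
      rw [mem_sphere_zero_iff_norm, ← norm_sq_eq_one_iff] at hy hu
      rw [norm_sq_four] at hy
      rw [EuclideanSpace.real_norm_sq_eq, Fin.sum_univ_three] at hu
      simp only [Matrix.cons_val, m] at hy hu ⊢
      refine ⟨hy, by ring, ?_⟩
      linear_combination (u 0 ^ 2 + u 1 ^ 2 + u 2 ^ 2) * hy + hu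
  rw [himage]
  exact (h4.prod h3).image m hm.continuousOn

section surface

variable {c : ℝ} (hc : c < -3 / 2)
include hc

theorem chartInv_mem_unitCotangent {x : Phase} (hx : x ∈ cotangentSphere)
    (hQ : regHam c x = 1 / 2) (hl : 2 * c / 3 < rotMoment x) : chartInv c x ∈ unitCotangent :=
  boost_mem_unitCotangent (keplerFreq_pos hc hl) (keplerFreq_sq hc hl.le) hx hQ

theorem mem_chartTarget {x : Phase} (hx : x ∈ cotangentSphere)
    (hl : 2 * c / 3 < rotMoment x) : x ∈ chartTarget c :=
  ⟨hl, boostDenom_pos (inv_ne_zero (keplerFreq_pos hc hl).ne') (mem_cotangentSphere.1 hx).1⟩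

/-- At the moment `2c/3` the frequency would be `minFreq c` and the normalized moment `-minFreq c ^
3 < -1`, which no unit covector has. This is the gap that separates the components of the level. -/
theorem rotMoment_ne {x : Phase} (hx : x ∈ cotangentSphere)
    (hQ : regHam c x = 1 / 2) : rotMoment x ≠ 2 * c / 3 := by
  intro hl
  have h1 := one_lt_minFreq hc
  have h2 := minFreq_sq hc
  have hk : 0 < minFreq c := by linarith
  have hu := boost_mem_unitCotangent hk (by rw [h2, hl]; ring) hx hQ
  have hD := boostDenom_pos (inv_ne_zero hk.ne') (mem_cotangentSphere.1 hx).1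
  have h := (abs_le.1 (abs_rotMoment_le hu)).1
  have h' := rotMoment_boost (x := x) (inv_ne_zero hk.ne') hD.ne'
  have h'' : rotMoment ((boost (minFreq c)⁻¹ x).1, minFreq c • (boost (minFreq c)⁻¹ x).2) =
      minFreq c * rotMoment (boost (minFreq c)⁻¹ x) := by
    simp only [rotMoment, PiLp.smul_apply, smul_eq_mul]
    ring
  rw [h'', h', hl] at h
  nlinarith

theorem chart_image_unitCotangent : chart c '' unitCotangent =
    {x | x ∈ cotangentSphere ∧ regHam c x = 1 / 2 ∧ 2 * c / 3 < rotMoment x} := by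
  ext x
  constructor
  · rintro ⟨y, hy, rfl⟩
    exact chart_unitCotangent hc hy
  · rintro ⟨h1, h2, h3⟩
    exact ⟨_, chartInv_mem_unitCotangent hc h1 h2 h3, chart_chartInv hc (mem_chartTarget hc h1 h3)⟩

omit hc in
theorem regHam_poleNorth : regHam c poleNorth = 1 / 2 := by
  simp [regHam, moserFactor, poleNorth, norm_sq_four]

omit hc in
theorem poleNorth_mem_cotangentSphere : poleNorth ∈ cotangentSphere := by
  rw [mem_cotangentSphere]
  simp [poleNorth]

/-- No point of the level has moment `2c/3`, so a connected subset through the collisions stays on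
one side; and that side is connected, being the image of the unit cotangent bundle. -/
theorem energySurface_eq : energySurface c =
    {x | x ∈ cotangentSphere ∧ regHam c x = 1 / 2 ∧ 2 * c / 3 < rotMoment x} := by
  have hN : poleNorth ∈ {x | x ∈ cotangentSphere ∧ regHam c x = 1 / 2} :=
    ⟨poleNorth_mem_cotangentSphere, regHam_poleNorth⟩
  have hNl : 2 * c / 3 < rotMoment poleNorth := by
    have : rotMoment poleNorth = 0 := by simp [rotMoment, poleNorth]
    rw [this]
    linarith
  have hcont := (contDiff_rotMoment (n := 0)).continuous
  apply Subset.antisymm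
  · intro x hx
    have hsub := connectedComponentIn_subset _ _ hx
    refine ⟨hsub.1, hsub.2, ?_⟩
    have := isPreconnected_connectedComponentIn.subset_left_of_subset_union
      (u := {x | 2 * c / 3 < rotMoment x}) (v := {x | rotMoment x < 2 * c / 3})
      (s := connectedComponentIn {x | x ∈ cotangentSphere ∧ regHam c x = 1 / 2} poleNorth)
      (isOpen_lt continuous_const hcont) (isOpen_lt hcont continuous_const)
      (disjoint_left.2 fun y (hy : 2 * c / 3 < rotMoment y)
        (hy' : rotMoment y < 2 * c / 3) => lt_asymm hy hy') (fun y hy => ?_)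
      ⟨poleNorth, mem_connectedComponentIn hN, hNl⟩
    · exact this hx
    · have hy' := connectedComponentIn_subset _ _ hy
      exact (rotMoment_ne hc hy'.1 hy'.2).symm.lt_or_gt
  · refine IsPreconnected.subset_connectedComponentIn ?_ ⟨hN.1, hN.2, hNl⟩
      fun x hx => ⟨hx.1, hx.2.1⟩
    rw [← chart_image_unitCotangent hc]
    exact isPreconnected_unitCotangent.image _ fun x hx =>
      (contDiffAt_chart hc (unitCotangent_subset hc hx)).continuousAt.continuousWithinAt

theorem chart_mem_energySurface {x : Phase} (hx : x ∈ unitCotangent) :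
    chart c x ∈ energySurface c := by
  rw [energySurface_eq hc]
  exact chart_unitCotangent hc hx

theorem energySurface_subset_chartTarget : energySurface c ⊆ chartTarget c := by
  rw [energySurface_eq hc]
  exact fun x hx => mem_chartTarget hc hx.1 hx.2.2

theorem chartInv_mem_of_energySurface {x : Phase} (hx : x ∈ energySurface c) :
    chartInv c x ∈ unitCotangent := by
  rw [energySurface_eq hc] at hx
  exact chartInv_mem_unitCotangent hc hx.1 hx.2.1 hx.2.2

theorem chart_chartInv_of_energySurface {x : Phase} (hx : x ∈ energySurface c) :
    chart c (chartInv c x) = x :=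
  chart_chartInv hc (energySurface_subset_chartTarget hc hx)

end surface

/-! ### The Hamiltonian vector field -/

/-- The generator of the rotation whose moment is `rotMoment`. -/
def rotGen : E4 →L[ℝ] E4 := LinearMap.toContinuousLinearMap
  { toFun := fun x => !₂[0, x 2, -x 1, 0]
    map_add' := fun x y => by
      apply PiLp.ext
      intro i
      fin_cases i <;> simp
      ring
    map_smul' := fun a x => by
      apply PiLp.ext
      intro i
      fin_cases i <;> simp }

@[simp] theorem rotGen_zero (x : E4) : rotGen x 0 = 0 := rfl
@[simp] theorem rotGen_one (x : E4) : rotGen x 1 = x 2 := rfl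
@[simp] theorem rotGen_two (x : E4) : rotGen x 2 = -x 1 := rfl
@[simp] theorem rotGen_three (x : E4) : rotGen x 3 = 0 := rfl

/-- The Hamiltonian vector field of `regHam c` on the cotangent bundle of the sphere. -/
def hamField (c : ℝ) (x : Phase) : Phase :=
  ((moserFactor c x * ‖x.2‖ ^ 2 * (1 - x.1 0)) • rotGen x.1 + moserFactor c x ^ 2 • x.2,
    (moserFactor c x * ‖x.2‖ ^ 2 * (-c - 1 / 2 + rotMoment x)) • EuclideanSpace.single 0 1 +
      (moserFactor c x * ‖x.2‖ ^ 2 * (1 - x.1 0)) • rotGen x.2 -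
      -- The multiple of `ξ` is the Lagrange multiplier that keeps the field tangent to `T*S³`.
      (moserFactor c x ^ 2 * ‖x.2‖ ^ 2 + moserFactor c x * ‖x.2‖ ^ 2 *
        (-c - 1 / 2 + rotMoment x) * x.1 0) • x.1)

theorem moserFactor_eq (c : ℝ) (x : Phase) :
    moserFactor c x = 1 + (1 - x.1 0) * (-c - 1 / 2 + rotMoment x) := by
  rw [moserFactor, rotMoment]
  ring

theorem contDiff_moserFactor (c : ℝ) {n : WithTop ℕ∞} : ContDiff ℝ n (moserFactor c) := by
  unfold moserFactor
  fun_prop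

theorem contDiff_hamField (c : ℝ) : ContDiff ℝ 1 (hamField c) := by
  have h1 : ContDiff ℝ 1 (moserFactor c) := contDiff_moserFactor c
  have h2 : ContDiff ℝ 1 rotMoment := contDiff_rotMoment
  have h3 : ContDiff ℝ 1 fun x : Phase => ‖x.2‖ ^ 2 := contDiff_snd.norm_sq ℝ
  have h4 : ContDiff ℝ 1 fun x : Phase => rotGen x.1 := rotGen.contDiff.comp contDiff_fst
  have h5 : ContDiff ℝ 1 fun x : Phase => rotGen x.2 := rotGen.contDiff.comp contDiff_snd
  have h6 : ContDiff ℝ 1 fun x : Phase => x.1 0 := contDiff_phase_fst 0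
  unfold hamField
  fun_prop

theorem contDiff_regHam (c : ℝ) {n : WithTop ℕ∞} : ContDiff ℝ n (regHam c) := by
  have h1 : ContDiff ℝ n (moserFactor c) := contDiff_moserFactor c
  have h3 : ContDiff ℝ n fun x : Phase => ‖x.2‖ ^ 2 := contDiff_snd.norm_sq ℝ
  unfold regHam
  fun_prop

theorem hasDerivAt_line (x y : Phase) :
    (∀ i, HasDerivAt (fun t : ℝ => (x + t • y).1 i) (y.1 i) 0) ∧
      ∀ i, HasDerivAt (fun t : ℝ => (x + t • y).2 i) (y.2 i) 0 := by
  constructor <;> intro i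
  · simpa using ((hasDerivAt_id (0 : ℝ)).mul_const (y.1 i)).const_add (x.1 i)
  · simpa using ((hasDerivAt_id (0 : ℝ)).mul_const (y.2 i)).const_add (x.2 i)

theorem fderiv_eq_of_line {f : Phase → ℝ} {x y : Phase} {a : ℝ} (hf : DifferentiableAt ℝ f x)
    (h : HasDerivAt (fun t : ℝ => f (x + t • y)) a 0) : fderiv ℝ f x y = a := by
  have hl : HasDerivAt (fun t : ℝ => x + t • y) y 0 := by
    simpa using ((hasDerivAt_id (0 : ℝ)).smul_const y).const_add x
  have hf' : HasFDerivAt f (fderiv ℝ f x) (x + (0 : ℝ) • y) := by simpa using hf.hasFDerivAt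
  exact (hf'.comp_hasDerivAt 0 hl).unique h

theorem fderiv_rotMoment (x y : Phase) : fderiv ℝ rotMoment x y =
    x.1 2 * y.2 1 + y.1 2 * x.2 1 - (x.1 1 * y.2 2 + y.1 1 * x.2 2) := by
  refine fderiv_eq_of_line (contDiff_rotMoment.differentiable (n := 1) (by simp) x) ?_
  obtain ⟨h1, h2⟩ := hasDerivAt_line x y
  have := ((h1 2).mul (h2 1)).sub ((h1 1).mul (h2 2))
  simp only [zero_smul, add_zero] at this
  refine this.congr_deriv ?_
  ring

theorem fderiv_regHam (c : ℝ) (x y : Phase) : fderiv ℝ (regHam c) x y =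
    moserFactor c x * ‖x.2‖ ^ 2 * (-y.1 0 * (-c - 1 / 2 + rotMoment x) +
      (1 - x.1 0) * fderiv ℝ rotMoment x y) + moserFactor c x ^ 2 * inner ℝ x.2 y.2 := by
  refine fderiv_eq_of_line ((contDiff_regHam c).differentiable (n := 1) (by simp) x) ?_
  obtain ⟨h1, h2⟩ := hasDerivAt_line x y
  have hl : HasDerivAt (fun t : ℝ => x + t • y) y 0 := by
    simpa using ((hasDerivAt_id (0 : ℝ)).smul_const y).const_add x
  have hm : HasDerivAt (fun t : ℝ => rotMoment (x + t • y)) (fderiv ℝ rotMoment x y) 0 := by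
    have hf' : HasFDerivAt rotMoment (fderiv ℝ rotMoment x) (x + (0 : ℝ) • y) := by
      simpa using (contDiff_rotMoment.differentiable (n := 1) (by simp) x).hasFDerivAt
    exact hf'.comp_hasDerivAt 0 hl
  have hf : HasDerivAt (fun t : ℝ => moserFactor c (x + t • y)) (-y.1 0 *
      (-c - 1 / 2 + rotMoment x) + (1 - x.1 0) * fderiv ℝ rotMoment x y) 0 := by
    have := (((h1 0).const_sub 1).mul (hm.const_add (-c - 1 / 2))).const_add 1
    simp only [zero_smul, add_zero] at this
    refine this.congr_of_eventuallyEq (Eventually.of_forall fun t => ?_)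
    simp only [moserFactor_eq]
    rfl
  have hn : HasDerivAt (fun t : ℝ => ‖(x + t • y).2‖ ^ 2) (2 * inner ℝ x.2 y.2) 0 := by
    have h : HasDerivAt (fun t : ℝ => (x + t • y).2) y.2 0 := hl.snd
    simpa using h.norm_sq
  have := ((hf.pow 2).mul hn).div_const 2
  simp only [zero_smul, add_zero, Pi.pow_apply] at this
  refine this.congr_deriv ?_
  ring

theorem mem_tangentCotangentSphere {x v : Phase} : v ∈ tangentCotangentSphere x ↔
    x.1 0 * v.1 0 + x.1 1 * v.1 1 + x.1 2 * v.1 2 + x.1 3 * v.1 3 = 0 ∧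
      v.1 0 * x.2 0 + v.1 1 * x.2 1 + v.1 2 * x.2 2 + v.1 3 * x.2 3 +
        (x.1 0 * v.2 0 + x.1 1 * v.2 1 + x.1 2 * v.2 2 + x.1 3 * v.2 3) = 0 := by
  rw [tangentCotangentSphere, mem_ofPred_eq, inner_four, inner_four, inner_four]

theorem symp_eq (v w : Phase) : symp v w =
    v.2 0 * w.1 0 + v.2 1 * w.1 1 + v.2 2 * w.1 2 + v.2 3 * w.1 3 -
      (w.2 0 * v.1 0 + w.2 1 * v.1 1 + w.2 2 * v.1 2 + w.2 3 * v.1 3) := by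
  rw [symp, inner_four, inner_four]

section hamField

variable {c : ℝ} {x : Phase}

theorem hamField_fst (i : Fin 4) : (hamField c x).1 i =
    moserFactor c x * ‖x.2‖ ^ 2 * (1 - x.1 0) * rotGen x.1 i + moserFactor c x ^ 2 * x.2 i := rfl

theorem hamField_snd (i : Fin 4) : (hamField c x).2 i =
    (moserFactor c x * ‖x.2‖ ^ 2 * (-c - 1 / 2 + rotMoment x)) *
      (EuclideanSpace.single 0 1 : E4) i +
      (moserFactor c x * ‖x.2‖ ^ 2 * (1 - x.1 0)) * rotGen x.2 i -
      (moserFactor c x ^ 2 * ‖x.2‖ ^ 2 + moserFactor c x * ‖x.2‖ ^ 2 *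
        (-c - 1 / 2 + rotMoment x) * x.1 0) * x.1 i := rfl

theorem hamField_mem (hx : x ∈ cotangentSphere) : hamField c x ∈ tangentCotangentSphere x := by
  obtain ⟨h1, h2⟩ := mem_cotangentSphere.1 hx
  rw [mem_tangentCotangentSphere]
  simp only [hamField_fst, hamField_snd, rotGen_zero, rotGen_one, rotGen_two, rotGen_three,
    PiLp.single_apply, Fin.reduceEq, if_true, if_false]
  have h3 := norm_sq_four x.2
  constructor
  · linear_combination moserFactor c x ^ 2 * h2
  · generalize moserFactor c x = f at *
    generalize ‖x.2‖ ^ 2 = n at *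
    linear_combination (-f ^ 2 * n - f * n * (-c - 1 / 2 + rotMoment x) * x.1 0) * h1 -
      f ^ 2 * h3

theorem symp_hamField {y : Phase} (hy : y ∈ tangentCotangentSphere x) :
    symp (hamField c x) y = -fderiv ℝ (regHam c) x y := by
  obtain ⟨h1, h2⟩ := mem_tangentCotangentSphere.1 hy
  rw [fderiv_regHam, fderiv_rotMoment, symp_eq, inner_four]
  simp only [hamField_fst, hamField_snd, rotGen_zero, rotGen_one, rotGen_two, rotGen_three,
    PiLp.single_apply, Fin.reduceEq, if_true, if_false]
  linear_combination (-(moserFactor c x ^ 2 * ‖x.2‖ ^ 2 + moserFactor c x * ‖x.2‖ ^ 2 *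
        (-c - 1 / 2 + rotMoment x) * x.1 0)) * h1

/-- `ω` is nondegenerate on the cotangent bundle of the sphere. -/
theorem exists_symp_pos (hx : x ∈ cotangentSphere) {v : Phase}
    (hv : v ∈ tangentCotangentSphere x) (hv0 : v ≠ 0) :
    ∃ w ∈ tangentCotangentSphere x, 0 < symp v w := by
  obtain ⟨h1, h2⟩ := hv
  obtain ⟨h3, h4⟩ := hx
  have h5 : inner ℝ x.1 x.1 = (1 : ℝ) := by rw [real_inner_self_eq_norm_sq, h3, one_pow]
  set a : ℝ := inner ℝ x.1 v.2 with ha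
  set w1 : E4 := v.2 - a • x.1 with hw1
  have hxw : inner ℝ x.1 w1 = 0 := by
    rw [hw1, inner_sub_right, inner_smul_right, h5, ← ha]
    ring
  set b : ℝ := -inner ℝ w1 x.2 with hb
  -- The witness is `(v.2, -v.1)`, the standard complex structure applied to `v`, corrected by
  -- multiples of `ξ` so as to be tangent. Its pairing with `v` is a sum of squares.
  refine ⟨(w1, -v.1 + b • x.1), ⟨hxw, ?_⟩, ?_⟩
  · simp only [inner_add_right, inner_neg_right, inner_smul_right, h1, h5]
    rw [hb]
    ring
  · have e1 : symp v (w1, -v.1 + b • x.1) = ‖w1‖ ^ 2 + ‖v.1‖ ^ 2 := by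
      have e2 : v.2 = w1 + a • x.1 := by rw [hw1]; abel
      have e3 : inner ℝ v.2 w1 = ‖w1‖ ^ 2 := by
        rw [e2, inner_add_left, inner_smul_left, hxw, real_inner_self_eq_norm_sq]
        simp
      simp only [symp, e3, inner_add_left, inner_neg_left, inner_smul_left, h1,
        real_inner_self_eq_norm_sq, mul_zero, add_zero]
      ring
    rw [e1]
    by_contra hneg
    have hz1 : ‖v.1‖ ^ 2 = 0 := by nlinarith [sq_nonneg ‖w1‖, sq_nonneg ‖v.1‖]
    have hz2 : ‖w1‖ ^ 2 = 0 := by nlinarith [sq_nonneg ‖w1‖, sq_nonneg ‖v.1‖]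
    have hv1 : v.1 = 0 := by simpa using hz1
    have hw : w1 = 0 := by simpa using hz2
    have ha0 : a = 0 := by simpa [hv1] using h2
    rw [hw1, ha0, zero_smul, sub_zero] at hw
    exact hv0 (Prod.ext hv1 hw)

theorem symp_sub_left (v v' w : Phase) : symp (v - v') w = symp v w - symp v' w := by
  simp only [symp_eq, Prod.fst_sub, Prod.snd_sub, PiLp.sub_apply]
  ring

/-- Nondegeneracy of `ω` on `T*S³`: the difference of two solutions pairs to zero with every tangent
vector. -/
theorem eq_hamField_of_symp (hx : x ∈ cotangentSphere) {v : Phase}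
    (hv : v ∈ tangentCotangentSphere x)
    (h : ∀ y ∈ tangentCotangentSphere x, symp v y = -fderiv ℝ (regHam c) x y) :
    v = hamField c x := by
  by_contra hne
  have hm := hamField_mem (c := c) hx
  have hsub : v - hamField c x ∈ tangentCotangentSphere x := by
    refine ⟨?_, ?_⟩
    · simp only [Prod.fst_sub, inner_sub_right, hv.1, hm.1, sub_zero]
    · have h1 := hv.2
      have h2 := hm.2
      simp only [Prod.fst_sub, Prod.snd_sub, inner_sub_right, inner_sub_left]
      linarith
  obtain ⟨w, hw, hpos⟩ := exists_symp_pos hx hsub (sub_ne_zero.2 hne)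
  rw [symp_sub_left, h w hw, symp_hamField hw] at hpos
  simp at hpos

end hamField

theorem energySurface_subset {c : ℝ} : energySurface c ⊆ cotangentSphere := fun _ hx =>
  (connectedComponentIn_subset _ _ hx).1

/-- Replaces the implicit description of the velocity by an ordinary differential equation whose
field is defined and `C¹` on all of `ℝ⁴ × ℝ⁴`. -/
theorem isOrbit_iff {c : ℝ} {γ : ℝ → Phase} : IsOrbit c γ ↔
    ∀ t, γ t ∈ energySurface c ∧ HasDerivAt γ (hamField c (γ t)) t := by
  refine forall_congr' fun t => and_congr_right fun h => ?_
  have hx := energySurface_subset h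
  constructor
  · rintro ⟨X, hX, hd, hs⟩
    rwa [← eq_hamField_of_symp hx hX hs]
  · exact fun hd => ⟨_, hamField_mem hx, hd, fun Y hY => symp_hamField hY⟩

/-- The set of times where the curves agree is closed, and open by local uniqueness, since a `C¹`
field is locally Lipschitz; the line is connected. -/
theorem IsOrbit.eq_of_eq {c : ℝ} {γ δ : ℝ → Phase} (hγ : IsOrbit c γ) (hδ : IsOrbit c δ)
    {t₀ : ℝ} (h : γ t₀ = δ t₀) : γ = δ := by
  rw [isOrbit_iff] at hγ hδ
  have hγc : Continuous γ := continuous_iff_continuousAt.2 fun t => (hγ t).2.continuousAt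
  have hδc : Continuous δ := continuous_iff_continuousAt.2 fun t => (hδ t).2.continuousAt
  have hclopen : IsClopen {t | γ t = δ t} := by
    refine ⟨isClosed_eq hγc hδc, isOpen_iff_mem_nhds.2 fun t ht => ?_⟩
    obtain ⟨K, s, hs, hK⟩ := (contDiff_hamField c).contDiffAt (x := γ t).exists_lipschitzOnWith
    have h1 : ∀ᶠ u in 𝓝 t, γ u ∈ s := hγc.continuousAt.eventually hs
    have h2 : ∀ᶠ u in 𝓝 t, δ u ∈ s :=
      hδc.continuousAt.eventually (by rwa [← show γ t = δ t from ht])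
    exact ODE_solution_unique_of_eventually (v := fun _ => hamField c) (s := fun _ => s) (K := K)
      (Eventually.of_forall fun _ => hK) (h1.mono fun u hu => ⟨(hγ u).2, hu⟩)
      (h2.mono fun u hu => ⟨(hδ u).2, hu⟩) ht
  have huniv := hclopen.eq_univ ⟨t₀, h⟩
  funext t
  exact (huniv ▸ mem_univ t : t ∈ {t | γ t = δ t})

/-! ### Rotations and the geodesic flow -/

/-- The rotation by the angle `s` that is generated by `rotGen`. -/
def rotVec (s : ℝ) (x : E4) : E4 :=
  !₂[x 0, Real.cos s * x 1 + Real.sin s * x 2, Real.cos s * x 2 - Real.sin s * x 1, x 3]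

def rotate (s : ℝ) (x : Phase) : Phase := (rotVec s x.1, rotVec s x.2)

@[simp] theorem rotVec_zero (s : ℝ) (x : E4) : rotVec s x 0 = x 0 := rfl
@[simp] theorem rotVec_one (s : ℝ) (x : E4) :
    rotVec s x 1 = Real.cos s * x 1 + Real.sin s * x 2 := rfl
@[simp] theorem rotVec_two (s : ℝ) (x : E4) :
    rotVec s x 2 = Real.cos s * x 2 - Real.sin s * x 1 := rfl
@[simp] theorem rotVec_three (s : ℝ) (x : E4) : rotVec s x 3 = x 3 := rfl

/-- The geodesic flow on the cotangent bundle of the sphere. -/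
def geodesic (s : ℝ) (x : Phase) : Phase :=
  (Real.cos s • x.1 + Real.sin s • x.2, Real.cos s • x.2 - Real.sin s • x.1)

theorem rotMoment_rotate (s : ℝ) (x : Phase) : rotMoment (rotate s x) = rotMoment x := by
  simp only [rotMoment, rotate, rotVec_one, rotVec_two]
  linear_combination (x.1 2 * x.2 1 - x.1 1 * x.2 2) * Real.sin_sq_add_cos_sq s

theorem rotMoment_geodesic (s : ℝ) (x : Phase) : rotMoment (geodesic s x) = rotMoment x := by
  simp only [rotMoment, geodesic, PiLp.add_apply, PiLp.sub_apply, PiLp.smul_apply, smul_eq_mul]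
  linear_combination (x.1 2 * x.2 1 - x.1 1 * x.2 2) * Real.sin_sq_add_cos_sq s

theorem norm_rotVec (s : ℝ) (x : E4) : ‖rotVec s x‖ ^ 2 = ‖x‖ ^ 2 := by
  simp only [norm_sq_four, rotVec_zero, rotVec_one, rotVec_two, rotVec_three]
  linear_combination (x 1 ^ 2 + x 2 ^ 2) * Real.sin_sq_add_cos_sq s

theorem inner_rotVec (s : ℝ) (x y : E4) :
    inner ℝ (rotVec s x) (rotVec s y) = (inner ℝ x y : ℝ) := by
  simp only [inner_four, rotVec_zero, rotVec_one, rotVec_two, rotVec_three]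
  linear_combination (x 1 * y 1 + x 2 * y 2) * Real.sin_sq_add_cos_sq s

theorem rotate_mem_unitCotangent (s : ℝ) {x : Phase} (hx : x ∈ unitCotangent) :
    rotate s x ∈ unitCotangent := by
  refine ⟨?_, (inner_rotVec s _ _).trans hx.2.1, ?_⟩
  · rw [← norm_sq_eq_one_iff]
    exact (norm_rotVec s x.1).trans (norm_sq_eq_one_iff.2 hx.1)
  · rw [← norm_sq_eq_one_iff]
    exact (norm_rotVec s x.2).trans (norm_sq_eq_one_iff.2 hx.2.2)

theorem geodesic_mem_unitCotangent (s : ℝ) {x : Phase} (hx : x ∈ unitCotangent) :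
    geodesic s x ∈ unitCotangent := by
  rw [mem_unitCotangent] at hx ⊢
  obtain ⟨h1, h2, h3⟩ := hx
  have h := Real.sin_sq_add_cos_sq s
  simp only [geodesic, PiLp.add_apply, PiLp.sub_apply, PiLp.smul_apply, smul_eq_mul]
  refine ⟨?_, ?_, ?_⟩
  · linear_combination Real.cos s ^ 2 * h1 + Real.sin s ^ 2 * h3 +
      2 * Real.cos s * Real.sin s * h2 + h
  · linear_combination Real.cos s * Real.sin s * (h3 - h1) +
      (Real.cos s ^ 2 - Real.sin s ^ 2) * h2
  · linear_combination Real.cos s ^ 2 * h3 + Real.sin s ^ 2 * h1 -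
      2 * Real.cos s * Real.sin s * h2 + h

theorem boostDenom_rotate (k s : ℝ) (x : Phase) : boostDenom k (rotate s x) = boostDenom k x := rfl

theorem boost_rotate (k s : ℝ) (x : Phase) : boost k (rotate s x) = rotate s (boost k x) := by
  apply phase_ext <;> intro i <;> fin_cases i <;>
    simp only [Fin.zero_eta, Fin.mk_one, Fin.reduceFinMk, boost_fst_zero, boost_fst_one,
      boost_fst_two, boost_fst_three, boost_snd_zero, boost_snd_one, boost_snd_two,
      boost_snd_three, boostDenom_rotate] <;>
    simp only [rotate, rotVec_zero, rotVec_one, rotVec_two, rotVec_three, boost_fst_zero,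
      boost_fst_one, boost_fst_two, boost_fst_three, boost_snd_zero, boost_snd_one, boost_snd_two,
      boost_snd_three] <;> ring

theorem rotVec_smul (s a : ℝ) (x : E4) : rotVec s (a • x) = a • rotVec s x := by
  apply PiLp.ext
  intro i
  fin_cases i <;> simp <;> ring

theorem chart_rotate (c s : ℝ) (x : Phase) : chart c (rotate s x) = rotate s (chart c x) := by
  rw [chart, chart, rotMoment_rotate, ← boost_rotate]
  simp only [rotate, rotVec_smul]

theorem keplerFreq_rotate (c s : ℝ) (x : Phase) : keplerFreq c (rotate s x) = keplerFreq c x := by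
  rw [keplerFreq, keplerFreq, rotMoment_rotate]

theorem chartInv_rotate (c s : ℝ) (x : Phase) :
    chartInv c (rotate s x) = rotate s (chartInv c x) := by
  rw [chartInv, chartInv, keplerFreq_rotate, boost_rotate]
  simp only [rotate, rotVec_smul]

theorem rotate_rotate (s t : ℝ) (x : Phase) : rotate s (rotate t x) = rotate (s + t) x := by
  apply phase_ext <;> intro i <;> fin_cases i <;>
    simp [rotate, Real.cos_add, Real.sin_add] <;> ring

@[simp] theorem rotate_zero (x : Phase) : rotate 0 x = x := by
  apply phase_ext <;> intro i <;> fin_cases i <;> simp [rotate]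

@[simp] theorem geodesic_zero (x : Phase) : geodesic 0 x = x := by
  simp [geodesic]

theorem geodesic_two_pi (x : Phase) : geodesic (2 * Real.pi) x = x := by
  simp [geodesic]

theorem rotate_mem_energySurface {c : ℝ} (hc : c < -3 / 2) (s : ℝ) {x : Phase}
    (hx : x ∈ energySurface c) : rotate s x ∈ energySurface c := by
  rw [← chart_chartInv_of_energySurface hc hx, ← chart_rotate]
  exact chart_mem_energySurface hc (rotate_mem_unitCotangent s
      (chartInv_mem_of_energySurface hc hx))

/-! ### The flow of the regularized problem -/

theorem hasDerivAt_phase {f : ℝ → Phase} {v : Phase} {t : ℝ}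
    (h1 : ∀ i, HasDerivAt (fun s => (f s).1 i) (v.1 i) t)
    (h2 : ∀ i, HasDerivAt (fun s => (f s).2 i) (v.2 i) t) : HasDerivAt f v t := by
  have key : ∀ {g : ℝ → E4} {w : E4}, (∀ i, HasDerivAt (fun s => g s i) (w i) t) →
      HasDerivAt g w t := fun {g w} h => by
    have hd : DifferentiableAt ℝ g t :=
      differentiableAt_euclidean.2 fun i => (h i).differentiableAt
    have hw : deriv g t = w := by
      apply PiLp.ext
      intro i
      exact (((EuclideanSpace.proj i : E4 →L[ℝ] ℝ).hasFDerivAt.comp_hasDerivAt t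
        hd.hasDerivAt).unique (h i))
    exact hw ▸ hd.hasDerivAt
  exact (key h1).prodMk (key h2)

/-- The vector field of the problem in the normalized coordinates, on the set of frequency `k`. -/
def normalField (k : ℝ) (x : Phase) : Phase :=
  (k • x.2 + ((1 - x.1 0) / k ^ 2) • rotGen x.1, -(k • x.1) + ((1 - x.1 0) / k ^ 2) • rotGen x.2)

section

variable {c : ℝ} (hc : c < -3 / 2)
include hc

/-- On the level `f² ‖η‖² = 1` with `f` known from `moserFactor_chart`, so every coefficient of the
field becomes a rational function of `k`, `D` and `ξ₀`. -/
theorem hamField_chart {x : Phase} (hx : x ∈ unitCotangent) {k D : ℝ}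
    (hk : k = freq c (rotMoment x)) (hD : D = boostDenom k x) :
    hamField c (chart c x) =
      (((1 - x.1 0) / k ^ 2) • rotGen (chart c x).1 + (4 * k ^ 4 / D ^ 2) • (chart c x).2,
        (D * (k ^ 2 - 1) / (4 * k ^ 2)) • EuclideanSpace.single 0 1 +
          ((1 - x.1 0) / k ^ 2) • rotGen (chart c x).2 -
          (1 + D * (k ^ 2 - 1) / (4 * k ^ 2) * (chart c x).1 0) • (chart c x).1) := by
  have hs := unitCotangent_subset hc hx
  have hf := moserFactor_chart hc hs
  have hk0 := freq_rotMoment_pos hc hs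
  have hD0 := hs.2
  have hQ := (chart_unitCotangent hc hx).2.1
  have hmom : rotMoment (chart c x) = k ^ 2 / 2 + c := by
    rw [rotMoment_chart hc hs]
    have := (freq_spec hc hs.1).2
    rw [hk]
    field_simp
    linarith
  have h0 : 1 - (chart c x).1 0 = 2 * (1 - x.1 0) / D := by
    have : (chart c x).1 0 = (k ^ 2 * (1 + x.1 0) - (1 - x.1 0)) / D := by rw [hD, hk]; rfl
    rw [this, eq_div_iff (by rw [hD, hk]; exact hD0.ne'), sub_mul,
      div_mul_cancel₀ _ (by rw [hD, hk]; exact hD0.ne'), hD, boostDenom]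
    ring
  rw [← hk] at hf hk0 hD0
  rw [← hD] at hf hD0
  have hfn : moserFactor c (chart c x) * ‖(chart c x).2‖ ^ 2 = D / (2 * k ^ 2) := by
    rw [regHam, hf] at hQ
    rw [hf]
    field_simp at hQ ⊢
    linear_combination hQ
  have hfn2 : moserFactor c (chart c x) ^ 2 * ‖(chart c x).2‖ ^ 2 = 1 := by
    rw [regHam] at hQ
    linarith
  have e1 : D / (2 * k ^ 2) * (1 - (chart c x).1 0) = (1 - x.1 0) / k ^ 2 := by
    rw [h0]
    field_simp
  have e2 : D / (2 * k ^ 2) * (-c - 1 / 2 + (k ^ 2 / 2 + c)) = D * (k ^ 2 - 1) / (4 * k ^ 2) := by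
    field_simp
    ring
  have e3 : (2 * k ^ 2 / D) ^ 2 = 4 * k ^ 4 / D ^ 2 := by ring
  rw [hamField, hfn2, hfn, hmom, hf, e1, e2, e3]

/-- In the chart, the Hamiltonian vector field is `normalField`. -/
theorem hasDerivAt_chart {w : ℝ → Phase} {k t : ℝ} (hw : ∀ s, w s ∈ unitCotangent)
    (hk : ∀ s, freq c (rotMoment (w s)) = k) (hd : HasDerivAt w (normalField k (w t)) t) :
    HasDerivAt (fun s => chart c (w s)) (hamField c (chart c (w t))) t := by
  have hs := unitCotangent_subset hc (hw t)
  have hk0 : 0 < k := hk t ▸ freq_rotMoment_pos hc hs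
  have hD0 : 0 < boostDenom k (w t) := hk t ▸ hs.2
  -- Along `w` the frequency is constant, so the chart acts as a boost with fixed `k` and the
  -- derivative of `freq` does not enter.
  have hchart : ∀ s, chart c (w s) = boost k ((w s).1, k⁻¹ • (w s).2) := fun s => by
    rw [chart, hk s]
  rw [hamField_chart hc (hw t) (hk t).symm rfl]
  simp only [hchart]
  have d1 : ∀ i, HasDerivAt (fun s => (w s).1 i) ((normalField k (w t)).1 i) t := fun i =>
    (EuclideanSpace.proj i : E4 →L[ℝ] ℝ).hasFDerivAt.comp_hasDerivAt t hd.fst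
  have d2 : ∀ i, HasDerivAt (fun s => (w s).2 i) ((normalField k (w t)).2 i) t := fun i =>
    (EuclideanSpace.proj i : E4 →L[ℝ] ℝ).hasFDerivAt.comp_hasDerivAt t hd.snd
  have d2' : ∀ i, HasDerivAt (fun s => (k⁻¹ • (w s).2) i) (k⁻¹ * (normalField k (w t)).2 i) t :=
    fun i => (d2 i).const_mul k⁻¹
  have dD : HasDerivAt (fun s => boostDenom k (w s))
      ((k ^ 2 - 1) * (normalField k (w t)).1 0) t := by
    have := (((d1 0).const_add 1).const_mul (k ^ 2)).add ((d1 0).const_sub 1)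
    refine this.congr_deriv ?_
    ring
  have dD' : HasDerivAt (fun s => boostDenom k ((w s).1, k⁻¹ • (w s).2))
      ((k ^ 2 - 1) * (normalField k (w t)).1 0) t := dD
  have hDeq : boostDenom k ((w t).1, k⁻¹ • (w t).2) = boostDenom k (w t) := rfl
  have aux1 : ∀ i, HasDerivAt (fun s => 2 * k * (w s).1 i / boostDenom k ((w s).1, k⁻¹ • (w s).2))
      _ t := fun i => ((d1 i).const_mul (2 * k)).div dD' hD0.ne'
  have aux2 : ∀ i, HasDerivAt (fun s => (boostDenom k ((w s).1, k⁻¹ • (w s).2) *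
      (k⁻¹ • (w s).2) i + (1 - k ^ 2) * (k⁻¹ • (w s).2) 0 * (w s).1 i) / (2 * k)) _ t := fun i =>
    ((dD'.mul (d2' i)).add (((d2' 0).const_mul (1 - k ^ 2)).mul (d1 i))).div_const (2 * k)
  have hb : boostDenom k (w t) = k ^ 2 * (1 + (w t).1 0) + (1 - (w t).1 0) := rfl
  apply hasDerivAt_phase <;> intro i <;> fin_cases i
  · refine ((((d1 0).const_add 1).const_mul (k ^ 2)).sub
      ((d1 0).const_sub 1) |>.div dD' hD0.ne').congr_deriv ?_
    simp only [normalField, Fin.zero_eta, PiLp.add_apply, PiLp.smul_apply, smul_eq_mul,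
      rotGen_zero, boost_snd_zero, hDeq, Pi.sub_apply]
    field_simp
    rw [hb]
    ring
  on_goal 1 => refine (aux1 1).congr_deriv ?_
  on_goal 2 => refine (aux1 2).congr_deriv ?_
  on_goal 3 => refine (aux1 3).congr_deriv ?_
  on_goal 4 => refine (d2' 0).congr_deriv ?_
  on_goal 5 => refine (aux2 1).congr_deriv ?_
  on_goal 6 => refine (aux2 2).congr_deriv ?_
  on_goal 7 => refine (aux2 3).congr_deriv ?_
  all_goals
    simp only [normalField, Fin.zero_eta, Fin.mk_one, Fin.reduceFinMk, PiLp.add_apply,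
      PiLp.sub_apply, PiLp.neg_apply, PiLp.smul_apply, smul_eq_mul, rotGen_zero, rotGen_one,
      rotGen_two, rotGen_three, boost_fst_zero, boost_fst_one, boost_fst_two, boost_fst_three,
      boost_snd_one, boost_snd_two, boost_snd_three, hDeq, PiLp.single_apply,
      Fin.reduceEq, if_true, if_false]
    field_simp
    try rw [hb]
    ring

end

/-- The angle by which the frame has rotated at time `t`. -/
def frameAngle (k : ℝ) (x : Phase) (t : ℝ) : ℝ :=
  (t - (x.1 0 * Real.sin (k * t) - x.2 0 * (Real.cos (k * t) - 1)) / k) / k ^ 2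

/-- The flow of the problem in the normalized coordinates. -/
def normalFlow (k : ℝ) (x : Phase) (t : ℝ) : Phase :=
  rotate (frameAngle k x t) (geodesic (k * t) x)

/-- The rate `(1 - ξ₀)/k²` is a trigonometric polynomial in `k t` along a geodesic, and `frameAngle`
is its elementary primitive. -/
theorem hasDerivAt_frameAngle {k : ℝ} (hk : k ≠ 0) (x : Phase) (t : ℝ) :
    HasDerivAt (frameAngle k x) ((1 - (geodesic (k * t) x).1 0) / k ^ 2) t := by
  have hkt : HasDerivAt (fun t => k * t) k t := by simpa using (hasDerivAt_id t).const_mul k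
  have := ((hasDerivAt_id t).sub (((hkt.sin.const_mul (x.1 0)).sub
    ((hkt.cos.sub_const 1).const_mul (x.2 0))).div_const k)).div_const (k ^ 2)
  refine this.congr_deriv ?_
  simp only [geodesic, PiLp.add_apply, PiLp.smul_apply, smul_eq_mul]
  field_simp
  ring

/-- Rotations commute with the geodesic flow and leave `ξ₀` unchanged, so the rate of rotation can
be evaluated along the unrotated geodesic and integrated separately. -/
theorem hasDerivAt_normalFlow {k : ℝ} (hk : k ≠ 0) (x : Phase) (t : ℝ) :
    HasDerivAt (normalFlow k x) (normalField k (normalFlow k x t)) t := by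
  have hkt : HasDerivAt (fun t => k * t) k t := by simpa using (hasDerivAt_id t).const_mul k
  have hφ := hasDerivAt_frameAngle hk x t
  set φ' := (1 - (geodesic (k * t) x).1 0) / k ^ 2 with hφ'
  have g1 : ∀ i, HasDerivAt (fun t => (geodesic (k * t) x).1 i) (k * (geodesic (k * t) x).2 i) t :=
    fun i => by
      refine ((hkt.cos.mul_const (x.1 i)).add (hkt.sin.mul_const (x.2 i))).congr_deriv ?_
      simp only [geodesic, PiLp.sub_apply, PiLp.smul_apply, smul_eq_mul]
      ring
  have g2 : ∀ i, HasDerivAt (fun t => (geodesic (k * t) x).2 i)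
      (-(k * (geodesic (k * t) x).1 i)) t :=
    fun i => by
      refine ((hkt.cos.mul_const (x.2 i)).sub (hkt.sin.mul_const (x.1 i))).congr_deriv ?_
      simp only [geodesic, PiLp.add_apply, PiLp.smul_apply, smul_eq_mul]
      ring
  have hval : normalField k (normalFlow k x t) =
    (k • (normalFlow k x t).2 + φ' • rotGen (normalFlow k x t).1,
      -(k • (normalFlow k x t).1) + φ' • rotGen (normalFlow k x t).2) := rfl
  rw [hval]
  apply hasDerivAt_phase <;> intro i <;> fin_cases i
  · refine (g1 0).congr_deriv ?_
    simp [normalFlow, rotate]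
  · refine ((hφ.cos.mul (g1 1)).add (hφ.sin.mul (g1 2))).congr_deriv ?_
    simp [normalFlow, rotate]
    ring
  · refine ((hφ.cos.mul (g1 2)).sub (hφ.sin.mul (g1 1))).congr_deriv ?_
    simp [normalFlow, rotate]
    ring
  · refine (g1 3).congr_deriv ?_
    simp [normalFlow, rotate]
  · refine (g2 0).congr_deriv ?_
    simp [normalFlow, rotate]
  · refine ((hφ.cos.mul (g2 1)).add (hφ.sin.mul (g2 2))).congr_deriv ?_
    simp [normalFlow, rotate]
    ring
  · refine ((hφ.cos.mul (g2 2)).sub (hφ.sin.mul (g2 1))).congr_deriv ?_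
    simp [normalFlow, rotate]
    ring
  · refine (g2 3).congr_deriv ?_
    simp [normalFlow, rotate]

theorem normalFlow_mem (k : ℝ) {x : Phase} (hx : x ∈ unitCotangent) (t : ℝ) :
    normalFlow k x t ∈ unitCotangent :=
  rotate_mem_unitCotangent _ (geodesic_mem_unitCotangent _ hx)

theorem rotMoment_normalFlow (k : ℝ) (x : Phase) (t : ℝ) :
    rotMoment (normalFlow k x t) = rotMoment x := by
  rw [normalFlow, rotMoment_rotate, rotMoment_geodesic]

@[simp] theorem normalFlow_zero (k : ℝ) (x : Phase) : normalFlow k x 0 = x := by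
  simp [normalFlow, frameAngle]

/-- The orbit through `chart c x`. -/
def orbit (c : ℝ) (x : Phase) (t : ℝ) : Phase := chart c (normalFlow (freq c (rotMoment x)) x t)

theorem isOrbit_orbit {c : ℝ} (hc : c < -3 / 2) {x : Phase} (hx : x ∈ unitCotangent) :
    IsOrbit c (orbit c x) := by
  rw [isOrbit_iff]
  intro t
  have hk := freq_rotMoment_pos hc (unitCotangent_subset hc hx)
  refine ⟨chart_mem_energySurface hc (normalFlow_mem _ hx t), ?_⟩
  exact hasDerivAt_chart hc (fun s => normalFlow_mem _ hx s)
    (fun s => by rw [rotMoment_normalFlow]) (hasDerivAt_normalFlow hk.ne' x t)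

theorem orbit_zero (c : ℝ) (x : Phase) : orbit c x 0 = chart c x := by
  rw [orbit, normalFlow_zero]

theorem IsOrbit.eq_orbit {c : ℝ} (hc : c < -3 / 2) {γ : ℝ → Phase} (hγ : IsOrbit c γ) :
    γ = orbit c (chartInv c (γ 0)) := by
  have h0 := (hγ 0).1
  refine hγ.eq_of_eq (isOrbit_orbit hc (chartInv_mem_of_energySurface hc h0)) (t₀ := 0) ?_
  rw [orbit_zero, chart_chartInv_of_energySurface hc h0]

/-! ### The model of the page -/

/-- The ambient space of the model of the page, with points `(α, β, Z, t)`. -/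
abbrev Model := ℂ × ℂ × ℂ × ℝ

/-- The embedding of the model of the page into the normalized coordinates. -/
def embed : Model →L[ℝ] Phase := LinearMap.toContinuousLinearMap
  -- In terms of `ζ = ξ + i η`: `α = ζ₁ + i ζ₂`, `β = ζ₁ - i ζ₂`, `Z = ζ₀`, `i t = ζ₃`.
  -- Orthonormality of `ξ` and `η` says that `ζ` is null, `Σ ζⱼ² = 0`, and that `‖ζ‖² = 2`; these
  -- are the two equations of `quadric`.
  { toFun := fun m =>
      (!₂[m.2.2.1.re, (m.1.re + m.2.1.re) / 2, (m.1.im - m.2.1.im) / 2, 0],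
        !₂[m.2.2.1.im, (m.1.im + m.2.1.im) / 2, (m.2.1.re - m.1.re) / 2, m.2.2.2])
    map_add' := fun m n => by
      apply phase_ext <;> intro i <;> fin_cases i <;> simp <;> ring
    map_smul' := fun a m => by
      apply phase_ext <;> intro i <;> fin_cases i <;> simp <;> ring }

/-- The left inverse of `embed`. -/
def unembed : Phase →L[ℝ] Model := LinearMap.toContinuousLinearMap
  { toFun := fun x => (⟨x.1 1 - x.2 2, x.1 2 + x.2 1⟩, ⟨x.1 1 + x.2 2, x.2 1 - x.1 2⟩,
      ⟨x.1 0, x.2 0⟩, x.2 3)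
    map_add' := fun x y => by
      refine Prod.ext (Complex.ext ?_ ?_) (Prod.ext (Complex.ext ?_ ?_)
        (Prod.ext (Complex.ext ?_ ?_) ?_)) <;> simp <;> ring
    map_smul' := fun a x => by
      refine Prod.ext (Complex.ext ?_ ?_) (Prod.ext (Complex.ext ?_ ?_)
        (Prod.ext (Complex.ext ?_ ?_) ?_)) <;> simp <;> ring }

section embed

variable (m : Model) (x : Phase)

theorem embed_fst_zero : (embed m).1 0 = m.2.2.1.re := rfl
theorem embed_fst_one : (embed m).1 1 = (m.1.re + m.2.1.re) / 2 := rfl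
theorem embed_fst_two : (embed m).1 2 = (m.1.im - m.2.1.im) / 2 := rfl
theorem embed_fst_three : (embed m).1 3 = 0 := rfl
theorem embed_snd_zero : (embed m).2 0 = m.2.2.1.im := rfl
theorem embed_snd_one : (embed m).2 1 = (m.1.im + m.2.1.im) / 2 := rfl
theorem embed_snd_two : (embed m).2 2 = (m.2.1.re - m.1.re) / 2 := rfl
theorem embed_snd_three : (embed m).2 3 = m.2.2.2 := rfl

theorem unembed_apply : unembed x = (⟨x.1 1 - x.2 2, x.1 2 + x.2 1⟩,
    ⟨x.1 1 + x.2 2, x.2 1 - x.1 2⟩, ⟨x.1 0, x.2 0⟩, x.2 3) := rfl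

end embed

theorem unembed_embed (m : Model) : unembed (embed m) = m := by
  rw [unembed_apply]
  refine Prod.ext (Complex.ext ?_ ?_) (Prod.ext (Complex.ext ?_ ?_)
    (Prod.ext (Complex.ext ?_ ?_) ?_)) <;>
    simp only [embed_fst_zero, embed_fst_one, embed_fst_two, embed_snd_zero, embed_snd_one,
      embed_snd_two, embed_snd_three] <;> ring

theorem embed_unembed {x : Phase} (hx : x.1 3 = 0) : embed (unembed x) = x := by
  apply phase_ext <;> intro i <;> fin_cases i <;>
    simp only [Fin.zero_eta, Fin.mk_one, Fin.reduceFinMk, embed_fst_zero, embed_fst_one,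
      embed_fst_two, embed_fst_three, embed_snd_zero, embed_snd_one, embed_snd_two,
      embed_snd_three, unembed_apply, hx] <;> ring

open Complex (normSq)

/-- The model of the doubled page. The page is the half `0 ≤ t`. -/
def quadric : Set Model := {m | m.1 * m.2.1 + m.2.2.1 ^ 2 = (m.2.2.2 : ℂ) ^ 2 ∧
  normSq m.1 + normSq m.2.1 + 2 * normSq m.2.2.1 + 2 * m.2.2.2 ^ 2 = 4}

theorem mem_quadric {m : Model} : m ∈ quadric ↔
    m.1.re * m.2.1.re - m.1.im * m.2.1.im + m.2.2.1.re ^ 2 - m.2.2.1.im ^ 2 = m.2.2.2 ^ 2 ∧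
    m.1.re * m.2.1.im + m.1.im * m.2.1.re + 2 * m.2.2.1.re * m.2.2.1.im = 0 ∧
    m.1.re ^ 2 + m.1.im ^ 2 + m.2.1.re ^ 2 + m.2.1.im ^ 2 +
      2 * (m.2.2.1.re ^ 2 + m.2.2.1.im ^ 2) + 2 * m.2.2.2 ^ 2 = 4 := by
  rw [quadric, mem_ofPred_eq, Complex.ext_iff, and_assoc]
  simp only [pow_two, Complex.add_re, Complex.mul_re, Complex.ofReal_re, Complex.ofReal_im,
    Complex.add_im, Complex.mul_im, Complex.normSq_apply]
  constructor
  · rintro ⟨h1, h2, h3⟩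
    exact ⟨by linarith, by linarith, by linarith⟩
  · rintro ⟨h1, h2, h3⟩
    exact ⟨by linarith, by linarith, by linarith⟩

theorem embed_mem_unitCotangent {m : Model} : embed m ∈ unitCotangent ↔ m ∈ quadric := by
  rw [mem_unitCotangent, mem_quadric]
  simp only [embed_fst_zero, embed_fst_one, embed_fst_two, embed_fst_three, embed_snd_zero,
    embed_snd_one, embed_snd_two, embed_snd_three]
  constructor
  · rintro ⟨h1, h2, h3⟩
    exact ⟨by linarith, by linarith, by linarith⟩
  · rintro ⟨h1, h2, h3⟩
    exact ⟨by linarith, by linarith, by linarith⟩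

/-- The normalized moment on the model. -/
def moment (m : Model) : ℝ := (normSq m.1 - normSq m.2.1) / 4

theorem rotMoment_embed (m : Model) : rotMoment (embed m) = moment m := by
  simp only [rotMoment, moment, embed_fst_one, embed_fst_two, embed_snd_one, embed_snd_two,
    Complex.normSq_apply]
  ring

/-- The rotation on the model. -/
def rotModel (s : ℝ) (m : Model) : Model :=
  (Complex.exp (-s * Complex.I) * m.1, Complex.exp (s * Complex.I) * m.2.1, m.2.2)

theorem embed_rotModel (s : ℝ) (m : Model) : embed (rotModel s m) = rotate s (embed m) := by
  apply phase_ext <;> intro i <;> fin_cases i <;>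
    simp only [Fin.zero_eta, Fin.mk_one, Fin.reduceFinMk, embed_fst_zero, embed_fst_one,
      embed_fst_two, embed_fst_three, embed_snd_zero, embed_snd_one, embed_snd_two,
      embed_snd_three, rotModel, rotate, rotVec_zero, rotVec_one, rotVec_two, rotVec_three,
      Complex.mul_re, Complex.mul_im, Complex.exp_re, Complex.exp_im, Complex.neg_re,
      Complex.neg_im, Complex.ofReal_re, Complex.ofReal_im, Complex.I_re, Complex.I_im, neg_zero,
      mul_zero, sub_zero, mul_one, add_zero, Real.exp_zero, Real.cos_neg, Real.sin_neg,
      one_mul] <;> ring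

theorem unembed_rotate (s : ℝ) (x : Phase) : unembed (rotate s x) = rotModel s (unembed x) := by
  rw [unembed_apply, unembed_apply]
  refine Prod.ext (Complex.ext ?_ ?_) (Prod.ext (Complex.ext ?_ ?_) rfl) <;>
    simp only [rotModel, rotate, rotVec_one, rotVec_two,
      Complex.mul_re, Complex.mul_im, Complex.exp_re, Complex.exp_im, Complex.neg_re,
      Complex.neg_im, Complex.ofReal_re, Complex.ofReal_im, Complex.I_re, Complex.I_im, neg_zero,
      mul_zero, sub_zero, mul_one, add_zero, Real.exp_zero, Real.cos_neg, Real.sin_neg,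
      one_mul] <;> ring

/-- The parametrization of the doubled page by its model. -/
def pageChart (c : ℝ) (m : Model) : Phase := chart c (embed m)

/-- The coordinates on the page. -/
def pageCoord (c : ℝ) (x : Phase) : Model := unembed (chartInv c x)

theorem chart_fst_three (c : ℝ) (x : Phase) : (chart c x).1 3 =
    2 * freq c (rotMoment x) / boostDenom (freq c (rotMoment x)) x * x.1 3 := by
  change 2 * freq c (rotMoment x) * x.1 3 / boostDenom (freq c (rotMoment x)) x = _
  ring

theorem chart_snd_three {c : ℝ} {x : Phase} (hx : x.1 3 = 0) : (chart c x).2 3 =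
    boostDenom (freq c (rotMoment x)) x / (2 * freq c (rotMoment x) ^ 2) * x.2 3 := by
  change (boostDenom (freq c (rotMoment x)) x * ((freq c (rotMoment x))⁻¹ * x.2 3) +
    _ * x.1 3) / (2 * freq c (rotMoment x)) = _
  rw [hx]
  ring

/-! ### The page in the coordinates of the model -/

section page

variable {c : ℝ} (hc : c < -3 / 2) {m : Model} {x : Phase}
include hc

/-- The chart multiplies `ξ₃` by a positive function, and also `η₃` where `ξ₃ = 0`. The conditions
that define the page and its interior therefore have the same form on both sides. -/
theorem chart_fst_three_eq_zero (hx : x ∈ chartSource c) : (chart c x).1 3 = 0 ↔ x.1 3 = 0 := by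
  have hk := freq_rotMoment_pos hc hx
  have hD := hx.2
  rw [chart_fst_three, mul_eq_zero_iff_left (by positivity)]

theorem chart_snd_three_pos (hx : x ∈ chartSource c) (h3 : x.1 3 = 0) :
    0 < (chart c x).2 3 ↔ 0 < x.2 3 := by
  have hk := freq_rotMoment_pos hc hx
  have hD := hx.2
  rw [chart_snd_three h3, mul_pos_iff_of_pos_left (by positivity)]

theorem chart_snd_three_nonneg (hx : x ∈ chartSource c) (h3 : x.1 3 = 0) :
    0 ≤ (chart c x).2 3 ↔ 0 ≤ x.2 3 := by
  have hk := freq_rotMoment_pos hc hx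
  have hD := hx.2
  rw [chart_snd_three h3, mul_nonneg_iff_of_pos_left (by positivity)]

theorem embed_mem_chartSource (hm : m ∈ quadric) : embed m ∈ chartSource c :=
  unitCotangent_subset hc (embed_mem_unitCotangent.2 hm)

theorem pageChart_mem_energySurface (hm : m ∈ quadric) : pageChart c m ∈ energySurface c :=
  chart_mem_energySurface hc (embed_mem_unitCotangent.2 hm)

theorem pageChart_mem_page_iff (hm : m ∈ quadric) : pageChart c m ∈ page c ↔ 0 ≤ m.2.2.2 := by
  have hs := embed_mem_chartSource hc hm
  constructor
  · exact fun h => (chart_snd_three_nonneg hc hs (embed_fst_three m)).1 h.2.2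
  · exact fun h => ⟨pageChart_mem_energySurface hc hm,
      (chart_fst_three_eq_zero hc hs).2 (embed_fst_three m),
      (chart_snd_three_nonneg hc hs (embed_fst_three m)).2 h⟩

theorem pageChart_mem_pageInterior_iff (hm : m ∈ quadric) :
    pageChart c m ∈ pageInterior c ↔ 0 < m.2.2.2 := by
  have hs := embed_mem_chartSource hc hm
  constructor
  · exact fun h => (chart_snd_three_pos hc hs (embed_fst_three m)).1 h.2.2
  · exact fun h => ⟨pageChart_mem_energySurface hc hm,
      (chart_fst_three_eq_zero hc hs).2 (embed_fst_three m),
      (chart_snd_three_pos hc hs (embed_fst_three m)).2 h⟩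

omit hc in
theorem page_eq : page c = pageInterior c ∪ pageBoundary c := by
  ext x
  constructor
  · rintro ⟨h1, h2, h3⟩
    rcases h3.eq_or_lt with h | h
    · exact Or.inr ⟨h1, h2, h.symm⟩
    · exact Or.inl ⟨h1, h2, h⟩
  · rintro (⟨h1, h2, h3⟩ | ⟨h1, h2, h3⟩)
    · exact ⟨h1, h2, h3.le⟩
    · exact ⟨h1, h2, h3.ge⟩

theorem pageChart_mem_pageBoundary_iff (hm : m ∈ quadric) :
    pageChart c m ∈ pageBoundary c ↔ m.2.2.2 = 0 := by
  have h1 := pageChart_mem_page_iff hc hm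
  have h2 := pageChart_mem_pageInterior_iff hc hm
  constructor
  · intro h
    have h3 := h1.1 (page_eq ▸ Or.inr h)
    refine le_antisymm (not_lt.1 fun h4 => ?_) h3
    exact (h2.2 h4).2.2.ne' h.2.2
  · intro h
    have h3 := h1.2 h.ge
    rw [page_eq] at h3
    exact h3.resolve_left fun h4 => (h2.1 h4).ne' h

theorem pageCoord_mem (hx : x ∈ energySurface c) (h3 : x.1 3 = 0) :
    pageCoord c x ∈ quadric ∧ pageChart c (pageCoord c x) = x := by
  have hu := chartInv_mem_of_energySurface hc hx
  have hcc := chart_chartInv_of_energySurface hc hx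
  have h0 : (chartInv c x).1 3 = 0 := by
    rw [← chart_fst_three_eq_zero hc (unitCotangent_subset hc hu), hcc, h3]
  refine ⟨?_, ?_⟩
  · rw [← embed_mem_unitCotangent, pageCoord, embed_unembed h0]
    exact hu
  · rw [pageChart, pageCoord, embed_unembed h0, hcc]

theorem pageCoord_page (hx : x ∈ page c) : pageCoord c x ∈ quadric ∧ 0 ≤ (pageCoord c x).2.2.2 ∧
    pageChart c (pageCoord c x) = x := by
  obtain ⟨h1, h2⟩ := pageCoord_mem hc hx.1 hx.2.1
  exact ⟨h1, by rwa [← pageChart_mem_page_iff hc h1, h2], h2⟩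

theorem pageCoord_pageChart (hm : embed m ∈ chartSource c) :
    pageCoord c (pageChart c m) = m := by
  rw [pageCoord, pageChart, chartInv_chart hc hm, unembed_embed]

theorem pageChart_injOn : InjOn (pageChart c) quadric := fun m hm n hn h => by
  rw [← pageCoord_pageChart hc (embed_mem_chartSource hc hm), h,
    pageCoord_pageChart hc (embed_mem_chartSource hc hn)]

omit hc in
theorem pageChart_rotModel (s : ℝ) (m : Model) :
    pageChart c (rotModel s m) = rotate s (pageChart c m) := by
  rw [pageChart, embed_rotModel, chart_rotate, pageChart]

omit hc in
theorem pageCoord_rotate (s : ℝ) (x : Phase) :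
    pageCoord c (rotate s x) = rotModel s (pageCoord c x) := by
  rw [pageCoord, chartInv_rotate, unembed_rotate, pageCoord]

theorem contDiffAt_pageChart (hm : m ∈ quadric) : ContDiffAt ℝ ∞ (pageChart c) m :=
  (contDiffAt_chart hc (embed_mem_chartSource hc hm)).comp m embed.contDiff.contDiffAt

theorem contDiffAt_pageCoord (hx : x ∈ chartTarget c) : ContDiffAt ℝ ∞ (pageCoord c) x :=
  unembed.contDiff.contDiffAt.comp x (contDiffAt_chartInv hc hx)

end page

/-! ### Tangent vectors in the chart -/

/-- The product rule at a zero of one factor needs only continuity of the other. This avoids all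
derivatives of `freq` and of the denominators. -/
theorem hasDerivAt_mul_of_eq_zero {A ε : ℝ → ℝ} {e t : ℝ} (hA : ContinuousAt A t)
    (hε : HasDerivAt ε e t) (h0 : ε t = 0) : HasDerivAt (fun s => A s * ε s) (A t * e) t := by
  rw [hasDerivAt_iff_tendsto_slope] at hε ⊢
  have h : Tendsto (fun s => A s * slope ε t s) (𝓝[≠] t) (𝓝 (A t * e)) :=
    (hA.tendsto.mono_left nhdsWithin_le_nhds).mul hε
  refine h.congr fun s => ?_
  simp only [slope, h0, mul_zero, vsub_eq_sub, sub_zero, smul_eq_mul]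
  ring

/-- The tangent space of the unit cotangent bundle. -/
def tangentUnit (x : Phase) : Set Phase :=
  {u | inner ℝ x.1 u.1 = 0 ∧ inner ℝ u.1 x.2 + inner ℝ x.1 u.2 = 0 ∧ inner ℝ x.2 u.2 = 0}

section tangent

variable {c : ℝ} (hc : c < -3 / 2) {x u : Phase}
include hc

theorem hasDerivAt_chart_line (hx : x ∈ chartSource c) (u : Phase) :
    HasDerivAt (fun t : ℝ => chart c (x + t • u)) (fderiv ℝ (chart c) x u) 0 := by
  have hl : HasDerivAt (fun t : ℝ => x + t • u) u 0 := by
    simpa using ((hasDerivAt_id (0 : ℝ)).smul_const u).const_add x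
  have hf' : HasFDerivAt (chart c) (fderiv ℝ (chart c) x) (x + (0 : ℝ) • u) := by
    simpa using ((contDiffAt_chart hc hx).differentiableAt (by simp)).hasFDerivAt
  exact hf'.comp_hasDerivAt 0 hl

/-- Differentiates `norm_sq_chart`, `inner_chart`, `regHam_chart` and `chart_fst_three` at a point
where the constraints hold. The differentials of the constraints are related by a triangular matrix
with diagonal `A, B, 1, F`, all positive, so their common kernels correspond. -/
theorem fderiv_chart_constraints (hx : x ∈ unitCotangent) (u : Phase) :
    ∃ A B C D E F : ℝ, 0 < A ∧ 0 < B ∧ 0 < F ∧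
      inner ℝ (chart c x).1 (fderiv ℝ (chart c) x u).1 = A * inner ℝ x.1 u.1 ∧
      inner ℝ (fderiv ℝ (chart c) x u).1 (chart c x).2 +
        inner ℝ (chart c x).1 (fderiv ℝ (chart c) x u).2 =
        B * (inner ℝ u.1 x.2 + inner ℝ x.1 u.2) + C * inner ℝ x.1 u.1 ∧
      fderiv ℝ (regHam c) (chart c x) (fderiv ℝ (chart c) x u) = inner ℝ x.2 u.2 +
        D * (inner ℝ u.1 x.2 + inner ℝ x.1 u.2) + E * inner ℝ x.1 u.1 ∧
      (x.1 3 = 0 → (fderiv ℝ (chart c) x u).1 3 = F * u.1 3) := by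
  have hs := unitCotangent_subset hc hx
  have hk := freq_rotMoment_pos hc hs
  have hD := hs.2
  have hl : HasDerivAt (fun t : ℝ => x + t • u) u 0 := by
    simpa using ((hasDerivAt_id (0 : ℝ)).smul_const u).const_add x
  have hlc := hl.continuousAt
  have hd := hasDerivAt_chart_line hc hs u
  set w := fderiv ℝ (chart c) x u with hw
  have hev : ∀ᶠ t : ℝ in 𝓝 0, x + t • u ∈ chartSource c :=
    hlc.eventually ((isOpen_chartSource hc).mem_nhds (by simpa using hs))
  have ck : ContinuousAt (fun t : ℝ => freq c (rotMoment (x + t • u))) 0 :=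
    ContinuousAt.comp (g := fun y => freq c (rotMoment y)) (f := fun t : ℝ => x + t • u)
      (by simpa using (contDiffAt_freq_rotMoment hc hs).continuousAt) hlc
  have hk0 : freq c (rotMoment (x + (0 : ℝ) • u)) ≠ 0 := by simpa using hk.ne'
  have cD : ContinuousAt (fun t : ℝ => boostDenom (freq c (rotMoment (x + t • u)))
      (x + t • u)) 0 := by
    have h0 : ContinuousAt (fun t : ℝ => (x + t • u).1 0) 0 :=
      ((hasDerivAt_line x u).1 0).continuousAt
    exact ((ck.pow 2).mul (continuousAt_const.add h0)).add (continuousAt_const.sub h0)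
  have hD0 : boostDenom (freq c (rotMoment (x + (0 : ℝ) • u))) (x + (0 : ℝ) • u) ≠ 0 := by
    simpa using hD.ne'
  have c20 : ContinuousAt (fun t : ℝ => (x + t • u).2 0) 0 :=
    ((hasDerivAt_line x u).2 0).continuousAt
  have h1 : HasDerivAt (fun t : ℝ => (x + t • u).1) u.1 0 := hl.fst
  have h2 : HasDerivAt (fun t : ℝ => (x + t • u).2) u.2 0 := hl.snd
  have dε : HasDerivAt (fun t : ℝ => ‖(x + t • u).1‖ ^ 2 - 1) (2 * inner ℝ x.1 u.1) 0 := by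
    simpa using h1.norm_sq.sub_const 1
  have dm : HasDerivAt (fun t : ℝ => inner ℝ (x + t • u).1 (x + t • u).2)
      (inner ℝ u.1 x.2 + inner ℝ x.1 u.2) 0 := by
    have := h1.inner ℝ h2
    simp only [zero_smul, add_zero] at this
    rw [add_comm]
    exact this
  have dn : HasDerivAt (fun t : ℝ => ‖(x + t • u).2‖ ^ 2) (2 * inner ℝ x.2 u.2) 0 := by
    simpa using h2.norm_sq
  have ε0 : ‖(x + (0 : ℝ) • u).1‖ ^ 2 - 1 = 0 := by simp [hx.1]
  have m0 : inner ℝ (x + (0 : ℝ) • u).1 (x + (0 : ℝ) • u).2 = (0 : ℝ) := by simp [hx.2.1]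
  have d1 : HasDerivAt (fun t : ℝ => (chart c (x + t • u)).1) w.1 0 := hd.fst
  have d2 : HasDerivAt (fun t : ℝ => (chart c (x + t • u)).2) w.2 0 := hd.snd
  have cA : ContinuousAt (fun t : ℝ => 4 * freq c (rotMoment (x + t • u)) ^ 2 /
      boostDenom (freq c (rotMoment (x + t • u))) (x + t • u) ^ 2) 0 :=
    (continuousAt_const.mul (ck.pow 2)).div (cD.pow 2) (pow_ne_zero 2 hD0)
  have cC : ContinuousAt (fun t : ℝ => (1 - freq c (rotMoment (x + t • u)) ^ 2) *
      ((freq c (rotMoment (x + t • u)))⁻¹ * (x + t • u).2 0) /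
        boostDenom (freq c (rotMoment (x + t • u))) (x + t • u)) 0 :=
    ((continuousAt_const.sub (ck.pow 2)).mul ((ck.inv₀ hk0).mul c20)).div cD hD0
  have cD' : ContinuousAt (fun t : ℝ => 2 * (1 - freq c (rotMoment (x + t • u)) ^ 2) *
      (x + t • u).2 0 / boostDenom (freq c (rotMoment (x + t • u))) (x + t • u)) 0 :=
    ((continuousAt_const.mul (continuousAt_const.sub (ck.pow 2))).mul c20).div cD hD0
  have cE : ContinuousAt (fun t : ℝ => ((1 - freq c (rotMoment (x + t • u)) ^ 2) *
      (x + t • u).2 0 / boostDenom (freq c (rotMoment (x + t • u))) (x + t • u)) ^ 2) 0 :=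
    (((continuousAt_const.sub (ck.pow 2)).mul c20).div cD hD0).pow 2
  have cF : ContinuousAt (fun t : ℝ => 2 * freq c (rotMoment (x + t • u)) /
      boostDenom (freq c (rotMoment (x + t • u))) (x + t • u)) 0 :=
    (continuousAt_const.mul ck).div cD hD0
  have e1 : HasDerivAt (fun t : ℝ => ‖(chart c (x + t • u)).1‖ ^ 2 - 1) _ 0 :=
    (hasDerivAt_mul_of_eq_zero cA dε ε0).congr_of_eventuallyEq
      (hev.mono fun t ht => norm_sq_chart ht)
  have e2 : HasDerivAt (fun t : ℝ => inner ℝ (chart c (x + t • u)).1 (chart c (x + t • u)).2) _ 0 :=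
    ((hasDerivAt_mul_of_eq_zero (ck.inv₀ hk0) dm m0).add
      (hasDerivAt_mul_of_eq_zero cC dε ε0)).congr_of_eventuallyEq
      (hev.mono fun t ht => inner_chart hc ht)
  have e3 : HasDerivAt (fun t : ℝ => 2 * regHam c (chart c (x + t • u))) _ 0 :=
    ((dn.add (hasDerivAt_mul_of_eq_zero cD' dm m0)).add
      (hasDerivAt_mul_of_eq_zero cE dε ε0)).congr_of_eventuallyEq
      (hev.mono fun t ht => regHam_chart hc ht)
  have f1 : HasDerivAt (fun t : ℝ => ‖(chart c (x + t • u)).1‖ ^ 2 - 1)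
      (2 * inner ℝ (chart c x).1 w.1) 0 := by simpa using d1.norm_sq.sub_const 1
  have f2 : HasDerivAt (fun t : ℝ => inner ℝ (chart c (x + t • u)).1 (chart c (x + t • u)).2)
      (inner ℝ w.1 (chart c x).2 + inner ℝ (chart c x).1 w.2) 0 := by
    have := d1.inner ℝ d2
    simp only [zero_smul, add_zero] at this
    rw [add_comm]
    exact this
  have f3 : HasDerivAt (fun t : ℝ => 2 * regHam c (chart c (x + t • u)))
      (2 * fderiv ℝ (regHam c) (chart c x) w) 0 := by
    have h : HasFDerivAt (regHam c) (fderiv ℝ (regHam c) (chart c x))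
        (chart c (x + (0 : ℝ) • u)) := by
      simpa using ((contDiff_regHam c).differentiable (n := 1) (by simp) (chart c x)).hasFDerivAt
    exact (h.comp_hasDerivAt 0 hd).const_mul 2
  have q1 := f1.unique e1
  have q2 := f2.unique e2
  have q3 := f3.unique e3
  simp only [zero_smul, add_zero, Pi.inv_apply] at q1 q2 q3
  refine ⟨4 * freq c (rotMoment x) ^ 2 / boostDenom (freq c (rotMoment x)) x ^ 2,
    (freq c (rotMoment x))⁻¹, (1 - freq c (rotMoment x) ^ 2) *
      ((freq c (rotMoment x))⁻¹ * x.2 0) / boostDenom (freq c (rotMoment x)) x * 2,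
    (2 * (1 - freq c (rotMoment x) ^ 2) * x.2 0 / boostDenom (freq c (rotMoment x)) x) / 2,
    ((1 - freq c (rotMoment x) ^ 2) * x.2 0 / boostDenom (freq c (rotMoment x)) x) ^ 2,
    2 * freq c (rotMoment x) / boostDenom (freq c (rotMoment x)) x,
    by positivity, by positivity, by positivity, by linarith, by linarith, by linarith, ?_⟩
  intro h3
  have g1 : HasDerivAt (fun t : ℝ => (chart c (x + t • u)).1 3) _ 0 :=
    (hasDerivAt_mul_of_eq_zero cF ((hasDerivAt_line x u).1 3)
      (by simpa using h3)).congr_of_eventuallyEq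
      (Eventually.of_forall fun t => chart_fst_three c _)
  have g2 : HasDerivAt (fun t : ℝ => (chart c (x + t • u)).1 3) (w.1 3) 0 :=
    (EuclideanSpace.proj 3 : E4 →L[ℝ] ℝ).hasFDerivAt.comp_hasDerivAt 0 d1
  simpa using g2.unique g1

theorem fderiv_chart_mem_tangentPage_iff (hx : x ∈ unitCotangent) (h3 : x.1 3 = 0) :
    fderiv ℝ (chart c) x u ∈ tangentPage c (chart c x) ↔ u ∈ tangentUnit x ∧ u.1 3 = 0 := by
  obtain ⟨A, B, C, D, E, F, hA, hB, hF, e1, e2, e3, e4⟩ := fderiv_chart_constraints hc hx u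
  have e4 := e4 h3
  constructor
  · rintro ⟨⟨g1, g2⟩, g3, g4⟩
    rw [e1, mul_eq_zero_iff_left hA.ne'] at g1
    rw [e2, g1, mul_zero, add_zero, mul_eq_zero_iff_left hB.ne'] at g2
    rw [e3, g1, g2, mul_zero, mul_zero, add_zero, add_zero] at g4
    rw [e4, mul_eq_zero_iff_left hF.ne'] at g3
    exact ⟨⟨g1, g2, g4⟩, g3⟩
  · rintro ⟨⟨g1, g2, g3⟩, g4⟩
    refine ⟨⟨?_, ?_⟩, ?_, ?_⟩
    · rw [e1, g1, mul_zero]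
    · rw [e2, g1, g2]
      ring
    · rw [e4, g4, mul_zero]
    · rw [e3, g1, g2, g3]
      ring

end tangent

/-- The tangent space of the model of the page. -/
def tangentQuadric (m : Model) : Set Model :=
  {v | m.1 * v.2.1 + m.2.1 * v.1 + 2 * m.2.2.1 * v.2.2.1 = 2 * m.2.2.2 * v.2.2.2 ∧
    (m.1.re * v.1.re + m.1.im * v.1.im) + (m.2.1.re * v.2.1.re + m.2.1.im * v.2.1.im) +
      2 * (m.2.2.1.re * v.2.2.1.re + m.2.2.1.im * v.2.2.1.im) + 2 * m.2.2.2 * v.2.2.2 = 0}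

theorem embed_mem_tangentUnit {m v : Model} :
    embed v ∈ tangentUnit (embed m) ↔ v ∈ tangentQuadric m := by
  rw [tangentUnit, mem_ofPred_eq, tangentQuadric, mem_ofPred_eq, Complex.ext_iff]
  simp only [inner_four, embed_fst_zero, embed_fst_one, embed_fst_two, embed_fst_three,
    embed_snd_zero, embed_snd_one, embed_snd_two, embed_snd_three, Complex.add_re, Complex.mul_re,
    Complex.add_im, Complex.mul_im, Complex.ofReal_re, Complex.ofReal_im, Complex.re_ofNat,
    Complex.im_ofNat]
  constructor
  · rintro ⟨h1, h2, h3⟩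
    exact ⟨⟨by linarith, by linarith⟩, by linarith⟩
  · rintro ⟨⟨h1, h2⟩, h3⟩
    exact ⟨by linarith, by linarith, by linarith⟩

section tangent

variable {c : ℝ} (hc : c < -3 / 2) {m : Model} {x : Phase}
include hc

theorem fderiv_pageChart (hm : m ∈ quadric) (v : Model) :
    fderiv ℝ (pageChart c) m v = fderiv ℝ (chart c) (embed m) (embed v) := by
  have h := ((contDiffAt_chart hc (embed_mem_chartSource hc hm)).differentiableAt
    (by simp)).hasFDerivAt.comp m embed.hasFDerivAt
  exact congrArg (fun L : Model →L[ℝ] Phase => L v) h.fderiv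

theorem fderiv_pageChart_mem (hm : m ∈ quadric) {v : Model} (hv : v ∈ tangentQuadric m) :
    fderiv ℝ (pageChart c) m v ∈ tangentPage c (pageChart c m) := by
  rw [fderiv_pageChart hc hm]
  exact (fderiv_chart_mem_tangentPage_iff hc (embed_mem_unitCotangent.2 hm)
    (embed_fst_three m)).2 ⟨embed_mem_tangentUnit.2 hv, embed_fst_three v⟩

/-- The coordinates invert the chart on a neighbourhood in the ambient space of the model, not only
on the quadric, so the identity may be differentiated in every direction. -/
theorem fderiv_pageCoord_fderiv_pageChart (hm : m ∈ quadric) (v : Model) :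
    fderiv ℝ (pageCoord c) (pageChart c m) (fderiv ℝ (pageChart c) m v) = v := by
  have hs := embed_mem_chartSource hc hm
  have h1 := ((contDiffAt_pageChart hc hm).differentiableAt (by simp)).hasFDerivAt
  have h2 : HasFDerivAt (pageCoord c) (fderiv ℝ (pageCoord c) (pageChart c m)) (pageChart c m) :=
    ((contDiffAt_pageCoord hc (chart_mem hc hs)).differentiableAt (by simp)).hasFDerivAt
  have h3 : HasFDerivAt (fun n => pageCoord c (pageChart c n))
      (ContinuousLinearMap.id ℝ Model) m := by
    refine (hasFDerivAt_id m).congr_of_eventuallyEq ?_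
    have : ∀ᶠ n in 𝓝 m, embed n ∈ chartSource c :=
      embed.continuous.continuousAt.eventually ((isOpen_chartSource hc).mem_nhds hs)
    exact this.mono fun n hn => pageCoord_pageChart hc hn
  exact congrArg (fun L : Model →L[ℝ] Model => L v) ((h2.comp m h1).unique h3)

/-- Differentiating `chart ∘ chartInv = id` gives a preimage of the vector; its `ξ₃`-component
vanishes, so that `embed` recovers it from its model coordinates. -/
theorem fderiv_pageCoord_mem (hx : x ∈ energySurface c) (h3 : x.1 3 = 0) {v : Phase}
    (hv : v ∈ tangentPage c x) :
    fderiv ℝ (pageCoord c) x v ∈ tangentQuadric (pageCoord c x) ∧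
      fderiv ℝ (pageChart c) (pageCoord c x) (fderiv ℝ (pageCoord c) x v) = v := by
  have ht := energySurface_subset_chartTarget hc hx
  have hu := chartInv_mem_of_energySurface hc hx
  have hcc := chart_chartInv_of_energySurface hc hx
  have hs := unitCotangent_subset hc hu
  have h0 : (chartInv c x).1 3 = 0 := by
    rw [← chart_fst_three_eq_zero hc hs, hcc, h3]
  obtain ⟨hq, hq2⟩ := pageCoord_mem hc hx h3
  have d1 := ((contDiffAt_chartInv hc ht).differentiableAt (by simp)).hasFDerivAt
  have d2 := ((contDiffAt_chart hc hs).differentiableAt (by simp)).hasFDerivAt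
  have d3 : HasFDerivAt (fun y => chart c (chartInv c y)) (ContinuousLinearMap.id ℝ Phase) x := by
    refine (hasFDerivAt_id x).congr_of_eventuallyEq ?_
    filter_upwards [(isOpen_chartTarget hc).mem_nhds ht] with y hy using chart_chartInv hc hy
  have e1 : fderiv ℝ (chart c) (chartInv c x) (fderiv ℝ (chartInv c) x v) = v :=
    congrArg (fun L : Phase →L[ℝ] Phase => L v) ((d2.comp x d1).unique d3)
  have e2 : fderiv ℝ (pageCoord c) x v = unembed (fderiv ℝ (chartInv c) x v) :=
    congrArg (fun L : Phase →L[ℝ] Model => L v) (unembed.hasFDerivAt.comp x d1).fderiv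
  have e3 : embed (pageCoord c x) = chartInv c x := embed_unembed h0
  have hmem : fderiv ℝ (chart c) (chartInv c x) (fderiv ℝ (chartInv c) x v) ∈
      tangentPage c (chart c (chartInv c x)) := by rwa [e1, hcc]
  obtain ⟨g1, g2⟩ := (fderiv_chart_mem_tangentPage_iff hc hu h0).1 hmem
  have e4 : embed (fderiv ℝ (pageCoord c) x v) = fderiv ℝ (chartInv c) x v := by
    rw [e2, embed_unembed g2]
  refine ⟨?_, ?_⟩
  · rw [← embed_mem_tangentUnit, e3, e4]
    exact g1
  · rw [fderiv_pageChart hc hq, e4, e3, e1]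

end tangent

/-! ### Position and angular momentum in the chart -/

theorem norm_position_sq {x : Phase} (hx : x ∈ cotangentSphere) :
    ‖position x‖ ^ 2 = ((1 - x.1 0) * ‖x.2‖) ^ 2 := by
  obtain ⟨h1, h2⟩ := mem_cotangentSphere.1 hx
  have s1 : (1 : Fin 3).succ = (2 : Fin 4) := rfl
  have s2 : (2 : Fin 3).succ = (3 : Fin 4) := rfl
  have s0 : (0 : Fin 3).succ = (1 : Fin 4) := rfl
  rw [EuclideanSpace.real_norm_sq_eq, Fin.sum_univ_three, mul_pow, norm_sq_four]
  simp only [position, s0, s1, s2]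
  linear_combination (x.2 0 ^ 2) * h1 + (2 * x.2 0 * (1 - x.1 0)) * h2

theorem angularMomentum_eq {x : Phase} (h0 : x.1 0 ≠ 1) : angularMomentum x = -rotMoment x := by
  have h : 1 - x.1 0 ≠ 0 := sub_ne_zero.2 h0.symm
  have s1 : (1 : Fin 3).succ = (2 : Fin 4) := rfl
  have s0 : (0 : Fin 3).succ = (1 : Fin 4) := rfl
  simp only [angularMomentum, position, momentum, rotMoment, s0, s1]
  field_simp
  ring

theorem position_two (x : Phase) : position x 2 = x.2 0 * x.1 3 + (1 - x.1 0) * x.2 3 := rfl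

theorem momentum_two (x : Phase) : momentum x 2 = -(x.1 3 / (1 - x.1 0)) := rfl

section position

variable {c : ℝ} (hc : c < -3 / 2) {x : Phase}
include hc

omit hc in
theorem one_sub_chart_fst_zero (hx : x ∈ chartSource c) : 1 - (chart c x).1 0 =
    2 * (1 - x.1 0) / boostDenom (freq c (rotMoment x)) x := by
  have hD := hx.2.ne'
  have : (chart c x).1 0 = (freq c (rotMoment x) ^ 2 * (1 + x.1 0) - (1 - x.1 0)) /
    boostDenom (freq c (rotMoment x)) x := rfl
  rw [this]
  field_simp
  rw [boostDenom]
  ring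

/-- On the level `‖η‖` is the inverse of the Moser factor, so the distance depends only on `ξ₀` and
`k`. The factor `1/k²` is the semi-major axis of the Kepler ellipse. -/
theorem norm_position_chart (hx : x ∈ unitCotangent) :
    ‖position (chart c x)‖ = (1 - x.1 0) / freq c (rotMoment x) ^ 2 := by
  have hs := unitCotangent_subset hc hx
  have hk := freq_rotMoment_pos hc hs
  have hD := hs.2
  have h0 : x.1 0 ≤ 1 := by
    have := (mem_unitCotangent.1 hx).1
    nlinarith [sq_nonneg (x.1 1), sq_nonneg (x.1 2), sq_nonneg (x.1 3)]
  obtain ⟨h1, h2, -⟩ := chart_unitCotangent hc hx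
  rw [← sq_eq_sq₀ (norm_nonneg _) (div_nonneg (by linarith) (by positivity)),
    norm_position_sq h1, one_sub_chart_fst_zero hs]
  rw [regHam, moserFactor_chart hc hs] at h2
  have h3 : ‖(chart c x).2‖ ^ 2 = boostDenom (freq c (rotMoment x)) x ^ 2 /
      (4 * freq c (rotMoment x) ^ 4) := by
    field_simp at h2 ⊢
    linarith
  rw [mul_pow, h3]
  field_simp
  ring

theorem position_chart_two (hx : x ∈ chartSource c) : position (chart c x) 2 =
    (x.2 0 * x.1 3 + (1 - x.1 0) * x.2 3) / freq c (rotMoment x) ^ 2 := by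
  have hk := (freq_rotMoment_pos hc hx).ne'
  have hD := hx.2.ne'
  have e1 : (chart c x).1 3 = 2 * freq c (rotMoment x) * x.1 3 /
    boostDenom (freq c (rotMoment x)) x := rfl
  have e2 : (chart c x).2 0 = (freq c (rotMoment x))⁻¹ * x.2 0 := rfl
  have e3 : (chart c x).2 3 = (boostDenom (freq c (rotMoment x)) x *
    ((freq c (rotMoment x))⁻¹ * x.2 3) + (1 - freq c (rotMoment x) ^ 2) *
      ((freq c (rotMoment x))⁻¹ * x.2 0) * x.1 3) / (2 * freq c (rotMoment x)) := rfl
  rw [position_two, one_sub_chart_fst_zero hx, e1, e2, e3]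
  field_simp
  rw [boostDenom]
  ring

omit hc in
theorem chart_fst_zero_eq_one (hx : x ∈ chartSource c) : (chart c x).1 0 = 1 ↔ x.1 0 = 1 := by
  have h := one_sub_chart_fst_zero hx
  have hD := hx.2.ne'
  constructor
  · intro h1
    rw [h1, sub_self, eq_comm, div_eq_zero_iff] at h
    rcases h with h | h
    · linarith
    · exact absurd h hD
  · intro h1
    rw [h1, sub_self, mul_zero, zero_div] at h
    linarith

theorem rotMoment_chart_pos (hx : x ∈ chartSource c) :
    0 < rotMoment (chart c x) ↔ 0 < rotMoment x := by
  rw [rotMoment_chart hc hx, div_pos_iff_of_pos_right (freq_rotMoment_pos hc hx)]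

theorem rotMoment_chart_neg (hx : x ∈ chartSource c) :
    rotMoment (chart c x) < 0 ↔ rotMoment x < 0 := by
  rw [rotMoment_chart hc hx, div_lt_iff₀ (freq_rotMoment_pos hc hx), zero_mul]

end position

/-! ### The circular orbits -/

/-- The direct circular orbit in the model of the page. -/
def directCircle : Set Model := {m | m.1 = 0 ∧ normSq m.2.1 = 4 ∧ m.2.2 = 0}

/-- The retrograde circular orbit in the model of the page. -/
def retrogradeCircle : Set Model := {m | normSq m.1 = 4 ∧ m.2.1 = 0 ∧ m.2.2 = 0}

theorem directCircle_subset : directCircle ⊆ quadric := by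
  rintro ⟨a, b, z, t⟩ ⟨h1, h2, h3⟩
  obtain ⟨h4, h5⟩ := Prod.ext_iff.1 h3
  simp only [Prod.fst_zero, Prod.snd_zero] at h1 h2 h4 h5
  subst h1 h4 h5
  simp [quadric, h2]

theorem retrogradeCircle_subset : retrogradeCircle ⊆ quadric := by
  rintro ⟨a, b, z, t⟩ ⟨h1, h2, h3⟩
  obtain ⟨h4, h5⟩ := Prod.ext_iff.1 h3
  simp only [Prod.fst_zero, Prod.snd_zero] at h1 h2 h4 h5
  subst h2 h4 h5
  simp [quadric, h1]

/-- The geodesic flow multiplies `ζ = ξ + i η` by `e^{-is}`. Where only `β` is nonzero a rotation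
has the same effect; where only `α` is nonzero, the opposite rotation. -/
theorem geodesic_embed_direct (s : ℝ) (b : ℂ) :
    geodesic s (embed (0, b, 0)) = rotate (-s) (embed (0, b, 0)) := by
  apply phase_ext <;> intro i <;> fin_cases i <;>
    simp [geodesic, rotate, embed_fst_zero, embed_fst_one, embed_fst_two, embed_fst_three,
      embed_snd_zero, embed_snd_one, embed_snd_two, embed_snd_three] <;> ring

theorem geodesic_embed_retrograde (s : ℝ) (a : ℂ) :
    geodesic s (embed (a, 0, 0)) = rotate s (embed (a, 0, 0)) := by
  apply phase_ext <;> intro i <;> fin_cases i <;>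
    simp [geodesic, rotate, embed_fst_zero, embed_fst_one, embed_fst_two, embed_fst_three,
      embed_snd_zero, embed_snd_one, embed_snd_two, embed_snd_three] <;> ring

theorem normalFlow_embed_direct {k : ℝ} (hk : k ≠ 0) (b : ℂ) (t : ℝ) :
    normalFlow k (embed (0, b, 0)) t = rotate ((1 / k ^ 2 - k) * t) (embed (0, b, 0)) := by
  have h1 : (embed (0, b, 0)).1 0 = 0 := rfl
  have h2 : (embed (0, b, 0)).2 0 = 0 := rfl
  rw [normalFlow, geodesic_embed_direct, rotate_rotate, frameAngle, h1, h2]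
  congr 1
  field_simp
  ring

theorem normalFlow_embed_retrograde {k : ℝ} (hk : k ≠ 0) (a : ℂ) (t : ℝ) :
    normalFlow k (embed (a, 0, 0)) t = rotate ((1 / k ^ 2 + k) * t) (embed (a, 0, 0)) := by
  have h1 : (embed (a, 0, 0)).1 0 = 0 := rfl
  have h2 : (embed (a, 0, 0)).2 0 = 0 := rfl
  rw [normalFlow, geodesic_embed_retrograde, rotate_rotate, frameAngle, h1, h2]
  congr 1
  field_simp
  ring

theorem normSq_exp_mul (s : ℝ) (z : ℂ) : normSq (Complex.exp (s * Complex.I) * z) = normSq z := by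
  rw [Complex.normSq_eq_norm_sq, norm_mul, Complex.norm_exp_ofReal_mul_I, one_mul,
    Complex.normSq_eq_norm_sq]

theorem normSq_rotModel_fst (s : ℝ) (m : Model) : normSq (rotModel s m).1 = normSq m.1 := by
  have h : (rotModel s m).1 = Complex.exp ((-s : ℝ) * Complex.I) * m.1 := by
    rw [Complex.ofReal_neg]
    rfl
  rw [h, normSq_exp_mul]

theorem normSq_rotModel_snd (s : ℝ) (m : Model) : normSq (rotModel s m).2.1 = normSq m.2.1 :=
  normSq_exp_mul s _

theorem exists_exp_mul_eq {a b : ℂ} (ha : a ≠ 0) (h : normSq a = normSq b) :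
    ∃ s : ℝ, Complex.exp (s * Complex.I) * a = b := by
  have h1 : ‖b / a‖ = 1 := by
    have : ‖a‖ = ‖b‖ := by
      rw [← sq_eq_sq₀ (norm_nonneg _) (norm_nonneg _), Complex.sq_norm, Complex.sq_norm, h]
    rw [norm_div, ← this, div_self (norm_ne_zero_iff.2 ha)]
  refine ⟨(b / a).arg, ?_⟩
  have := Complex.norm_mul_exp_arg_mul_I (b / a)
  rw [h1, Complex.ofReal_one, one_mul] at this
  rw [this, div_mul_cancel₀ _ ha]

/-- The direct circular orbit. -/
def directOrbit (c : ℝ) : ℝ → Phase := orbit c (embed (0, 2, 0))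

/-- The retrograde circular orbit. -/
def retrogradeOrbit (c : ℝ) : ℝ → Phase := orbit c (embed (2, 0, 0))

theorem direct_mem : ((0, 2, 0) : Model) ∈ directCircle := by
  simp [directCircle, Complex.normSq_apply]
  norm_num

theorem retrograde_mem : ((2, 0, 0) : Model) ∈ retrogradeCircle := by
  simp [retrogradeCircle, Complex.normSq_apply]
  norm_num

/-! ### Existence and uniqueness of the circular orbits -/

section circular

variable {c : ℝ} (hc : c < -3 / 2)
include hc

theorem one_lt_freq {x : Phase} (hx : x ∈ chartSource c) : 1 < freq c (rotMoment x) :=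
  (one_lt_minFreq hc).trans (freq_spec hc hx.1).1

/-- The orbit is a uniform rotation with speed `1/k² - k`. This is nonzero because `k > 1`, so the
orbit runs through the whole circle. -/
theorem range_directOrbit : range (directOrbit c) = pageChart c '' directCircle := by
  have hs := embed_mem_chartSource hc (directCircle_subset direct_mem)
  have hk := one_lt_freq hc hs
  set k := freq c (rotMoment (embed (0, 2, 0))) with hkdef
  have hflow : ∀ t, directOrbit c t = pageChart c (rotModel ((1 / k ^ 2 - k) * t) (0, 2, 0)) :=
    fun t => by
      rw [directOrbit, orbit, ← hkdef, normalFlow_embed_direct (by linarith), ← embed_rotModel,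
        pageChart]
  ext x
  constructor
  · rintro ⟨t, rfl⟩
    rw [hflow]
    refine mem_image_of_mem _ ⟨by simp [rotModel], ?_, rfl⟩
    rw [normSq_rotModel_snd]
    exact direct_mem.2.1
  · rintro ⟨⟨a, b, z⟩, ⟨h1, h2, h3⟩, rfl⟩
    simp only at h1 h2 h3
    subst h1 h3
    obtain ⟨s, hs⟩ := exists_exp_mul_eq (a := 2) (b := b) two_ne_zero (by
      rw [h2]; simp; norm_num)
    have hne : 1 / k ^ 2 - k ≠ 0 := by
      have : 1 / k ^ 2 < 1 := by
        rw [div_lt_one (by positivity)]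
        nlinarith
      linarith
    refine ⟨s / (1 / k ^ 2 - k), ?_⟩
    rw [hflow, mul_div_cancel₀ _ hne, rotModel]
    simp only [mul_zero, hs]

theorem range_retrogradeOrbit : range (retrogradeOrbit c) = pageChart c '' retrogradeCircle := by
  have hs := embed_mem_chartSource hc (retrogradeCircle_subset retrograde_mem)
  have hk := one_lt_freq hc hs
  set k := freq c (rotMoment (embed (2, 0, 0))) with hkdef
  have hflow : ∀ t, retrogradeOrbit c t = pageChart c (rotModel ((1 / k ^ 2 + k) * t) (2, 0, 0)) :=
    fun t => by
      rw [retrogradeOrbit, orbit, ← hkdef, normalFlow_embed_retrograde (by linarith),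
        ← embed_rotModel, pageChart]
  ext x
  constructor
  · rintro ⟨t, rfl⟩
    rw [hflow]
    refine mem_image_of_mem _ ⟨?_, by simp [rotModel], rfl⟩
    rw [normSq_rotModel_fst]
    exact retrograde_mem.1
  · rintro ⟨⟨a, b, z⟩, ⟨h1, h2, h3⟩, rfl⟩
    simp only at h1 h2 h3
    subst h2 h3
    obtain ⟨s, hs⟩ := exists_exp_mul_eq (a := 2) (b := a) two_ne_zero (by
      rw [h1]; simp; norm_num)
    have hne : 1 / k ^ 2 + k ≠ 0 := by positivity
    refine ⟨-s / (1 / k ^ 2 + k), ?_⟩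
    rw [hflow, mul_div_cancel₀ _ hne, rotModel]
    simp only [mul_zero, Complex.ofReal_neg, neg_neg, hs]

theorem isCircularOrbit_of_range {γ : ℝ → Phase} (hγ : IsOrbit c γ) {r : ℝ}
    (h : ∀ t, ∃ m ∈ quadric, m.2.2 = 0 ∧ moment m = r ∧ γ t = pageChart c m) :
    IsCircularOrbit c γ := by
  refine ⟨hγ, 1 / freq c r ^ 2, fun t => ?_⟩
  obtain ⟨m, hm, h0, hr, heq⟩ := h t
  have hs := embed_mem_chartSource hc hm
  obtain ⟨hZ, ht⟩ := Prod.ext_iff.1 h0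
  have h00 : (embed m).1 0 = 0 := by rw [embed_fst_zero, hZ]; rfl
  have h3 : (embed m).2 3 = 0 := by rw [embed_snd_three, ht]; rfl
  have e0 : (γ t).1 0 ≠ 1 := by
    rw [heq, pageChart, Ne, chart_fst_zero_eq_one hs, h00]
    norm_num
  have e3 : (γ t).1 3 = 0 := by
    rw [heq, pageChart, chart_fst_three_eq_zero hc hs, embed_fst_three]
  refine ⟨e0, ?_, ?_, ?_⟩
  · rw [heq, pageChart, position_chart_two hc hs, embed_fst_three, h3]
    simp
  · rw [momentum_two, e3]
    simp
  · rw [heq, pageChart, norm_position_chart hc (embed_mem_unitCotangent.2 hm), h00,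
      rotMoment_embed, hr, sub_zero]

theorem isDirectOrbit_directOrbit : IsDirectOrbit c (directOrbit c) := by
  have key : ∀ t, ∃ m ∈ quadric, m.2.2 = 0 ∧ moment m = -1 ∧ directOrbit c t = pageChart c m :=
    fun t => by
      have : directOrbit c t ∈ pageChart c '' directCircle :=
        range_directOrbit hc ▸ mem_range_self t
      obtain ⟨m, hm, h⟩ := this
      refine ⟨m, directCircle_subset hm, hm.2.2, ?_, h.symm⟩
      rw [moment, hm.1, hm.2.1]
      norm_num
  have hcirc : IsCircularOrbit c (directOrbit c) := isCircularOrbit_of_range hc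
    (isOrbit_orbit hc (embed_mem_unitCotangent.2 (directCircle_subset direct_mem))) key
  refine ⟨hcirc, fun t => ?_⟩
  obtain ⟨ρ, hρ⟩ := hcirc.2
  rw [angularMomentum_eq (hρ t).1, Left.neg_pos_iff]
  obtain ⟨m, hm, -, hr, heq⟩ := key t
  rw [heq, pageChart, rotMoment_chart_neg hc (embed_mem_chartSource hc hm), rotMoment_embed, hr]
  norm_num

theorem isRetrogradeOrbit_retrogradeOrbit : IsRetrogradeOrbit c (retrogradeOrbit c) := by
  have key : ∀ t, ∃ m ∈ quadric, m.2.2 = 0 ∧ moment m = 1 ∧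
      retrogradeOrbit c t = pageChart c m := fun t => by
    have : retrogradeOrbit c t ∈ pageChart c '' retrogradeCircle :=
      range_retrogradeOrbit hc ▸ mem_range_self t
    obtain ⟨m, hm, h⟩ := this
    refine ⟨m, retrogradeCircle_subset hm, hm.2.2, ?_, h.symm⟩
    rw [moment, hm.1, hm.2.1]
    norm_num
  have hcirc : IsCircularOrbit c (retrogradeOrbit c) := isCircularOrbit_of_range hc
    (isOrbit_orbit hc (embed_mem_unitCotangent.2 (retrogradeCircle_subset retrograde_mem))) key
  refine ⟨hcirc, fun t => ?_⟩
  obtain ⟨ρ, hρ⟩ := hcirc.2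
  rw [angularMomentum_eq (hρ t).1, Left.neg_neg_iff]
  obtain ⟨m, hm, -, hr, heq⟩ := key t
  rw [heq, pageChart, rotMoment_chart_pos hc (embed_mem_chartSource hc hm), rotMoment_embed, hr]
  norm_num

/-- A circular orbit passes through a point of the model with `Z = 0` and `t = 0`. -/
theorem IsCircularOrbit.exists_model {γ : ℝ → Phase} (hγ : IsCircularOrbit c γ) :
    ∃ m ∈ quadric, m.2.2 = 0 ∧ γ 0 = pageChart c m := by
  obtain ⟨horb, ρ, hρ⟩ := hγ
  have h0 := (horb 0).1
  have hu := chartInv_mem_of_energySurface hc h0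
  have hk := one_lt_freq hc (unitCotangent_subset hc hu)
  have hγ' := horb.eq_orbit hc
  set w := chartInv c (γ 0) with hw
  set k := freq c (rotMoment w) with hkdef
  have hnorm : ∀ t, 1 - (w.1 0 * Real.cos (k * t) + w.2 0 * Real.sin (k * t)) = ρ * k ^ 2 :=
    fun t => by
      have h1 := (hρ t).2.2.2
      rw [hγ', orbit, norm_position_chart hc (normalFlow_mem _ hu t), rotMoment_normalFlow,
        ← hkdef, div_eq_iff (by positivity)] at h1
      rw [← h1]
      simp [normalFlow, rotate, geodesic]
      ring
  have hk0 : k ≠ 0 := by linarith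
  -- A combination of `cos` and `sin` can be constant only if both coefficients vanish; the phases
  -- `0`, `π` and `π/2` suffice to see this.
  have n0 := hnorm 0
  have n1 := hnorm (Real.pi / k)
  have n2 := hnorm (Real.pi / 2 / k)
  simp only [mul_zero, Real.cos_zero, Real.sin_zero, mul_div_cancel₀ _ hk0, Real.cos_pi,
    Real.sin_pi, Real.cos_pi_div_two, Real.sin_pi_div_two] at n0 n1 n2
  have hx0 : w.1 0 = 0 := by linarith
  have hv0 : w.2 0 = 0 := by linarith
  obtain ⟨g1, g2, g3, -⟩ := hρ 0
  have e3 : (γ 0).1 3 = 0 := by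
    rw [momentum_two, neg_eq_zero, div_eq_zero_iff] at g3
    exact g3.resolve_right (sub_ne_zero.2 g1.symm)
  have e4 : (γ 0).2 3 = 0 := by
    rw [position_two, e3, mul_zero, zero_add, mul_eq_zero] at g2
    exact g2.resolve_left (sub_ne_zero.2 g1.symm)
  obtain ⟨q1, q2⟩ := pageCoord_mem hc h0 e3
  refine ⟨pageCoord c (γ 0), q1, ?_, q2.symm⟩
  have ht : (pageCoord c (γ 0)).2.2.2 = 0 := by
    rw [← pageChart_mem_pageBoundary_iff hc q1, q2]
    exact ⟨h0, e3, e4⟩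
  refine Prod.ext (Complex.ext ?_ ?_) ht
  · exact hx0
  · exact hv0

omit hc in
theorem IsOrbit.shift {γ : ℝ → Phase} (hγ : IsOrbit c γ) (s : ℝ) :
    IsOrbit c fun t => γ (t + s) := by
  rw [isOrbit_iff] at hγ ⊢
  exact fun t => ⟨(hγ _).1, (hγ (t + s)).2.comp_add_const t s⟩

omit hc in
theorem IsOrbit.range_eq {γ δ : ℝ → Phase} (hγ : IsOrbit c γ) (hδ : IsOrbit c δ)
    (h : γ 0 ∈ range δ) : range γ = range δ := by
  obtain ⟨s, hs⟩ := h
  have h1 : γ = fun t => δ (t + s) := hγ.eq_of_eq (hδ.shift s) (t₀ := 0) (by rw [zero_add, hs])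
  rw [h1]
  ext x
  constructor
  · rintro ⟨t, rfl⟩
    exact ⟨t + s, rfl⟩
  · rintro ⟨t, rfl⟩
    exact ⟨t - s, by simp⟩

omit hc in
theorem quadric_binding {m : Model} (hm : m ∈ quadric) (h : m.2.2 = 0) :
    m ∈ directCircle ∨ m ∈ retrogradeCircle := by
  obtain ⟨h1, h2⟩ := hm
  obtain ⟨hZ, ht⟩ := Prod.ext_iff.1 h
  rw [hZ, ht] at h1 h2
  have h3 : m.1 * m.2.1 = 0 := by simpa using h1
  rcases mul_eq_zero.1 h3 with h4 | h4
  · exact Or.inl ⟨h4, by simpa [h4] using h2, h⟩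
  · exact Or.inr ⟨by simpa [h4] using h2, h4, h⟩

/-- A circular orbit starts on one of the two circles, and the sign of the moment, `-1` on one and
`1` on the other, excludes the wrong one. -/
theorem IsDirectOrbit.range_eq {γ : ℝ → Phase} (hγ : IsDirectOrbit c γ) :
    range γ = range (directOrbit c) := by
  obtain ⟨m, hm, h0, heq⟩ := hγ.1.exists_model hc
  refine hγ.1.1.range_eq (isDirectOrbit_directOrbit hc).1.1 ?_
  rw [range_directOrbit hc, heq]
  refine mem_image_of_mem _ ((quadric_binding hm h0).resolve_right fun h => ?_)
  obtain ⟨ρ, hρ⟩ := hγ.1.2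
  have := hγ.2 0
  rw [angularMomentum_eq (hρ 0).1, Left.neg_pos_iff, heq, pageChart,
    rotMoment_chart_neg hc (embed_mem_chartSource hc hm), rotMoment_embed, moment, h.1,
        h.2.1] at this
  norm_num at this

theorem IsRetrogradeOrbit.range_eq {γ : ℝ → Phase} (hγ : IsRetrogradeOrbit c γ) :
    range γ = range (retrogradeOrbit c) := by
  obtain ⟨m, hm, h0, heq⟩ := hγ.1.exists_model hc
  refine hγ.1.1.range_eq (isRetrogradeOrbit_retrogradeOrbit hc).1.1 ?_
  rw [range_retrogradeOrbit hc, heq]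
  refine mem_image_of_mem _ ((quadric_binding hm h0).resolve_left fun h => ?_)
  obtain ⟨ρ, hρ⟩ := hγ.1.2
  have := hγ.2 0
  rw [angularMomentum_eq (hρ 0).1, Left.neg_neg_iff, heq, pageChart,
    rotMoment_chart_pos hc (embed_mem_chartSource hc hm), rotMoment_embed, moment, h.1,
        h.2.1] at this
  norm_num at this

end circular

/-! ### The return map -/

/-- The return map of the page. -/
def returnMap (c : ℝ) (x : Phase) : Phase := rotate (2 * Real.pi / keplerFreq c x ^ 3) x

section returnMap

variable {c : ℝ} (hc : c < -3 / 2)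
include hc

theorem rotate_mem_page (s : ℝ) {x : Phase} (hx : x ∈ page c) : rotate s x ∈ page c :=
  ⟨rotate_mem_energySurface hc s hx.1, hx.2⟩

theorem rotate_mem_pageInterior (s : ℝ) {x : Phase} (hx : x ∈ pageInterior c) :
    rotate s x ∈ pageInterior c :=
  ⟨rotate_mem_energySurface hc s hx.1, hx.2⟩

theorem smoothOn_returnMap : SmoothOn (returnMap c) (page c) := by
  refine ⟨chartTarget c, isOpen_chartTarget hc,
    fun x hx => energySurface_subset_chartTarget hc hx.1, fun x hx => ?_⟩
  apply ContDiffAt.contDiffWithinAt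
  have ha : ContDiffAt ℝ ∞ (fun y => 2 * Real.pi / keplerFreq c y ^ 3) x :=
    contDiffAt_const.div ((contDiffAt_keplerFreq hc hx.1).pow 3)
      (pow_ne_zero 3 (keplerFreq_pos hc hx.1).ne')
  have hcos := ha.cos
  have hsin := ha.sin
  have h1 : ∀ i, ContDiffAt ℝ ∞ (fun y : Phase => y.1 i) x := fun i =>
    (contDiff_phase_fst i).contDiffAt
  have h2 : ∀ i, ContDiffAt ℝ ∞ (fun y : Phase => y.2 i) x := fun i =>
    (contDiff_phase_snd i).contDiffAt
  apply contDiffAt_phase <;> intro i <;> fin_cases i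
  · exact h1 0
  · exact (hcos.mul (h1 1)).add (hsin.mul (h1 2))
  · exact (hcos.mul (h1 2)).sub (hsin.mul (h1 1))
  · exact h1 3
  · exact h2 0
  · exact (hcos.mul (h2 1)).add (hsin.mul (h2 2))
  · exact (hcos.mul (h2 2)).sub (hsin.mul (h2 1))
  · exact h2 3

/-- The first return of the orbits of the interior of the page. -/
theorem firstReturn {x : Phase} (hx : x ∈ pageInterior c) :
    orbit c (chartInv c x) (2 * Real.pi / keplerFreq c x) = returnMap c x ∧
      ∀ t ∈ Ioo 0 (2 * Real.pi / keplerFreq c x), orbit c (chartInv c x) t ∉ pageInterior c := by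
  have ht := energySurface_subset_chartTarget hc hx.1
  have hk := keplerFreq_pos hc ht.1
  have hu := chartInv_mem_of_energySurface hc hx.1
  have hs := unitCotangent_subset hc hu
  have hcc := chart_chartInv_of_energySurface hc hx.1
  have hfreq := freq_chartInv hc ht
  have h3 : (chartInv c x).1 3 = 0 := by
    rw [← chart_fst_three_eq_zero hc hs, hcc, hx.2.1]
  have h4 : 0 < (chartInv c x).2 3 := by
    rw [← chart_snd_three_pos hc hs h3, hcc]
    exact hx.2.2
  constructor
  · have e1 : keplerFreq c x * (2 * Real.pi / keplerFreq c x) = 2 * Real.pi :=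
      mul_div_cancel₀ _ hk.ne'
    -- After a full period the oscillating part of `frameAngle` vanishes, and `t/k²` with `t = 2π/k`
    -- is left.
    rw [orbit, hfreq, normalFlow, e1, geodesic_two_pi, chart_rotate, hcc, returnMap, frameAngle, e1]
    congr 1
    simp
    field_simp
  · intro t ht' hint
    rw [orbit, hfreq] at hint
    have hm := normalFlow_mem (keplerFreq c x) hu t
    have hms := unitCotangent_subset hc hm
    have h5 := (chart_fst_three_eq_zero hc hms).1 hint.2.1
    have h6 := (chart_snd_three_pos hc hms h5).1 hint.2.2
    -- The pair `(ξ₃, η₃)` moves as `(sin kt, cos kt)` times a positive constant, so a return to the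
    -- interior forces `sin = 0` and `cos > 0`.
    have e5 : (normalFlow (keplerFreq c x) (chartInv c x) t).1 3 =
        Real.sin (keplerFreq c x * t) * (chartInv c x).2 3 := by
      simp [normalFlow, rotate, geodesic, h3]
    have e6 : (normalFlow (keplerFreq c x) (chartInv c x) t).2 3 =
        Real.cos (keplerFreq c x * t) * (chartInv c x).2 3 := by
      simp [normalFlow, rotate, geodesic, h3]
    rw [e5, mul_eq_zero] at h5
    rw [e6] at h6
    have hsin := h5.resolve_right h4.ne'
    have hcos : 0 < Real.cos (keplerFreq c x * t) := pos_of_mul_pos_left h6 h4.le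
    have hcos1 : Real.cos (keplerFreq c x * t) = 1 := by
      have := Real.sin_sq_add_cos_sq (keplerFreq c x * t)
      rw [hsin] at this
      nlinarith
    have hlt : keplerFreq c x * t < 2 * Real.pi := by
      have := ht'.2
      rwa [lt_div_iff₀ hk, mul_comm] at this
    have hpos : 0 < keplerFreq c x * t := mul_pos hk ht'.1
    have := (Real.cos_eq_one_iff_of_lt_of_lt (by linarith [Real.pi_pos]) hlt).1 hcos1
    linarith

theorem isReturnMap_returnMap : IsReturnMap c (returnMap c) := by
  refine ⟨smoothOn_returnMap hc, fun x hx => rotate_mem_page hc _ hx, fun x hx => ?_⟩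
  have ht := energySurface_subset_chartTarget hc hx.1
  obtain ⟨h1, h2⟩ := firstReturn hc hx
  refine ⟨orbit c (chartInv c x), isOrbit_orbit hc (chartInv_mem_of_energySurface hc hx.1), ?_,
    2 * Real.pi / keplerFreq c x, div_pos Real.two_pi_pos (keplerFreq_pos hc ht.1), h1, ?_, h2⟩
  · rw [orbit_zero, chart_chartInv_of_energySurface hc hx.1]
  · rw [h1]
    exact rotate_mem_pageInterior hc _ hx

/-- Tilting the covector of a boundary point towards the third axis, `cos s • η + sin s • e₃`, gives
a path of unit covectors that enters the interior. -/
theorem page_subset_closure : page c ⊆ closure (pageInterior c) := by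
  rw [page_eq]
  rintro x (hx | hx)
  · exact subset_closure hx
  obtain ⟨q1, q2⟩ := pageCoord_mem hc hx.1 hx.2.1
  have ht : (pageCoord c x).2.2.2 = 0 := by
    rwa [← pageChart_mem_pageBoundary_iff hc q1, q2]
  set m := pageCoord c x with hm
  set w := embed m with hw
  have hwu := embed_mem_unitCotangent.2 q1
  have hw3 : w.2 3 = 0 := ht
  let e : ℝ → Phase := fun s => (w.1, Real.cos s • w.2 + Real.sin s • EuclideanSpace.single 3 1)
  have heu : ∀ s, e s ∈ unitCotangent := fun s => by
    have h := hwu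
    rw [mem_unitCotangent] at h ⊢
    have hw13 : (embed m).1 3 = 0 := rfl
    have hw3' : (embed m).2 3 = 0 := hw3
    simp [e, hw, hw13, hw3'] at h ⊢
    obtain ⟨h1, h2, h3⟩ := h
    refine ⟨h1, by linear_combination Real.cos s * h2, ?_⟩
    linear_combination Real.cos s ^ 2 * h3 + Real.sin_sq_add_cos_sq s
  have he0 : e 0 = w := by simp [e]
  have hcont : Continuous e := by
    simp only [e]
    fun_prop
  have htend : Tendsto (fun s => chart c (e s)) (𝓝[>] 0) (𝓝 x) := by
    have h1 : ContinuousAt (chart c) (e 0) :=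
      (contDiffAt_chart hc (unitCotangent_subset hc (heu 0))).continuousAt
    have h2 : ContinuousAt (fun s => chart c (e s)) 0 :=
      ContinuousAt.comp (g := chart c) h1 hcont.continuousAt
    have h3 : chart c (e 0) = x := by rw [he0, hw, ← q2, pageChart]
    rw [← h3]
    exact h2.tendsto.mono_left nhdsWithin_le_nhds
  refine mem_closure_of_tendsto htend ?_
  filter_upwards [Ioo_mem_nhdsGT (show (0 : ℝ) < 1 by norm_num)] with s hs
  have hsin : 0 < Real.sin s := Real.sin_pos_of_pos_of_lt_pi hs.1
    (by linarith [Real.pi_gt_three, hs.2])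
  have he13 : (e s).1 3 = 0 := rfl
  have he23 : (e s).2 3 = Real.sin s := by simp [e, hw3]
  have hes := unitCotangent_subset hc (heu s)
  refine ⟨chart_mem_energySurface hc (heu s), (chart_fst_three_eq_zero hc hes).2 he13, ?_⟩
  rw [chart_snd_three_pos hc hes he13, he23]
  exact hsin

/-- In the interior the orbit is determined by its starting point, and a return time other than
`2π/k` would contradict the first return property of one of the two maps. The boundary follows by
density and continuity. -/
theorem IsReturnMap.eqOn {R : Phase → Phase} (hR : IsReturnMap c R) :
    EqOn R (returnMap c) (page c) := by
  have hint : EqOn R (returnMap c) (pageInterior c) := by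
    intro x hx
    obtain ⟨γ, hγ, h0, τ, hτ, h1, h2, h3⟩ := hR.2.2 x hx
    have ht := energySurface_subset_chartTarget hc hx.1
    obtain ⟨g1, g2⟩ := firstReturn hc hx
    have hγ' := hγ.eq_orbit hc
    rw [h0] at hγ'
    rw [← hγ'] at g1 g2
    have hpos : 0 < 2 * Real.pi / keplerFreq c x := div_pos Real.two_pi_pos (keplerFreq_pos hc ht.1)
    rcases lt_trichotomy τ (2 * Real.pi / keplerFreq c x) with h | h | h
    · exact absurd h2 (g2 τ ⟨hτ, h⟩)
    · rw [← h1, h, g1]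
    · refine absurd ?_ (h3 _ ⟨hpos, h⟩)
      rw [g1]
      exact rotate_mem_pageInterior hc _ hx
  have hcont : ∀ {S : Phase → Phase}, SmoothOn S (page c) → ContinuousOn S (page c) := by
    rintro S ⟨U, -, hU, hS⟩
    exact hS.continuousOn.mono hU
  refine hint.of_subset_closure (hcont hR.1) (hcont (smoothOn_returnMap hc)) ?_
    (page_subset_closure hc)
  rw [page_eq]
  exact subset_union_left

end returnMap

/-! ### The polar orbits -/

theorem pole_mem_quadric {ε : ℝ} (hε : ε ^ 2 = 1) : ((0, 0, (ε : ℂ), 1) : Model) ∈ quadric := by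
  rw [mem_quadric]
  simp [hε]
  norm_num

section polar

variable {c : ℝ} (hc : c < -3 / 2)
include hc

theorem freq_zero : freq c 0 = √(-2 * c) ∧ freq c 0 ^ 2 = -2 * c := by
  have h : √(-2 * c) ^ 2 = -2 * c := Real.sq_sqrt (by linarith)
  have : freq c 0 = √(-2 * c) := by
    refine freq_unique hc (Real.sqrt_lt_sqrt (by linarith) (by linarith)) ?_
    linear_combination √(-2 * c) * h
  exact ⟨this, by rw [this, h]⟩

theorem pageChart_pole {ε : ℝ} (hε : ε ^ 2 = 1) : pageChart c (0, 0, (ε : ℂ), 1) =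
    (!₂[ε, 0, 0, 0], !₂[0, 0, 0, (-2 * c * (1 + ε) + (1 - ε)) / (-4 * c)]) := by
  obtain ⟨-, hk2⟩ := freq_zero hc
  have hk : freq c 0 ≠ 0 := fun h => by rw [h] at hk2; norm_num at hk2; linarith
  have hmom : rotMoment (embed (0, 0, (ε : ℂ), 1)) = 0 := by
    rw [rotMoment_embed]
    simp [moment]
  have h0 : (embed (0, 0, (ε : ℂ), 1)).1 0 = ε := rfl
  have hD : boostDenom (freq c 0) (embed (0, 0, (ε : ℂ), 1)) = -2 * c * (1 + ε) + (1 - ε) := by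
    rw [boostDenom, h0, hk2]
  have hD0 : boostDenom (freq c 0) (embed (0, 0, (ε : ℂ), 1)) ≠ 0 := by
    have := (embed_mem_chartSource hc (pole_mem_quadric hε)).2
    rw [hmom] at this
    exact this.ne'
  rw [pageChart, chart, hmom]
  have hD' : boostDenom (freq c 0) ((embed (0, 0, (ε : ℂ), 1)).1,
      (freq c 0)⁻¹ • (embed (0, 0, (ε : ℂ), 1)).2) =
    boostDenom (freq c 0) (embed (0, 0, (ε : ℂ), 1)) := rfl
  apply phase_ext <;> intro i <;> fin_cases i <;>
    simp [hD', embed_fst_zero, embed_fst_one, embed_fst_two, embed_fst_three, embed_snd_zero,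
      embed_snd_one, embed_snd_two, embed_snd_three]
  · rw [div_eq_iff hD0, hD, hk2]
    linear_combination (2 * c + 1) * hε
  · rw [hD]
    have hc0 : c ≠ 0 := by linarith
    have : freq c 0 * freq c 0 = -2 * c := by rw [← pow_two, hk2]
    field_simp
    rw [hk2]
    field_simp
    ring

theorem pageChart_north : pageChart c (0, 0, ((1 : ℝ) : ℂ), 1) = poleNorth := by
  rw [pageChart_pole hc (by norm_num), poleNorth]
  have : (-2 * c * (1 + 1) + (1 - 1)) / (-4 * c) = 1 := by
    have hc0 : c ≠ 0 := by linarith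
    field_simp
    ring
  rw [this]

theorem pageChart_south : pageChart c (0, 0, ((-1 : ℝ) : ℂ), 1) = poleSouth c := by
  rw [pageChart_pole hc (by norm_num), poleSouth]
  have : (-2 * c * (1 + -1) + (1 - -1)) / (-4 * c) = -1 / (2 * c) := by
    have hc0 : c ≠ 0 := by linarith
    field_simp
    ring
  rw [this]

/-- The moment and the coordinates `α`, `β` vanish, so rotations act trivially and the orbit is a
great circle in the `(ξ₀, ξ₃)`-plane. It passes through `ξ₀ = 1`, and the sign of `-ε + cos` is that
of `-ε`. -/
theorem isPolarOrbit_pole {ε : ℝ} (hε : ε ^ 2 = 1) :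
    IsPolarOrbit c (orbit c (embed (0, 0, (ε : ℂ), 1))) ∧
      ∀ t, position (orbit c (embed (0, 0, (ε : ℂ), 1)) t) 2 =
        (-ε + Real.cos (freq c 0 * t)) / freq c 0 ^ 2 := by
  have hu := embed_mem_unitCotangent.2 (pole_mem_quadric hε)
  have hmom : rotMoment (embed (0, 0, (ε : ℂ), 1)) = 0 := by
    rw [rotMoment_embed]
    simp [moment]
  have hk : freq c 0 ≠ 0 := by
    have := one_lt_freq hc (unitCotangent_subset hc hu)
    rw [hmom] at this
    linarith
  have hflow : ∀ t, normalFlow (freq c 0) (embed (0, 0, (ε : ℂ), 1)) t =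
      (!₂[Real.cos (freq c 0 * t) * ε, 0, 0, Real.sin (freq c 0 * t)],
        !₂[-(Real.sin (freq c 0 * t) * ε), 0, 0, Real.cos (freq c 0 * t)]) := fun t => by
    apply phase_ext <;> intro i <;> fin_cases i <;>
      simp [normalFlow, rotate, geodesic, embed_fst_zero, embed_fst_one, embed_fst_two,
        embed_fst_three, embed_snd_zero, embed_snd_one, embed_snd_two, embed_snd_three]
  have hper : ∀ t, normalFlow (freq c 0) (embed (0, 0, (ε : ℂ), 1)) (t + 2 * Real.pi / freq c 0) =
      normalFlow (freq c 0) (embed (0, 0, (ε : ℂ), 1)) t := fun t => by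
    rw [hflow, hflow, mul_add, mul_div_cancel₀ _ hk, Real.cos_add_two_pi, Real.sin_add_two_pi]
  have hkpos : 0 < freq c 0 := by
    have := freq_rotMoment_pos hc (unitCotangent_subset hc hu)
    rwa [hmom] at this
  refine ⟨⟨isOrbit_orbit hc hu, ⟨2 * Real.pi / freq c 0, div_pos Real.two_pi_pos hkpos,
    fun t => ?_⟩, fun t => ?_, ?_⟩, fun t => ?_⟩
  · rw [orbit, orbit, hmom, hper]
  · rw [orbit, hmom, hflow, chart]
    simp
  · have hex : ∃ t, Real.cos (freq c 0 * t) * ε = 1 := by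
      rcases sq_eq_one_iff.1 hε with h | h
      · exact ⟨0, by simp [h]⟩
      · exact ⟨Real.pi / freq c 0, by rw [mul_div_cancel₀ _ hk, h]; simp⟩
    obtain ⟨t, ht⟩ := hex
    refine ⟨t, ?_⟩
    rw [orbit, hmom, chart_fst_zero_eq_one (unitCotangent_subset hc (normalFlow_mem _ hu t)),
      hflow]
    exact ht
  · have hs := unitCotangent_subset hc (normalFlow_mem (freq c 0) hu t)
    rw [orbit, hmom, position_chart_two hc hs, rotMoment_normalFlow, hmom, hflow]
    congr 1
    simp
    linear_combination (-ε) * Real.sin_sq_add_cos_sq (freq c 0 * t)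

omit hc in
theorem returnMap_pole (ε : ℝ) :
    returnMap c (pageChart c (0, 0, (ε : ℂ), 1)) = pageChart c (0, 0, (ε : ℂ), 1) := by
  rw [returnMap, ← pageChart_rotModel]
  simp [rotModel]

end polar

/-! ### The page as a disk cotangent bundle -/

theorem smoothOn_of_contDiffAt {X Y : Type*} [NormedAddCommGroup X] [NormedSpace ℝ X]
    [NormedAddCommGroup Y] [NormedSpace ℝ Y] {f : X → Y} {s U : Set X} (hU : IsOpen U)
    (hs : s ⊆ U) (h : ∀ x ∈ U, ContDiffAt ℝ ∞ f x) : SmoothOn f s :=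
  ⟨U, hU, hs, fun x hx => (h x hx).contDiffWithinAt⟩

theorem norm_sq_three (x : E3) : ‖x‖ ^ 2 = x 0 ^ 2 + x 1 ^ 2 + x 2 ^ 2 := by
  rw [EuclideanSpace.real_norm_sq_eq, Fin.sum_univ_three]

theorem inner_three (x y : E3) : inner ℝ x y = x 0 * y 0 + x 1 * y 1 + x 2 * y 2 := by
  simp only [PiLp.inner_apply, Fin.sum_univ_three, RCLike.inner_apply, conj_trivial]
  ring

/-- Stereographic projection of the fibers, from a hemisphere to the unit disk. -/
def hemisphereProj (x : Phase) : E3 × E3 :=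
  (!₂[x.1 0, x.1 1, x.1 2],
    !₂[x.2 0 / (1 + x.2 3), x.2 1 / (1 + x.2 3), x.2 2 / (1 + x.2 3)])

/-- The inverse of the stereographic projection of the fibers. -/
def hemisphereLift (p : E3 × E3) : Phase :=
  (!₂[p.1 0, p.1 1, p.1 2, 0],
    !₂[2 * p.2 0 / (1 + ‖p.2‖ ^ 2), 2 * p.2 1 / (1 + ‖p.2‖ ^ 2), 2 * p.2 2 / (1 + ‖p.2‖ ^ 2),
      (1 - ‖p.2‖ ^ 2) / (1 + ‖p.2‖ ^ 2)])

theorem hemisphereLift_mem {p : E3 × E3} (hp : p ∈ diskCotangentBundle) :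
    hemisphereLift p ∈ unitCotangent ∧ 0 ≤ (hemisphereLift p).2 3 := by
  obtain ⟨h1, h2, h3⟩ := hp
  have h1' : ‖p.1‖ ^ 2 = 1 := by rw [h1, one_pow]
  have hn := norm_sq_three p.2
  rw [norm_sq_three] at h1'
  rw [inner_three] at h2
  have hpos : 0 < 1 + ‖p.2‖ ^ 2 := by positivity
  refine ⟨mem_unitCotangent.2 ⟨?_, ?_, ?_⟩, ?_⟩
  · simpa [hemisphereLift] using h1'
  · simp [hemisphereLift]
    field_simp
    linear_combination 2 * h2
  · simp [hemisphereLift]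
    field_simp
    linear_combination (-4) * hn
  · exact div_nonneg (by nlinarith [norm_nonneg p.2]) hpos.le

theorem hemisphereProj_mem {x : Phase} (hx : x ∈ unitCotangent) (h3 : x.1 3 = 0)
    (h : 0 ≤ x.2 3) : hemisphereProj x ∈ diskCotangentBundle := by
  obtain ⟨h1, h2, h4⟩ := mem_unitCotangent.1 hx
  rw [h3] at h1 h2
  have hpos : 0 < 1 + x.2 3 := by linarith
  refine ⟨?_, ?_, ?_⟩
  · rw [← sq_eq_sq₀ (norm_nonneg _) zero_le_one, norm_sq_three]
    simp [hemisphereProj]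
    linarith
  · rw [inner_three]
    simp [hemisphereProj]
    field_simp
    linarith
  · rw [← sq_le_sq₀ (norm_nonneg _) zero_le_one, norm_sq_three]
    simp [hemisphereProj]
    rw [div_pow, div_pow, div_pow, ← add_div, ← add_div, div_le_one (by positivity)]
    nlinarith

theorem hemisphereProj_hemisphereLift (p : E3 × E3) :
    hemisphereProj (hemisphereLift p) = p := by
  have hpos : 0 < 1 + ‖p.2‖ ^ 2 := by positivity
  have h : 1 + (1 - ‖p.2‖ ^ 2) / (1 + ‖p.2‖ ^ 2) = 2 / (1 + ‖p.2‖ ^ 2) := by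
    field_simp
    ring
  refine Prod.ext ?_ ?_ <;> ext i <;> fin_cases i <;> simp [hemisphereProj, hemisphereLift, h] <;>
    field_simp

theorem hemisphereLift_hemisphereProj {x : Phase} (hx : x ∈ unitCotangent) (h3 : x.1 3 = 0)
    (h : 0 ≤ x.2 3) : hemisphereLift (hemisphereProj x) = x := by
  obtain ⟨h1, h2, h4⟩ := mem_unitCotangent.1 hx
  have hpos : 0 < 1 + x.2 3 := by linarith
  have hn : ‖(hemisphereProj x).2‖ ^ 2 = (1 - x.2 3) / (1 + x.2 3) := by
    rw [norm_sq_three]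
    simp [hemisphereProj]
    field_simp
    linear_combination h4
  have hn' : 1 + (1 - x.2 3) / (1 + x.2 3) = 2 / (1 + x.2 3) := by
    field_simp
    ring
  have hn'' : 1 - (1 - x.2 3) / (1 + x.2 3) = 2 * x.2 3 / (1 + x.2 3) := by
    field_simp
    ring
  rw [hemisphereLift, hn, hn', hn'']
  apply phase_ext <;> intro i <;> fin_cases i <;> simp [hemisphereProj, h3] <;> field_simp

theorem contDiff_hemisphereLift : ContDiff ℝ ∞ hemisphereLift := by
  have h1 : ∀ i, ContDiff ℝ ∞ fun p : E3 × E3 => p.1 i := fun i => by fun_prop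
  have h2 : ∀ i, ContDiff ℝ ∞ fun p : E3 × E3 => p.2 i := fun i => by fun_prop
  have h3 : ContDiff ℝ ∞ fun p : E3 × E3 => ‖p.2‖ ^ 2 := contDiff_snd.norm_sq ℝ
  have h4 : ∀ p : E3 × E3, 1 + ‖p.2‖ ^ 2 ≠ 0 := fun p => by positivity
  rw [contDiff_iff_contDiffAt]
  intro p
  have h5 : ContDiff ℝ ∞ fun p : E3 × E3 => 1 + ‖p.2‖ ^ 2 := contDiff_const.add h3
  apply contDiffAt_phase <;> intro i <;> fin_cases i
  · exact (h1 0).contDiffAt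
  · exact (h1 1).contDiffAt
  · exact (h1 2).contDiffAt
  · exact contDiffAt_const
  · exact ((contDiff_const.mul (h2 0)).div h5 h4).contDiffAt
  · exact ((contDiff_const.mul (h2 1)).div h5 h4).contDiffAt
  · exact ((contDiff_const.mul (h2 2)).div h5 h4).contDiffAt
  · exact ((contDiff_const.sub h3).div h5 h4).contDiffAt

theorem contDiffAt_hemisphereProj {x : Phase} (h : -1 < x.2 3) :
    ContDiffAt ℝ ∞ hemisphereProj x := by
  have h1 : ∀ i, ContDiffAt ℝ ∞ (fun y : Phase => y.1 i) x := fun i =>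
    (contDiff_phase_fst i).contDiffAt
  have h2 : ∀ i, ContDiffAt ℝ ∞ (fun y : Phase => y.2 i) x := fun i =>
    (contDiff_phase_snd i).contDiffAt
  have h3 : ContDiffAt ℝ ∞ (fun y : Phase => 1 + y.2 3) x := contDiffAt_const.add (h2 3)
  have h4 : 1 + x.2 3 ≠ 0 := by linarith
  refine ContDiffAt.prodMk ?_ ?_ <;> rw [contDiffAt_euclidean] <;> intro i <;> fin_cases i
  · exact h1 0
  · exact h1 1
  · exact h1 2
  · exact (h2 0).div h3 h4
  · exact (h2 1).div h3 h4
  · exact (h2 2).div h3 h4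

theorem chartInv_page {c : ℝ} (hc : c < -3 / 2) {x : Phase} (hx : x ∈ page c) :
    chartInv c x ∈ unitCotangent ∧ (chartInv c x).1 3 = 0 ∧ 0 ≤ (chartInv c x).2 3 := by
  have hu := chartInv_mem_of_energySurface hc hx.1
  have hs := unitCotangent_subset hc hu
  have hcc := chart_chartInv_of_energySurface hc hx.1
  have h3 : (chartInv c x).1 3 = 0 := by
    rw [← chart_fst_three_eq_zero hc hs, hcc, hx.2.1]
  refine ⟨hu, h3, ?_⟩
  rw [← chart_snd_three_nonneg hc hs h3, hcc]
  exact hx.2.2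

theorem chart_mem_page {c : ℝ} (hc : c < -3 / 2) {x : Phase} (hx : x ∈ unitCotangent)
    (h3 : x.1 3 = 0) (h : 0 ≤ x.2 3) : chart c x ∈ page c := by
  have hs := unitCotangent_subset hc hx
  exact ⟨chart_mem_energySurface hc hx, (chart_fst_three_eq_zero hc hs).2 h3,
    (chart_snd_three_nonneg hc hs h3).2 h⟩

/-- In normalized coordinates the page consists of `ξ ∈ S²` and `η` in the closed upper hemisphere
of the unit sphere of `ξ^⊥ ⊂ ℝ⁴`. Stereographic projection from `-e₃` takes this hemisphere to the
unit disk of the cotangent plane at `ξ`. -/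
theorem areDiffeomorphic_page {c : ℝ} (hc : c < -3 / 2) :
    AreDiffeomorphic (page c) diskCotangentBundle := by
  refine ⟨fun x => hemisphereProj (chartInv c x), fun p => chart c (hemisphereLift p),
    ?_, ?_, ?_, ?_, ?_, ?_⟩
  · have hcont : ContinuousOn (fun x => (chartInv c x).2 3) (chartTarget c) := fun x hx =>
      ((contDiff_phase_snd 3).contDiffAt.comp x
        (contDiffAt_chartInv hc hx)).continuousAt.continuousWithinAt
    refine smoothOn_of_contDiffAt (hcont.isOpen_inter_preimage (isOpen_chartTarget hc)
      (isOpen_Ioi (a := -1))) (fun x hx => ⟨energySurface_subset_chartTarget hc hx.1, ?_⟩)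
      fun x hx => ?_
    · have := (chartInv_page hc hx).2.2
      exact lt_of_lt_of_le (by norm_num) this
    · exact (contDiffAt_hemisphereProj hx.2).comp x (contDiffAt_chartInv hc hx.1)
  · refine smoothOn_of_contDiffAt ((isOpen_chartSource hc).preimage
      contDiff_hemisphereLift.continuous)
      (fun p hp => unitCotangent_subset hc (hemisphereLift_mem hp).1) fun p hp => ?_
    exact (contDiffAt_chart hc hp).comp p contDiff_hemisphereLift.contDiffAt
  · intro x hx
    obtain ⟨h1, h2, h3⟩ := chartInv_page hc hx
    exact hemisphereProj_mem h1 h2 h3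
  · intro p hp
    exact chart_mem_page hc (hemisphereLift_mem hp).1 rfl (hemisphereLift_mem hp).2
  · intro x hx
    obtain ⟨h1, h2, h3⟩ := chartInv_page hc hx
    simp only [hemisphereLift_hemisphereProj h1 h2 h3]
    exact chart_chartInv_of_energySurface hc hx.1
  · intro p hp
    simp only [chartInv_chart hc (unitCotangent_subset hc (hemisphereLift_mem hp).1),
      hemisphereProj_hemisphereLift]

/-! ### The Hopf link -/

/-- The double cover of the boundary of the page by the sphere. -/
def hopfModel (z : ℂ × ℂ) : Model := (2 * z.2 ^ 2, -2 * z.1 ^ 2, 2 * z.1 * z.2, 0)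

theorem hopfModel_mem {z : ℂ × ℂ} (hz : ‖z.1‖ ^ 2 + ‖z.2‖ ^ 2 = 1) : hopfModel z ∈ quadric := by
  refine ⟨?_, ?_⟩
  · simp only [hopfModel]
    push_cast
    ring
  · simp only [hopfModel, Complex.normSq_eq_norm_sq, norm_mul, norm_pow, norm_neg,
      Complex.norm_ofNat]
    linear_combination 4 * (‖z.1‖ ^ 2 + ‖z.2‖ ^ 2 + 1) * hz

/-- The squares determine `z₁` and `z₂` up to signs, and the product `z₁ z₂` couples the two signs.
-/
theorem hopfModel_eq_iff {z w : ℂ × ℂ} : hopfModel z = hopfModel w ↔ w = z ∨ w = -z := by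
  constructor
  · intro h
    simp only [hopfModel, Prod.mk.injEq, and_true] at h
    obtain ⟨h1, h2, h3⟩ := h
    have e1 : w.2 ^ 2 = z.2 ^ 2 := by linear_combination (-1 / 2) * h1
    have e2 : w.1 ^ 2 = z.1 ^ 2 := by linear_combination (1 / 2) * h2
    have e3 : w.1 * w.2 = z.1 * z.2 := by linear_combination (-1 / 2) * h3
    rcases sq_eq_sq_iff_eq_or_eq_neg.1 e2 with h4 | h4
    · by_cases h0 : z.1 = 0
      · rcases sq_eq_sq_iff_eq_or_eq_neg.1 e1 with h5 | h5
        · exact Or.inl (Prod.ext h4 h5)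
        · exact Or.inr (Prod.ext (by simp [h4, h0]) h5)
      · rw [h4] at e3
        exact Or.inl (Prod.ext h4 (mul_left_cancel₀ h0 e3))
    · by_cases h0 : z.1 = 0
      · rcases sq_eq_sq_iff_eq_or_eq_neg.1 e1 with h5 | h5
        · exact Or.inl (Prod.ext (by simp [h4, h0]) h5)
        · exact Or.inr (Prod.ext h4 h5)
      · refine Or.inr (Prod.ext h4 (mul_left_cancel₀ h0 ?_))
        rw [h4] at e3
        rw [Prod.snd_neg]
        linear_combination -e3
  · rintro (rfl | rfl)
    · rfl
    · simp [hopfModel]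

/-- On `t = 0` the equation is `αβ = -Z²`, so `Z/2` is, up to a sign that `z₂` absorbs, the product
of square roots of `α/2` and `-β/2`. Also `|Z|² = |α| |β|`, so the size equation becomes `(|α| +
|β|)² = 4`, the equation of `S³`. -/
theorem exists_hopfModel_eq {m : Model} (hm : m ∈ quadric) (h0 : m.2.2.2 = 0) :
    ∃ z : ℂ × ℂ, ‖z.1‖ ^ 2 + ‖z.2‖ ^ 2 = 1 ∧ hopfModel z = m := by
  obtain ⟨h1, h2⟩ := hm
  obtain ⟨a, b, Z, t⟩ := m
  simp only at h0 h1 h2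
  subst h0
  obtain ⟨z1, hz1⟩ := IsAlgClosed.exists_pow_nat_eq (-b / 2) two_pos
  obtain ⟨z2, hz2⟩ := IsAlgClosed.exists_pow_nat_eq (a / 2) two_pos
  have hb : ‖z1‖ ^ 2 = ‖b‖ / 2 := by rw [← norm_pow, hz1]; simp
  have ha : ‖z2‖ ^ 2 = ‖a‖ / 2 := by rw [← norm_pow, hz2]; simp
  have hZ : ‖a‖ * ‖b‖ = ‖Z‖ ^ 2 := by
    rw [← norm_mul, ← norm_pow]
    have : a * b = -Z ^ 2 := by
      rw [eq_neg_iff_add_eq_zero, h1]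
      simp
    rw [this, norm_neg]
  have hn : ‖z1‖ ^ 2 + ‖z2‖ ^ 2 = 1 := by
    rw [ha, hb]
    simp only [Complex.normSq_eq_norm_sq] at h2
    nlinarith [norm_nonneg a, norm_nonneg b]
  have hsq : (2 * z1 * z2) ^ 2 = Z ^ 2 := by
    have h3 : a * b = -Z ^ 2 := by
      rw [eq_neg_iff_add_eq_zero, h1]
      simp
    linear_combination 4 * z2 ^ 2 * hz1 + (-2 * b) * hz2 - h3
  rcases sq_eq_sq_iff_eq_or_eq_neg.1 hsq with h | h
  · refine ⟨(z1, z2), hn, ?_⟩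
    simp only [hopfModel, h, hz1, hz2]
    ring_nf
  · refine ⟨(z1, -z2), by simpa using hn, ?_⟩
    have h' : 2 * z1 * -z2 = Z := by rw [mul_neg, h, neg_neg]
    simp only [hopfModel, h', neg_sq, hz1, hz2]
    ring_nf

theorem contDiff_hopfModel : ContDiff ℝ ∞ hopfModel := by
  unfold hopfModel
  fun_prop

theorem fderiv_hopfModel (z v : ℂ × ℂ) : fderiv ℝ hopfModel z v =
    (4 * z.2 * v.2, -4 * z.1 * v.1, 2 * (z.1 * v.2 + z.2 * v.1), 0) := by
  have h1 : HasFDerivAt (fun z : ℂ × ℂ => z.1) (ContinuousLinearMap.fst ℝ ℂ ℂ) z := hasFDerivAt_fst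
  have h2 : HasFDerivAt (fun z : ℂ × ℂ => z.2) (ContinuousLinearMap.snd ℝ ℂ ℂ) z := hasFDerivAt_snd
  have h := ((h2.pow 2).const_mul 2).prodMk (((h1.pow 2).const_mul (-2)).prodMk
    (((h1.const_mul 2).mul h2).prodMk (hasFDerivAt_const (0 : ℝ) z)))
  have e : fderiv ℝ hopfModel z = _ := h.fderiv
  rw [e]
  simp
  refine ⟨by ring, by ring, by ring⟩

theorem isHopfLink_pageBoundary {c : ℝ} (hc : c < -3 / 2) :
    IsHopfLink (pageBoundary c) (range (directOrbit c)) (range (retrogradeOrbit c)) := by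
  have hcont := contDiff_hopfModel.continuous
  refine ⟨fun z => pageChart c (hopfModel z), ?_, ?_, ?_, ?_, ?_, ?_⟩
  · refine smoothOn_of_contDiffAt ((isOpen_chartSource hc).preimage
      (embed.continuous.comp hcont)) (fun z hz => embed_mem_chartSource hc (hopfModel_mem hz))
      fun z hz => ?_
    exact (contDiffAt_chart hc hz).comp z (embed.contDiff.comp contDiff_hopfModel).contDiffAt
  · ext x
    constructor
    · rintro ⟨z, hz, rfl⟩
      exact (pageChart_mem_pageBoundary_iff hc (hopfModel_mem hz)).2 rfl
    · intro hx
      obtain ⟨q1, q2⟩ := pageCoord_mem hc hx.1 hx.2.1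
      obtain ⟨z, hz, h⟩ := exists_hopfModel_eq q1
        (by rwa [← pageChart_mem_pageBoundary_iff hc q1, q2])
      exact ⟨z, hz, by simp only [h, q2]⟩
  · intro z w hz hw
    rw [(pageChart_injOn hc).eq_iff (hopfModel_mem hz) (hopfModel_mem hw), hopfModel_eq_iff]
  · intro z v hz _ h
    have hm := hopfModel_mem hz
    have hd : fderiv ℝ (fun z => pageChart c (hopfModel z)) z v =
        fderiv ℝ (pageChart c) (hopfModel z) (fderiv ℝ hopfModel z v) := by
      have := ((contDiffAt_pageChart hc hm).differentiableAt (by simp)).hasFDerivAt.comp z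
        (contDiff_hopfModel.differentiable (by simp) z).hasFDerivAt
      exact congrArg (fun L : ℂ × ℂ →L[ℝ] Phase => L v) this.fderiv
    rw [hd] at h
    have h' := fderiv_pageCoord_fderiv_pageChart hc hm (fderiv ℝ hopfModel z v)
    rw [h, map_zero, fderiv_hopfModel] at h'
    simp only [Prod.ext_iff, Prod.fst_zero, Prod.snd_zero] at h'
    obtain ⟨e1, e2, e3, -⟩ := h'
    by_cases h1 : z.1 = 0
    · have h2 : z.2 ≠ 0 := fun h2 => by rw [h1, h2] at hz; norm_num at hz
      have hv2 : v.2 = 0 := by simpa [h2] using e1.symm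
      have hv1 : v.1 = 0 := by simpa [h2, hv2] using e3.symm
      exact Prod.ext hv1 hv2
    · have hv1 : v.1 = 0 := by simpa [h1] using e2.symm
      have hv2 : v.2 = 0 := by simpa [h1, hv1] using e3.symm
      exact Prod.ext hv1 hv2
  · rw [range_directOrbit hc]
    ext x
    constructor
    · rintro ⟨z, ⟨hz1, hz2⟩, rfl⟩
      refine mem_image_of_mem _ ⟨by simp [hopfModel, hz2], ?_, by simp [hopfModel, hz2]⟩
      simp [hopfModel, Complex.normSq_eq_norm_sq, hz1]
      norm_num
    · rintro ⟨m, hm, rfl⟩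
      obtain ⟨z, hz, rfl⟩ := exists_hopfModel_eq (directCircle_subset hm) (Prod.ext_iff.1 hm.2.2).2
      have hz2 : z.2 = 0 := by simpa [hopfModel] using hm.1
      refine ⟨z, ⟨?_, hz2⟩, rfl⟩
      rw [hz2, norm_zero] at hz
      exact (pow_eq_one_iff_of_nonneg (norm_nonneg _) two_ne_zero).1 (by linarith)
  · rw [range_retrogradeOrbit hc]
    ext x
    constructor
    · rintro ⟨z, ⟨hz1, hz2⟩, rfl⟩
      refine mem_image_of_mem _ ⟨?_, by simp [hopfModel, hz1], by simp [hopfModel, hz1]⟩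
      simp [hopfModel, Complex.normSq_eq_norm_sq, hz2]
      norm_num
    · rintro ⟨m, hm, rfl⟩
      obtain ⟨z, hz, rfl⟩ := exists_hopfModel_eq (retrogradeCircle_subset hm)
        (Prod.ext_iff.1 hm.2.2).2
      have hz1 : z.1 = 0 := by simpa [hopfModel] using hm.2.1
      refine ⟨z, ⟨hz1, ?_⟩, rfl⟩
      rw [hz1, norm_zero] at hz
      exact (pow_eq_one_iff_of_nonneg (norm_nonneg _) two_ne_zero).1 (by linarith)

/-! ### The projection to the disk -/

/-- The length of `(Z, t)`. -/
def radius (w : ℂ × ℝ) : ℝ := √(normSq w.1 + w.2 ^ 2)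

/-- Stereographic projection `ℂ × ℝ → ℂ` from the negative half-axis, composed with the complex
conjugation. -/
def discProj (w : ℂ × ℝ) : ℂ := (starRingEnd ℂ) w.1 / ((radius w + w.2 : ℝ) : ℂ)

/-- The point of the unit sphere in `ℂ × ℝ` with a given projection. -/
def discLift (z : ℂ) : ℂ × ℝ :=
  ((2 / (1 + normSq z)) • (starRingEnd ℂ) z, (1 - normSq z) / (1 + normSq z))

theorem radius_sq (w : ℂ × ℝ) : radius w ^ 2 = normSq w.1 + w.2 ^ 2 :=
  Real.sq_sqrt (add_nonneg (Complex.normSq_nonneg _) (sq_nonneg _))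

theorem radius_nonneg (w : ℂ × ℝ) : 0 ≤ radius w := Real.sqrt_nonneg _

theorem radius_pos {w : ℂ × ℝ} (hw : w ≠ 0) : 0 < radius w := by
  refine (radius_nonneg w).lt_of_ne fun h => hw ?_
  have h1 := radius_sq w
  rw [← h] at h1
  have h2 := Complex.normSq_nonneg w.1
  refine Prod.ext (Complex.normSq_eq_zero.1 (by nlinarith)) ?_
  exact pow_eq_zero_iff two_ne_zero |>.1 (by nlinarith)

theorem radius_smul {a : ℝ} (ha : 0 ≤ a) (w : ℂ × ℝ) : radius (a • w) = a * radius w := by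
  rw [← sq_eq_sq₀ (radius_nonneg _) (mul_nonneg ha (radius_nonneg _)), mul_pow, radius_sq,
    radius_sq]
  simp [Complex.normSq_apply]
  ring

theorem one_add_normSq_pos (z : ℂ) : 0 < 1 + normSq z := by
  have := Complex.normSq_nonneg z
  linarith

theorem radius_discLift (z : ℂ) : radius (discLift z) = 1 := by
  have h := one_add_normSq_pos z
  have h1 : normSq z = z.re ^ 2 + z.im ^ 2 := by rw [Complex.normSq_apply]; ring
  rw [← sq_eq_sq₀ (radius_nonneg _) zero_le_one, radius_sq, Complex.normSq_apply]
  simp only [discLift, Complex.smul_re, Complex.smul_im, Complex.conj_re, Complex.conj_im,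
    smul_eq_mul]
  field_simp
  linear_combination (-4) * h1

theorem radius_add_discLift (z : ℂ) : radius (discLift z) + (discLift z).2 =
    2 / (1 + normSq z) := by
  have h := one_add_normSq_pos z
  rw [radius_discLift, discLift]
  field_simp
  ring

theorem discProj_smul {a : ℝ} (ha : 0 < a) (w : ℂ × ℝ) : discProj (a • w) = discProj w := by
  rw [discProj, discProj, radius_smul ha.le, Prod.smul_snd, smul_eq_mul, ← mul_add, Prod.smul_fst,
    Complex.ofReal_mul, Complex.real_smul, map_mul, Complex.conj_ofReal, mul_div_mul_left]
  exact_mod_cast ha.ne'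

theorem discProj_discLift (z : ℂ) : discProj (discLift z) = z := by
  have h := one_add_normSq_pos z
  rw [discProj, radius_add_discLift, discLift, Complex.real_smul, map_mul, Complex.conj_ofReal,
    Complex.conj_conj, mul_div_cancel_left₀]
  exact_mod_cast (by positivity : 2 / (1 + normSq z) ≠ 0)

theorem normSq_discProj {w : ℂ × ℝ} (hw : 0 < radius w + w.2) :
    normSq (discProj w) = (radius w - w.2) / (radius w + w.2) := by
  have h := radius_sq w
  rw [discProj, map_div₀, Complex.normSq_conj, Complex.normSq_ofReal]
  field_simp
  linear_combination -h

theorem smul_discLift_discProj {w : ℂ × ℝ} (hw : 0 < radius w + w.2) :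
    radius w • discLift (discProj w) = w := by
  have hr : 0 < radius w := by
    refine radius_pos fun h => ?_
    rw [h] at hw
    simp [radius] at hw
  have h1 : 1 + normSq (discProj w) = 2 * radius w / (radius w + w.2) := by
    rw [normSq_discProj hw]
    field_simp
    ring
  have h2 : 1 - normSq (discProj w) = 2 * w.2 / (radius w + w.2) := by
    rw [normSq_discProj hw]
    field_simp
    ring
  refine Prod.ext ?_ ?_
  · have hw' : ((radius w + w.2 : ℝ) : ℂ) ≠ 0 := by exact_mod_cast hw.ne'
    have hr' : ((radius w : ℝ) : ℂ) ≠ 0 := by exact_mod_cast hr.ne'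
    simp only [discLift, h1, Prod.smul_fst, Complex.real_smul]
    rw [discProj, map_div₀, Complex.conj_conj, Complex.conj_ofReal]
    push_cast at hw' ⊢
    field_simp
  · simp only [discLift, h1, h2, Prod.smul_snd, smul_eq_mul]
    field_simp

theorem contDiff_normSq {n : WithTop ℕ∞} : ContDiff ℝ n normSq := by
  have : (normSq : ℂ → ℝ) = fun z => ‖z‖ ^ 2 := funext Complex.normSq_eq_norm_sq
  change ContDiff ℝ n (normSq : ℂ → ℝ)
  rw [this]
  exact contDiff_id.norm_sq ℝ

theorem contDiff_conj {n : WithTop ℕ∞} : ContDiff ℝ n (starRingEnd ℂ) :=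
  (Complex.conjCLE : ℂ ≃L[ℝ] ℂ).contDiff

theorem contDiff_ofReal {n : WithTop ℕ∞} : ContDiff ℝ n (fun x : ℝ => (x : ℂ)) :=
  Complex.ofRealCLM.contDiff

theorem contDiffAt_radius {w : ℂ × ℝ} (hw : w ≠ 0) : ContDiffAt ℝ ∞ radius w := by
  have h : normSq w.1 + w.2 ^ 2 ≠ 0 := by
    rw [← radius_sq]
    exact pow_ne_zero 2 (radius_pos hw).ne'
  exact ((contDiff_normSq.comp contDiff_fst).add (contDiff_snd.pow 2)).contDiffAt.sqrt h

theorem ne_zero_of_radius_add {w : ℂ × ℝ} (hw : 0 < radius w + w.2) : w ≠ 0 := fun h => by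
  rw [h] at hw
  simp [radius] at hw

theorem contDiffAt_discProj {w : ℂ × ℝ} (hw : 0 < radius w + w.2) : ContDiffAt ℝ ∞ discProj w := by
  have h1 := (contDiffAt_radius (ne_zero_of_radius_add hw)).add contDiffAt_snd
  have h2 : ContDiffAt ℝ ∞ (fun w : ℂ × ℝ => ((radius w + w.2 : ℝ) : ℂ)) w :=
    contDiff_ofReal.contDiffAt.comp w h1
  have h3 : discProj = fun w => (starRingEnd ℂ) w.1 * ((radius w + w.2 : ℝ) : ℂ)⁻¹ :=
    funext fun w => div_eq_mul_inv _ _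
  rw [h3]
  exact (contDiff_conj.comp contDiff_fst).contDiffAt.mul (h2.inv (by exact_mod_cast hw.ne'))

theorem continuous_radius : Continuous radius := by
  unfold radius
  exact (((Complex.continuous_normSq.comp continuous_fst).add (continuous_snd.pow 2))).sqrt

theorem contDiff_discLift : ContDiff ℝ ∞ discLift := by
  have h : ContDiff ℝ ∞ fun z : ℂ => 1 + normSq z := contDiff_const.add contDiff_normSq
  have h0 : ∀ z : ℂ, 1 + normSq z ≠ 0 := fun z => (one_add_normSq_pos z).ne'
  exact ((contDiff_const.div h h0).smul contDiff_conj).prodMk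
    ((contDiff_const.sub contDiff_normSq).div h h0)

theorem isOpen_radius_add : IsOpen {w : ℂ × ℝ | 0 < radius w + w.2} :=
  isOpen_lt continuous_const (continuous_radius.add continuous_snd)

section discProj

variable {w : ℂ × ℝ} (hw : 0 < radius w + w.2)
include hw

theorem hasFDerivAt_discProj : HasFDerivAt discProj (fderiv ℝ discProj w) w :=
  ((contDiffAt_discProj hw).differentiableAt (by simp)).hasFDerivAt

/-- Differentiating the polar decomposition `w = radius w • discLift (discProj w)` along a vector of
the kernel leaves only the radial term. -/
theorem exists_smul_of_fderiv_discProj {v : ℂ × ℝ} (hv : fderiv ℝ discProj w v = 0) :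
    ∃ a : ℝ, v = a • w := by
  have hw0 := ne_zero_of_radius_add hw
  have h1 := ((contDiffAt_radius hw0).differentiableAt (by simp)).hasFDerivAt
  have h2 := ((contDiff_discLift.differentiable (by simp) (discProj w)).hasFDerivAt).comp w
    (hasFDerivAt_discProj hw)
  have h3 := h1.smul h2
  have h4 : HasFDerivAt (fun w => radius w • discLift (discProj w))
      (ContinuousLinearMap.id ℝ (ℂ × ℝ)) w := by
    refine (hasFDerivAt_id w).congr_of_eventuallyEq ?_
    filter_upwards [isOpen_radius_add.mem_nhds hw] with y hy using smul_discLift_discProj hy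
  have h5 := congrArg (fun L : ℂ × ℝ →L[ℝ] ℂ × ℝ => L v) (h3.unique h4)
  simp [hv] at h5
  refine ⟨fderiv ℝ radius w v / radius w, ?_⟩
  calc v = (fderiv ℝ radius w v / radius w) • radius w • discLift (discProj w) := by
        rw [smul_smul, div_mul_cancel₀ _ (radius_pos hw0).ne', h5]
    _ = _ := by rw [smul_discLift_discProj hw]

theorem fderiv_discProj_self : fderiv ℝ discProj w w = 0 := by
  have hl : HasDerivAt (fun t : ℝ => (1 + t) • w) w 0 := by
    simpa using ((hasDerivAt_id (0 : ℝ)).const_add 1).smul_const w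
  have h : HasFDerivAt discProj (fderiv ℝ discProj w) ((1 + (0 : ℝ)) • w) := by
    simpa using hasFDerivAt_discProj hw
  have h1 := h.comp_hasDerivAt 0 hl
  have h2 : HasDerivAt (fun t : ℝ => discProj ((1 + t) • w)) 0 0 := by
    refine (hasDerivAt_const (0 : ℝ) (discProj w)).congr_of_eventuallyEq ?_
    filter_upwards [Ioi_mem_nhds (show (-1 : ℝ) < 0 by norm_num)] with t ht
    exact discProj_smul (by linarith [mem_Ioi.1 ht]) w
  exact h1.unique h2

theorem exists_fderiv_discProj_eq (y : ℂ) : ∃ v, fderiv ℝ discProj w v = y := by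
  have hw0 := ne_zero_of_radius_add hw
  have h1 : HasFDerivAt (fun z => radius w • discLift z) _ (discProj w) :=
    ((contDiff_discLift.differentiable (by simp) (discProj w)).hasFDerivAt).const_smul (radius w)
  have h : HasFDerivAt discProj (fderiv ℝ discProj w) (radius w • discLift (discProj w)) := by
    rw [smul_discLift_discProj hw]
    exact hasFDerivAt_discProj hw
  have h2 := h.comp (discProj w) h1
  have h3 : HasFDerivAt (fun z => discProj (radius w • discLift z))
      (ContinuousLinearMap.id ℝ ℂ) (discProj w) := by
    refine (hasFDerivAt_id _).congr_of_eventuallyEq (Eventually.of_forall fun z => ?_)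
    exact (discProj_smul (radius_pos hw0) _).trans (discProj_discLift z)
  exact ⟨_, congrArg (fun L : ℂ →L[ℝ] ℂ => L y) (h2.unique h3)⟩

end discProj

/-! ### The fibration -/

/-- The Lefschetz fibration of the page. -/
def lefschetz (c : ℝ) (x : Phase) : ℂ := discProj (pageCoord c x).2.2

/-- The binding of the page: the union of the two circular orbits. -/
def binding (c : ℝ) : Set Phase := range (directOrbit c) ∪ range (retrogradeOrbit c)

theorem radius_add_pos {w : ℂ × ℝ} (hw : w ≠ 0) (h : 0 ≤ w.2) : 0 < radius w + w.2 :=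
  add_pos_of_pos_of_nonneg (radius_pos hw) h

section lefschetz

variable {c : ℝ} (hc : c < -3 / 2) {x : Phase} {m : Model}
include hc

theorem pageChart_mem_binding_iff (hm : m ∈ quadric) : pageChart c m ∈ binding c ↔ m.2.2 = 0 := by
  rw [binding, range_directOrbit hc, range_retrogradeOrbit hc, ← image_union]
  constructor
  · rintro ⟨n, hn, h⟩
    have hn' : n ∈ quadric ∧ n.2.2 = 0 := by
      rcases hn with hn | hn
      · exact ⟨directCircle_subset hn, hn.2.2⟩
      · exact ⟨retrogradeCircle_subset hn, hn.2.2⟩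
    rw [← pageChart_injOn hc hn'.1 hm h]
    exact hn'.2
  · exact fun h => mem_image_of_mem _ (quadric_binding hm h)

theorem mem_page_diff_iff :
    x ∈ page c \ binding c ↔ x ∈ page c ∧ (pageCoord c x).2.2 ≠ 0 := by
  refine and_congr_right fun h => ?_
  obtain ⟨h1, h2, h3⟩ := pageCoord_page hc h
  rw [Ne, ← pageChart_mem_binding_iff hc h1, h3]

theorem radius_add_pageCoord_pos (hx : x ∈ page c \ binding c) :
    0 < radius (pageCoord c x).2.2 + (pageCoord c x).2.2.2 := by
  obtain ⟨h1, h2⟩ := (mem_page_diff_iff hc).1 hx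
  exact radius_add_pos h2 (pageCoord_page hc h1).2.1

theorem binding_subset_page : binding c ⊆ page c := by
  rw [binding, range_directOrbit hc, range_retrogradeOrbit hc, ← image_union]
  rintro x ⟨m, hm, rfl⟩
  have h : m ∈ quadric ∧ m.2.2 = 0 := by
    rcases hm with hn | hn
    · exact ⟨directCircle_subset hn, hn.2.2⟩
    · exact ⟨retrogradeCircle_subset hn, hn.2.2⟩
  exact (pageChart_mem_page_iff hc h.1).2 (Prod.ext_iff.1 h.2).2.ge

theorem smoothOn_lefschetz : SmoothOn (lefschetz c) (page c \ binding c) := by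
  have hcont : ContinuousOn (fun x => (pageCoord c x).2.2) (chartTarget c) := fun x hx =>
    (contDiff_snd.contDiffAt.comp x (contDiff_snd.contDiffAt.comp x
      (contDiffAt_pageCoord hc hx))).continuousAt.continuousWithinAt
  refine smoothOn_of_contDiffAt (hcont.isOpen_inter_preimage (isOpen_chartTarget hc)
    isOpen_radius_add) (fun x hx => ⟨energySurface_subset_chartTarget hc hx.1.1,
      radius_add_pageCoord_pos hc hx⟩) fun x hx => ?_
  exact (contDiffAt_discProj hx.2).comp x (contDiff_snd.contDiffAt.comp x
    (contDiff_snd.contDiffAt.comp x (contDiffAt_pageCoord hc hx.1)))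

omit hc in
/-- A point of the model over a given point of the sphere in `ℂ × ℝ`. -/
theorem exists_quadric {w : ℂ × ℝ} (hw : w ≠ 0) :
    ∃ m ∈ quadric, ∃ a : ℝ, 0 < a ∧ m.2.2 = a • w := by
  -- The point sought is a multiple of `(b, b, w)`, where `b` is a square root of `t² - Z²`; the
  -- scale `a` is fixed by the size equation.
  obtain ⟨b, hb⟩ := IsAlgClosed.exists_pow_nat_eq ((w.2 : ℂ) ^ 2 - w.1 ^ 2) two_pos
  have hr := radius_pos hw
  have hr2 := radius_sq w
  have hpos : 0 < normSq b + radius w ^ 2 :=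
    add_pos_of_nonneg_of_pos (Complex.normSq_nonneg _) (by positivity)
  set s := √(normSq b + radius w ^ 2) with hs
  have hs0 : 0 < s := Real.sqrt_pos.2 hpos
  have hs2 : s ^ 2 = normSq b + radius w ^ 2 := Real.sq_sqrt hpos.le
  set a := √2 / s with ha
  have ha0 : 0 < a := by positivity
  have ha2 : a ^ 2 * (normSq b + radius w ^ 2) = 2 := by
    rw [← hs2, ha, div_pow, Real.sq_sqrt zero_le_two]
    field_simp
  refine ⟨(a • b, a • b, a • w), ⟨?_, ?_⟩, a, ha0, rfl⟩
  · simp only [Complex.real_smul, Prod.smul_fst, Prod.smul_snd, smul_eq_mul]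
    push_cast
    linear_combination (a : ℂ) ^ 2 * hb
  · simp only [Complex.real_smul, Prod.smul_fst, Prod.smul_snd, smul_eq_mul, map_mul,
      Complex.normSq_ofReal]
    linear_combination 2 * ha2 - 2 * a ^ 2 * hr2

theorem lefschetz_image : lefschetz c '' (page c \ binding c) = closedBall 0 1 := by
  ext z
  rw [mem_closedBall_zero_iff]
  constructor
  · rintro ⟨x, hx, rfl⟩
    have h := radius_add_pageCoord_pos hc hx
    have h1 := normSq_discProj h
    have h2 := (pageCoord_page hc hx.1).2.1
    rw [lefschetz, ← sq_le_sq₀ (norm_nonneg _) zero_le_one, ← Complex.normSq_eq_norm_sq, h1,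
      one_pow, div_le_one h]
    linarith
  · intro hz
    have hne : discLift z ≠ 0 := fun h => by
      have := radius_discLift z
      rw [h] at this
      simp [radius] at this
    obtain ⟨m, hm, a, ha, h⟩ := exists_quadric hne
    have ht : 0 ≤ m.2.2.2 := by
      rw [h]
      refine mul_nonneg ha.le (div_nonneg ?_ (one_add_normSq_pos z).le)
      rw [Complex.normSq_eq_norm_sq]
      nlinarith [norm_nonneg z]
    refine ⟨pageChart c m, (mem_page_diff_iff hc).2 ⟨(pageChart_mem_page_iff hc hm).2 ht, ?_⟩, ?_⟩
    · rw [pageCoord_pageChart hc (embed_mem_chartSource hc hm), h]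
      exact smul_ne_zero ha.ne' hne
    · rw [lefschetz, pageCoord_pageChart hc (embed_mem_chartSource hc hm), h, discProj_smul ha,
        discProj_discLift]

theorem mem_pageBoundary_iff_norm_lefschetz (hx : x ∈ page c \ binding c) :
    x ∈ pageBoundary c ↔ ‖lefschetz c x‖ = 1 := by
  have h := radius_add_pageCoord_pos hc hx
  have h1 := normSq_discProj h
  obtain ⟨q1, q2, q3⟩ := pageCoord_page hc hx.1
  rw [← q3, pageChart_mem_pageBoundary_iff hc q1, q3, ← sq_eq_sq₀ (norm_nonneg _) zero_le_one,
    ← Complex.normSq_eq_norm_sq, lefschetz, h1, one_pow, div_eq_one_iff_eq h.ne']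
  constructor <;> intro h <;> linarith

/-- The interior of the page is symplectic. -/
theorem exists_symp_ne_zero (hx : x ∈ pageInterior c) {v : Phase} (hv : v ∈ tangentPage c x)
    (hv0 : v ≠ 0) : ∃ w ∈ tangentPage c x, symp v w ≠ 0 := by
  have hxs := energySurface_subset hx.1
  obtain ⟨hvt, hv3, hvQ⟩ := hv
  obtain ⟨y, hy, hpos⟩ := exists_symp_pos hxs hvt hv0
  have hX := hamField_mem (c := c) hxs
  set X := hamField c x with hXdef
  -- Within the tangent space of `T*S³`, the tangent space of the page is the `ω`-orthogonal
  -- complement of the Hamiltonian field `X` and of `e`. Here `ω(X, e) ≠ 0`, because `X` crosses the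
  -- page transversally. Projecting `y` off `X` and `e` does not change its pairing with `v`.
  set e : Phase := (0, EuclideanSpace.single 3 1) with he
  have het : e ∈ tangentCotangentSphere x := by
    rw [mem_tangentCotangentSphere]
    simp [he, hx.2.1]
  have hX3 : X.1 3 ≠ 0 := by
    have hf : moserFactor c x ≠ 0 := by
      intro hf
      have h := hx.1
      rw [energySurface_eq hc] at h
      have h2 := h.2.1
      rw [regHam, hf] at h2
      norm_num at h2
    rw [hXdef, hamField_fst, rotGen_three, mul_zero, zero_add]
    exact mul_ne_zero (pow_ne_zero 2 hf) hx.2.2.ne'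
  have hsXv : symp v X = 0 := by
    have := symp_hamField (c := c) hvt
    rw [hvQ] at this
    rw [symp_eq] at this ⊢
    linarith
  have hsev : symp v e = 0 := by
    rw [symp_eq]
    simp [he, hv3]
  have hQX : fderiv ℝ (regHam c) x X = 0 := by
    have := symp_hamField (c := c) hX
    rw [← hXdef, symp_eq] at this
    linarith
  have hQe : fderiv ℝ (regHam c) x e = X.1 3 := by
    have := symp_hamField (c := c) het
    rw [← hXdef, symp_eq] at this
    simp [he] at this
    simpa [he] using this.symm
  set a := y.1 3 / X.1 3 with ha
  set b := fderiv ℝ (regHam c) x y / X.1 3 with hb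
  have hmem : y - a • X - b • e ∈ tangentCotangentSphere x := by
    rw [mem_tangentCotangentSphere] at hy hX het ⊢
    simp only [Prod.fst_sub, Prod.snd_sub, Prod.smul_fst, Prod.smul_snd, PiLp.sub_apply,
      PiLp.smul_apply, smul_eq_mul]
    constructor
    · linear_combination hy.1 - a * hX.1 - b * het.1
    · linear_combination hy.2 - a * hX.2 - b * het.2
  refine ⟨y - a • X - b • e, ⟨hmem, ?_, ?_⟩, ?_⟩
  · simp [he, ha, div_mul_cancel₀ _ hX3]
  · rw [map_sub, map_sub, map_smul, map_smul, hQX, hQe, hb, smul_eq_mul, smul_eq_mul,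
      div_mul_cancel₀ _ hX3]
    ring
  · have : symp v (y - a • X - b • e) = symp v y - a * symp v X - b * symp v e := by
      simp only [symp_eq, Prod.fst_sub, Prod.snd_sub, Prod.smul_fst, Prod.smul_snd, PiLp.sub_apply,
        PiLp.smul_apply, smul_eq_mul]
      ring
    rw [this, hsXv, hsev]
    simpa using hpos.ne'

end lefschetz

/-! ### The critical points -/

section tangent

variable {c : ℝ} (hc : c < -3 / 2) {x : Phase} {m : Model}
include hc

theorem fderiv_lefschetz (hx : x ∈ page c \ binding c) (v : Phase) :
    fderiv ℝ (lefschetz c) x v =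
      fderiv ℝ discProj (pageCoord c x).2.2 (fderiv ℝ (pageCoord c) x v).2.2 := by
  have h1 := ((contDiffAt_pageCoord hc
      (energySurface_subset_chartTarget hc hx.1.1)).differentiableAt
    (by simp)).hasFDerivAt
  have h2 := (hasFDerivAt_discProj (radius_add_pageCoord_pos hc hx)).comp x h1.snd.snd
  exact congrArg (fun L : Phase →L[ℝ] ℂ => L v) h2.fderiv

/-- The fibers of the page are described by the model. -/
theorem fderiv_lefschetz_pageChart (hm : m ∈ quadric) (h0 : m.2.2 ≠ 0) (ht : 0 ≤ m.2.2.2)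
    (u : Model) : fderiv ℝ (lefschetz c) (pageChart c m) (fderiv ℝ (pageChart c) m u) =
      fderiv ℝ discProj m.2.2 u.2.2 := by
  have hs := embed_mem_chartSource hc hm
  have hx : pageChart c m ∈ page c \ binding c :=
    (mem_page_diff_iff hc).2 ⟨(pageChart_mem_page_iff hc hm).2 ht,
      by rwa [pageCoord_pageChart hc hs]⟩
  rw [fderiv_lefschetz hc hx, fderiv_pageCoord_fderiv_pageChart hc hm, pageCoord_pageChart hc hs]

omit hc in
-- With the `α`-component zero, the cone equation is solved for the `β`-component because `α ≠ 0`.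
-- The size equation is then restored by a multiple of `(0, 2β, Z, t)`, which is tangent to the cone
-- and moves `(Z, t)` only radially.
theorem exists_tangentQuadric (h : m.1 ≠ 0) (v : ℂ × ℝ) (hw : m.2.2 ≠ 0) (hm : m ∈ quadric) :
    ∃ u ∈ tangentQuadric m, ∃ a : ℝ, u.2.2 = v + a • m.2.2 := by
  obtain ⟨α, β, Z, t⟩ := m
  obtain ⟨V, s⟩ := v
  simp only at h hw
  have hr := radius_pos hw
  have hr2 := radius_sq (Z, t)
  have hm1 : α * β + Z ^ 2 = (t : ℂ) ^ 2 := hm.1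
  simp only at hr2
  set b := (2 * t * s - 2 * Z * V) / α with hb
  have hb' : α * b = 2 * t * s - 2 * Z * V := mul_div_cancel₀ _ h
  have hpos : 0 < normSq β + radius (Z, t) ^ 2 :=
    add_pos_of_nonneg_of_pos (Complex.normSq_nonneg _) (by positivity)
  set a := -((β.re * b.re + β.im * b.im) + 2 * (Z.re * V.re + Z.im * V.im) + 2 * t * s) /
    (2 * (normSq β + radius (Z, t) ^ 2)) with ha
  have ha' : a * (2 * (normSq β + radius (Z, t) ^ 2)) =
      -((β.re * b.re + β.im * b.im) + 2 * (Z.re * V.re + Z.im * V.im) + 2 * t * s) :=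
    div_mul_cancel₀ _ (by positivity)
  refine ⟨(0, b + (2 * a) • β, V + a • Z, s + a * t), ⟨?_, ?_⟩, a, rfl⟩
  · simp only [Complex.real_smul]
    push_cast
    linear_combination hb' + 2 * a * hm1
  · rw [hr2] at ha'
    simp only [Complex.normSq_apply] at ha'
    simp only [Complex.zero_re, Complex.zero_im, Complex.add_re, Complex.add_im, Complex.smul_re,
      Complex.smul_im, smul_eq_mul]
    linear_combination ha'

omit hc in
theorem swap_mem_quadric (hm : m ∈ quadric) : ((m.2.1, m.1, m.2.2) : Model) ∈ quadric := by
  obtain ⟨h1, h2⟩ := hm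
  refine ⟨?_, ?_⟩
  · simp only
    linear_combination h1
  · simp only
    linear_combination h2

omit hc in
theorem swap_mem_tangentQuadric {u : Model}
    (hu : u ∈ tangentQuadric (m.2.1, m.1, m.2.2)) :
    ((u.2.1, u.1, u.2.2) : Model) ∈ tangentQuadric m := by
  obtain ⟨h1, h2⟩ := hu
  refine ⟨?_, ?_⟩
  · simp only at h1 ⊢
    linear_combination h1
  · simp only at h2 ⊢
    linear_combination h2

/-- Every direction of `(Z, t)` lifts to the page up to a radial multiple, which `discProj` does not
see. The roles of `α` and `β` are symmetric. -/
theorem not_mem_criticalSet (hm : m ∈ quadric) (h0 : m.2.2 ≠ 0) (ht : 0 ≤ m.2.2.2)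
    (h : m.1 ≠ 0 ∨ m.2.1 ≠ 0) (w : ℂ) : ∃ v ∈ tangentPage c (pageChart c m),
      fderiv ℝ (lefschetz c) (pageChart c m) v = w := by
  have hr := radius_add_pos h0 ht
  obtain ⟨v, hv⟩ := exists_fderiv_discProj_eq hr w
  have key : ∃ u ∈ tangentQuadric m, ∃ a : ℝ, u.2.2 = v + a • m.2.2 := by
    rcases h with h | h
    · exact exists_tangentQuadric h v h0 hm
    · obtain ⟨u, hu, a, ha⟩ := exists_tangentQuadric (m := (m.2.1, m.1, m.2.2)) h v h0
        (swap_mem_quadric hm)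
      exact ⟨_, swap_mem_tangentQuadric hu, a, ha⟩
  obtain ⟨u, hu, a, ha⟩ := key
  refine ⟨_, fderiv_pageChart_mem hc hm hu, ?_⟩
  rw [fderiv_lefschetz_pageChart hc hm h0 ht, ha, map_add, map_smul, fderiv_discProj_self hr, hv,
    smul_zero, add_zero]

omit hc in
theorem quadric_pole (hm : m ∈ quadric) (ht : 0 ≤ m.2.2.2) (h1 : m.1 = 0) (h2 : m.2.1 = 0) :
    m = (0, 0, ((1 : ℝ) : ℂ), 1) ∨ m = (0, 0, ((-1 : ℝ) : ℂ), 1) := by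
  obtain ⟨α, β, Z, t⟩ := m
  obtain ⟨e1, e2⟩ := hm
  simp only at h1 h2 ht e1 e2
  subst h1 h2
  rw [zero_mul, zero_add] at e1
  simp only [map_zero] at e2
  have ht1 : t = 1 := by
    have h3 : normSq Z = t ^ 2 := by
      rcases sq_eq_sq_iff_eq_or_eq_neg.1 e1 with h | h <;> rw [h]
      · rw [Complex.normSq_ofReal, pow_two]
      · rw [Complex.normSq_neg, Complex.normSq_ofReal, pow_two]
    rw [h3] at e2
    nlinarith
  subst ht1
  rcases sq_eq_sq_iff_eq_or_eq_neg.1 e1 with h | h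
  · exact Or.inl (by rw [h])
  · exact Or.inr (by rw [h]; push_cast; rfl)

/-- Where `α = β = 0` the cone and size equations together force the `(Z, t)`-component of a tangent
vector to vanish, so `dπ = 0`. Everywhere else `dπ` is onto. -/
theorem criticalSet_lefschetz : criticalSet c (range (directOrbit c)) (range (retrogradeOrbit c))
    (lefschetz c) = {poleNorth, poleSouth c} := by
  rw [← pageChart_north hc, ← pageChart_south hc]
  have hpole : ∀ ε : ℝ, ε ^ 2 = 1 → pageChart c (0, 0, (ε : ℂ), 1) ∈ criticalSet c
      (range (directOrbit c)) (range (retrogradeOrbit c)) (lefschetz c) := by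
    intro ε hε
    have hm := pole_mem_quadric hε
    have h0 : ((0, 0, (ε : ℂ), 1) : Model).2.2 ≠ 0 := fun h => by simpa using (Prod.ext_iff.1 h).2
    have hs := embed_mem_chartSource hc hm
    have hp : pageChart c (0, 0, (ε : ℂ), 1) ∈ page c :=
      (pageChart_mem_page_iff hc hm).2 zero_le_one
    have hx : pageChart c (0, 0, (ε : ℂ), 1) ∈ page c \ binding c :=
      (mem_page_diff_iff hc).2 ⟨hp, by rwa [pageCoord_pageChart hc hs]⟩
    refine ⟨hx, fun h => ?_⟩
    obtain ⟨v, hv, hv1⟩ := h 1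
    rw [fderiv_lefschetz hc hx] at hv1
    have ht := (fderiv_pageCoord_mem hc hp.1 hp.2.1 hv).1
    rw [pageCoord_pageChart hc hs] at ht hv1
    set u := fderiv ℝ (pageCoord c) (pageChart c (0, 0, (ε : ℂ), 1)) v
    have hu : u.2.2 = 0 := by
      obtain ⟨g1, g2⟩ := ht
      simp only [zero_mul, zero_add, Complex.zero_re, Complex.zero_im, Complex.ofReal_re,
        Complex.ofReal_im] at g1 g2
      have g3 := congrArg Complex.re g1
      have g4 := congrArg Complex.im g1
      simp at g3 g4
      have hε0 : ε ≠ 0 := fun h => by rw [h] at hε; norm_num at hε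
      have hr : u.2.2.2 = 0 := by linarith
      refine Prod.ext (Complex.ext ?_ ?_) hr
      · rw [hr, mul_zero, mul_eq_zero] at g3
        exact g3.resolve_left (by simpa using hε0)
      · exact g4.resolve_left hε0
    rw [hu, map_zero] at hv1
    exact zero_ne_one hv1
  ext x
  constructor
  · rintro ⟨hx, hcrit⟩
    obtain ⟨q1, q2, q3⟩ := pageCoord_page hc hx.1
    have h0 := ((mem_page_diff_iff hc).1 hx).2
    by_cases h : (pageCoord c x).1 ≠ 0 ∨ (pageCoord c x).2.1 ≠ 0
    · refine absurd (not_mem_criticalSet hc q1 h0 q2 h) ?_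
      rwa [q3]
    · push Not at h
      rcases quadric_pole q1 q2 h.1 h.2 with h' | h'
      · rw [← q3, h']
        exact Or.inl rfl
      · rw [← q3, h']
        exact Or.inr rfl
  · rintro (rfl | rfl)
    · exact hpole 1 (by norm_num)
    · exact hpole (-1) (by norm_num)

theorem lefschetz_pole {ε : ℝ} (hε : ε ^ 2 = 1) :
    lefschetz c (pageChart c (0, 0, (ε : ℂ), 1)) = ((ε * (√2 - 1) : ℝ) : ℂ) := by
  have hm := pole_mem_quadric hε
  rw [lefschetz, pageCoord_pageChart hc (embed_mem_chartSource hc hm), discProj, radius]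
  have h2 : √(normSq (ε : ℂ) + 1 ^ 2) = √2 := by
    rw [Complex.normSq_ofReal, ← pow_two, hε]
    norm_num
  simp only [h2, Complex.conj_ofReal]
  rw [← Complex.ofReal_div]
  congr 1
  have h3 : √2 + 1 ≠ 0 := by positivity
  rw [div_eq_iff h3]
  have h4 := Real.sq_sqrt (zero_le_two (α := ℝ))
  linear_combination (-ε) * h4

theorem lefschetz_injOn_criticalSet : InjOn (lefschetz c)
    (criticalSet c (range (directOrbit c)) (range (retrogradeOrbit c)) (lefschetz c)) := by
  rw [criticalSet_lefschetz hc, ← pageChart_north hc, ← pageChart_south hc]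
  have h1 := lefschetz_pole hc (ε := 1) (by norm_num)
  have h2 := lefschetz_pole hc (ε := -1) (by norm_num)
  have hs : 1 < √2 := by
    rw [Real.lt_sqrt zero_le_one]
    norm_num
  have hne : ((1 * (√2 - 1) : ℝ) : ℂ) ≠ ((-1 * (√2 - 1) : ℝ) : ℂ) := by
    rw [Ne, Complex.ofReal_inj]
    intro h
    linarith
  rintro x (rfl | rfl) y (rfl | rfl) h
  · rfl
  · rw [h1, h2] at h
    exact absurd h hne
  · rw [h1, h2] at h
    exact absurd h.symm hne
  · rfl

theorem criticalSet_subset_pageInterior :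
    criticalSet c (range (directOrbit c)) (range (retrogradeOrbit c)) (lefschetz c) ⊆
      pageInterior c := by
  rw [criticalSet_lefschetz hc, ← pageChart_north hc, ← pageChart_south hc]
  rintro x (rfl | rfl)
  · exact (pageChart_mem_pageInterior_iff hc (pole_mem_quadric (by norm_num))).2 one_pos
  · exact (pageChart_mem_pageInterior_iff hc (pole_mem_quadric (by norm_num))).2 one_pos

end tangent

/-! ### The fibers are symplectic -/

/-- The vector field that generates the rotations. -/
def rotField (x : Phase) : Phase := (rotGen x.1, rotGen x.2)

/-- The moment is the Hamiltonian of the rotations; `ω` on the fibers is evaluated through this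
identity alone. -/
theorem symp_rotField (x v : Phase) : symp v (rotField x) = fderiv ℝ rotMoment x v := by
  rw [fderiv_rotMoment, symp_eq]
  simp only [rotField, rotGen_zero, rotGen_one, rotGen_two, rotGen_three]
  ring

theorem hasDerivAt_rotate (x : Phase) : HasDerivAt (fun s => rotate s x) (rotField x) 0 := by
  have hc := Real.hasDerivAt_cos 0
  have hs := Real.hasDerivAt_sin 0
  simp only [Real.sin_zero, neg_zero, Real.cos_zero] at hc hs
  apply hasDerivAt_phase <;> intro i <;> fin_cases i
  · exact hasDerivAt_const 0 _
  · exact ((hc.mul_const (x.1 1)).add (hs.mul_const (x.1 2))).congr_deriv (by simp [rotField])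
  · exact ((hc.mul_const (x.1 2)).sub (hs.mul_const (x.1 1))).congr_deriv (by simp [rotField])
  · exact hasDerivAt_const 0 _
  · exact hasDerivAt_const 0 _
  · exact ((hc.mul_const (x.2 1)).add (hs.mul_const (x.2 2))).congr_deriv (by simp [rotField])
  · exact ((hc.mul_const (x.2 2)).sub (hs.mul_const (x.2 1))).congr_deriv (by simp [rotField])
  · exact hasDerivAt_const 0 _

/-- The vector field that generates the rotations of the model. -/
def rotTangent (m : Model) : Model := (-Complex.I * m.1, Complex.I * m.2.1, 0)

theorem hasDerivAt_rotModel (m : Model) : HasDerivAt (fun s => rotModel s m) (rotTangent m) 0 := by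
  have h1 : HasDerivAt (fun s : ℝ => (s : ℂ) * Complex.I) Complex.I 0 := by
    simpa using Complex.ofRealCLM.hasDerivAt.mul_const Complex.I
  have h2 : HasDerivAt (fun s : ℝ => -(s : ℂ) * Complex.I) (-Complex.I) 0 :=
    h1.neg.congr_of_eventuallyEq (Eventually.of_forall fun s => by simp)
  have e1 := (h2.cexp.mul_const m.1).prodMk ((h1.cexp.mul_const m.2.1).prodMk
    (hasDerivAt_const (0 : ℝ) m.2.2))
  exact e1.congr_deriv (by simp [rotTangent])

theorem rotTangent_mem (m : Model) : rotTangent m ∈ tangentQuadric m := by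
  refine ⟨?_, ?_⟩
  · simp [rotTangent]
    ring
  · simp [rotTangent]
    ring

/-- The derivative of the moment. -/
def momentDeriv (m u : Model) : ℝ :=
  ((m.1.re * u.1.re + m.1.im * u.1.im) - (m.2.1.re * u.2.1.re + m.2.1.im * u.2.1.im)) / 2

theorem hasFDerivAt_moment (m u : Model) :
    HasDerivAt (fun s : ℝ => moment (m + s • u)) (momentDeriv m u) 0 := by
  have h : (fun s : ℝ => moment (m + s • u)) = fun s : ℝ =>
      (((m.1.re + s * u.1.re) * (m.1.re + s * u.1.re) + (m.1.im + s * u.1.im) *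
        (m.1.im + s * u.1.im)) - ((m.2.1.re + s * u.2.1.re) * (m.2.1.re + s * u.2.1.re) +
          (m.2.1.im + s * u.2.1.im) * (m.2.1.im + s * u.2.1.im))) / 4 := by
    funext s
    simp [moment, Complex.normSq_apply]
  have hl : ∀ a b : ℝ, HasDerivAt (fun s : ℝ => a + s * b) b 0 := fun a b => by
    simpa using ((hasDerivAt_id (0 : ℝ)).mul_const b).const_add a
  have hsq : ∀ a b : ℝ, HasDerivAt (fun s : ℝ => (a + s * b) * (a + s * b)) (2 * (a * b)) 0 :=
    fun a b => ((hl a b).mul (hl a b)).congr_deriv (by simp; ring)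
  rw [h]
  refine ((((hsq _ _).add (hsq _ _)).sub ((hsq _ _).add (hsq _ _))).div_const 4).congr_deriv ?_
  rw [momentDeriv]
  ring

section symp

variable {c : ℝ} (hc : c < -3 / 2) {m : Model}
include hc

/-- By the cubic `s/k = k²/2 + c`. Its derivative is positive, so the moment on `Σ_c` increases with
the normalized moment. -/
theorem hasDerivAt_div_freq {s : ℝ} (hs : -minFreq c ^ 3 < s) :
    HasDerivAt (fun s => s / freq c s) (2 * freq c s / (3 * freq c s ^ 2 + 2 * c)) s := by
  obtain ⟨h1, h2⟩ := freq_spec hc hs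
  have h3 := freq_deriv_pos hc h1
  have h4 := one_lt_minFreq hc
  have hk : freq c s ≠ 0 := by linarith
  refine ((hasDerivAt_id s).div (contDiffAt_freq hc hs).2 hk).congr_deriv ?_
  have h5 : 3 * freq c s ^ 2 + 2 * c ≠ 0 := by linarith
  have h6 : s * (2 / (3 * freq c s ^ 2 + 2 * c)) * (3 * freq c s ^ 2 + 2 * c) = s * 2 := by
    rw [mul_assoc, div_mul_cancel₀ _ h5]
  rw [div_eq_div_iff (pow_ne_zero 2 hk) h5]
  simp only [id]
  linear_combination h2 - h6

theorem fderiv_pageChart_rotTangent (hm : m ∈ quadric) :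
    fderiv ℝ (pageChart c) m (rotTangent m) = rotField (pageChart c m) := by
  have hd : HasFDerivAt (pageChart c) (fderiv ℝ (pageChart c) m) (rotModel 0 m) := by
    have : rotModel 0 m = m := by simp [rotModel]
    rw [this]
    exact ((contDiffAt_pageChart hc hm).differentiableAt (by simp)).hasFDerivAt
  have h := hd.comp_hasDerivAt 0 (hasDerivAt_rotModel m)
  refine h.unique ((hasDerivAt_rotate (pageChart c m)).congr_of_eventuallyEq ?_)
  exact Eventually.of_forall fun s => pageChart_rotModel s m

/-- The symplectic form in the direction of the rotations. -/
theorem exists_symp_rotTangent (hm : m ∈ quadric) : ∃ a : ℝ, 0 < a ∧ ∀ u : Model,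
    symp (fderiv ℝ (pageChart c) m u) (fderiv ℝ (pageChart c) m (rotTangent m)) =
      a * momentDeriv m u := by
  have hs := embed_mem_chartSource hc hm
  have hs1 : -minFreq c ^ 3 < moment m := by
    rw [← rotMoment_embed]
    exact hs.1
  have hd := ((contDiffAt_pageChart hc hm).differentiableAt (by simp)).hasFDerivAt
  obtain ⟨h1, h2⟩ := freq_spec hc hs1
  have h3 := freq_deriv_pos hc h1
  have h4 := one_lt_minFreq hc
  refine ⟨2 * freq c (moment m) / (3 * freq c (moment m) ^ 2 + 2 * c),
    div_pos (by linarith) (by linarith), fun u => ?_⟩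
  rw [fderiv_pageChart_rotTangent hc hm, symp_rotField]
  have hl : HasDerivAt (fun t : ℝ => m + t • u) u 0 := by
    simpa using ((hasDerivAt_id (0 : ℝ)).smul_const u).const_add m
  have hd0 : HasFDerivAt (pageChart c) (fderiv ℝ (pageChart c) m) (m + (0 : ℝ) • u) := by
    simpa using hd
  have hR : HasFDerivAt rotMoment (fderiv ℝ rotMoment (pageChart c m))
      (pageChart c (m + (0 : ℝ) • u)) := by
    simpa using (contDiff_rotMoment.differentiable (n := 1) (by simp) _).hasFDerivAt
  have g0 : HasDerivAt (fun t : ℝ => pageChart c (m + t • u)) (fderiv ℝ (pageChart c) m u) 0 := by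
    have := hd0.comp_hasDerivAt 0 hl
    exact this
  have g1 : HasDerivAt (fun t : ℝ => rotMoment (pageChart c (m + t • u)))
      (fderiv ℝ rotMoment (pageChart c m) (fderiv ℝ (pageChart c) m u)) 0 := by
    have := hR.comp_hasDerivAt 0 g0
    exact this
  have g2 : HasDerivAt (fun s => s / freq c s) (2 * freq c (moment m) /
      (3 * freq c (moment m) ^ 2 + 2 * c)) (moment (m + (0 : ℝ) • u)) := by
    simpa using hasDerivAt_div_freq hc hs1
  refine g1.unique ((g2.comp 0 (hasFDerivAt_moment m u)).congr_of_eventuallyEq ?_)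
  have hev : ∀ᶠ t : ℝ in 𝓝 0, embed (m + t • u) ∈ chartSource c :=
    (embed.continuous.continuousAt.comp hl.continuousAt).eventually
      ((isOpen_chartSource hc).mem_nhds (by simpa using hs))
  filter_upwards [hev] with t ht
  rw [pageChart, rotMoment_chart hc ht, rotMoment_embed]
  rfl

omit hc in
/-- A vertical tangent vector on which the derivative of the moment vanishes is a multiple of the
generator of the rotations. -/
theorem exists_eq_smul_rotTangent (hm : m ∈ quadric) (h0 : m.2.2 ≠ 0)
    (h : m.1 ≠ 0 ∨ m.2.1 ≠ 0) {u : Model} (hu : u ∈ tangentQuadric m) {μ : ℝ}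
    (hμ : u.2.2 = μ • m.2.2) (hL : momentDeriv m u = 0) : ∃ s : ℝ, u = s • rotTangent m := by
  obtain ⟨α, β, Z, t⟩ := m
  obtain ⟨a, b, V, s⟩ := u
  obtain ⟨h1, h2⟩ := Prod.ext_iff.1 hμ
  obtain ⟨g1, g2⟩ := hu
  obtain ⟨q1, -⟩ := hm
  simp only [Prod.smul_mk, Complex.real_smul, smul_eq_mul] at h0 h h1 h2 g1 g2 q1
  subst h1 h2
  rw [momentDeriv] at hL
  simp only at hL
  have hr := radius_pos h0
  have hr2 := radius_sq (Z, t)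
  simp only at hr2
  set ρ := α.re * a.re + α.im * a.im with hρ
  have hρ' : β.re * b.re + β.im * b.im = ρ := by linarith
  have e1 : ρ = -μ * radius (Z, t) ^ 2 := by
    rw [hr2, Complex.normSq_apply]
    simp only [Complex.re_ofReal_mul, Complex.im_ofReal_mul] at g2
    rw [hρ'] at g2
    linarith
  have g3 : α * b + β * a = 2 * μ * (α * β) := by
    push_cast at g1
    linear_combination g1 - 2 * μ * q1
  have g3r := congrArg Complex.re g3
  have g3i := congrArg Complex.im g3
  simp at g3r g3i
  -- The real part of the linearized cone equation times the conjugate of `αβ`. Together with `ρ =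
  -- -μ |(Z, t)|²` from the size equation it forces `μ = 0`.
  have e2 : ρ * (normSq α + normSq β) = 2 * μ * (normSq α * normSq β) := by
    simp only [Complex.normSq_apply]
    linear_combination (α.re * α.re + α.im * α.im) * (-hρ') + (-(β.re * β.re + β.im * β.im)) * hρ +
      (α.re * β.re - α.im * β.im) * g3r + (α.re * β.im + α.im * β.re) * g3i
  have hμ0 : μ = 0 := by
    have hpos : 0 < normSq α + normSq β := by
      have h1 := Complex.normSq_nonneg α
      have h2 := Complex.normSq_nonneg β
      rcases h with h | h
      · exact add_pos_of_pos_of_nonneg (Complex.normSq_pos.2 h) h2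
      · exact add_pos_of_nonneg_of_pos h1 (Complex.normSq_pos.2 h)
    have h3 : 0 < radius (Z, t) ^ 2 * (normSq α + normSq β) + 2 * (normSq α * normSq β) :=
      add_pos_of_pos_of_nonneg (mul_pos (by positivity) hpos)
        (by have := mul_nonneg (Complex.normSq_nonneg α) (Complex.normSq_nonneg β); linarith)
    rw [e1] at e2
    have h4 : μ * (radius (Z, t) ^ 2 * (normSq α + normSq β) + 2 * (normSq α * normSq β)) = 0 := by
      linear_combination -e2
    exact (mul_eq_zero.1 h4).resolve_right h3.ne'
  subst hμ0
  have hρ0 : ρ = 0 := by rw [e1]; ring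
  have g4 : α * b + β * a = 0 := by rw [g3]; simp
  rcases h with h | h
  · have hn : normSq α ≠ 0 := (Complex.normSq_pos.2 h).ne'
    set σ := (α.im * a.re - α.re * a.im) / normSq α with hσ
    have hσ' : σ * normSq α = α.im * a.re - α.re * a.im := div_mul_cancel₀ _ hn
    have ha : a = σ * (-Complex.I * α) := by
      have : (starRingEnd ℂ α) ≠ 0 := by simpa using h
      apply mul_left_cancel₀ this
      rw [Complex.normSq_apply] at hσ'
      rw [hρ] at hρ0
      apply Complex.ext <;> simp
      · linear_combination hρ0
      · linear_combination hσ'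
    refine ⟨σ, ?_⟩
    have hb : b = σ * (Complex.I * β) := by
      apply mul_left_cancel₀ h
      linear_combination g4 - β * ha
    simp [rotTangent, ha, hb]
  · have hn : normSq β ≠ 0 := (Complex.normSq_pos.2 h).ne'
    set σ := (β.re * b.im - β.im * b.re) / normSq β with hσ
    have hσ' : σ * normSq β = β.re * b.im - β.im * b.re := div_mul_cancel₀ _ hn
    have hb : b = σ * (Complex.I * β) := by
      have : (starRingEnd ℂ β) ≠ 0 := by simpa using h
      apply mul_left_cancel₀ this
      rw [Complex.normSq_apply] at hσ'
      rw [hρ0] at hρ'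
      apply Complex.ext <;> simp
      · linear_combination hρ'
      · linear_combination -hσ'
    refine ⟨σ, ?_⟩
    have ha : a = σ * (-Complex.I * α) := by
      apply mul_left_cancel₀ h
      linear_combination g4 - α * hb
    simp [rotTangent, ha, hb]

omit hc in
-- The vector stretches `α` and shrinks `β`. Its coefficients are chosen so that a radial change of
-- `(Z, t)` restores both the cone and the size equation.
theorem exists_momentDeriv_pos (hm : m ∈ quadric) (h0 : m.2.2 ≠ 0) (h : m.1 ≠ 0 ∨ m.2.1 ≠ 0) :
    ∃ u ∈ tangentQuadric m, 0 < momentDeriv m u ∧ ∃ a : ℝ, u.2.2 = a • m.2.2 := by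
  obtain ⟨α, β, Z, t⟩ := m
  have q1 : α * β + Z ^ 2 = (t : ℂ) ^ 2 := hm.1
  simp only at h0 h
  have hr := radius_pos h0
  have hr2 := radius_sq (Z, t)
  simp only at hr2
  have nα := Complex.normSq_nonneg α
  have nβ := Complex.normSq_nonneg β
  set S := radius (Z, t) ^ 2 with hS
  have hS0 : 0 < S := by positivity
  refine ⟨((normSq β + S) • α, (-(normSq α + S)) • β,
    ((normSq β - normSq α) / 2) • (Z, t)), ⟨?_, ?_⟩, ?_, _, rfl⟩
  · simp only [Complex.real_smul, Prod.smul_mk, smul_eq_mul]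
    push_cast
    linear_combination ((normSq β : ℂ) - normSq α) * q1
  · simp only [Complex.smul_re, Complex.smul_im, Prod.smul_mk, smul_eq_mul]
    rw [hr2]
    simp only [Complex.normSq_apply]
    ring
  · rw [momentDeriv]
    simp only [Complex.smul_re, Complex.smul_im, smul_eq_mul]
    have hpos : 0 < normSq α + normSq β := by
      rcases h with h | h
      · exact add_pos_of_pos_of_nonneg (Complex.normSq_pos.2 h) nβ
      · exact add_pos_of_nonneg_of_pos nα (Complex.normSq_pos.2 h)
    have : (α.re * ((normSq β + S) * α.re) + α.im * ((normSq β + S) * α.im) -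
        (β.re * (-(normSq α + S) * β.re) + β.im * (-(normSq α + S) * β.im))) / 2 =
        (2 * (normSq α * normSq β) + S * (normSq α + normSq β)) / 2 := by
      simp only [Complex.normSq_apply]
      ring
    rw [this]
    have h1 := mul_nonneg nα nβ
    have h2 := mul_pos hS0 hpos
    linarith

omit hc in
theorem symp_smul_left (a : ℝ) (v w : Phase) : symp (a • v) w = a * symp v w := by
  simp only [symp_eq, Prod.smul_fst, Prod.smul_snd, PiLp.smul_apply, smul_eq_mul]
  ring

omit hc in
theorem symp_swap (v w : Phase) : symp v w = -symp w v := by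
  simp only [symp_eq]
  ring

/-- A vertical vector that changes the moment pairs nontrivially with the generator of the
rotations. One that does not is a multiple of this generator and pairs with a vertical vector that
changes the moment. -/
theorem exists_symp_ne_zero_fiber {x : Phase} (hx : x ∈ (page c \ binding c) \ criticalSet c
      (range (directOrbit c)) (range (retrogradeOrbit c)) (lefschetz c)) {v : Phase}
    (hv : v ∈ tangentPage c x) (hv0 : fderiv ℝ (lefschetz c) x v = 0) (hne : v ≠ 0) :
    ∃ w ∈ tangentPage c x, fderiv ℝ (lefschetz c) x w = 0 ∧ symp v w ≠ 0 := by
  obtain ⟨hx, hcrit⟩ := hx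
  obtain ⟨q1, q2, q3⟩ := pageCoord_page hc hx.1
  have h0 := ((mem_page_diff_iff hc).1 hx).2
  have hr := radius_add_pageCoord_pos hc hx
  obtain ⟨hu, huv⟩ := fderiv_pageCoord_mem hc hx.1.1 hx.1.2.1 hv
  rw [fderiv_lefschetz hc hx] at hv0
  set m := pageCoord c x with hmdef
  set u := fderiv ℝ (pageCoord c) x v with hudef
  have h : m.1 ≠ 0 ∨ m.2.1 ≠ 0 := by
    by_contra! h
    refine hcrit ?_
    rw [criticalSet_lefschetz hc, ← pageChart_north hc, ← pageChart_south hc, ← q3]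
    rcases quadric_pole q1 q2 h.1 h.2 with h' | h'
    · exact Or.inl (by rw [h'])
    · exact Or.inr (by rw [h']; rfl)
  have hvert : ∀ w : Model, (∃ a : ℝ, w.2.2 = a • m.2.2) →
      fderiv ℝ (lefschetz c) x (fderiv ℝ (pageChart c) m w) = 0 := by
    rintro w ⟨a, ha⟩
    have := fderiv_lefschetz_pageChart hc q1 h0 q2 w
    rw [q3] at this
    rw [this, ha, map_smul, fderiv_discProj_self hr, smul_zero]
  have htan : ∀ w ∈ tangentQuadric m, fderiv ℝ (pageChart c) m w ∈ tangentPage c x :=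
    fun w hw => by
      have := fderiv_pageChart_mem hc q1 hw
      rwa [q3] at this
  obtain ⟨μ, hμ⟩ := exists_smul_of_fderiv_discProj hr hv0
  obtain ⟨a, ha, hsymp⟩ := exists_symp_rotTangent hc q1
  by_cases hL : momentDeriv m u = 0
  · obtain ⟨s, hs⟩ := exists_eq_smul_rotTangent q1 h0 h hu hμ hL
    obtain ⟨w, hw, hwpos, hwv⟩ := exists_momentDeriv_pos q1 h0 h
    refine ⟨_, htan w hw, hvert w hwv, ?_⟩
    have hs0 : s ≠ 0 := fun h => hne (by rw [← huv, hs, h, zero_smul, map_zero])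
    rw [← huv, hs, map_smul, symp_smul_left, symp_swap, hsymp]
    exact mul_ne_zero hs0 (neg_ne_zero.2 (mul_pos ha hwpos).ne')
  · refine ⟨_, htan _ (rotTangent_mem m), hvert _ ⟨0, by simp [rotTangent]⟩, ?_⟩
    rw [← huv, hsymp]
    exact mul_ne_zero ha.ne' hL

end symp

/-! ### The return map preserves the fibers -/

section invariance

variable {c : ℝ} (hc : c < -3 / 2) {x : Phase}

theorem lefschetz_rotate (s : ℝ) (x : Phase) : lefschetz c (rotate s x) = lefschetz c x := by
  rw [lefschetz, pageCoord_rotate]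
  rfl

include hc

theorem rotate_mem_page_diff (s : ℝ) (hx : x ∈ page c \ binding c) :
    rotate s x ∈ page c \ binding c := by
  rw [mem_page_diff_iff hc] at hx ⊢
  refine ⟨rotate_mem_page hc s hx.1, ?_⟩
  rw [pageCoord_rotate]
  exact hx.2

/-- The angle of the rotation depends only on the moment, which rotations preserve; hence the
opposite rotation gives preimages. -/
theorem returnMap_image_fiber (z : ℂ) :
    returnMap c '' fiber c (range (directOrbit c)) (range (retrogradeOrbit c)) (lefschetz c) z =
      fiber c (range (directOrbit c)) (range (retrogradeOrbit c)) (lefschetz c) z := by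
  have h : ∀ s, ∀ x ∈ fiber c (range (directOrbit c)) (range (retrogradeOrbit c)) (lefschetz c) z,
      rotate s x ∈ fiber c (range (directOrbit c)) (range (retrogradeOrbit c)) (lefschetz c) z :=
    fun s x hx => ⟨rotate_mem_page_diff hc s hx.1, (lefschetz_rotate s x).trans hx.2⟩
  apply Subset.antisymm
  · rintro _ ⟨x, hx, rfl⟩
    exact h _ x hx
  · intro x hx
    refine ⟨rotate (-(2 * Real.pi / keplerFreq c x ^ 3)) x, h _ x hx, ?_⟩
    rw [returnMap, keplerFreq_rotate, rotate_rotate, add_neg_cancel, rotate_zero]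

end invariance

/-! ### Rescaling points of the cone over the model -/

/-- The quadratic form that is constant on the model. -/
def sizeSq (v : Model) : ℝ := normSq v.1 + normSq v.2.1 + 2 * normSq v.2.2.1 + 2 * v.2.2.2 ^ 2

/-- The positive multiple of a vector on which `sizeSq` is `4`. -/
def rescale (v : Model) : Model := (2 / √(sizeSq v)) • v

theorem sizeSq_smul (a : ℝ) (v : Model) : sizeSq (a • v) = a ^ 2 * sizeSq v := by
  simp only [sizeSq, Prod.smul_fst, Prod.smul_snd, Complex.real_smul, map_mul,
    Complex.normSq_ofReal, smul_eq_mul]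
  ring

theorem rescale_mem {v : Model} (hv : v.1 * v.2.1 + v.2.2.1 ^ 2 = (v.2.2.2 : ℂ) ^ 2)
    (h : 0 < sizeSq v) : rescale v ∈ quadric := by
  have h1 : sizeSq (rescale v) = 4 := by
    rw [rescale, sizeSq_smul, div_pow, Real.sq_sqrt h.le]
    field_simp
    norm_num
  refine ⟨?_, h1⟩
  simp only [rescale, Prod.smul_fst, Prod.smul_snd, Complex.real_smul, smul_eq_mul]
  push_cast
  linear_combination (2 / (√(sizeSq v) : ℂ)) ^ 2 * hv

theorem rescale_smul {a : ℝ} (ha : 0 < a) (v : Model) : rescale (a • v) = rescale v := by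
  rw [rescale, rescale, sizeSq_smul, Real.sqrt_mul (sq_nonneg a), Real.sqrt_sq ha.le, smul_smul]
  congr 1
  field_simp

theorem rescale_of_mem {m : Model} (hm : m ∈ quadric) : rescale m = m := by
  have h : sizeSq m = 2 ^ 2 := by
    rw [sizeSq, hm.2]
    norm_num
  rw [rescale, h, Real.sqrt_sq zero_le_two, div_self two_ne_zero, one_smul]

theorem contDiff_sizeSq : ContDiff ℝ ∞ sizeSq := by
  have h1 : ContDiff ℝ ∞ fun v : Model => normSq v.1 := contDiff_normSq.comp contDiff_fst
  have h2 : ContDiff ℝ ∞ fun v : Model => normSq v.2.1 := contDiff_normSq.comp (by fun_prop)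
  have h3 : ContDiff ℝ ∞ fun v : Model => normSq v.2.2.1 := contDiff_normSq.comp (by fun_prop)
  have h4 : ContDiff ℝ ∞ fun v : Model => v.2.2.2 ^ 2 := by fun_prop
  exact ((h1.add h2).add (contDiff_const.mul h3)).add (contDiff_const.mul h4)

theorem contDiffAt_rescale {v : Model} (h : 0 < sizeSq v) : ContDiffAt ℝ ∞ rescale v :=
  (contDiffAt_const.div (contDiff_sizeSq.contDiffAt.sqrt h.ne') (Real.sqrt_pos.2 h).ne').smul
    contDiffAt_id

theorem rescale_scale_pos {v : Model} (h : 0 < sizeSq v) : 0 < 2 / √(sizeSq v) :=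
  div_pos two_pos (Real.sqrt_pos.2 h)

theorem isCompact_quadric : IsCompact quadric := by
  have h1 : ∀ m : Model, m ∈ quadric ↔
      m.1 * m.2.1 + m.2.2.1 ^ 2 = (m.2.2.2 : ℂ) ^ 2 ∧ sizeSq m = 4 := fun m => Iff.rfl
  have hcl : IsClosed quadric := by
    have : quadric = {m : Model | m.1 * m.2.1 + m.2.2.1 ^ 2 = (m.2.2.2 : ℂ) ^ 2} ∩
        {m | sizeSq m = 4} := rfl
    rw [this]
    refine (isClosed_eq (by fun_prop) ?_).inter
      (isClosed_eq contDiff_sizeSq.continuous continuous_const)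
    exact (Complex.continuous_ofReal.comp (by fun_prop)).pow 2
  refine Metric.isCompact_of_isClosed_isBounded hcl
    ((Metric.isBounded_closedBall (x := (0 : Model)) (r := 2)).subset fun m hm => ?_)
  have h2 := hm.2
  have n1 := Complex.normSq_nonneg m.1
  have n2 := Complex.normSq_nonneg m.2.1
  have n3 := Complex.normSq_nonneg m.2.2.1
  have n4 := sq_nonneg m.2.2.2
  have hb : ∀ w : ℂ, normSq w ≤ 4 → ‖w‖ ≤ 2 := fun w hw => by
    rw [Complex.normSq_eq_norm_sq] at hw
    nlinarith [norm_nonneg w]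
  rw [mem_closedBall_zero_iff]
  refine max_le (hb _ (by linarith)) (max_le (hb _ (by linarith)) (max_le (hb _ (by linarith)) ?_))
  rw [Real.norm_eq_abs]
  exact abs_le_of_sq_le_sq (by nlinarith) zero_le_two

/-! ### The closures of the fibers -/

/-- The discriminant of the fiber over the projection of `w`. -/
def pencil (w : ℂ × ℝ) : ℂ := (w.2 : ℂ) ^ 2 - w.1 ^ 2

theorem discLift_ne_zero (z : ℂ) : discLift z ≠ 0 := fun h => by
  have := radius_discLift z
  rw [h] at this
  simp [radius] at this

theorem discLift_snd_nonneg {z : ℂ} (hz : z ∈ closedBall (0 : ℂ) 1) : 0 ≤ (discLift z).2 := by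
  rw [mem_closedBall_zero_iff] at hz
  refine div_nonneg ?_ (one_add_normSq_pos z).le
  rw [Complex.normSq_eq_norm_sq]
  nlinarith [norm_nonneg z]

theorem normSq_discLift (z : ℂ) : normSq (discLift z).1 + (discLift z).2 ^ 2 = 1 := by
  rw [← radius_sq, radius_discLift, one_pow]

/-- The open fiber of the Lefschetz fibration. -/
abbrev openFiber (c : ℝ) (z : ℂ) : Set Phase :=
  fiber c (range (directOrbit c)) (range (retrogradeOrbit c)) (lefschetz c) z

section fibers

variable {c : ℝ} (hc : c < -3 / 2) {m : Model} {z : ℂ}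
include hc

theorem pageChart_mem_openFiber (hm : m ∈ quadric) (hz : z ∈ closedBall (0 : ℂ) 1) {a : ℝ}
    (ha : 0 < a) (h : m.2.2 = a • discLift z) : pageChart c m ∈ openFiber c z := by
  have hs := embed_mem_chartSource hc hm
  refine ⟨(mem_page_diff_iff hc).2 ⟨(pageChart_mem_page_iff hc hm).2 ?_, ?_⟩, ?_⟩
  · rw [h]
    exact mul_nonneg ha.le (discLift_snd_nonneg hz)
  · rw [pageCoord_pageChart hc hs, h]
    exact smul_ne_zero ha.ne' (discLift_ne_zero z)
  · rw [lefschetz, pageCoord_pageChart hc hs, h, discProj_smul ha, discProj_discLift]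

theorem exists_of_mem_openFiber {x : Phase} (hx : x ∈ openFiber c z) :
    ∃ m ∈ quadric, ∃ a : ℝ, 0 < a ∧ m.2.2 = a • discLift z ∧ pageChart c m = x := by
  obtain ⟨h1, h2, h3⟩ := pageCoord_page hc hx.1.1
  have hr := radius_add_pageCoord_pos hc hx.1
  refine ⟨_, h1, radius (pageCoord c x).2.2, radius_pos ((mem_page_diff_iff hc).1 hx.1).2, ?_, h3⟩
  rw [← hx.2]
  exact (smul_discLift_discProj hr).symm

/-- Clearing the denominator in `discProj (Z, t) = z` yields a closed condition that also admits
`(Z, t) = 0`. The union is therefore the image of a compact set. -/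
theorem isClosed_openFiber_union : IsClosed (openFiber c z ∪ binding c) := by
  set K : Set Model := quadric ∩ {m | 0 ≤ m.2.2.2 ∧
    (starRingEnd ℂ) m.2.2.1 = z * ((radius m.2.2 + m.2.2.2 : ℝ) : ℂ)} with hK
  have hcl : IsClosed {m : Model | 0 ≤ m.2.2.2 ∧
      (starRingEnd ℂ) m.2.2.1 = z * ((radius m.2.2 + m.2.2.2 : ℝ) : ℂ)} := by
    have h1 : IsClosed {m : Model | 0 ≤ m.2.2.2} := isClosed_le continuous_const (by fun_prop)
    refine h1.inter (isClosed_eq ?_ ?_)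
    · exact Complex.continuous_conj.comp (by fun_prop)
    · refine continuous_const.mul (Complex.continuous_ofReal.comp ?_)
      exact (continuous_radius.comp (by fun_prop)).add (by fun_prop)
  have hKc : IsCompact K := isCompact_quadric.inter_right hcl
  have hcont : ContinuousOn (pageChart c) K := fun m hm =>
    (contDiffAt_pageChart hc hm.1).continuousAt.continuousWithinAt
  have heq : openFiber c z ∪ binding c = pageChart c '' K := by
    ext x
    constructor
    · rintro (hx | hx)
      · obtain ⟨h1, h2, h3⟩ := pageCoord_page hc hx.1.1
        refine ⟨_, ⟨h1, h2, ?_⟩, h3⟩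
        have hr := radius_add_pageCoord_pos hc hx.1
        rw [← hx.2, lefschetz, discProj, div_mul_cancel₀]
        exact_mod_cast hr.ne'
      · obtain ⟨h1, h2, h3⟩ := pageCoord_page hc (binding_subset_page hc hx)
        rw [← h3, pageChart_mem_binding_iff hc h1] at hx
        refine ⟨_, ⟨h1, h2, ?_⟩, h3⟩
        rw [hx]
        simp [radius]
    · rintro ⟨m, ⟨hm, ht, h⟩, rfl⟩
      by_cases h0 : m.2.2 = 0
      · exact Or.inr ((pageChart_mem_binding_iff hc hm).2 h0)
      · have hs := embed_mem_chartSource hc hm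
        have hr := radius_add_pos h0 ht
        refine Or.inl ⟨(mem_page_diff_iff hc).2 ⟨(pageChart_mem_page_iff hc hm).2 ht,
          by rwa [pageCoord_pageChart hc hs]⟩, ?_⟩
        rw [lefschetz, pageCoord_pageChart hc hs, discProj, h, mul_div_cancel_right₀]
        exact_mod_cast hr.ne'
  rw [heq]
  exact (hKc.image_of_continuousOn hcont).isClosed

/-- A point of the binding is a limit of points of each fiber. -/
theorem mem_closure_openFiber (hz : z ∈ closedBall (0 : ℂ) 1) {e : ℝ → Model}
    (he : Continuous e) (hcone : ∀ s, (e s).1 * (e s).2.1 + (e s).2.2.1 ^ 2 = ((e s).2.2.2 : ℂ) ^ 2)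
    (hsize : ∀ s, 0 < sizeSq (e s)) (hproj : ∀ s, (e s).2.2 = s • discLift z) :
    pageChart c (rescale (e 0)) ∈ closure (openFiber c z) := by
  have h1 : ContinuousAt rescale (e 0) := (contDiffAt_rescale (hsize 0)).continuousAt
  have h2 : ContinuousAt (fun s => rescale (e s)) 0 :=
    ContinuousAt.comp (g := rescale) h1 he.continuousAt
  have h3 : ContinuousAt (pageChart c) (rescale (e 0)) :=
    (contDiffAt_pageChart hc (rescale_mem (hcone 0) (hsize 0))).continuousAt
  have h4 : ContinuousAt (fun s => pageChart c (rescale (e s))) 0 :=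
    ContinuousAt.comp (g := pageChart c) h3 h2
  refine mem_closure_of_tendsto (h4.tendsto.mono_left (nhdsWithin_le_nhds (s := Ioi 0))) ?_
  filter_upwards [self_mem_nhdsWithin] with s hs
  refine pageChart_mem_openFiber hc (rescale_mem (hcone s) (hsize s)) hz
    (mul_pos (rescale_scale_pos (hsize s)) hs) ?_
  rw [mul_smul, ← hproj]
  rfl

/-- With `β` fixed, the points `α = s² δ/β`, `(Z, t) = s w` lie on the cone and, once rescaled, in
the fiber for `s > 0`; they tend to the circle `α = 0`. The other circle is symmetric. -/
theorem binding_subset_closure (hz : z ∈ closedBall (0 : ℂ) 1) :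
    binding c ⊆ closure (openFiber c z) := by
  set w := discLift z with hw
  rw [binding, range_directOrbit hc, range_retrogradeOrbit hc]
  rintro _ (⟨m, hm, rfl⟩ | ⟨m, hm, rfl⟩)
  · have hmq := directCircle_subset hm
    obtain ⟨a, b, q⟩ := m
    obtain ⟨h1, h2, h3⟩ := hm
    simp only at h1 h2 h3
    subst h1 h3
    have hb : b ≠ 0 := fun h => by rw [h] at h2; simp at h2
    set e : ℝ → Model := fun s => ((s ^ 2 : ℝ) * (pencil w / b), b, s • w) with he
    have h0 : e 0 = (0, b, 0) := by simp [he]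
    have hmem := mem_closure_openFiber hc hz (e := e) (by simp only [he]; fun_prop) (fun s => ?_)
      (fun s => ?_) (fun s => rfl)
    · rwa [h0, rescale_of_mem hmq] at hmem
    · simp only [he, Prod.smul_fst, Prod.smul_snd, Complex.real_smul, smul_eq_mul, pencil]
      push_cast
      field_simp
      ring
    · have n1 := Complex.normSq_nonneg (e s).1
      have n3 := Complex.normSq_nonneg (e s).2.2.1
      have n4 := sq_nonneg (e s).2.2.2
      have n2 : normSq (e s).2.1 = 4 := h2
      rw [sizeSq]
      linarith
  · have hmq := retrogradeCircle_subset hm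
    obtain ⟨a, b, q⟩ := m
    obtain ⟨h2, h1, h3⟩ := hm
    simp only at h1 h2 h3
    subst h1 h3
    have ha : a ≠ 0 := fun h => by rw [h] at h2; simp at h2
    set e : ℝ → Model := fun s => (a, (s ^ 2 : ℝ) * (pencil w / a), s • w) with he
    have h0 : e 0 = (a, 0, 0) := by simp [he]
    have hmem := mem_closure_openFiber hc hz (e := e) (by simp only [he]; fun_prop) (fun s => ?_)
      (fun s => ?_) (fun s => rfl)
    · rwa [h0, rescale_of_mem hmq] at hmem
    · simp only [he, Prod.smul_fst, Prod.smul_snd, Complex.real_smul, smul_eq_mul, pencil]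
      push_cast
      field_simp
      ring
    · have n1 : normSq (e s).1 = 4 := h2
      have n2 := Complex.normSq_nonneg (e s).2.1
      have n3 := Complex.normSq_nonneg (e s).2.2.1
      have n4 := sq_nonneg (e s).2.2.2
      rw [sizeSq]
      linarith

theorem closure_openFiber (hz : z ∈ closedBall (0 : ℂ) 1) :
    closure (openFiber c z) = openFiber c z ∪ binding c :=
  Subset.antisymm (closure_minimal subset_union_left (isClosed_openFiber_union hc))
    (union_subset subset_closure (binding_subset_closure hc hz))

/-- Over the regular values the discriminant does not vanish. -/
theorem pencil_ne_zero (hz : z ∈ closedBall (0 : ℂ) 1) (h : z ∉ lefschetz c '' criticalSet c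
    (range (directOrbit c)) (range (retrogradeOrbit c)) (lefschetz c)) :
    pencil (discLift z) ≠ 0 := by
  intro h0
  -- If the discriminant vanished, this point with `α = β = 0` would lie on the cone over the fiber,
  -- and its rescaling would be a critical point over `z`.
  set v : Model := (0, 0, discLift z) with hv
  have hcone : v.1 * v.2.1 + v.2.2.1 ^ 2 = (v.2.2.2 : ℂ) ^ 2 := by
    rw [pencil] at h0
    simp only [hv]
    linear_combination -h0
  have hsize : sizeSq v = 2 := by
    have := normSq_discLift z
    simp only [sizeSq, hv, map_zero]
    linarith
  have hpos : 0 < sizeSq v := by rw [hsize]; exact two_pos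
  have hm := rescale_mem hcone hpos
  have ha := rescale_scale_pos hpos
  have hx := pageChart_mem_openFiber hc hm hz ha rfl
  refine h ⟨_, ?_, hx.2⟩
  rw [criticalSet_lefschetz hc, ← pageChart_north hc, ← pageChart_south hc]
  rcases quadric_pole hm ((pageChart_mem_page_iff hc hm).1 hx.1.1) (smul_zero _) (smul_zero _)
    with h' | h'
  · exact Or.inl (by rw [h'])
  · exact Or.inr (by rw [h']; rfl)

end fibers

/-! ### The annuli -/

/-- The cone over the annulus in the model over `z`, for an argument `χ` of the discriminant. -/
def annulusCone (z : ℂ) (χ : ℝ) (p : ℝ × ℝ) : Model :=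
  -- The factors `r²`, `(1 - r)²` and `r (1 - r)` are balanced so that the cone equation holds. The
  -- phase `χ (1 - r)` cancels the argument of the discriminant at `r = 0` and is absent at `r = 1`,
  -- which makes both boundary circles independent of `z` after rescaling.
  ((p.2 : ℂ) ^ 2 * Complex.exp ((χ * (1 - p.2) - p.1 : ℝ) * Complex.I),
    (1 - p.2 : ℂ) ^ 2 * pencil (discLift z) * Complex.exp ((p.1 - χ * (1 - p.2) : ℝ) * Complex.I),
    (p.2 * (1 - p.2)) • discLift z)

/-- The annulus in the model. -/
def annulusModel (z : ℂ) (χ : ℝ) (p : ℝ × ℝ) : Model := rescale (annulusCone z χ p)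

/-- The parametrization of a compact fiber by the annulus. -/
def annulus (c : ℝ) (z : ℂ) (χ : ℝ) (p : ℝ × ℝ) : Phase := pageChart c (annulusModel z χ p)

theorem annulusCone_mem (z : ℂ) (χ : ℝ) (p : ℝ × ℝ) :
    (annulusCone z χ p).1 * (annulusCone z χ p).2.1 + (annulusCone z χ p).2.2.1 ^ 2 =
      ((annulusCone z χ p).2.2.2 : ℂ) ^ 2 := by
  have h : Complex.exp ((χ * (1 - p.2) - p.1 : ℝ) * Complex.I) *
      Complex.exp ((p.1 - χ * (1 - p.2) : ℝ) * Complex.I) = 1 := by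
    rw [← Complex.exp_add, ← Complex.exp_zero]
    congr 1
    push_cast
    ring
  simp only [annulusCone, Prod.smul_fst, Prod.smul_snd, Complex.real_smul, smul_eq_mul, pencil]
  push_cast at h ⊢
  linear_combination (p.2 : ℂ) ^ 2 * (1 - p.2 : ℂ) ^ 2 *
    (((discLift z).2 : ℂ) ^ 2 - (discLift z).1 ^ 2) * h

theorem normSq_exp (s : ℝ) : normSq (Complex.exp (s * Complex.I)) = 1 := by
  have := normSq_exp_mul s 1
  rwa [mul_one, map_one] at this

theorem normSq_annulusCone_fst (z : ℂ) (χ : ℝ) (p : ℝ × ℝ) :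
    normSq (annulusCone z χ p).1 = p.2 ^ 4 := by
  simp only [annulusCone, map_mul, normSq_exp, map_pow, Complex.normSq_ofReal]
  ring

theorem normSq_annulusCone_snd (z : ℂ) (χ : ℝ) (p : ℝ × ℝ) :
    normSq (annulusCone z χ p).2.1 = (1 - p.2) ^ 4 * normSq (pencil (discLift z)) := by
  have : (1 - p.2 : ℂ) = ((1 - p.2 : ℝ) : ℂ) := by push_cast; rfl
  simp only [annulusCone, this, map_mul, normSq_exp, map_pow, Complex.normSq_ofReal]
  ring

theorem sizeSq_annulusCone (z : ℂ) (χ : ℝ) (p : ℝ × ℝ) : sizeSq (annulusCone z χ p) =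
    p.2 ^ 4 + normSq (pencil (discLift z)) * (1 - p.2) ^ 4 + 2 * (p.2 ^ 2 * (1 - p.2) ^ 2) := by
  have h := normSq_discLift z
  rw [sizeSq, normSq_annulusCone_fst, normSq_annulusCone_snd]
  simp only [annulusCone, Prod.smul_fst, Prod.smul_snd, Complex.real_smul, smul_eq_mul, map_mul,
    Complex.normSq_ofReal]
  linear_combination 2 * p.2 ^ 2 * (1 - p.2) ^ 2 * h

section annulus

variable {z : ℂ} (hz : pencil (discLift z) ≠ 0)
include hz

theorem sizeSq_annulusCone_pos (χ : ℝ) (p : ℝ × ℝ) : 0 < sizeSq (annulusCone z χ p) := by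
  have h := Complex.normSq_pos.2 hz
  rw [sizeSq_annulusCone]
  by_cases h0 : p.2 = 0
  · rw [h0]
    simpa using hz
  · have : 0 < p.2 ^ 4 := by positivity
    have : 0 ≤ normSq (pencil (discLift z)) * (1 - p.2) ^ 4 := by positivity
    positivity

theorem annulusModel_mem (χ : ℝ) (p : ℝ × ℝ) : annulusModel z χ p ∈ quadric :=
  rescale_mem (annulusCone_mem z χ p) (sizeSq_annulusCone_pos hz χ p)

omit hz in
theorem exp_mul_I_add (a b : ℝ) : Complex.exp ((a + b : ℝ) * Complex.I) =
    Complex.exp (a * Complex.I) * Complex.exp (b * Complex.I) := by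
  rw [← Complex.exp_add]
  congr 1
  push_cast
  ring

omit hz in
theorem annulusCone_add (χ θ r s : ℝ) :
    annulusCone z χ (θ + s, r) = rotModel s (annulusCone z χ (θ, r)) := by
  have h1 : (χ * (1 - r) - (θ + s) : ℝ) = -s + (χ * (1 - r) - θ) := by ring
  have h2 : (θ + s - χ * (1 - r) : ℝ) = s + (θ - χ * (1 - r)) := by ring
  simp only [annulusCone, rotModel, h1, h2, exp_mul_I_add, Complex.ofReal_neg]
  refine Prod.ext ?_ (Prod.ext ?_ rfl)
  · simp only
    ring
  · simp only
    ring

omit hz in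
theorem sizeSq_rotModel (s : ℝ) (m : Model) : sizeSq (rotModel s m) = sizeSq m := by
  rw [sizeSq, normSq_rotModel_fst, normSq_rotModel_snd]
  rfl

omit hz in
theorem rescale_rotModel (s : ℝ) (m : Model) : rescale (rotModel s m) = rotModel s (rescale m) := by
  rw [rescale, sizeSq_rotModel, rescale]
  simp only [rotModel, Prod.smul_mk, Prod.smul_fst, Prod.smul_snd, mul_smul_comm]

omit hz in
-- The coordinate `θ` is the angle of the rotations, so that `∂/∂θ` is `rotField`.
theorem annulus_add (c χ θ r s : ℝ) :
    annulus c z χ (θ + s, r) = rotate s (annulus c z χ (θ, r)) := by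
  rw [annulus, annulusModel, annulusCone_add, rescale_rotModel, pageChart_rotModel]
  rfl

omit hz in
theorem annulusModel_proj (χ : ℝ) (p : ℝ × ℝ) : (annulusModel z χ p).2.2 =
    (2 / √(sizeSq (annulusCone z χ p)) * (p.2 * (1 - p.2))) • discLift z := by
  rw [mul_smul]
  rfl

variable {c : ℝ} (hc : c < -3 / 2)
include hc

theorem contDiffAt_annulus {E : Type*} [NormedAddCommGroup E] [NormedSpace ℝ E] {ζ : E → ℂ}
    {χ : E → ℝ} {p : E → ℝ × ℝ} {e : E} (h1 : ContDiffAt ℝ ∞ ζ e) (h2 : ContDiffAt ℝ ∞ χ e)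
    (h3 : ContDiffAt ℝ ∞ p e) (h : ζ e = z) :
    ContDiffAt ℝ ∞ (fun e => annulusModel (ζ e) (χ e) (p e)) e ∧
      ContDiffAt ℝ ∞ (fun e => annulus c (ζ e) (χ e) (p e)) e := by
  subst h
  have hw : ContDiffAt ℝ ∞ (fun e => discLift (ζ e)) e := contDiff_discLift.contDiffAt.comp e h1
  have hδ : ContDiffAt ℝ ∞ (fun e => pencil (discLift (ζ e))) e :=
    ((contDiff_ofReal.contDiffAt.comp e hw.snd).pow 2).sub (hw.fst.pow 2)
  have hr : ContDiffAt ℝ ∞ (fun e => ((p e).2 : ℂ)) e := contDiff_ofReal.contDiffAt.comp e h3.snd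
  have hs : ContDiffAt ℝ ∞ (fun e => (1 - (p e).2 : ℂ)) e := contDiffAt_const.sub hr
  have ha : ContDiffAt ℝ ∞ (fun e => χ e * (1 - (p e).2) - (p e).1) e :=
    (h2.mul (contDiffAt_const.sub h3.snd)).sub h3.fst
  have hb : ContDiffAt ℝ ∞ (fun e => (p e).1 - χ e * (1 - (p e).2)) e :=
    h3.fst.sub (h2.mul (contDiffAt_const.sub h3.snd))
  have ha' : ContDiffAt ℝ ∞
      (fun e => Complex.exp ((χ e * (1 - (p e).2) - (p e).1 : ℝ) * Complex.I)) e :=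
    ((contDiff_ofReal.contDiffAt.comp e ha).mul contDiffAt_const).cexp
  have hb' : ContDiffAt ℝ ∞
      (fun e => Complex.exp (((p e).1 - χ e * (1 - (p e).2) : ℝ) * Complex.I)) e :=
    ((contDiff_ofReal.contDiffAt.comp e hb).mul contDiffAt_const).cexp
  have hcone : ContDiffAt ℝ ∞ (fun e => annulusCone (ζ e) (χ e) (p e)) e :=
    ((hr.pow 2).mul ha').prodMk ((((hs.pow 2).mul hδ).mul hb').prodMk
      ((h3.snd.mul (contDiffAt_const.sub h3.snd)).smul hw))
  have hm : ContDiffAt ℝ ∞ (fun e => annulusModel (ζ e) (χ e) (p e)) e :=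
    (contDiffAt_rescale (sizeSq_annulusCone_pos hz (χ e) (p e))).comp e hcone
  exact ⟨hm, (contDiffAt_pageChart hc (annulusModel_mem hz _ _)).comp e hm⟩

theorem contDiff_annulus (χ : ℝ) : ContDiff ℝ ∞ (annulus c z χ) :=
  contDiff_iff_contDiffAt.2 fun _ =>
    (contDiffAt_annulus hz hc contDiffAt_const contDiffAt_const contDiffAt_id rfl).2

omit hc in
/-- The moment on the circle with parameter `r` of the annulus. -/
theorem moment_annulusModel (χ : ℝ) (p : ℝ × ℝ) : moment (annulusModel z χ p) =
    (p.2 ^ 4 - normSq (pencil (discLift z)) * (1 - p.2) ^ 4) /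
      (p.2 ^ 4 + normSq (pencil (discLift z)) * (1 - p.2) ^ 4 + 2 * (p.2 ^ 2 * (1 - p.2) ^ 2)) := by
  have h := sizeSq_annulusCone_pos hz χ p
  have h1 := normSq_annulusCone_fst z χ p
  have h2 := normSq_annulusCone_snd z χ p
  have h3 := Real.sq_sqrt h.le
  rw [← sizeSq_annulusCone z χ p, moment, annulusModel, rescale]
  simp only [Prod.smul_fst, Prod.smul_snd, Complex.real_smul, map_mul, h1, h2,
    Complex.normSq_ofReal]
  rw [eq_div_iff h.ne']
  have h4 : √(sizeSq (annulusCone z χ p)) ≠ 0 := (Real.sqrt_pos.2 h).ne'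
  have h5 : 2 / √(sizeSq (annulusCone z χ p)) * (2 / √(sizeSq (annulusCone z χ p))) *
      sizeSq (annulusCone z χ p) = 4 := by
    field_simp
    rw [h3]
    ring
  linear_combination (p.2 ^ 4 - normSq (pencil (discLift z)) * (1 - p.2) ^ 4) / 4 * h5

/-- The value of the moment on the circle with parameter `r`. -/
def annulusMoment (z : ℂ) (r : ℝ) : ℝ :=
  (r ^ 4 - normSq (pencil (discLift z)) * (1 - r) ^ 4) /
    (r ^ 4 + normSq (pencil (discLift z)) * (1 - r) ^ 4 + 2 * (r ^ 2 * (1 - r) ^ 2))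

/-- The action variable. -/
def action (c : ℝ) (z : ℂ) (r : ℝ) : ℝ := annulusMoment z r / freq c (annulusMoment z r)

omit hc in
theorem annulusMoment_mem (r : ℝ) : -1 ≤ annulusMoment z r := by
  have h := sizeSq_annulusCone_pos hz 0 (0, r)
  rw [sizeSq_annulusCone] at h
  simp only at h
  rw [annulusMoment, le_div_iff₀ h]
  have h1 : 0 ≤ r ^ 4 := by positivity
  have h2 : 0 ≤ r ^ 2 * (1 - r) ^ 2 := by positivity
  linarith

theorem rotMoment_annulus (χ : ℝ) (p : ℝ × ℝ) :
    rotMoment (annulus c z χ p) = action c z p.2 := by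
  rw [annulus, pageChart, rotMoment_chart hc (embed_mem_chartSource hc (annulusModel_mem hz χ p)),
    rotMoment_embed, moment_annulusModel hz]
  rfl

omit hc in
-- The numerator is arranged as a sum of terms that are positive for `0 < r < 1` and vanish at both
-- ends: the moment increases along the annulus but is stationary at its boundary.
theorem hasDerivAt_annulusMoment (r : ℝ) : HasDerivAt (annulusMoment z)
    ((8 * normSq (pencil (discLift z)) * r ^ 3 * (1 - r) ^ 3 + 4 * r ^ 5 * (1 - r) +
      4 * normSq (pencil (discLift z)) * r * (1 - r) ^ 5) /
      (r ^ 4 + normSq (pencil (discLift z)) * (1 - r) ^ 4 + 2 * (r ^ 2 * (1 - r) ^ 2)) ^ 2) r := by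
  have h := sizeSq_annulusCone_pos hz 0 (0, r)
  rw [sizeSq_annulusCone] at h
  simp only at h
  set D := normSq (pencil (discLift z)) with hD
  have h1 : HasDerivAt (fun r : ℝ => 1 - r) (-1) r := by
    simpa using (hasDerivAt_id r).const_sub 1
  have h4 : HasDerivAt (fun r : ℝ => r ^ 4) (4 * r ^ 3) r := by simpa using hasDerivAt_pow 4 r
  have h2 : HasDerivAt (fun r : ℝ => r ^ 2) (2 * r) r := by simpa using hasDerivAt_pow 2 r
  have g4 : HasDerivAt (fun r : ℝ => (1 - r) ^ 4) (4 * (1 - r) ^ 3 * (-1)) r := by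
    exact (h1.pow 4).congr_deriv (by norm_num)
  have g2 : HasDerivAt (fun r : ℝ => (1 - r) ^ 2) (2 * (1 - r) * (-1)) r := by
    exact (h1.pow 2).congr_deriv (by norm_num)
  have e1 := h4.sub (g4.const_mul D)
  have e2 := (h4.add (g4.const_mul D)).add ((h2.mul g2).const_mul 2)
  refine (e1.div e2 h.ne').congr_deriv ?_
  congr 1
  simp only [Pi.add_apply, Pi.sub_apply, Pi.mul_apply]
  ring

theorem hasDerivAt_action (r : ℝ) : ∃ a : ℝ, HasDerivAt (action c z) a r ∧
    (r ∈ Ioo (0 : ℝ) 1 → 0 < a) := by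
  have hs := neg_minFreq_cube_lt hc (annulusMoment_mem hz r)
  have h1 := freq_spec hc hs
  have h3 := freq_deriv_pos hc h1.1
  have h4 := one_lt_minFreq hc
  refine ⟨_, (hasDerivAt_div_freq hc hs).comp r (hasDerivAt_annulusMoment hz r), fun hr => ?_⟩
  have hr0 := hr.1
  have hr1 : 0 < 1 - r := by linarith [hr.2]
  have hD := Complex.normSq_pos.2 hz
  have hk : 0 < freq c (annulusMoment z r) := by linarith [h1.1]
  have hk' : 0 < 3 * freq c (annulusMoment z r) ^ 2 + 2 * c := by linarith
  positivity

theorem contDiff_action : ContDiff ℝ ∞ (action c z) := by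
  rw [contDiff_iff_contDiffAt]
  intro r
  have hs := neg_minFreq_cube_lt hc (annulusMoment_mem hz r)
  have h := sizeSq_annulusCone_pos hz 0 (0, r)
  rw [sizeSq_annulusCone] at h
  simp only at h
  have h1 : ContDiffAt ℝ ∞ (annulusMoment z) r :=
    ContDiffAt.div (by fun_prop) (by fun_prop) h.ne'
  have hk : freq c (annulusMoment z r) ≠ 0 := by
    linarith [(freq_spec hc hs).1, one_lt_minFreq hc]
  exact h1.div ((contDiffAt_freq hc hs).1.comp r h1) hk

theorem strictMonoOn_action : StrictMonoOn (action c z) (Icc 0 1) := by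
  refine strictMonoOn_of_deriv_pos (convex_Icc 0 1) (contDiff_action hz hc).continuous.continuousOn
    fun r hr => ?_
  rw [interior_Icc] at hr
  obtain ⟨a, ha, hpos⟩ := hasDerivAt_action hz hc r
  rw [ha.deriv]
  exact hpos hr

theorem fderiv_annulus_fst (χ : ℝ) (p : ℝ × ℝ) :
    fderiv ℝ (annulus c z χ) p (1, 0) = rotField (annulus c z χ p) := by
  have h : HasFDerivAt (annulus c z χ) (fderiv ℝ (annulus c z χ) p) (p + (0 : ℝ) • (1, 0)) := by
    simpa using ((contDiff_annulus hz hc χ).differentiable (by simp) p).hasFDerivAt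
  have hl : HasDerivAt (fun t : ℝ => p + t • ((1, 0) : ℝ × ℝ)) (1, 0) 0 := by
    simpa using ((hasDerivAt_id (0 : ℝ)).smul_const ((1, 0) : ℝ × ℝ)).const_add p
  have h1 := h.comp_hasDerivAt 0 hl
  refine h1.unique ((hasDerivAt_rotate (annulus c z χ p)).congr_of_eventuallyEq ?_)
  refine Eventually.of_forall fun s => ?_
  have : p + s • ((1, 0) : ℝ × ℝ) = (p.1 + s, p.2) := Prod.ext (by simp) (by simp)
  simp only [Function.comp, this]
  exact annulus_add c χ p.1 p.2 s

theorem fderiv_rotMoment_annulus (χ : ℝ) (p v : ℝ × ℝ) :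
    fderiv ℝ rotMoment (annulus c z χ p) (fderiv ℝ (annulus c z χ) p v) =
      v.2 * deriv (action c z) p.2 := by
  have h1 := ((contDiff_annulus hz hc χ).differentiable (by simp) p).hasFDerivAt
  have h2 := (contDiff_rotMoment.differentiable (n := 1) (by simp) (annulus c z χ p)).hasFDerivAt
  have h3 : HasFDerivAt (fun q => rotMoment (annulus c z χ q)) _ p := h2.comp p h1
  have h4 : HasDerivAt (action c z) (deriv (action c z) p.2) p.2 :=
    ((contDiff_action hz hc).differentiable (by simp) p.2).hasDerivAt
  have h5 := h4.hasFDerivAt.comp p hasFDerivAt_snd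
  have h6 := h3.unique (h5.congr_of_eventuallyEq
    (Eventually.of_forall fun q => rotMoment_annulus hz hc χ q))
  have h7 := congrArg (fun L : ℝ × ℝ →L[ℝ] ℝ => L v) h6
  simpa using h7

/-- Contracting `ω` with `∂/∂θ`, the rotation field, gives the differential of the moment, which is
the function `action` of `r` alone. Thus `ω = dI ∧ dθ`. -/
theorem symp_annulus (χ : ℝ) (p : ℝ × ℝ) :
    symp (fderiv ℝ (annulus c z χ) p (0, 1)) (fderiv ℝ (annulus c z χ) p (1, 0)) =
      deriv (action c z) p.2 := by
  rw [fderiv_annulus_fst hz hc, symp_rotField, fderiv_rotMoment_annulus hz hc, one_mul]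

/-- In the interior the action detects the radial component. At `r = 0, 1` its derivative vanishes,
but there `(Z, t)` is a positive multiple of `r (1 - r)`, with derivative `1 - 2 r ≠ 0`. What
remains is the rotation field, nonzero because `α` and `β` do not vanish together. -/
theorem annulus_immersion (χ θ : ℝ) {r : ℝ} (hr : r ∈ Icc (0 : ℝ) 1) :
    Function.Injective (fderiv ℝ (annulus c z χ) (θ, r)) := by
  rw [injective_iff_map_eq_zero]
  rintro ⟨a, b⟩ hv
  have hmq := annulusModel_mem hz χ (θ, r)
  have hb : b = 0 := by
    by_cases hr' : r ∈ Ioo (0 : ℝ) 1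
    · have h := fderiv_rotMoment_annulus hz hc χ (θ, r) (a, b)
      rw [hv, map_zero] at h
      obtain ⟨d, hd, hpos⟩ := hasDerivAt_action hz hc r
      simp only [hd.deriv] at h
      exact (mul_eq_zero.1 h.symm).resolve_right (hpos hr').ne'
    · have hr2 : 1 - 2 * r ≠ 0 := by
        intro h
        exact hr' ⟨by linarith, by linarith⟩
      have hr1 : r * (1 - r) = 0 := by
        rcases hr.1.eq_or_lt with h | h
        · rw [← h, zero_mul]
        · have : ¬ r < 1 := fun h' => hr' ⟨h, h'⟩
          have : r = 1 := le_antisymm hr.2 (not_lt.1 this)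
          rw [this]
          norm_num
      have hM := (contDiffAt_annulus (e := (θ, r)) (χ := fun _ => χ) hz hc
        (contDiffAt_const (c := z)) contDiffAt_const contDiffAt_id rfl).1
      have hM' := (hM.differentiableAt (by simp)).hasFDerivAt
      simp only [id] at hM'
      have hΦ := ((contDiffAt_pageChart hc hmq).differentiableAt (by simp)).hasFDerivAt
      have h1 := hΦ.comp (θ, r) hM'
      have h2 := congrArg (fun L : ℝ × ℝ →L[ℝ] Phase => L (a, b)) h1.fderiv
      have h3 : fderiv ℝ (pageChart c) (annulusModel z χ (θ, r))
          (fderiv ℝ (fun p => annulusModel z χ p) (θ, r) (a, b)) = 0 := h2.symm.trans hv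
      have h4 := fderiv_pageCoord_fderiv_pageChart hc hmq
        (fderiv ℝ (fun p => annulusModel z χ p) (θ, r) (a, b))
      rw [h3, map_zero] at h4
      have hl : HasDerivAt (fun t : ℝ => ((θ, r) : ℝ × ℝ) + t • ((a, b) : ℝ × ℝ)) (a, b) 0 := by
        simpa using ((hasDerivAt_id (0 : ℝ)).smul_const ((a, b) : ℝ × ℝ)).const_add (θ, r)
      have hM0 : HasFDerivAt (fun p => annulusModel z χ p)
          (fderiv ℝ (fun p => annulusModel z χ p) (θ, r)) ((θ, r) + (0 : ℝ) • (a, b)) := by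
        simpa using hM'
      have h5 := hM0.comp_hasDerivAt 0 hl
      rw [← h4] at h5
      have h6 : HasDerivAt (fun t : ℝ => (annulusModel z χ ((θ, r) + t • (a, b))).2.2) 0 0 :=
        h5.snd.snd
      have h7 : HasDerivAt (fun t : ℝ => (r + t * b) * (1 - (r + t * b))) (b * (1 - 2 * r)) 0 := by
        have h8 : HasDerivAt (fun t : ℝ => r + t * b) b 0 := by
          simpa using ((hasDerivAt_id (0 : ℝ)).mul_const b).const_add r
        refine (h8.mul (h8.const_sub 1)).congr_deriv ?_
        simp
        ring
      have h8 : ContinuousAt (fun t : ℝ => 2 / √(sizeSq (annulusCone z χ ((θ, r) + t • (a, b)))))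
          0 := by
        have hcs : Continuous fun t : ℝ => sizeSq (annulusCone z χ ((θ, r) + t • (a, b))) := by
          simp only [sizeSq_annulusCone]
          fun_prop
        exact (continuous_const.div hcs.sqrt fun t =>
          (Real.sqrt_pos.2 (sizeSq_annulusCone_pos hz χ _)).ne').continuousAt
      have h9 := (hasDerivAt_mul_of_eq_zero h8 h7 (by simpa using hr1)).smul_const (discLift z)
      have h10 := h6.unique (h9.congr_of_eventuallyEq (Eventually.of_forall fun t => by
        change (annulusModel z χ _).2.2 = _
        rw [annulusModel_proj]
        simp))
      have h11 := (smul_eq_zero.1 h10.symm).resolve_right (discLift_ne_zero z)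
      have h12 := (rescale_scale_pos (sizeSq_annulusCone_pos hz χ ((θ, r) + (0 : ℝ) • (a, b)))).ne'
      exact (mul_eq_zero.1 ((mul_eq_zero.1 h11).resolve_left h12)).resolve_right hr2
  subst hb
  have h : fderiv ℝ (annulus c z χ) (θ, r) (a, 0) = a • rotField (annulus c z χ (θ, r)) := by
    rw [← fderiv_annulus_fst hz hc, ← map_smul]
    simp
  rw [h, annulus, ← fderiv_pageChart_rotTangent hc hmq, ← map_smul] at hv
  have h1 := fderiv_pageCoord_fderiv_pageChart hc hmq (a • rotTangent (annulusModel z χ (θ, r)))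
  rw [hv, map_zero] at h1
  have ha : a = 0 := by
    refine (smul_eq_zero.1 h1.symm).resolve_right fun h2 => ?_
    have hn := (rescale_scale_pos (sizeSq_annulusCone_pos hz χ (θ, r))).ne'
    have e1 : (annulusModel z χ (θ, r)).1 = 0 := by simpa [rotTangent] using congrArg Prod.fst h2
    have e2 : (annulusModel z χ (θ, r)).2.1 = 0 := by
      simpa [rotTangent] using congrArg (fun v : Model => v.2.1) h2
    have e3 : (annulusCone z χ (θ, r)).1 = 0 := (smul_eq_zero.1 e1).resolve_left hn
    have e4 : (annulusCone z χ (θ, r)).2.1 = 0 := (smul_eq_zero.1 e2).resolve_left hn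
    have h3 := normSq_annulusCone_fst z χ (θ, r)
    have h4 := normSq_annulusCone_snd z χ (θ, r)
    rw [e3, map_zero] at h3
    rw [e4, map_zero] at h4
    have hr0 : r = 0 := pow_eq_zero_iff (four_ne_zero) |>.1 h3.symm
    rw [hr0] at h4
    have := Complex.normSq_pos.2 hz
    norm_num at h4
    exact this.ne h4
  rw [ha]
  rfl

/-- The ratio of `|α|` and `|β|` determines `r/(1 - r)`, compared here after cross-multiplication.
The phase of whichever of `α`, `β` is nonzero then determines `θ` modulo `2π`. -/
theorem annulus_injective (χ θ θ' : ℝ) {r r' : ℝ} (hr : r ∈ Icc (0 : ℝ) 1)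
    (hr' : r' ∈ Icc (0 : ℝ) 1) (h : annulus c z χ (θ, r) = annulus c z χ (θ', r')) :
    r = r' ∧ ∃ k : ℤ, θ' = θ + k * (2 * Real.pi) := by
  have h1 : annulusModel z χ (θ, r) = annulusModel z χ (θ', r') :=
    pageChart_injOn hc (annulusModel_mem hz _ _) (annulusModel_mem hz _ _) h
  have hD := Complex.normSq_pos.2 hz
  have hn := rescale_scale_pos (sizeSq_annulusCone_pos hz χ (θ, r))
  have hn' := rescale_scale_pos (sizeSq_annulusCone_pos hz χ (θ', r'))
  have hrr : r = r' := by
    have e1 := congrArg (fun v : Model => normSq v.1) h1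
    have e2 := congrArg (fun v : Model => normSq v.2.1) h1
    simp only [annulusModel, rescale, Prod.smul_fst, Prod.smul_snd, Complex.real_smul, map_mul,
      Complex.normSq_ofReal, normSq_annulusCone_fst, normSq_annulusCone_snd] at e1 e2
    set n := 2 / √(sizeSq (annulusCone z χ (θ, r)))
    set n' := 2 / √(sizeSq (annulusCone z χ (θ', r')))
    set D := normSq (pencil (discLift z))
    have e3 : (r * (1 - r')) ^ 4 = (r' * (1 - r)) ^ 4 := by
      have h0 : n * n * (n' * n' * D) ≠ 0 := by positivity
      apply mul_left_cancel₀ h0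
      linear_combination (n' * n' * D * (1 - r') ^ 4) * e1 - (n' * n' * r' ^ 4) * e2
    have e4 : r * (1 - r') = r' * (1 - r) :=
      (pow_left_inj₀ (mul_nonneg hr.1 (by linarith [hr'.2]))
        (mul_nonneg hr'.1 (by linarith [hr.2])) four_ne_zero).1 e3
    linarith
  subst hrr
  refine ⟨rfl, ?_⟩
  have hsize : sizeSq (annulusCone z χ (θ, r)) = sizeSq (annulusCone z χ (θ', r)) := by
    rw [sizeSq_annulusCone, sizeSq_annulusCone]
  have h2 : annulusCone z χ (θ, r) = annulusCone z χ (θ', r) := by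
    rw [annulusModel, annulusModel, rescale, rescale, ← hsize] at h1
    exact smul_right_injective _ hn.ne' h1
  have e1 := congrArg (fun v : Model => v.1) h2
  have e2 := congrArg (fun v : Model => v.2.1) h2
  simp only [annulusCone] at e1 e2
  by_cases h0 : r = 0
  · have hne : (1 - (r : ℂ)) ^ 2 * pencil (discLift z) ≠ 0 := by
      rw [h0]
      simpa using hz
    obtain ⟨k, hk⟩ := Complex.exp_eq_exp_iff_exists_int.1 (mul_left_cancel₀ hne e2)
    refine ⟨-k, ?_⟩
    have := congrArg Complex.im hk
    simp at this
    push_cast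
    linarith
  · have hne : (r : ℂ) ^ 2 ≠ 0 := pow_ne_zero 2 (by exact_mod_cast h0)
    obtain ⟨k, hk⟩ := Complex.exp_eq_exp_iff_exists_int.1 (mul_left_cancel₀ hne e1)
    refine ⟨k, ?_⟩
    have := congrArg Complex.im hk
    simp at this
    linarith

omit hz hc in
theorem rescale_of_sizeSq_one {v : Model} (h : sizeSq v = 1) : rescale v = (2 : ℝ) • v := by
  rw [rescale, h, Real.sqrt_one, div_one]

omit hc in
theorem annulusModel_zero {χ : ℝ} (hχ : pencil (discLift z) =
    (‖pencil (discLift z)‖ : ℂ) * Complex.exp (χ * Complex.I)) (θ : ℝ) :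
    annulusModel z χ (θ, 0) = (0, Complex.exp (θ * Complex.I) * 2, 0) := by
  have h1 : annulusCone z χ (θ, 0) =
      ‖pencil (discLift z)‖ • ((0, Complex.exp (θ * Complex.I), 0) : Model) := by
    have h2 : Complex.exp (χ * Complex.I) * Complex.exp ((θ - χ : ℝ) * Complex.I) =
        Complex.exp (θ * Complex.I) := by
      rw [← exp_mul_I_add, add_sub_cancel]
    refine Prod.ext (by simp [annulusCone]) (Prod.ext ?_ (by simp [annulusCone]))
    simp only [annulusCone, Prod.smul_fst, Prod.smul_snd, Complex.real_smul, Complex.ofReal_zero,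
      sub_zero, one_pow, one_mul, mul_one]
    rw [← h2]
    conv_lhs => rw [hχ]
    ring
  rw [annulusModel, h1, rescale_smul (norm_pos_iff.2 hz), rescale_of_sizeSq_one]
  · simp [mul_comm]
  · simp [sizeSq, normSq_exp]

omit hz hc in
theorem annulusModel_one (χ θ : ℝ) :
    annulusModel z χ (θ, 1) = (Complex.exp (-θ * Complex.I) * 2, 0, 0) := by
  have h1 : annulusCone z χ (θ, 1) = (Complex.exp (((-θ : ℝ) : ℂ) * Complex.I), 0, 0) := by
    refine Prod.ext ?_ (Prod.ext ?_ ?_) <;> simp [annulusCone]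
  rw [annulusModel, h1, rescale_of_sizeSq_one]
  · simp [mul_comm]
  · simp [sizeSq, -Complex.ofReal_neg, normSq_exp]

theorem range_annulus_zero {χ : ℝ} (hχ : pencil (discLift z) =
    (‖pencil (discLift z)‖ : ℂ) * Complex.exp (χ * Complex.I)) :
    range (fun θ => annulus c z χ (θ, 0)) = range (directOrbit c) := by
  rw [range_directOrbit hc]
  ext x
  constructor
  · rintro ⟨θ, rfl⟩
    simp only [annulus, annulusModel_zero hz hχ]
    refine mem_image_of_mem _ ⟨rfl, ?_, rfl⟩
    simp only [normSq_exp_mul]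
    exact direct_mem.2.1
  · rintro ⟨⟨a, b, q⟩, ⟨h1, h2, h3⟩, rfl⟩
    simp only at h1 h2 h3
    subst h1 h3
    obtain ⟨s, hs⟩ := exists_exp_mul_eq (a := 2) (b := b) two_ne_zero (by
      rw [h2]; exact direct_mem.2.1)
    exact ⟨s, by simp only [annulus, annulusModel_zero hz hχ, hs]⟩

omit hz in
theorem range_annulus_one (χ : ℝ) :
    range (fun θ => annulus c z χ (θ, 1)) = range (retrogradeOrbit c) := by
  rw [range_retrogradeOrbit hc]
  ext x
  constructor
  · rintro ⟨θ, rfl⟩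
    simp only [annulus, annulusModel_one]
    refine mem_image_of_mem _ ⟨?_, rfl, rfl⟩
    have := normSq_exp_mul (-θ) 2
    rw [Complex.ofReal_neg] at this
    simp only [this]
    exact retrograde_mem.1
  · rintro ⟨⟨a, b, q⟩, ⟨h1, h2, h3⟩, rfl⟩
    simp only at h1 h2 h3
    subst h2 h3
    obtain ⟨s, hs⟩ := exists_exp_mul_eq (a := 2) (b := a) two_ne_zero (by
      rw [h1]; exact retrograde_mem.1)
    exact ⟨-s, by simp only [annulus, annulusModel_one, Complex.ofReal_neg, neg_neg, hs]⟩

/-- If `|α| = A` and `(Z, t) = S w`, then `r/(1 - r) = A/S`, and the argument of `α` gives `θ`.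
Since `α ≠ 0`, the equation `αβ = S² δ` determines `β`. -/
theorem openFiber_subset_image (χ : ℝ) :
    openFiber c z ⊆ annulus c z χ '' (univ ×ˢ Icc 0 1) := by
  intro x hx
  obtain ⟨m, hm, S, hS, h, rfl⟩ := exists_of_mem_openFiber hc hx
  have hm1 := hm.1
  have hprod : m.1 * m.2.1 = (S : ℂ) ^ 2 * pencil (discLift z) := by
    rw [h] at hm1
    simp only [Prod.smul_fst, Prod.smul_snd, Complex.real_smul, smul_eq_mul] at hm1
    push_cast at hm1
    rw [pencil]
    linear_combination hm1
  have hα : m.1 ≠ 0 := by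
    intro h0
    rw [h0, zero_mul, eq_comm] at hprod
    exact mul_ne_zero (pow_ne_zero 2 (by exact_mod_cast hS.ne')) hz hprod
  have hA : 0 < ‖m.1‖ := norm_pos_iff.2 hα
  set A := ‖m.1‖ with hAdef
  have hAS : 0 < A + S := by linarith
  have hAS' : (A : ℂ) + S ≠ 0 := by exact_mod_cast hAS.ne'
  have hr1 : 1 - A / (A + S) = S / (A + S) := by
    field_simp
    ring
  have hr1' : 1 - (A : ℂ) / (A + S) = S / (A + S) := by
    field_simp
    ring
  have harg := Complex.norm_mul_exp_arg_mul_I m.1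
  rw [← hAdef] at harg
  have hinv : Complex.exp (m.1.arg * Complex.I) * Complex.exp ((-m.1.arg : ℝ) * Complex.I) = 1 := by
    rw [← exp_mul_I_add]
    simp
  have hcone : annulusCone z χ (χ * (1 - A / (A + S)) - m.1.arg, A / (A + S)) =
      (A / (A + S) ^ 2) • m := by
    refine Prod.ext ?_ (Prod.ext ?_ ?_)
    · simp only [annulusCone, sub_sub_cancel, Prod.smul_fst, Complex.real_smul]
      push_cast
      conv_rhs => rw [← harg]
      field_simp
    · simp only [annulusCone, sub_sub_cancel_left, Prod.smul_fst, Prod.smul_snd, Complex.real_smul]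
      push_cast at hinv ⊢
      rw [hr1']
      apply mul_left_cancel₀ hα
      have e1 : m.1 * Complex.exp (-(m.1.arg : ℂ) * Complex.I) = A := by
        linear_combination (A : ℂ) * hinv -
          Complex.exp (-(m.1.arg : ℂ) * Complex.I) * harg
      calc m.1 * ((S / (A + S) : ℂ) ^ 2 * pencil (discLift z) *
          Complex.exp (-(m.1.arg : ℂ) * Complex.I)) =
            (m.1 * Complex.exp (-(m.1.arg : ℂ) * Complex.I)) *
              ((S / (A + S) : ℂ) ^ 2 * pencil (discLift z)) := by ring
        _ = (A / (A + S) ^ 2) * ((S : ℂ) ^ 2 * pencil (discLift z)) := by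
            rw [e1]
            field_simp
        _ = m.1 * (A / (A + S) ^ 2 * m.2.1) := by
            rw [← hprod]
            ring
    · simp only [annulusCone, Prod.smul_snd]
      rw [h, smul_smul, hr1]
      congr 1
      field_simp
  refine ⟨(χ * (1 - A / (A + S)) - m.1.arg, A / (A + S)), ⟨trivial, by positivity, ?_⟩, ?_⟩
  · rw [div_le_one hAS]
    linarith
  · rw [annulus, annulusModel, hcone, rescale_smul (by positivity), rescale_of_mem hm]

theorem isAnnulus_annulus (hball : z ∈ closedBall (0 : ℂ) 1) {χ : ℝ} (hχ : pencil (discLift z) =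
    (‖pencil (discLift z)‖ : ℂ) * Complex.exp (χ * Complex.I)) :
    IsAnnulus (closure (openFiber c z)) (range (directOrbit c)) (range (retrogradeOrbit c))
      (annulus c z χ) where
  smooth := ⟨univ, isOpen_univ, subset_univ _, (contDiff_annulus hz hc χ).contDiffOn⟩
  periodic θ r _ := by
    have h1 := annulusCone_add (z := z) χ θ r (2 * Real.pi)
    have h2 : rotModel (2 * Real.pi) (annulusCone z χ (θ, r)) = annulusCone z χ (θ, r) := by
      have h3 : Complex.exp (-((2 * Real.pi : ℝ) : ℂ) * Complex.I) = 1 := by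
        rw [neg_mul, Complex.exp_neg]
        push_cast
        rw [Complex.exp_two_pi_mul_I, inv_one]
      have h4 : Complex.exp (((2 * Real.pi : ℝ) : ℂ) * Complex.I) = 1 := by
        push_cast
        exact Complex.exp_two_pi_mul_I
      rw [rotModel, h3, h4, one_mul, one_mul]
    rw [annulus, annulusModel, h1, h2]
    rfl
  injective θ θ' r hr r' hr' h := annulus_injective hz hc χ θ θ' hr hr' h
  immersion θ r hr := annulus_immersion hz hc χ θ hr
  image := by
    rw [closure_openFiber hc hball]
    apply Subset.antisymm
    · rintro _ ⟨⟨θ, r⟩, ⟨-, hr⟩, rfl⟩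
      rcases hr.1.eq_or_lt with h0 | h0
      · refine Or.inr (Or.inl ?_)
        rw [← range_annulus_zero hz hc hχ]
        exact ⟨θ, by simp only at h0; rw [h0]⟩
      · rcases hr.2.eq_or_lt with h1 | h1
        · refine Or.inr (Or.inr ?_)
          rw [← range_annulus_one hc χ]
          exact ⟨θ, by simp only at h1; rw [h1]⟩
        · refine Or.inl (pageChart_mem_openFiber hc (annulusModel_mem hz _ _) hball ?_
            (annulusModel_proj χ (θ, r)))
          exact mul_pos (rescale_scale_pos (sizeSq_annulusCone_pos hz χ _))
            (mul_pos h0 (by linarith))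
    · refine union_subset (openFiber_subset_image hz hc χ) (union_subset ?_ ?_)
      · rw [← range_annulus_zero hz hc hχ]
        rintro _ ⟨θ, rfl⟩
        exact ⟨(θ, 0), ⟨trivial, le_rfl, zero_le_one⟩, rfl⟩
      · rw [← range_annulus_one hc χ]
        rintro _ ⟨θ, rfl⟩
        exact ⟨(θ, 1), ⟨trivial, zero_le_one, le_rfl⟩, rfl⟩
  image_zero := range_annulus_zero hz hc hχ
  image_one := range_annulus_one hc χ
  positive θ r hr := by
    obtain ⟨a, ha, hpos⟩ := hasDerivAt_action hz hc r
    rw [symp_annulus hz hc, ha.deriv]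
    exact hpos hr

/-- The rotation number of the return map as a function of the action. -/
def rotationNumber (c : ℝ) (s : ℝ) : ℝ := 2 * Real.pi / √(2 * (s - c)) ^ 3

omit hz hc in
theorem hasDerivAt_rotationNumber {s : ℝ} (hs : c < s) : ContDiffAt ℝ ∞ (rotationNumber c) s ∧
    deriv (rotationNumber c) s ≠ 0 := by
  have hpos : 0 < 2 * (s - c) := by linarith
  have hq : 0 < √(2 * (s - c)) := Real.sqrt_pos.2 hpos
  have h1 : HasDerivAt (fun s => 2 * (s - c)) 2 s := by
    simpa using ((hasDerivAt_id s).sub_const c).const_mul 2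
  refine ⟨?_, ?_⟩
  · have h2 : ContDiffAt ℝ ∞ (fun s => √(2 * (s - c))) s :=
      ContDiffAt.sqrt (by fun_prop) hpos.ne'
    exact contDiffAt_const.div (h2.pow 3) (pow_ne_zero 3 hq.ne')
  · have h2 := ((h1.sqrt hpos.ne').pow 3)
    have h3 : HasDerivAt (rotationNumber c) _ s :=
      (hasDerivAt_const s (2 * Real.pi)).div h2 (pow_ne_zero 3 hq.ne')
    rw [h3.deriv]
    refine div_ne_zero ?_ (pow_ne_zero 2 (pow_ne_zero 3 hq.ne'))
    have h4 := Real.pi_pos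
    rw [zero_mul, zero_sub, neg_ne_zero]
    have h5 : (2 : ℝ) / (2 * √(2 * (s - c))) ≠ 0 := by positivity
    simp only [Nat.cast_ofNat]
    positivity

theorem lt_action (r : ℝ) : c < action c z r := by
  have h := pageChart_mem_energySurface hc (annulusModel_mem hz 0 (0, r))
  rw [energySurface_eq hc] at h
  have h1 : 2 * c / 3 < rotMoment (annulus c z 0 (0, r)) := h.2.2
  rw [rotMoment_annulus hz hc] at h1
  simp only at h1
  linarith

theorem returnMap_annulus (χ θ r : ℝ) :
    returnMap c (annulus c z χ (θ, r)) =
      annulus c z χ (θ + rotationNumber c (action c z r), r) := by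
  rw [annulus_add, returnMap, keplerFreq, rotMoment_annulus hz hc]
  rfl

theorem isIntegrableTwist_returnMap (hball : z ∈ closedBall (0 : ℂ) 1) :
    IsIntegrableTwist (closure (openFiber c z)) (range (directOrbit c))
      (range (retrogradeOrbit c)) (returnMap c) := by
  have hχ := (Complex.norm_mul_exp_arg_mul_I (pencil (discLift z))).symm
  have hI := strictMonoOn_action hz hc
  have h0 : ∀ s ∈ Icc (action c z 0) (action c z 1), c < s := fun s hs =>
    (lt_action hz hc 0).trans_le hs.1
  refine ⟨annulus c z (pencil (discLift z)).arg, action c z, rotationNumber c,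
    isAnnulus_annulus hz hc hball hχ, ⟨univ, isOpen_univ, subset_univ _,
      (contDiff_action hz hc).contDiffOn⟩, hI, fun θ r _ => symp_annulus hz hc _ _,
    smoothOn_of_contDiffAt isOpen_Ioi h0 fun s hs => (hasDerivAt_rotationNumber hs).1,
    fun s hs => (hasDerivAt_rotationNumber (h0 s hs)).2,
    fun θ r _ => returnMap_annulus hz hc _ θ r⟩

end annulus

/-! ### Families of annuli -/

section family

variable {c : ℝ} (hc : c < -3 / 2)
include hc

/-- A family of parametrizations requires nothing more than a smooth choice `χ` of the argument of
the discriminant. The boundary values are given by formulas in which the parameter does not occur.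
-/
theorem isFiberFamily_annulus {X : Type*} [NormedAddCommGroup X] [NormedSpace ℝ X] {U B : Set X}
    (hU : IsOpen U) (hBU : B ⊆ U) {z : X → ℂ} {χ : X → ℝ} (hz : ∀ b ∈ U, ContDiffAt ℝ ∞ z b)
    (hχ : ∀ b ∈ U, ContDiffAt ℝ ∞ χ b) (hδ : ∀ b ∈ U, pencil (discLift (z b)) ≠ 0)
    (hB : ∀ b ∈ B, z b ∈ closedBall (0 : ℂ) 1)
    (harg : ∀ b ∈ B, pencil (discLift (z b)) =
      (‖pencil (discLift (z b))‖ : ℂ) * Complex.exp (χ b * Complex.I)) :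
    IsFiberFamily c (range (directOrbit c)) (range (retrogradeOrbit c)) (lefschetz c) B z
      fun q => annulus c (z q.1) (χ q.1) q.2 := by
  refine ⟨?_, fun b hb => ?_, fun b hb b' hb' θ => ⟨?_, ?_⟩⟩
  · refine smoothOn_of_contDiffAt (hU.prod isOpen_univ) (prod_mono hBU (subset_univ _))
      fun q hq => ?_
    exact (contDiffAt_annulus (hδ q.1 hq.1) hc ((hz q.1 hq.1).comp q contDiffAt_fst)
      ((hχ q.1 hq.1).comp q contDiffAt_fst) contDiffAt_snd rfl).2
  · exact isAnnulus_annulus (z := z b) (χ := χ b) (hδ b (hBU hb)) hc (hB b hb) (harg b hb)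
  · simp only [annulus, annulusModel_zero (hδ b (hBU hb)) (harg b hb),
      annulusModel_zero (hδ b' (hBU hb')) (harg b' hb')]
  · simp only [annulus, annulusModel_one]

omit hc in
theorem contDiff_pencil_discLift : ContDiff ℝ ∞ fun z => pencil (discLift z) :=
  ((contDiff_ofReal.comp (contDiff_snd.comp contDiff_discLift)).pow 2).sub
    ((contDiff_fst.comp contDiff_discLift).pow 2)

/-- Near `z₀` the principal logarithm of `δ/δ₀`, shifted by the argument of `δ₀`, is a smooth branch
of the argument of `δ`. -/
theorem exists_isFiberFamily {z₀ : ℂ} (h0 : pencil (discLift z₀) ≠ 0) :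
    ∃ N ∈ 𝓝 z₀, ∃ Ψ : ℂ × (ℝ × ℝ) → Phase, IsFiberFamily c (range (directOrbit c))
      (range (retrogradeOrbit c)) (lefschetz c) (N ∩ closedBall 0 1) (fun z => z) Ψ := by
  have hcont := contDiff_pencil_discLift.continuous
  set δ₀ := pencil (discLift z₀) with hδ₀
  set N : Set ℂ := {z | pencil (discLift z) / δ₀ ∈ Complex.slitPlane} with hN
  have hNo : IsOpen N := Complex.isOpen_slitPlane.preimage (hcont.div_const δ₀)
  have hδ : ∀ z ∈ N, pencil (discLift z) ≠ 0 := fun z hz h => by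
    rw [hN, mem_ofPred_eq, h, zero_div] at hz
    exact Complex.slitPlane_ne_zero hz rfl
  refine ⟨N, hNo.mem_nhds ?_, _, isFiberFamily_annulus hc (U := N)
    (χ := fun z => (Complex.log (pencil (discLift z) / δ₀)).im + δ₀.arg) hNo inter_subset_left
    (fun _ _ => contDiffAt_id) (fun z hz => ?_) hδ (fun z hz => hz.2) fun z hz => ?_⟩
  · rw [hN, mem_ofPred_eq, div_self h0]
    exact Complex.one_mem_slitPlane
  · have h1 : ContDiffAt ℝ ∞ (fun z => pencil (discLift z) / δ₀) z := by
      simp only [div_eq_mul_inv]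
      exact contDiff_pencil_discLift.contDiffAt.mul contDiffAt_const
    have h2 : ContDiffAt ℝ ∞ Complex.log (pencil (discLift z) / δ₀) :=
      (Complex.contDiffAt_log (n := ∞) hz).restrict_scalars ℝ
    exact (Complex.imCLM.contDiff.contDiffAt.comp z (h2.comp z h1)).add contDiffAt_const
  · rw [Complex.log_im, exp_mul_I_add]
    have h1 := Complex.norm_mul_exp_arg_mul_I (pencil (discLift z) / δ₀)
    have h2 := Complex.norm_mul_exp_arg_mul_I δ₀
    have h3 : pencil (discLift z) = pencil (discLift z) / δ₀ * δ₀ := (div_mul_cancel₀ _ h0).symm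
    have h4 : (‖pencil (discLift z)‖ : ℂ) = ‖pencil (discLift z) / δ₀‖ * ‖δ₀‖ := by
      rw [← Complex.ofReal_mul, ← norm_mul, ← h3]
    rw [h4]
    conv_lhs => rw [h3, ← h1]
    conv_lhs => enter [2]; rw [← h2]
    ring

/-- Over the unit circle `t = 0` and `δ = -(conj z)²`, with argument `π - 4πt` at the point
`e^{2πit}`. Once around, `χ` drops by `4π` while the fiber is the same, so the two parametrizations
differ by `θ ↦ θ - 4πr`, two Dehn twists. -/
theorem exists_monodromy : ∃ Ψ : ℝ × (ℝ × ℝ) → Phase,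
    IsFiberFamily c (range (directOrbit c)) (range (retrogradeOrbit c)) (lefschetz c)
      (Icc (0 : ℝ) 1) (fun t => Complex.exp (2 * Real.pi * t * Complex.I)) Ψ ∧
    ∀ θ, ∀ r ∈ Icc (0 : ℝ) 1, Ψ (1, (θ, r)) = Ψ (0, dehnTwist (dehnTwist (θ, r))) := by
  have hn : ∀ t : ℝ, normSq (Complex.exp (2 * Real.pi * t * Complex.I)) = 1 := fun t => by
    have := normSq_exp (2 * Real.pi * t)
    push_cast at this
    exact this
  have hδ : ∀ t : ℝ, pencil (discLift (Complex.exp (2 * Real.pi * t * Complex.I))) =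
      Complex.exp ((Real.pi - 4 * Real.pi * t : ℝ) * Complex.I) := fun t => by
    have h1 : discLift (Complex.exp (2 * Real.pi * t * Complex.I)) =
        (Complex.exp (-(2 * Real.pi * t * Complex.I)), 0) := by
      rw [discLift, hn, ← Complex.exp_conj]
      norm_num [map_ofNat]
    rw [h1, pencil]
    have h2 : ((Real.pi - 4 * Real.pi * t : ℝ) : ℂ) * Complex.I =
        Real.pi * Complex.I +
          (-(2 * Real.pi * t * Complex.I) + -(2 * Real.pi * t * Complex.I)) := by
      push_cast
      ring
    rw [h2, Complex.exp_add, Complex.exp_add, Complex.exp_pi_mul_I]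
    push_cast
    ring
  have hnorm : ∀ t : ℝ, ‖pencil (discLift (Complex.exp (2 * Real.pi * t * Complex.I)))‖ = 1 :=
    fun t => by rw [hδ, Complex.norm_exp_ofReal_mul_I]
  refine ⟨_, isFiberFamily_annulus hc (χ := fun t => Real.pi - 4 * Real.pi * t) isOpen_univ
    (subset_univ _) (fun t _ => ?_) (fun t _ => ?_) (fun t _ => ?_) (fun t _ => ?_) fun t _ => ?_,
    fun θ r hr => ?_⟩
  · exact ((contDiff_const.mul contDiff_ofReal).mul contDiff_const).cexp.contDiffAt
  · fun_prop
  · rw [← norm_ne_zero_iff, hnorm]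
    exact one_ne_zero
  · rw [mem_closedBall_zero_iff, ← sq_le_sq₀ (norm_nonneg _) zero_le_one,
      ← Complex.normSq_eq_norm_sq, hn, one_pow]
  · rw [hnorm, hδ, Complex.ofReal_one, one_mul]
  · have hz : Complex.exp (2 * Real.pi * (1 : ℝ) * Complex.I) =
        Complex.exp (2 * Real.pi * (0 : ℝ) * Complex.I) := by
      push_cast
      rw [mul_one, Complex.exp_two_pi_mul_I, mul_zero, zero_mul, Complex.exp_zero]
    simp only [dehnTwist, annulus, annulusModel]
    rw [hz]
    congr 2
    refine Prod.ext ?_ (Prod.ext ?_ rfl)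
    · simp only [annulusCone]
      congr 1
      -- The change of `χ` contributes `-4π (1 - r)` to the difference of the phases and the twists
      -- contribute `-4π r`; the total is `-2 · 2π`.
      refine Complex.exp_eq_exp_iff_exists_int.2 ⟨-2, ?_⟩
      push_cast
      ring
    · simp only [annulusCone]
      congr 1
      refine Complex.exp_eq_exp_iff_exists_int.2 ⟨2, ?_⟩
      push_cast
      ring

end family

/-! ### The square root on the right half-plane -/

/-- The branch of the square root with positive real part. -/
def csqrt (w : ℂ) : ℂ := Complex.exp (Complex.log w / 2)

theorem csqrt_sq {w : ℂ} (hw : w ≠ 0) : csqrt w ^ 2 = w := by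
  rw [csqrt, ← Complex.exp_nat_mul]
  push_cast
  rw [mul_div_cancel₀ _ two_ne_zero, Complex.exp_log hw]

theorem csqrt_re_pos {w : ℂ} (hw : w ∈ Complex.slitPlane) : 0 < (csqrt w).re := by
  have h1 := Complex.neg_pi_lt_arg w
  have h2 : w.arg < Real.pi := lt_of_le_of_ne (Complex.arg_le_pi w)
    (Complex.mem_slitPlane_iff_arg.1 hw).1
  rw [csqrt, Complex.exp_re]
  refine mul_pos (Real.exp_pos _) (Real.cos_pos_of_mem_Ioo ?_)
  have : (Complex.log w / 2).im = w.arg / 2 := by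
    rw [← Complex.log_im]
    simp
  rw [this]
  exact ⟨by linarith, by linarith⟩

theorem eq_csqrt {w y : ℂ} (hw : w ∈ Complex.slitPlane) (h : y ^ 2 = w) (hy : 0 < y.re) :
    y = csqrt w := by
  rw [← csqrt_sq (Complex.slitPlane_ne_zero hw)] at h
  refine (sq_eq_sq_iff_eq_or_eq_neg.1 h).resolve_right fun h' => ?_
  have := csqrt_re_pos hw
  rw [h', Complex.neg_re] at hy
  linarith

@[simp] theorem csqrt_one : csqrt 1 = 1 := by simp [csqrt]

theorem contDiffAt_csqrt {w : ℂ} (hw : w ∈ Complex.slitPlane) : ContDiffAt ℝ ∞ csqrt w :=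
  (((Complex.contDiffAt_log (n := ∞) hw).div_const 2).cexp).restrict_scalars ℝ

theorem hasDerivAt_csqrt {w : ℂ} (hw : w ∈ Complex.slitPlane) :
    ∃ a : ℂ, a ≠ 0 ∧ HasDerivAt csqrt a w :=
  ⟨_, mul_ne_zero (Complex.exp_ne_zero _)
    (div_ne_zero (inv_ne_zero (Complex.slitPlane_ne_zero hw)) two_ne_zero),
    ((Complex.hasDerivAt_log hw).div_const 2).cexp⟩

theorem one_sub_mem_slitPlane {u : ℂ} (hu : ‖u‖ < 1) : 1 - u ∈ Complex.slitPlane := by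
  refine Or.inl ?_
  have := (Complex.abs_re_le_norm u).trans_lt hu
  rw [abs_lt] at this
  rw [Complex.sub_re, Complex.one_re]
  linarith

/-! ### The base coordinate at the nodes -/

theorem det_eq (A : ℂ →L[ℝ] ℂ) :
    A.det = (A 1).re * (A Complex.I).im - (A 1).im * (A Complex.I).re := by
  rw [ContinuousLinearMap.det, ← LinearMap.det_toMatrix Complex.basisOneI, Matrix.det_fin_two]
  simp [LinearMap.toMatrix_apply]
  ring

/-- The local coordinate on the base at the critical values. -/
def nodeBase (ε : ℝ) (u : ℂ) : ℂ := discProj ((starRingEnd ℂ) (ε * csqrt (1 - u)), 1)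

/-- Different points of the plane at height `1` lie on different rays. -/
theorem discProj_one_inj {s s' : ℂ} (h : discProj (s, 1) = discProj (s', 1)) : s = s' := by
  have h1 : 0 < radius (s, 1) + ((s, 1) : ℂ × ℝ).2 := radius_add_pos
    (fun h => one_ne_zero (Prod.ext_iff.1 h).2) zero_le_one
  have h2 : 0 < radius (s', 1) + ((s', 1) : ℂ × ℝ).2 := radius_add_pos
    (fun h => one_ne_zero (Prod.ext_iff.1 h).2) zero_le_one
  have e1 := smul_discLift_discProj h1
  have e2 := smul_discLift_discProj h2
  rw [h] at e1
  obtain ⟨a1, b1⟩ := Prod.ext_iff.1 e1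
  obtain ⟨a2, b2⟩ := Prod.ext_iff.1 e2
  simp only [Prod.smul_fst, Prod.smul_snd, smul_eq_mul] at a1 b1 a2 b2
  have hne : (discLift (discProj (s', 1))).2 ≠ 0 := fun h => by
    rw [h, mul_zero] at b2
    exact zero_ne_one b2
  have hr : radius (s, 1) = radius (s', 1) := mul_right_cancel₀ hne (b1.trans b2.symm)
  rw [hr] at a1
  exact a1.symm.trans a2

section base

variable {ε : ℝ} (hε : ε ≠ 0)
include hε

theorem injOn_nodeBase : InjOn (nodeBase ε) (ball 0 1) := by
  intro u hu v hv h
  rw [mem_ball_zero_iff] at hu hv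
  have h1 := (starRingEnd ℂ).injective (discProj_one_inj h)
  have h2 := mul_left_cancel₀ (by exact_mod_cast hε) h1
  have h3 := congrArg (· ^ 2) h2
  simp only [csqrt_sq (Complex.slitPlane_ne_zero (one_sub_mem_slitPlane hu)),
    csqrt_sq (Complex.slitPlane_ne_zero (one_sub_mem_slitPlane hv))] at h3
  linear_combination -h3

omit hε in
theorem contDiffOn_nodeBase : ContDiffOn ℝ ∞ (nodeBase ε) (ball 0 1) := by
  intro u hu
  rw [mem_ball_zero_iff] at hu
  have h1 : ContDiffAt ℝ ∞ (fun u : ℂ => csqrt (1 - u)) u :=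
    (contDiffAt_csqrt (one_sub_mem_slitPlane hu)).comp u (contDiffAt_const.sub contDiffAt_id)
  have h2 : ContDiffAt ℝ ∞ (fun u : ℂ => ((starRingEnd ℂ) (ε * csqrt (1 - u)), (1 : ℝ))) u :=
    (contDiff_conj.contDiffAt.comp u (contDiffAt_const.mul h1)).prodMk contDiffAt_const
  refine ContDiffAt.contDiffWithinAt ((contDiffAt_discProj ?_).comp u h2)
  exact radius_add_pos (fun h => one_ne_zero (Prod.ext_iff.1 h).2) zero_le_one

/-- The coordinate is the holomorphic map `s = ε csqrt (1 - u)` followed by the radial map `s ↦ s/(R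
+ 1)`, where `R = √(|s|² + 1)`. The latter has the eigenvalues `1/(R + 1)` across the radius and
`1/(R (R + 1))` along it, both positive. -/
theorem det_fderiv_nodeBase_pos {u : ℂ} (hu : u ∈ ball (0 : ℂ) 1) :
    0 < (fderiv ℝ (nodeBase ε) u).det := by
  rw [mem_ball_zero_iff] at hu
  obtain ⟨a, ha, hd⟩ := hasDerivAt_csqrt (one_sub_mem_slitPlane hu)
  set s : ℂ := ε * csqrt (1 - u) with hs
  set γ : ℂ := -(ε * a) with hγdef
  have hγ : γ ≠ 0 := neg_ne_zero.2 (mul_ne_zero (by exact_mod_cast hε) ha)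
  have hg : HasDerivAt (fun u : ℂ => (ε : ℂ) * csqrt (1 - u)) γ u := by
    refine ((hd.comp u ((hasDerivAt_id u).const_sub 1)).const_mul (ε : ℂ)).congr_deriv ?_
    rw [hγdef]
    ring
  set R : ℝ := √(normSq s + 1) with hR
  have hpos : 0 < normSq s + 1 := by
    have := Complex.normSq_nonneg s
    linarith
  have hR0 : 0 < R := Real.sqrt_pos.2 hpos
  have hR2 : R ^ 2 = normSq s + 1 := Real.sq_sqrt hpos.le
  have key : ∀ v : ℂ, fderiv ℝ (nodeBase ε) u v = (((R + 1)⁻¹ : ℝ) : ℂ) * (γ * v) -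
      (((s.re * (γ * v).re + s.im * (γ * v).im) / (R * (R + 1) ^ 2) : ℝ) : ℂ) * s := by
    intro v
    have hl : HasDerivAt (fun t : ℝ => u + t • v) v 0 := by
      simpa using ((hasDerivAt_id (0 : ℝ)).smul_const v).const_add u
    have hgF := hg.hasFDerivAt.restrictScalars ℝ
    have h1 : HasDerivAt (fun t : ℝ => (ε : ℂ) * csqrt (1 - (u + t • v))) (γ * v) 0 := by
      refine (hgF.comp_hasDerivAt_of_eq 0 hl (by simp)).congr_deriv ?_
      simp [mul_comm]
    have hre : HasDerivAt (fun t : ℝ => ((ε : ℂ) * csqrt (1 - (u + t • v))).re) (γ * v).re 0 :=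
      Complex.reCLM.hasFDerivAt.comp_hasDerivAt 0 h1
    have him : HasDerivAt (fun t : ℝ => ((ε : ℂ) * csqrt (1 - (u + t • v))).im) (γ * v).im 0 :=
      Complex.imCLM.hasFDerivAt.comp_hasDerivAt 0 h1
    have h2 : HasDerivAt (fun t : ℝ => normSq ((ε : ℂ) * csqrt (1 - (u + t • v))) + 1)
        (2 * (s.re * (γ * v).re + s.im * (γ * v).im)) 0 := by
      simp only [Complex.normSq_apply]
      refine (((hre.mul hre).add (him.mul him)).add_const 1).congr_deriv ?_
      simp only [zero_smul, add_zero, ← hs]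
      ring
    have h3 := (h2.sqrt (by simpa [← hs] using hpos.ne')).add_const 1
    have hne : √(normSq ((ε : ℂ) * csqrt (1 - (u + (0 : ℝ) • v))) + 1) + 1 ≠ 0 := by
      positivity
    have h4 := (h3.inv hne).ofReal_comp.mul h1
    have h5 := h4.congr_of_eventuallyEq (f₁ := fun t : ℝ => nodeBase ε (u + t • v)) <| by
      refine Eventually.of_forall fun t => ?_
      simp only [nodeBase, discProj, radius, Complex.conj_conj, Complex.normSq_conj, one_pow,
        Pi.mul_apply, Pi.inv_apply, Complex.ofReal_inv]
      rw [div_eq_mul_inv, mul_comm]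
    have hb : HasFDerivAt (nodeBase ε) (fderiv ℝ (nodeBase ε) u) (u + (0 : ℝ) • v) := by
      rw [zero_smul, add_zero]
      exact ((contDiffOn_nodeBase.contDiffAt (isOpen_ball.mem_nhds
        (mem_ball_zero_iff.2 hu))).differentiableAt (by simp)).hasFDerivAt
    have h6 : HasDerivAt (fun t : ℝ => nodeBase ε (u + t • v)) (fderiv ℝ (nodeBase ε) u v) 0 := by
      have := hb.comp_hasDerivAt 0 hl
      exact this
    rw [h6.unique h5]
    simp only [zero_smul, add_zero, ← hs, ← hR, Pi.inv_apply]
    have e1 : -(2 * (s.re * (γ * v).re + s.im * (γ * v).im) / (2 * R)) / (R + 1) ^ 2 =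
        -((s.re * (γ * v).re + s.im * (γ * v).im) / (R * (R + 1) ^ 2)) := by
      field_simp
    rw [e1]
    push_cast
    ring
  rw [det_eq, key, key]
  have hfin : ∀ h q x y p r : ℝ, ((h * x - q * (p * x + r * y) * p) *
      (h * x - q * (p * (-y) + r * x) * r) -
      (h * y - q * (p * x + r * y) * r) * (h * (-y) - q * (p * (-y) + r * x) * p)) =
      (x ^ 2 + y ^ 2) * (h * (h - q * (p ^ 2 + r ^ 2))) := fun h q x y p r => by ring
  have hq : (R + 1)⁻¹ - 1 / (R * (R + 1) ^ 2) * (s.re ^ 2 + s.im ^ 2) = (R * (R + 1))⁻¹ := by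
    rw [Complex.normSq_apply] at hR2
    field_simp
    linear_combination hR2
  have h0 : (0 : ℝ) < (γ.re ^ 2 + γ.im ^ 2) * ((R + 1)⁻¹ * (R * (R + 1))⁻¹) := by
    have : γ.re ^ 2 + γ.im ^ 2 = normSq γ := by
      rw [Complex.normSq_apply]
      ring
    rw [this]
    have := Complex.normSq_pos.2 hγ
    positivity
  rw [← hq, ← hfin] at h0
  refine h0.trans_eq ?_
  simp only [Complex.sub_re, Complex.sub_im, Complex.re_ofReal_mul, Complex.im_ofReal_mul, mul_one]
  simp only [Complex.mul_re, Complex.mul_im, Complex.I_re, Complex.I_im]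
  ring

end base

/-! ### The complex coordinates at the nodes -/

/-- The parametrization of the cone over the model by complex coordinates. -/
def nodeModel (ε : ℝ) (p : ℂ × ℂ) : Model :=
  -- At height `t = 1` the cone is `αβ = 1 - Z²`. The conjugates are needed because at the poles `ω`
  -- is negative on complex lines in the coordinates `(α, β)`.
  ((starRingEnd ℂ) (p.1 + Complex.I * p.2), (starRingEnd ℂ) (p.1 - Complex.I * p.2),
    (starRingEnd ℂ) (ε * csqrt (1 - (p.1 ^ 2 + p.2 ^ 2))), 1)

/-- The inverse of `nodeModel` on the cone over the model. -/
def nodeCoord (m : Model) : ℂ × ℂ :=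
  ((starRingEnd ℂ) (m.1 + m.2.1) / (2 * m.2.2.2),
    (starRingEnd ℂ) (m.1 - m.2.1) / (2 * m.2.2.2 * Complex.I))

/-- The parametrization of the page by complex coordinates at the nodes. -/
def nodeChart (c ε : ℝ) (p : ℂ × ℂ) : Phase := pageChart c (rescale (nodeModel ε p))

/-- Here `1 - (p₁² + p₂²)` stays in the right half-plane, where `csqrt` is smooth with positive real
part; the sign of the real part of `Z` is then that of `ε`. -/
def nodeDomain : Set (ℂ × ℂ) := {p | ‖p.1 ^ 2 + p.2 ^ 2‖ < 1}

theorem isOpen_nodeDomain : IsOpen nodeDomain := isOpen_lt (by fun_prop) continuous_const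

theorem zero_mem_nodeDomain : (0 : ℂ × ℂ) ∈ nodeDomain := by
  change ‖(0 : ℂ) ^ 2 + 0 ^ 2‖ < 1
  simp

theorem sizeSq_nodeModel_pos (ε : ℝ) (p : ℂ × ℂ) : 0 < sizeSq (nodeModel ε p) := by
  have h1 := Complex.normSq_nonneg (nodeModel ε p).1
  have h2 := Complex.normSq_nonneg (nodeModel ε p).2.1
  have h3 := Complex.normSq_nonneg (nodeModel ε p).2.2.1
  have h4 : (nodeModel ε p).2.2.2 = 1 := rfl
  rw [sizeSq, h4]
  linarith

theorem nodeCoord_smul {a : ℝ} (ha : a ≠ 0) (m : Model) : nodeCoord (a • m) = nodeCoord m := by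
  have ha' : (a : ℂ) ≠ 0 := by exact_mod_cast ha
  simp only [nodeCoord, Prod.smul_fst, Prod.smul_snd, Complex.real_smul, smul_eq_mul, map_add,
    map_sub, map_mul, Complex.conj_ofReal, Complex.ofReal_mul]
  refine Prod.ext ?_ ?_
  · change _ / _ = _ / _
    rw [← mul_div_mul_left _ (2 * (m.2.2.2 : ℂ)) ha']
    congr 1 <;> ring
  · change _ / _ = _ / _
    rw [← mul_div_mul_left _ (2 * (m.2.2.2 : ℂ) * Complex.I) ha']
    congr 1 <;> ring

theorem nodeCoord_nodeModel (ε : ℝ) (p : ℂ × ℂ) : nodeCoord (nodeModel ε p) = p := by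
  simp only [nodeCoord, nodeModel, ← map_add, ← map_sub, Complex.conj_conj, Complex.ofReal_one]
  refine Prod.ext ?_ ?_
  · change _ / _ = _
    field_simp
    ring
  · change _ / _ = _
    field_simp
    ring

theorem contDiffOn_nodeModel (ε : ℝ) : ContDiffOn ℝ ∞ (nodeModel ε) nodeDomain := by
  intro p hp
  have h1 : ContDiffAt ℝ ∞ (fun p : ℂ × ℂ => csqrt (1 - (p.1 ^ 2 + p.2 ^ 2))) p :=
    ContDiffAt.comp (g := csqrt) (f := fun p : ℂ × ℂ => 1 - (p.1 ^ 2 + p.2 ^ 2)) p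
      (contDiffAt_csqrt (one_sub_mem_slitPlane hp)) (by fun_prop)
  have h2 : ContDiffAt ℝ ∞ (fun p : ℂ × ℂ => p.1 + Complex.I * p.2) p := by fun_prop
  have h3 : ContDiffAt ℝ ∞ (fun p : ℂ × ℂ => p.1 - Complex.I * p.2) p := by fun_prop
  exact ((contDiff_conj.contDiffAt.comp p h2).prodMk ((contDiff_conj.contDiffAt.comp p h3).prodMk
    ((contDiff_conj.contDiffAt.comp p (contDiffAt_const.mul h1)).prodMk
      contDiffAt_const))).contDiffWithinAt

/-! ### The page near a pole in complex coordinates -/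

section node

variable {ε : ℝ} (hε : ε ^ 2 = 1)
include hε

theorem nodeModel_cone {p : ℂ × ℂ} (hp : p ∈ nodeDomain) : (nodeModel ε p).1 * (nodeModel ε p).2.1 +
    (nodeModel ε p).2.2.1 ^ 2 = ((nodeModel ε p).2.2.2 : ℂ) ^ 2 := by
  simp only [nodeModel, ← map_mul, ← map_pow, ← map_add]
  rw [mul_pow, csqrt_sq (Complex.slitPlane_ne_zero (one_sub_mem_slitPlane hp)),
    ← Complex.ofReal_pow, hε, Complex.ofReal_one, one_pow]
  refine (congrArg (starRingEnd ℂ) ?_).trans (map_one (starRingEnd ℂ))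
  linear_combination (-p.2 ^ 2) * Complex.I_sq

theorem rescale_nodeModel_mem {p : ℂ × ℂ} (hp : p ∈ nodeDomain) :
    rescale (nodeModel ε p) ∈ quadric :=
  rescale_mem (nodeModel_cone hε hp) (sizeSq_nodeModel_pos ε p)

/-- After division by `t` the number `ε conj Z / t` is a square root of `1 - conj (αβ) / t²`, and
the condition on the real part of `Z` selects the branch. -/
theorem eq_nodeModel {m : Model} (hm : m.1 * m.2.1 + m.2.2.1 ^ 2 = (m.2.2.2 : ℂ) ^ 2)
    (ht : 0 < m.2.2.2) (hZ : 0 < ε * m.2.2.1.re) (hp : nodeCoord m ∈ nodeDomain) :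
    m = m.2.2.2 • nodeModel ε (nodeCoord m) := by
  obtain ⟨α, β, Z, t⟩ := m
  simp only at hm ht hZ
  have ht' : (t : ℂ) ≠ 0 := by exact_mod_cast ht.ne'
  have hε' : (ε : ℂ) ^ 2 = 1 := by exact_mod_cast hε
  have e1 : (nodeCoord (α, β, Z, t)).1 + Complex.I * (nodeCoord (α, β, Z, t)).2 =
      (starRingEnd ℂ) α / t := by
    simp only [nodeCoord, map_add, map_sub]
    field_simp
    ring
  have e2 : (nodeCoord (α, β, Z, t)).1 - Complex.I * (nodeCoord (α, β, Z, t)).2 =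
      (starRingEnd ℂ) β / t := by
    simp only [nodeCoord, map_add, map_sub]
    field_simp
    ring
  have e3 : (nodeCoord (α, β, Z, t)).1 ^ 2 + (nodeCoord (α, β, Z, t)).2 ^ 2 =
      (starRingEnd ℂ) (α * β) / t ^ 2 := by
    rw [map_mul, pow_two (t : ℂ), mul_div_mul_comm, ← e1, ← e2]
    linear_combination (nodeCoord (α, β, Z, t)).2 ^ 2 * Complex.I_sq
  have e4 : ε * (starRingEnd ℂ) Z / t =
      csqrt (1 - ((nodeCoord (α, β, Z, t)).1 ^ 2 + (nodeCoord (α, β, Z, t)).2 ^ 2)) := by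
    refine eq_csqrt (one_sub_mem_slitPlane hp) ?_ ?_
    · have hm' := congrArg (starRingEnd ℂ) hm
      simp only [map_add, map_mul, map_pow, Complex.conj_ofReal] at hm'
      rw [e3, div_pow, mul_pow, hε', map_mul]
      field_simp
      linear_combination hm'
    · rw [Complex.div_ofReal_re, Complex.re_ofReal_mul, Complex.conj_re]
      exact div_pos hZ ht
  simp only [nodeModel, e1, e2, ← e4, map_div₀, map_mul, Complex.conj_conj, Complex.conj_ofReal]
  refine Prod.ext ?_ (Prod.ext ?_ (Prod.ext ?_ ?_))
  · change α = t • (α / t)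
    rw [Complex.real_smul, mul_div_cancel₀ _ ht']
  · change β = t • (β / t)
    rw [Complex.real_smul, mul_div_cancel₀ _ ht']
  · change Z = t • (ε * (ε * Z / t))
    rw [Complex.real_smul]
    field_simp
    linear_combination (-Z) * hε'
  · change t = t • (1 : ℝ)
    simp

variable {c : ℝ} (hc : c < -3 / 2)
include hc

theorem pageCoord_nodeChart {p : ℂ × ℂ} (hp : p ∈ nodeDomain) :
    pageCoord c (nodeChart c ε p) = rescale (nodeModel ε p) :=
  pageCoord_pageChart hc (embed_mem_chartSource hc (rescale_nodeModel_mem hε hp))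

theorem nodeCoord_pageCoord_nodeChart {p : ℂ × ℂ} (hp : p ∈ nodeDomain) :
    nodeCoord (pageCoord c (nodeChart c ε p)) = p := by
  rw [pageCoord_nodeChart hε hc hp, rescale,
    nodeCoord_smul (rescale_scale_pos (sizeSq_nodeModel_pos ε p)).ne', nodeCoord_nodeModel]

theorem contDiffOn_nodeChart : ContDiffOn ℝ ∞ (nodeChart c ε) nodeDomain := fun p hp =>
  ((contDiffAt_pageChart hc (rescale_nodeModel_mem hε hp)).comp p
    ((contDiffAt_rescale (sizeSq_nodeModel_pos ε p)).comp p
      ((contDiffOn_nodeModel ε).contDiffAt (isOpen_nodeDomain.mem_nhds hp)))).contDiffWithinAt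

theorem nodeChart_mem_page {p : ℂ × ℂ} (hp : p ∈ nodeDomain) : nodeChart c ε p ∈ page c := by
  refine (pageChart_mem_page_iff hc (rescale_nodeModel_mem hε hp)).2 ?_
  exact mul_nonneg (rescale_scale_pos (sizeSq_nodeModel_pos ε p)).le zero_le_one

theorem lefschetz_nodeChart {p : ℂ × ℂ} (hp : p ∈ nodeDomain) :
    lefschetz c (nodeChart c ε p) = nodeBase ε (p.1 ^ 2 + p.2 ^ 2) := by
  rw [lefschetz, pageCoord_nodeChart hε hc hp]
  exact discProj_smul (rescale_scale_pos (sizeSq_nodeModel_pos ε p)) _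

/-- By `eq_nodeModel` a point of the page lies in the image as soon as `t > 0`, `ε Re Z > 0` and
`nodeCoord` has its value in `V`. These conditions are open. -/
theorem nodeChart_isOpen_image {V : Set (ℂ × ℂ)} (hV : IsOpen V) (hVD : V ⊆ nodeDomain)
    {p : ℂ × ℂ} (hp : p ∈ V) :
    ∃ O : Set Phase, IsOpen O ∧ nodeChart c ε p ∈ O ∧ page c ∩ O ⊆ nodeChart c ε '' V := by
  have hcoord : ContinuousOn (pageCoord c) (chartTarget c) := fun x hx =>
    (contDiffAt_pageCoord hc hx).continuousAt.continuousWithinAt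
  set M : Set Model := {m | 0 < m.2.2.2 ∧ 0 < ε * m.2.2.1.re} with hM
  have hM1 : IsOpen {m : Model | 0 < m.2.2.2} := isOpen_lt continuous_const (by fun_prop)
  have hM2 : IsOpen {m : Model | 0 < ε * m.2.2.1.re} := by
    refine isOpen_lt continuous_const (continuous_const.mul ?_)
    exact Complex.continuous_re.comp (by fun_prop)
  have hMo : IsOpen M := hM1.inter hM2
  have hnode : ContinuousOn nodeCoord M := by
    intro m hm
    have h0 : (2 * (m.2.2.2 : ℂ)) ≠ 0 :=
      mul_ne_zero two_ne_zero (by exact_mod_cast hm.1.ne')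
    have h1 : ContinuousAt (fun m : Model => 2 * (m.2.2.2 : ℂ)) m :=
      (continuous_const.mul (Complex.continuous_ofReal.comp (by fun_prop))).continuousAt
    have h2 : ContinuousAt (fun m : Model => (starRingEnd ℂ) (m.1 + m.2.1)) m :=
      (Complex.continuous_conj.comp (by fun_prop)).continuousAt
    have h3 : ContinuousAt (fun m : Model => (starRingEnd ℂ) (m.1 - m.2.1)) m :=
      (Complex.continuous_conj.comp (by fun_prop)).continuousAt
    exact ((h2.div h1 h0).prodMk (h3.div (h1.mul continuousAt_const)
      (mul_ne_zero h0 Complex.I_ne_zero))).continuousWithinAt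
  have hO := hcoord.isOpen_inter_preimage (isOpen_chartTarget hc)
    (hnode.isOpen_inter_preimage hMo hV)
  refine ⟨_, hO, ⟨energySurface_subset_chartTarget hc (nodeChart_mem_page hε hc (hVD hp)).1,
    ?_, ?_⟩, ?_⟩
  · rw [pageCoord_nodeChart hε hc (hVD hp)]
    have ha := rescale_scale_pos (sizeSq_nodeModel_pos ε p)
    refine ⟨mul_pos ha one_pos, ?_⟩
    change 0 < ε * ((2 / √(sizeSq (nodeModel ε p))) • (nodeModel ε p).2.2.1).re
    rw [Complex.smul_re, smul_eq_mul]
    change 0 < ε * (_ * ((starRingEnd ℂ) (ε * csqrt (1 - (p.1 ^ 2 + p.2 ^ 2)))).re)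
    rw [Complex.conj_re, Complex.re_ofReal_mul]
    have hpos := csqrt_re_pos (one_sub_mem_slitPlane (hVD hp))
    refine (mul_pos ha hpos).trans_eq ?_
    linear_combination (-(2 / √(sizeSq (nodeModel ε p)) *
      (csqrt (1 - (p.1 ^ 2 + p.2 ^ 2))).re)) * hε
  · rw [mem_preimage, nodeCoord_pageCoord_nodeChart hε hc (hVD hp)]
    exact hp
  · rintro x ⟨hx, -, ⟨ht, hZ⟩, hxV⟩
    refine ⟨_, hxV, ?_⟩
    obtain ⟨h1, -, h2⟩ := pageCoord_page hc hx
    have h3 := eq_nodeModel hε h1.1 ht hZ (hVD hxV)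
    rw [nodeChart, ← rescale_smul ht, ← h3, rescale_of_mem h1, h2]

/-! ### The complex structure at the nodes is tamed -/

omit hc in
-- In these directions `sizeSq` has only a quadratic term beyond its value `4`, so the rescaling is
-- the identity to first order.
theorem fderiv_rescale_pole (a b : ℂ) :
    fderiv ℝ rescale ((0, 0, (ε : ℂ), 1) : Model) (a, b, 0, 0) = (a, b, 0, 0) := by
  have hm := pole_mem_quadric hε
  set m : Model := (0, 0, (ε : ℂ), 1) with hmdef
  set u : Model := (a, b, 0, 0) with hu
  have hl : HasDerivAt (fun t : ℝ => m + t • u) u 0 := by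
    simpa using ((hasDerivAt_id (0 : ℝ)).smul_const u).const_add m
  have hsize : ∀ t : ℝ, sizeSq (m + t • u) = t ^ 2 * (normSq a + normSq b) + 4 := by
    intro t
    have h : normSq (ε : ℂ) = 1 := by rw [Complex.normSq_ofReal, ← pow_two, hε]
    simp only [sizeSq, hmdef, hu, Prod.smul_mk, Prod.mk_add_mk, zero_add, smul_zero, add_zero, h,
      Complex.real_smul, map_mul, Complex.normSq_ofReal]
    ring
  have hs0 : sizeSq m = 4 := by simpa using hsize 0
  have h1 : HasDerivAt (fun t : ℝ => t ^ 2 * (normSq a + normSq b) + 4) 0 0 := by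
    simpa using (((hasDerivAt_id (0 : ℝ)).pow 2).mul_const (normSq a + normSq b)).add_const 4
  have h4 : √(4 : ℝ) = 2 := by
    rw [show (4 : ℝ) = 2 ^ 2 by norm_num, Real.sqrt_sq zero_le_two]
  have h2 := ((h1.sqrt (by norm_num)).inv (by norm_num)).const_mul 2
  have h3 : HasDerivAt (fun t : ℝ => rescale (m + t • u)) u 0 := by
    refine ((h2.smul hl).congr_deriv ?_).congr_of_eventuallyEq (Eventually.of_forall fun t => ?_)
    · simp [h4]
    · simp only [rescale, hsize]
      rfl
  have hF : HasFDerivAt rescale (fderiv ℝ rescale m) (m + (0 : ℝ) • u) := by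
    rw [zero_smul, add_zero]
    exact ((contDiffAt_rescale (by rw [hs0]; norm_num)).differentiableAt (by simp)).hasFDerivAt
  have h5 : HasDerivAt (fun t : ℝ => rescale (m + t • u)) (fderiv ℝ rescale m u) 0 := by
    have := hF.comp_hasDerivAt 0 hl
    exact this
  exact h5.unique h3

omit hε hc in
-- The argument of the square root is quadratic in the coordinates apart from the constant `1`, so
-- it contributes nothing at the origin.
theorem hasDerivAt_nodeModel (ε : ℝ) (v : ℂ × ℂ) : HasDerivAt (fun t : ℝ => nodeModel ε (t • v))
    ((starRingEnd ℂ) (v.1 + Complex.I * v.2), (starRingEnd ℂ) (v.1 - Complex.I * v.2), 0, 0) 0 := by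
  have hl (w : ℂ) : HasDerivAt (fun t : ℝ => t • w) w 0 := by
    simpa using (hasDerivAt_id (0 : ℝ)).smul_const w
  have hconj {f : ℝ → ℂ} {w : ℂ} (hf : HasDerivAt f w 0) :
      HasDerivAt (fun t => (starRingEnd ℂ) (f t)) ((starRingEnd ℂ) w) 0 :=
    Complex.conjCLE.hasFDerivAt.comp_hasDerivAt 0 hf
  obtain ⟨a, -, hd⟩ := hasDerivAt_csqrt (w := 1) Complex.one_mem_slitPlane
  have hq : HasDerivAt (fun t : ℝ => 1 - ((t • v.1) ^ 2 + (t • v.2) ^ 2)) 0 0 := by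
    simpa using (((hl v.1).pow 2).add ((hl v.2).pow 2)).const_sub 1
  have hs : HasDerivAt (fun t : ℝ => csqrt (1 - ((t • v.1) ^ 2 + (t • v.2) ^ 2))) 0 0 := by
    have := (hd.hasFDerivAt.restrictScalars ℝ).comp_hasDerivAt_of_eq 0 hq (by simp)
    exact this.congr_deriv (by simp)
  have h3 : HasDerivAt (fun t : ℝ =>
      (starRingEnd ℂ) (ε * csqrt (1 - ((t • v.1) ^ 2 + (t • v.2) ^ 2)))) 0 0 := by
    simpa using hconj (hs.const_mul (ε : ℂ))
  have h1 := hconj ((hl v.1).add ((hl v.2).const_mul Complex.I))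
  have h2 := hconj ((hl v.1).sub ((hl v.2).const_mul Complex.I))
  exact h1.prodMk (h2.prodMk (h3.prodMk (hasDerivAt_const 0 (1 : ℝ))))

omit hε hc in
theorem nodeModel_zero (ε : ℝ) : nodeModel ε 0 = (0, 0, (ε : ℂ), 1) := by
  simp [nodeModel]

omit hc in
theorem nodeChart_zero (c : ℝ) : nodeChart c ε 0 = pageChart c (0, 0, (ε : ℂ), 1) := by
  rw [nodeChart, nodeModel_zero, rescale_of_mem (pole_mem_quadric hε)]

theorem fderiv_nodeChart_zero (v : ℂ × ℂ) : fderiv ℝ (nodeChart c ε) 0 v =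
    fderiv ℝ (pageChart c) (0, 0, (ε : ℂ), 1)
      ((starRingEnd ℂ) (v.1 + Complex.I * v.2), (starRingEnd ℂ) (v.1 - Complex.I * v.2), 0, 0) := by
  have hm := pole_mem_quadric hε
  have hr := rescale_of_mem hm
  have hs : 0 < sizeSq ((0, 0, (ε : ℂ), 1) : Model) := nodeModel_zero ε ▸ sizeSq_nodeModel_pos ε 0
  have hl : HasDerivAt (fun t : ℝ => t • v) v 0 := by
    simpa using (hasDerivAt_id (0 : ℝ)).smul_const v
  have h1 := ((contDiffAt_rescale hs).differentiableAt (by simp)).hasFDerivAt.comp_hasDerivAt_of_eq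
    0 (hasDerivAt_nodeModel ε v) (by rw [zero_smul, nodeModel_zero])
  rw [fderiv_rescale_pole hε] at h1
  have h2 := ((contDiffAt_pageChart hc hm).differentiableAt (by simp)).hasFDerivAt
    |>.comp_hasDerivAt_of_eq 0 h1 (by simp [nodeModel_zero, hr])
  have h3 := (((contDiffOn_nodeChart hε hc).contDiffAt (isOpen_nodeDomain.mem_nhds
    zero_mem_nodeDomain)).differentiableAt (by simp)).hasFDerivAt.comp_hasDerivAt_of_eq
      0 hl (by simp)
  exact h3.unique h2

/-- The derivative of the page chart at the poles. -/
theorem fderiv_pageChart_pole : ∃ k D : ℝ, 0 < k ∧ 0 < D ∧ ∀ a b : ℂ,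
    (fderiv ℝ (pageChart c) (0, 0, (ε : ℂ), 1) (a, b, 0, 0)).1 0 = 0 ∧
    (fderiv ℝ (pageChart c) (0, 0, (ε : ℂ), 1) (a, b, 0, 0)).1 1 = 2 * k / D * ((a.re + b.re) / 2) ∧
    (fderiv ℝ (pageChart c) (0, 0, (ε : ℂ), 1) (a, b, 0, 0)).1 2 = 2 * k / D * ((a.im - b.im) / 2) ∧
    (fderiv ℝ (pageChart c) (0, 0, (ε : ℂ), 1) (a, b, 0, 0)).1 3 = 0 ∧
    (fderiv ℝ (pageChart c) (0, 0, (ε : ℂ), 1) (a, b, 0, 0)).2 1 =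
      D / (2 * k ^ 2) * ((a.im + b.im) / 2) ∧
    (fderiv ℝ (pageChart c) (0, 0, (ε : ℂ), 1) (a, b, 0, 0)).2 2 =
      D / (2 * k ^ 2) * ((b.re - a.re) / 2) := by
  have hm := pole_mem_quadric hε
  set m : Model := (0, 0, (ε : ℂ), 1) with hmdef
  have hs := embed_mem_chartSource hc hm
  have hk := freq_rotMoment_pos hc hs
  have hD := hs.2
  set x := embed m with hx
  refine ⟨freq c (rotMoment x), boostDenom (freq c (rotMoment x)) x, hk, hD, fun a b => ?_⟩
  set v : Model := (a, b, 0, 0) with hv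
  have htan : fderiv ℝ (pageChart c) m v ∈ tangentPage c (pageChart c m) := by
    refine fderiv_pageChart_mem hc hm ⟨?_, ?_⟩ <;> simp [hmdef, hv]
  rw [fderiv_pageChart hc hm] at htan ⊢
  have hd := hasDerivAt_chart_line hc hs (embed v)
  rw [← hx] at *
  set w := fderiv ℝ (chart c) x (embed v) with hw
  have d1 (i : Fin 4) : HasDerivAt (fun t : ℝ => (chart c (x + t • embed v)).1 i) (w.1 i) 0 :=
    (EuclideanSpace.proj i : E4 →L[ℝ] ℝ).hasFDerivAt.comp_hasDerivAt 0 hd.fst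
  have d2 (i : Fin 4) : HasDerivAt (fun t : ℝ => (chart c (x + t • embed v)).2 i) (w.2 i) 0 :=
    (EuclideanSpace.proj i : E4 →L[ℝ] ℝ).hasFDerivAt.comp_hasDerivAt 0 hd.snd
  have hlc : ContinuousAt (fun t : ℝ => x + t • embed v) 0 := by fun_prop
  have ck : ContinuousAt (fun t : ℝ => freq c (rotMoment (x + t • embed v))) 0 :=
    ContinuousAt.comp (g := fun y => freq c (rotMoment y)) (f := fun t : ℝ => x + t • embed v)
      (by simpa using (contDiffAt_freq_rotMoment hc hs).continuousAt) hlc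
  have hk0 : freq c (rotMoment (x + (0 : ℝ) • embed v)) ≠ 0 := by simpa using hk.ne'
  have cD : ContinuousAt (fun t : ℝ =>
      boostDenom (freq c (rotMoment (x + t • embed v))) (x + t • embed v)) 0 := by
    have h0 : ContinuousAt (fun t : ℝ => (x + t • embed v).1 0) 0 :=
      ((hasDerivAt_line x (embed v)).1 0).continuousAt
    exact ((ck.pow 2).mul (continuousAt_const.add h0)).add (continuousAt_const.sub h0)
  have hD0 : boostDenom (freq c (rotMoment (x + (0 : ℝ) • embed v)))
      (x + (0 : ℝ) • embed v) ≠ 0 := by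
    simpa using hD.ne'
  have c1 : ContinuousAt (fun t : ℝ => 2 * freq c (rotMoment (x + t • embed v)) /
      boostDenom (freq c (rotMoment (x + t • embed v))) (x + t • embed v)) 0 :=
    (continuousAt_const.mul ck).div cD hD0
  have c2 : ContinuousAt (fun t : ℝ => boostDenom (freq c (rotMoment (x + t • embed v)))
      (x + t • embed v) / (2 * freq c (rotMoment (x + t • embed v)) ^ 2)) 0 :=
    cD.div (continuousAt_const.mul (ck.pow 2)) (mul_ne_zero two_ne_zero (pow_ne_zero 2 hk0))
  -- Along the line `η₀ = 0`, which removes the mixed term of `boost`. The components with index `1`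
  -- and `2` are then a continuous factor times a coordinate that vanishes at the pole, so only the
  -- values of `k` and `D` there matter.
  have hzero (t : ℝ) : (x + t • embed v).2 0 = 0 := by
    change x.2 0 + t * (embed v).2 0 = 0
    rw [hx, embed_snd_zero, embed_snd_zero]
    simp [hmdef, hv]
  have hx11 : (x + (0 : ℝ) • embed v).1 1 = 0 := by
    rw [zero_smul, add_zero, hx, embed_fst_one]; simp [hmdef]
  have hx12 : (x + (0 : ℝ) • embed v).1 2 = 0 := by
    rw [zero_smul, add_zero, hx, embed_fst_two]; simp [hmdef]
  have hx21 : (x + (0 : ℝ) • embed v).2 1 = 0 := by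
    rw [zero_smul, add_zero, hx, embed_snd_one]; simp [hmdef]
  have hx22 : (x + (0 : ℝ) • embed v).2 2 = 0 := by
    rw [zero_smul, add_zero, hx, embed_snd_two]; simp [hmdef]
  have e11 := (d1 1).unique ((hasDerivAt_mul_of_eq_zero c1 ((hasDerivAt_line x (embed v)).1 1)
    hx11).congr_of_eventuallyEq (f₁ := fun t : ℝ => (chart c (x + t • embed v)).1 1) <|
    Eventually.of_forall fun t => mul_div_right_comm _ _ _)
  have e12 := (d1 2).unique ((hasDerivAt_mul_of_eq_zero c1 ((hasDerivAt_line x (embed v)).1 2)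
    hx12).congr_of_eventuallyEq (f₁ := fun t : ℝ => (chart c (x + t • embed v)).1 2) <|
    Eventually.of_forall fun t => mul_div_right_comm _ _ _)
  have aux (t : ℝ) (i : Fin 4) (hi : (chart c (x + t • embed v)).2 i =
      (boostDenom (freq c (rotMoment (x + t • embed v))) (x + t • embed v) *
        ((freq c (rotMoment (x + t • embed v)))⁻¹ * (x + t • embed v).2 i) +
      (1 - freq c (rotMoment (x + t • embed v)) ^ 2) *
        ((freq c (rotMoment (x + t • embed v)))⁻¹ * (x + t • embed v).2 0) *
          (x + t • embed v).1 i) / (2 * freq c (rotMoment (x + t • embed v)))) :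
      (chart c (x + t • embed v)).2 i = boostDenom (freq c (rotMoment (x + t • embed v)))
      (x + t • embed v) / (2 * freq c (rotMoment (x + t • embed v)) ^ 2) *
        (x + t • embed v).2 i := by
    rw [hi, hzero]
    ring
  have e21 := (d2 1).unique ((hasDerivAt_mul_of_eq_zero c2 ((hasDerivAt_line x (embed v)).2 1)
    hx21).congr_of_eventuallyEq (f₁ := fun t : ℝ => (chart c (x + t • embed v)).2 1) <|
    Eventually.of_forall fun t => aux t 1 rfl)
  have e22 := (d2 2).unique ((hasDerivAt_mul_of_eq_zero c2 ((hasDerivAt_line x (embed v)).2 2)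
    hx22).congr_of_eventuallyEq (f₁ := fun t : ℝ => (chart c (x + t • embed v)).2 2) <|
    Eventually.of_forall fun t => aux t 2 rfl)
  rw [zero_smul, add_zero] at e11 e12 e21 e22
  refine ⟨?_, e11, e12, htan.2.1, e21, e22⟩
  have h := (mem_tangentCotangentSphere.1 htan.1).1
  have hc1 : (pageChart c m).1 1 = 0 := by
    change 2 * _ * x.1 1 / _ = (0 : ℝ)
    rw [hx, embed_fst_one]; simp [hmdef]
  have hc2 : (pageChart c m).1 2 = 0 := by
    change 2 * _ * x.1 2 / _ = (0 : ℝ)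
    rw [hx, embed_fst_two]; simp [hmdef]
  have hc3 : (pageChart c m).1 3 = 0 := by
    rw [pageChart, chart_fst_three, embed_fst_three, mul_zero]
  have hc0 : (pageChart c m).1 0 ≠ 0 := by
    intro h0
    have h4 := (mem_cotangentSphere.1 (energySurface_subset (pageChart_mem_energySurface hc hm))).1
    rw [h0, hc1, hc2, hc3] at h4
    norm_num at h4
  rw [hc1, hc2, hc3] at h
  simpa [hc0] using h

/-- The factors `2k/D` on `ξ` and `D/(2k²)` on `η` multiply to `1/k`. The pairing is `(|a|² +
|b|²)/(2k)`, where `a`, `b` are the derivatives of `α`, `β` along `v`. -/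
theorem symp_fderiv_nodeChart_zero {v : ℂ × ℂ} (hv : v ≠ 0) :
    0 < symp (fderiv ℝ (nodeChart c ε) 0 v) (fderiv ℝ (nodeChart c ε) 0 (Complex.I • v)) := by
  obtain ⟨k, D, hk, hD, h⟩ := fderiv_pageChart_pole hε hc
  rw [fderiv_nodeChart_zero hε hc, fderiv_nodeChart_zero hε hc]
  set a := (starRingEnd ℂ) (v.1 + Complex.I * v.2) with ha
  set b := (starRingEnd ℂ) (v.1 - Complex.I * v.2) with hb
  have ha' : (starRingEnd ℂ) ((Complex.I • v).1 + Complex.I * (Complex.I • v).2) =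
      -Complex.I * a := by
    rw [ha, ← Complex.conj_I, ← map_mul]
    congr 1
    simp only [Prod.smul_fst, Prod.smul_snd, smul_eq_mul]
    ring
  have hb' : (starRingEnd ℂ) ((Complex.I • v).1 - Complex.I * (Complex.I • v).2) =
      -Complex.I * b := by
    rw [hb, ← Complex.conj_I, ← map_mul]
    congr 1
    simp only [Prod.smul_fst, Prod.smul_snd, smul_eq_mul]
    ring
  rw [ha', hb', symp_eq]
  obtain ⟨p0, p1, p2, p3, p4, p5⟩ := h a b
  obtain ⟨q0, q1, q2, q3, q4, q5⟩ := h (-Complex.I * a) (-Complex.I * b)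
  rw [p0, p1, p2, p3, p4, p5, q0, q1, q2, q3, q4, q5]
  have hab : 0 < normSq a + normSq b := by
    by_contra hcon
    have n1 := Complex.normSq_nonneg a
    have n2 := Complex.normSq_nonneg b
    have za : a = 0 := Complex.normSq_eq_zero.1 (by linarith)
    have zb : b = 0 := Complex.normSq_eq_zero.1 (by linarith)
    rw [ha, map_eq_zero] at za
    rw [hb, map_eq_zero] at zb
    have z1 : v.1 = 0 := by linear_combination (za + zb) / 2
    have z2 : v.2 = 0 := by
      rw [z1, zero_add] at za
      exact (mul_eq_zero.1 za).resolve_left Complex.I_ne_zero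
    exact hv (Prod.ext z1 z2)
  have hpos : 0 < (normSq a + normSq b) / (2 * k) := by positivity
  refine hpos.trans_eq ?_
  simp only [Complex.normSq_apply, Complex.mul_re, Complex.mul_im, Complex.neg_re, Complex.neg_im,
    Complex.I_re, Complex.I_im]
  field_simp
  ring

/-- The coordinates are tamed near the origin. -/
theorem eventually_tamed : ∀ᶠ p in 𝓝 (0 : ℂ × ℂ), ∀ v : ℂ × ℂ, v ≠ 0 →
    0 < symp (fderiv ℝ (nodeChart c ε) p v) (fderiv ℝ (nodeChart c ε) p (Complex.I • v)) := by
  have hcont : ContinuousAt (fderiv ℝ (nodeChart c ε)) 0 :=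
    ((contDiffOn_nodeChart hε hc).contDiffAt (isOpen_nodeDomain.mem_nhds
      zero_mem_nodeDomain)).fderiv_right (m := 0) (by simp) |>.continuousAt
  have key : ∀ v ∈ sphere (0 : ℂ × ℂ) 1, ∀ᶠ z : (ℂ × ℂ) × (ℂ × ℂ) in 𝓝 (0, v),
      0 < symp (fderiv ℝ (nodeChart c ε) z.1 z.2)
        (fderiv ℝ (nodeChart c ε) z.1 (Complex.I • z.2)) := by
    intro v hv
    have hv0 : v ≠ 0 := by
      rintro rfl
      simp at hv
    have h1 : ContinuousAt (fun z : (ℂ × ℂ) × (ℂ × ℂ) => fderiv ℝ (nodeChart c ε) z.1) (0, v) :=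
      ContinuousAt.comp (g := fderiv ℝ (nodeChart c ε)) hcont continuousAt_fst
    have h2 := h1.clm_apply (continuousAt_snd (p := ((0 : ℂ × ℂ), v)))
    have h3 : ContinuousAt (fun z : (ℂ × ℂ) × (ℂ × ℂ) =>
        fderiv ℝ (nodeChart c ε) z.1 (Complex.I • z.2)) (0, v) :=
      h1.clm_apply (continuousAt_snd.const_smul Complex.I)
    have h4 : ContinuousAt (fun z : (ℂ × ℂ) × (ℂ × ℂ) => symp (fderiv ℝ (nodeChart c ε) z.1 z.2)
        (fderiv ℝ (nodeChart c ε) z.1 (Complex.I • z.2))) (0, v) :=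
      (h2.snd.inner h3.fst).sub (h3.snd.inner h2.fst)
    exact h4.eventually (lt_mem_nhds (symp_fderiv_nodeChart_zero hε hc hv0))
  -- Compactness of the unit sphere makes the neighbourhood of the origin uniform in `v`; vectors of
  -- other lengths follow by homogeneity.
  have hev := (isCompact_sphere (0 : ℂ × ℂ) 1).eventually_forall_of_forall_eventually
    (P := fun p v => 0 < symp (fderiv ℝ (nodeChart c ε) p v)
      (fderiv ℝ (nodeChart c ε) p (Complex.I • v))) key
  filter_upwards [hev] with p hp v hv
  have hn : 0 < ‖v‖ := norm_pos_iff.2 hv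
  have h1 := hp (‖v‖⁻¹ • v) (by
    rw [mem_sphere_zero_iff_norm, norm_smul, norm_inv, norm_norm, inv_mul_cancel₀ hn.ne'])
  rw [smul_comm Complex.I, map_smul, map_smul, symp_smul_left, symp_swap, symp_smul_left,
    ← mul_neg, ← symp_swap] at h1
  exact (mul_pos_iff_of_pos_left (inv_pos.2 hn)).1 ((mul_pos_iff_of_pos_left (inv_pos.2 hn)).1 h1)

theorem isNode_pole : IsNode c (lefschetz c) (pageChart c (0, 0, (ε : ℂ), 1)) := by
  obtain ⟨T, hT, hTo, hT0⟩ := _root_.eventually_nhds_iff.1 (eventually_tamed hε hc)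
  have hV : IsOpen (nodeDomain ∩ T) := isOpen_nodeDomain.inter hTo
  have hε0 : ε ≠ 0 := by
    rintro rfl
    norm_num at hε
  refine ⟨nodeDomain ∩ T, nodeChart c ε, ball 0 1, nodeBase ε, hV, ⟨zero_mem_nodeDomain, hT0⟩,
    nodeChart_zero hε c, (contDiffOn_nodeChart hε hc).mono inter_subset_left, ?_,
    fun p hp => nodeChart_mem_page hε hc hp.1,
    fun p hp => nodeChart_isOpen_image hε hc hV inter_subset_left hp,
        fun p hp v hv => hT p hp.2 v hv,
    isOpen_ball, mem_ball_self one_pos, ?_, contDiffOn_nodeBase, injOn_nodeBase hε0,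
    fun u hu => det_fderiv_nodeBase_pos hε0 hu,
    fun p hp => ⟨mem_ball_zero_iff.2 hp.1, lefschetz_nodeChart hε hc hp.1⟩⟩
  · intro p hp q hq h
    rw [← nodeCoord_pageCoord_nodeChart hε hc hp.1, h, nodeCoord_pageCoord_nodeChart hε hc hq.1]
  · rw [← nodeChart_zero hε c, lefschetz_nodeChart hε hc zero_mem_nodeDomain]
    simp

end node

/-! ### Assembly of the fibration and of the theorem -/

theorem isSymplecticLefschetzFibration_lefschetz {c : ℝ} (hc : c < -3 / 2) :
    IsSymplecticLefschetzFibration c (range (directOrbit c)) (range (retrogradeOrbit c))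
      (lefschetz c) where
  smooth := smoothOn_lefschetz hc
  image := lefschetz_image hc
  boundary _ hx := mem_pageBoundary_iff_norm_lefschetz hc hx
  symplectic _ hx _ hv hv0 := exists_symp_ne_zero hc hx hv hv0
  symplectic_fiber _ hx _ hv hv0 hne := exists_symp_ne_zero_fiber hc hx hv hv0 hne
  critical_finite := by
    rw [criticalSet_lefschetz hc]
    exact toFinite _
  critical_interior := criticalSet_subset_pageInterior hc
  critical_injOn := lefschetz_injOn_criticalSet hc
  node x hx := by
    rw [criticalSet_lefschetz hc, ← pageChart_north hc, ← pageChart_south hc] at hx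
    rcases hx with rfl | rfl
    · exact isNode_pole (by norm_num) hc
    · exact isNode_pole (by norm_num) hc
  closure_fiber _ hz := closure_openFiber hc hz
  locally_trivial _ hz h := exists_isFiberFamily hc (pencil_ne_zero hc hz h)
  monodromy := exists_monodromy hc

end RotatingKepler

end

open RotatingKepler in
theorem theorem1p6 (c : ℝ) (hc : c < -3 / 2) :
    ∃ γdir γret : ℝ → Phase,
      (IsDirectOrbit c γdir ∧ ∀ γ, IsDirectOrbit c γ → range γ = range γdir) ∧
      (IsRetrogradeOrbit c γret ∧ ∀ γ, IsRetrogradeOrbit c γ → range γ = range γret) ∧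
      AreDiffeomorphic (page c) diskCotangentBundle ∧
      IsHopfLink (pageBoundary c) (range γdir) (range γret) ∧
      ∃ R : Phase → Phase,
        (IsReturnMap c R ∧ ∀ R', IsReturnMap c R' → EqOn R' R (page c)) ∧
        ∃ π : Phase → ℂ,
          IsSymplecticLefschetzFibration c (range γdir) (range γret) π ∧
          (∀ z ∈ closedBall (0 : ℂ) 1,
            R '' fiber c (range γdir) (range γret) π z = fiber c (range γdir) (range γret) π z) ∧
          (∀ z ∈ closedBall (0 : ℂ) 1, z ∉ π '' criticalSet c (range γdir) (range γret) π →
            IsIntegrableTwist (closure (fiber c (range γdir) (range γret) π z))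
              (range γdir) (range γret) R) ∧
          criticalSet c (range γdir) (range γret) π = {poleNorth, poleSouth c} ∧
          poleNorth ≠ poleSouth c ∧ R poleNorth = poleNorth ∧ R (poleSouth c) = poleSouth c ∧
          (∃ γ, IsPolarOrbit c γ ∧ γ 0 = poleNorth ∧ ∀ t, position (γ t) 2 ≤ 0) ∧
          (∃ γ, IsPolarOrbit c γ ∧ γ 0 = poleSouth c ∧ ∀ t, 0 ≤ position (γ t) 2) := by
  have hpos : 0 < freq c 0 ^ 2 := by
    rw [(freq_zero hc).2]
    linarith
  obtain ⟨north, hnorth⟩ := isPolarOrbit_pole hc (ε := 1) (by norm_num)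
  obtain ⟨south, hsouth⟩ := isPolarOrbit_pole hc (ε := -1) (by norm_num)
  refine ⟨directOrbit c, retrogradeOrbit c,
    ⟨isDirectOrbit_directOrbit hc, fun γ hγ => hγ.range_eq hc⟩,
    ⟨isRetrogradeOrbit_retrogradeOrbit hc, fun γ hγ => hγ.range_eq hc⟩,
    areDiffeomorphic_page hc, isHopfLink_pageBoundary hc, returnMap c,
    ⟨isReturnMap_returnMap hc, fun R hR => hR.eqOn hc⟩, lefschetz c,
    isSymplecticLefschetzFibration_lefschetz hc, fun z _ => returnMap_image_fiber hc z,
    fun z hz h => isIntegrableTwist_returnMap (pencil_ne_zero hc hz h) hc hz,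
    criticalSet_lefschetz hc, fun h => ?_, ?_, ?_,
    ⟨_, north, ?_, fun t => ?_⟩, ⟨_, south, ?_, fun t => ?_⟩⟩
  · have h0 : (1 : ℝ) = -1 := congrArg (fun x : Phase => x.1 0) h
    norm_num at h0
  · rw [← pageChart_north hc, returnMap_pole]
  · rw [← pageChart_south hc, returnMap_pole]
  · rw [orbit_zero, ← pageChart_north hc]
    rfl
  · rw [hnorth]
    have := Real.cos_le_one (freq c 0 * t)
    exact div_nonpos_of_nonpos_of_nonneg (by linarith) hpos.le
  · rw [orbit_zero, ← pageChart_south hc]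
    rfl
  · rw [hsouth]
    have := Real.neg_one_le_cos (freq c 0 * t)
    exact div_nonneg (by linarith) hpos.le
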